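/- **Setting.** Let $0<|q|<1$, fix a square root $q^{1/2}$, put $\tau=q^{-1}$, $\tau^{1/2}=(q^{1/2})^{-1}$ and $z_j=\zeta_j^2$. Write $(a;p)_\infty=\prod_{k\ge0}(1-ap^k)$, $(a;p_1,p_2)_\infty=\prod_{k_1,k_2\ge0}(1-ap_1^{k_1}p_2^{k_2})$, $\theta(z|p)=(z;p)_\infty(p/z;p)_\infty$ and $\psi(z)=1/\big((zq;q^4)_\infty(z^{-1}q;q^4)_\infty\big)$. Let $V=\mathbb C v_+\oplus\mathbb C v_-$ and let $R(\zeta)\in\mathrm{End}(V\otimes V)$ be the six-vertex matrix, $R(\zeta)v_{\varepsilon_1'}\otimes v_{\varepsilon_2'}=\sum v_{\varepsilon_1}\otimes v_{\varepsilon_2}R(\zeta)^{\varepsilon_1\varepsilon_2}_{\varepsilon_1'\varepsilon_2'}$, with nonzero entries $R^{++}_{++}=R^{--}_{--}=1$, $R^{+-}_{+-}=R^{-+}_{-+}=\frac{(1-\zeta^2)q}{1-\zeta^2q^2}$, $R^{+-}_{-+}=R^{-+}_{+-}=\frac{(1-q^2)\zeta}{1-\zeta^2q^2}$. $R_{jk}(\zeta)$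 acts on the $j$-th and $k$-th factors of $V^{\otimes N}$, $P_{jk}$ exchanges these factors, and $R_{N-1|1,\dots,N-2}(w|\zeta')=R_{N-1,N-2}(w/\zeta_{N-2})\cdots R_{N-1,1}(w/\zeta_1)$ for $\zeta'=(\zeta_1,\dots,\zeta_{N-2})$. Put $u_\sigma=v_-\otimes v_++\sigma v_+\otimes v_-$. For $n\le l$, $N=n+l$, put $m=n-1$ if $n=l$ and $m=n$ if $n<l$. **The polynomial $\Delta^{(nl)}$.** For $a=(a_1,\dots,a_n)$, $b=(b_1,\dots,b_l)$ let $e_\kappa$ be the elementary symmetric polynomials, $\sum_k\beta_ku^k=\prod_i(1-b_iu)/\prod_j(1-a_j\tau^2u)$, and $$\varphi_j(x)=\sum_{k=0}^{l-n+j-2}\beta_k\big(\tau^k-\tau^{2(l-n+j-1)-k}\big)x^{l-n+j-2-k},\qquad f_\lambda(x)=\sum_{\kappa=0}^{\lambda-1}(-\tau^3)^\kappa e_\kappa(a)\varphi_{\lambda-\kappa}(x),$$ $$g_\lambda(x)=\sum_{\kappa=0}^{\lambda-2}(-\tau)^\kappa e_\kappa(a)\big(1-\tau^{2(\lambda-1-\kappa)}\big)x^{\lambda-2-\kappa},$$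 $$A_\lambda(x|a|b)=\prod_{j=1}^n(x-a_j\tau)f_\lambda(x)+\tau^{2(l-n+\lambda-1)}\prod_{i=1}^l(x-b_i\tau^{-1})g_\lambda(x).$$ Then $\Delta^{(nl)}(x_1,\dots,x_m|a|b)=\det\big(A_\lambda(x_\mu|a|b)\big)_{1\le\mu\le m,\ n-m+1\le\lambda\le n}$. Let $\langle\Delta^{(nl)}\rangle(x|\zeta)\in V^{\otimes N}$ be the vector, supported on the indices with $n$ signs $-$ and $l$ signs $+$, determined by $$\langle\Delta^{(nl)}\rangle(x|\zeta)^{-\cdots-+\cdots+}=\frac{\Delta^{(nl)}(x|z_1,\dots,z_n|z_{n+1},\dots,z_N)}{\prod_{j=1}^n\prod_{i=n+1}^N(z_i-z_j\tau^2)}\prod_{j=1}^n\zeta_j,$$ $$P_{j\,j+1}\langle\Delta^{(nl)}\rangle(x|\dots,\zeta_{j+1},\zeta_j,\dots)=R_{j\,j+1}(\zeta_j/\zeta_{j+1})\langle\Delta^{(nl)}\rangle(x|\dots,\zeta_j,\zeta_{j+1},\dots).$$ **The integral.** Let $r(\zeta)$ be a scalar function and $r_\varepsilon=\varepsilon r$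 for $\varepsilon=\pm1$. An *admissible* $\vartheta^{(nl)}_\varepsilon(x_1,\dots,x_m|\zeta_1,\dots,\zeta_N)$ is a function that is antisymmetric and holomorphic in the $x_\mu\in\mathbb C\setminus\{0\}$, symmetric and meromorphic in the $\zeta_j\in\mathbb C\setminus\{0\}$, and satisfies $$\vartheta^{(nl)}_\varepsilon(x|\dots,\zeta_j\tau^2,\dots)=\tau^{N/2}r_\varepsilon(\zeta_j)\prod_{\mu=1}^m\frac{-z_j\tau}{x_\mu}\prod_{k\ne j}\frac{\zeta_k}{\zeta_j}\;\vartheta^{(nl)}_\varepsilon(x|\zeta),\qquad \vartheta^{(nl)}_\varepsilon(\dots,x_\mu\tau^4,\dots|\zeta)=\prod_{j=1}^N\frac{-x_\mu\tau}{z_j}\;\vartheta^{(nl)}_\varepsilon(x|\zeta).$$ Put $$\overline G^{(nl)}_\varepsilon(\zeta)=\frac1{m!}\prod_{\mu=1}^m\oint_{C^{(N)}}\frac{dx_\mu}{2\pi i}\;\vartheta^{(nl)}_\varepsilon(x|\zeta)\prod_{\mu=1}^m\prod_{j=1}^N\psi(x_\mu/z_j)\;\langle\Delta^{(nl)}\rangle(x|\zeta),$$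 where $C^{(N)}=C^{(N)}(z_1,\dots,z_N)$ is a closed curve in $\mathbb C\setminus\{0\}$ that encircles once anticlockwise the points $z_j\tau^{-1-4k}$ and does not encircle the points $z_j\tau^{1+4k}$ ($1\le j\le N$, $k\ge0$). **Proposition.** Let $1\le n\le l$ with $(n,l)\ne(1,1)$, so $m\ge1$, let $N=n+l$ and $\varepsilon,\sigma\in\{\pm1\}$. Let $\vartheta^{(nl)}_\varepsilon$ and $\vartheta^{(n-1,l-1)}_{\sigma\varepsilon}$ be admissible with the same $r$ (that is, with $r_\varepsilon$ and $r_{\sigma\varepsilon}$, respectively), and suppose that $$\vartheta^{(nl)}_\varepsilon(x_1,\dots,x_{m-1},z_{N-1}\tau|\zeta',\zeta_{N-1},-\sigma\zeta_{N-1}\tau^{-1})=c^{(nl)}z_{N-1}^{N-m-1}\prod_{\mu=1}^{m-1}\theta(qx_\mu/z_{N-1}|q^2)\;\vartheta^{(n-1,l-1)}_{\sigma\varepsilon}(x_1,\dots,x_{m-1}|\zeta'),$$ $$c^{(nl)}=(-\tau)^{m-n-2l+3}(q^2;q^2)_\infty^2\frac{(q^4;q^4,q^4)_\infty^2}{(q^2;q^4,q^4)_\infty^2}.$$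 Then for generic nonzero $\zeta_1,\dots,\zeta_{N-1}$ the component $\overline G^{(nl)}_\varepsilon(\zeta)^{-\cdots-+\cdots+}$ ($n$ signs $-$, then $l$ signs $+$) has, as $\zeta_N\to-\sigma\zeta_{N-1}\tau$, at most a simple pole, and $$-2\frac{(q^2;q^4,q^4)_\infty^2}{(q^4;q^4,q^4)_\infty^2}\;\frac{\sigma^{N+1}\tau^{(n-l)/2}\,\mathrm{Res}_{\zeta_N/(-\sigma\zeta_{N-1}\tau)=1}\overline G^{(nl)}_\varepsilon(\zeta)^{-\cdots-+\cdots+}}{r_\varepsilon(-\sigma\zeta_{N-1}q)\,\zeta_{N-1}\prod_{j=1}^{N-2}\big(\zeta_j\zeta_{N-1}\psi(\tau z_{N-1}/z_j)\big)}=\Big(R_{N-1|1,\dots,N-2}(\zeta_{N-1}|\zeta')\,\overline G^{(n-1,l-1)}_{\sigma\varepsilon}(\zeta')\otimes u_\sigma\Big)^{-\cdots-+\cdots+}.$$ Here $\mathrm{Res}_{x/y=1}G(x)=F$ means $G(x)=\frac{F}{x/y-1}+O(1)$ as $x\to y$. *Generic* means: $z_i/z_j\notin q^{2\mathbb Z}$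 for $1\le i<j\le N-1$; $\vartheta^{(n-1,l-1)}_{\sigma\varepsilon}$ is regular at $\zeta'$ and $\vartheta^{(nl)}_\varepsilon$ at $(\zeta',\zeta_{N-1},-\sigma\zeta_{N-1}\tau^{\pm1})$; and $r$ is holomorphic and nonzero at $-\sigma\zeta_{N-1}q$. -/

import Mathlib

open scoped Topology BigOperators

noncomputable section

namespace QKZ

/-! Signs `±` are elements of `ℤˣ`.  A vector of `V^{⊗N}` is given by its coordinates in the
basis `v_{ε₁} ⊗ ⋯ ⊗ v_{ε_N}`, i.e. it is a function `(Fin N → ℤˣ) → ℂ`.  Throughout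
`τ = q⁻¹` and `z_j = ζ_j ^ 2`. -/

/-- A sign as a complex number. -/
def sgn (ε : ℤˣ) : ℂ := ((ε : ℤ) : ℂ)

/-! ### Infinite products -/

/-- `(a; p)_∞`. -/
def poch (a p : ℂ) : ℂ := ∏' k : ℕ, (1 - a * p ^ k)

/-- `(a; p₁, p₂)_∞`. -/
def poch2 (a p₁ p₂ : ℂ) : ℂ := ∏' k : ℕ × ℕ, (1 - a * p₁ ^ k.1 * p₂ ^ k.2)

/-- `θ(z | p) = (z; p)_∞ (p / z; p)_∞`. -/
def thetaFn (z p : ℂ) : ℂ := poch z p * poch (p / z) p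

/-- `ψ(z) = 1 / ((z q; q⁴)_∞ (z⁻¹ q; q⁴)_∞)`. -/
def psi (q z : ℂ) : ℂ := 1 / (poch (z * q) (q ^ 4) * poch (z⁻¹ * q) (q ^ 4))

/-! ### The `R` matrix -/

def bR (q ζ : ℂ) : ℂ := (1 - ζ ^ 2) * q / (1 - ζ ^ 2 * q ^ 2)

def cR (q ζ : ℂ) : ℂ := (1 - q ^ 2) * ζ / (1 - ζ ^ 2 * q ^ 2)

/-- The entry `R(ζ)^{e₁ e₂}_{d₁ d₂}` of the six vertex `R` matrix. -/
def REntry (q ζ : ℂ) (e₁ e₂ d₁ d₂ : ℤˣ) : ℂ :=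
  if e₁ = e₂ then (if d₁ = e₁ ∧ d₂ = e₂ then 1 else 0)
  else if d₁ = e₁ ∧ d₂ = e₂ then bR q ζ
  else if d₁ = e₂ ∧ d₂ = e₁ then cR q ζ
  else 0

/-- `R_{jk}(ζ)` (`j ≠ k`) acting on `V^{⊗N}`, with site `j` as first and site `k` as second
tensor factor. -/
def Rop (q ζ : ℂ) {N : ℕ} (j k : Fin N) (F : (Fin N → ℤˣ) → ℂ) : (Fin N → ℤˣ) → ℂ :=
  fun e => ∑ d₁ : ℤˣ, ∑ d₂ : ℤˣ, REntry q ζ (e j) (e k) d₁ d₂ *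
    F (Function.update (Function.update e j d₁) k d₂)

/-- With `M = N - 2`, the operator
`R_{N-1|1,…,N-2}(w | ζ') = R_{N-1,N-2}(w/ζ'_{N-2}) ⋯ R_{N-1,1}(w/ζ'_1)` on `V^{⊗N}`;
the factor `R_{N-1,1}` acts first. -/
def Rchain (q w : ℂ) {M : ℕ} (ζ' : Fin M → ℂ) (F : (Fin (M + 2) → ℤˣ) → ℂ) :
    (Fin (M + 2) → ℤˣ) → ℂ :=
  (List.finRange M).foldl
    (fun H j => Rop q (w / ζ' j) (Fin.castSucc (Fin.last M)) (Fin.castAdd 2 j) H) F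

/-- Coordinates of `u_σ = v_- ⊗ v_+ + σ v_+ ⊗ v_-`. -/
def uVec (σ : ℤˣ) (e₁ e₂ : ℤˣ) : ℂ :=
  if e₁ = -1 ∧ e₂ = 1 then 1 else if e₁ = 1 ∧ e₂ = -1 then sgn σ else 0

/-- `F ⊗ u_σ`. -/
def tensorU (σ : ℤˣ) {M : ℕ} (F : (Fin M → ℤˣ) → ℂ) : (Fin (M + 2) → ℤˣ) → ℂ :=
  fun e => F (fun j => e (Fin.castAdd 2 j)) *
    uVec σ (e (Fin.castSucc (Fin.last M))) (e (Fin.last (M + 1)))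

/-- The index `- ⋯ - + ⋯ +` with `n` signs `-` followed by `N - n` signs `+`. -/
def extreme (N n : ℕ) : Fin N → ℤˣ := fun i => if (i : ℕ) < n then -1 else 1

/-! ### The polynomial `Δ^{(nl)}` -/

/-- Elementary symmetric polynomial. -/
def esym {k : ℕ} (a : Fin k → ℂ) (r : ℕ) : ℂ :=
  ∑ s ∈ Finset.powersetCard r (Finset.univ : Finset (Fin k)), ∏ i ∈ s, a i

/-- Complete homogeneous symmetric polynomial. -/
def hsym {k : ℕ} (a : Fin k → ℂ) (r : ℕ) : ℂ :=
  ∑ s : Sym (Fin k) r, ((s : Multiset (Fin k)).map a).prod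

/-- The coefficient of `u ^ k` in `∏ᵢ (1 - bᵢ u) / ∏ⱼ (1 - aⱼ τ² u)`. -/
def beta (q : ℂ) {n l : ℕ} (a : Fin n → ℂ) (b : Fin l → ℂ) (k : ℕ) : ℂ :=
  ∑ i ∈ Finset.range (k + 1), (-1) ^ i * esym b i * (q⁻¹ ^ 2) ^ (k - i) * hsym a (k - i)

/-- The polynomial part in `x` of
`x^{j-2} (∏ᵢ (x - bᵢ τ) / ∏ᵢ (x - aᵢ τ³) - τ^{2(l-n+j-1)} ∏ᵢ (x - bᵢ τ⁻¹) / ∏ᵢ (x - aᵢ τ))`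
(for `n ≤ l`, `1 ≤ j`). -/
def phi (q : ℂ) {n l : ℕ} (j : ℕ) (x : ℂ) (a : Fin n → ℂ) (b : Fin l → ℂ) : ℂ :=
  ∑ k ∈ Finset.range (l + j - 1 - n),
    beta q a b k * (q⁻¹ ^ k - q⁻¹ ^ (2 * (l + j - 1 - n) - k)) * x ^ (l + j - 1 - n - 1 - k)

/-- `f_λ^{(nl)}(x | a | b)`. -/
def fPol (q : ℂ) {n l : ℕ} (lam : ℕ) (x : ℂ) (a : Fin n → ℂ) (b : Fin l → ℂ) : ℂ :=
  ∑ κ ∈ Finset.range lam, (-(q⁻¹ ^ 3)) ^ κ * esym a κ * phi q (lam - κ) x a b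

/-- `g_λ^{(n)}(x | a)`. -/
def gPol (q : ℂ) {n : ℕ} (lam : ℕ) (x : ℂ) (a : Fin n → ℂ) : ℂ :=
  ∑ κ ∈ Finset.range (lam - 1),
    (-q⁻¹) ^ κ * esym a κ * (1 - q⁻¹ ^ (2 * (lam - 1 - κ))) * x ^ (lam - 2 - κ)

/-- `A_λ^{(nl)}(x | a | b)`. -/
def APol (q : ℂ) {n l : ℕ} (lam : ℕ) (x : ℂ) (a : Fin n → ℂ) (b : Fin l → ℂ) : ℂ :=
  (∏ j, (x - a j * q⁻¹)) * fPol q lam x a b +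
    q⁻¹ ^ (2 * (l + lam - 1 - n)) * (∏ i, (x - b i * q)) * gPol q lam x a

/-- `Δ^{(nl)}(x₁,…,x_m | a | b) = det (A_λ(x_μ | a | b))`, `1 ≤ μ ≤ m`, `n-m+1 ≤ λ ≤ n`. -/
def DeltaPol (q : ℂ) {m n l : ℕ} (x : Fin m → ℂ) (a : Fin n → ℂ) (b : Fin l → ℂ) : ℂ :=
  Matrix.det (Matrix.of fun μ i : Fin m => APol q (n - m + 1 + (i : ℕ)) (x μ) a b)

/-! ### The vector `⟨Δ^{(nl)}⟩` -/

/-- The `(- ⋯ - + ⋯ +)` component of `⟨Δ^{(nl)}⟩`. -/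
def bracketExt (q : ℂ) {m n l : ℕ} (x : Fin m → ℂ) (ζ : Fin (n + l) → ℂ) : ℂ :=
  DeltaPol q x (fun j => ζ (Fin.castAdd l j) ^ 2) (fun i => ζ (Fin.natAdd n i) ^ 2) /
    (∏ j : Fin n, ∏ i : Fin l, (ζ (Fin.natAdd n i) ^ 2 - ζ (Fin.castAdd l j) ^ 2 * q⁻¹ ^ 2)) *
    ∏ j : Fin n, ζ (Fin.castAdd l j)

/-- `j` and `j + 1` carry the signs `+` and `-`, respectively. -/
def IsDescent {N : ℕ} (e : Fin N → ℤˣ) (j : ℕ) : Prop :=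
  ∃ h : j + 1 < N, e ⟨j, Nat.lt_of_succ_lt h⟩ = 1 ∧ e ⟨j + 1, h⟩ = -1

open Classical in
/-- The components of `⟨Δ^{(nl)}⟩` are obtained from the extreme one by the `R` symmetry.  Its
component equation at the positions `j, j+1` with the signs `(-,+)` on the left is
`F(…,ζ_{j+1},ζ_j,…)^{…-+…} = b F(ζ)^{…+-…} + c F(ζ)^{…-+…}`, where `b`, `c` are taken at
`ζ_j / ζ_{j+1}`; it is solved for `F(ζ)^{…+-…}`.  Every step lowers by one the number of pairs
`(+,-)` in wrong order, which is at most `n l` for an index of `V^{(nl)}`; the first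
argument counts the steps left. -/
def bracketAux (q : ℂ) {m n l : ℕ} (x : Fin m → ℂ) :
    ℕ → (Fin (n + l) → ℂ) → (Fin (n + l) → ℤˣ) → ℂ
  | 0, ζ, _ => bracketExt q x ζ
  | k + 1, ζ, e =>
    if h : ∃ j, IsDescent e j then
      let j : Fin (n + l) := ⟨Nat.find h, Nat.lt_of_succ_lt (Nat.find_spec h).1⟩
      let j' : Fin (n + l) := ⟨Nat.find h + 1, (Nat.find_spec h).1⟩
      (bracketAux q x k (ζ ∘ Equiv.swap j j') (e ∘ Equiv.swap j j') -
          cR q (ζ j / ζ j') * bracketAux q x k ζ (e ∘ Equiv.swap j j')) /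
        bR q (ζ j / ζ j')
    else bracketExt q x ζ

/-- The vector `⟨Δ^{(nl)}⟩(x | ζ) ∈ V^{(nl)}`. -/
def bracket (q : ℂ) {m n l : ℕ} (x : Fin m → ℂ) (ζ : Fin (n + l) → ℂ) :
    (Fin (n + l) → ℤˣ) → ℂ :=
  fun e => if (Finset.univ.filter fun j => e j = -1).card = n then
    bracketAux q x (n * l) ζ e else 0

/-! ### The kernel `ϑ` -/

/-- All coordinates are nonzero. -/
def NonZero {k : ℕ} (y : Fin k → ℂ) : Prop := ∀ j, y j ≠ 0

/-- `ϑ` is holomorphic on `(ℂ \ {0})^m × U` for some neighbourhood `U` of `ζ`. -/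
def RegularAt {m N : ℕ} (ϑ : (Fin m → ℂ) → (Fin N → ℂ) → ℂ) (ζ : Fin N → ℂ) : Prop :=
  ∃ U ∈ 𝓝 ζ, AnalyticOnNhd ℂ (fun y : (Fin m → ℂ) × (Fin N → ℂ) => ϑ y.1 y.2)
    ({x | NonZero x} ×ˢ U)

/-- `ϑ` is holomorphic in `x ∈ (ℂ \ {0})^m` and meromorphic in `ζ ∈ (ℂ \ {0})^N`: locally in `ζ`
it is the quotient of a function holomorphic in `(x, ζ)` by a nonzero holomorphic function
of `ζ`. -/
def IsMeromorphicKernel {m N : ℕ} (ϑ : (Fin m → ℂ) → (Fin N → ℂ) → ℂ) : Prop :=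
  ∀ ζ₀ : Fin N → ℂ, NonZero ζ₀ → ∃ U ∈ 𝓝 ζ₀, ∃ (d : (Fin N → ℂ) → ℂ)
    (P : (Fin m → ℂ) × (Fin N → ℂ) → ℂ),
    AnalyticOnNhd ℂ d U ∧ AnalyticOnNhd ℂ P ({x | NonZero x} ×ˢ U) ∧
    (∃ᶠ ζ in 𝓝 ζ₀, d ζ ≠ 0) ∧
    ∀ ζ ∈ U, d ζ ≠ 0 → ∀ x, NonZero x → ϑ x ζ = P (x, ζ) / d ζ

/-- The properties required of `ϑ_ε^{(nl)}`, where `N = n + l`, `p = q^{1/2}` and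
`r_ε(ζ) = ε r(ζ)`.  Identities between functions meromorphic in `ζ` are required
at the points where both sides are regular. -/
structure IsKernel (p q : ℂ) (r : ℂ → ℂ) (ε : ℤˣ) {m N : ℕ}
    (ϑ : (Fin m → ℂ) → (Fin N → ℂ) → ℂ) : Prop where
  meromorphic : IsMeromorphicKernel ϑ
  antisymm : ∀ ζ, NonZero ζ → RegularAt ϑ ζ → ∀ x, NonZero x → ∀ π : Equiv.Perm (Fin m),
    ϑ (x ∘ π) ζ = sgn (Equiv.Perm.sign π) * ϑ x ζ
  symm : ∀ ζ, NonZero ζ → ∀ π : Equiv.Perm (Fin N), RegularAt ϑ ζ → RegularAt ϑ (ζ ∘ π) →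
    ∀ x, NonZero x → ϑ x (ζ ∘ π) = ϑ x ζ
  zeta_shift : ∀ ζ, NonZero ζ → ∀ j : Fin N, RegularAt ϑ ζ →
    RegularAt ϑ (Function.update ζ j (ζ j * q⁻¹ ^ 2)) → AnalyticAt ℂ r (ζ j) →
    ∀ x, NonZero x →
    ϑ x (Function.update ζ j (ζ j * q⁻¹ ^ 2)) =
      p⁻¹ ^ N * (sgn ε * r (ζ j)) * (∏ μ, (-(ζ j ^ 2 * q⁻¹) / x μ)) *
        (∏ k ∈ Finset.univ.erase j, ζ k / ζ j) * ϑ x ζ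
  x_shift : ∀ ζ, NonZero ζ → RegularAt ϑ ζ → ∀ x, NonZero x → ∀ μ : Fin m,
    ϑ (Function.update x μ (x μ * q⁻¹ ^ 4)) ζ = (∏ j, (-(x μ * q⁻¹) / ζ j ^ 2)) * ϑ x ζ

/-- The kernel `Ψ^{(nl)}(x | ζ)`. -/
def Psi (q : ℂ) {m N : ℕ} (ϑ : (Fin m → ℂ) → (Fin N → ℂ) → ℂ)
    (x : Fin m → ℂ) (ζ : Fin N → ℂ) : ℂ :=
  ϑ x ζ * ∏ μ, ∏ j, psi q (x μ / ζ j ^ 2)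

/-! ### Contours and the integral -/

/-- Winding number of the closed curve `γ : [0,1] → ℂ` about `y`. -/
def winding (γ : ℝ → ℂ) (y : ℂ) : ℂ :=
  (2 * Real.pi * Complex.I)⁻¹ * ∫ t in (0 : ℝ)..1, deriv γ t / (γ t - y)

/-- The points `z_j τ^{-1-4k}`, to be encircled. -/
def innerPt (q : ℂ) {N : ℕ} (ζ : Fin N → ℂ) (j : Fin N) (k : ℕ) : ℂ :=
  ζ j ^ 2 * q ^ (1 + 4 * k)

/-- The points `z_j τ^{1+4k}`, not to be encircled. -/
def outerPt (q : ℂ) {N : ℕ} (ζ : Fin N → ℂ) (j : Fin N) (k : ℕ) : ℂ :=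
  ζ j ^ 2 * q⁻¹ ^ (1 + 4 * k)

/-- No point to be encircled coincides with one not to be encircled. -/
def NoPinch (q : ℂ) {N : ℕ} (ζ : Fin N → ℂ) : Prop :=
  ∀ i j k k', innerPt q ζ i k ≠ outerPt q ζ j k'

/-- `γ` is a closed `C¹` curve that encircles once anti-clockwise the points `z_j τ^{-1-4k}`
but does not encircle the points `z_j τ^{1+4k}`.  Injectivity is not required: this
only admits more curves than the simple closed ones. -/
structure IsContour (q : ℂ) {N : ℕ} (ζ : Fin N → ℂ) (γ : ℝ → ℂ) : Prop where
  contDiffOn : ContDiffOn ℝ 1 γ (Set.Icc 0 1)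
  closed : γ 0 = γ 1
  ne_zero : ∀ t ∈ Set.Icc (0 : ℝ) 1, γ t ≠ 0
  ne_inner : ∀ t ∈ Set.Icc (0 : ℝ) 1, ∀ j k, γ t ≠ innerPt q ζ j k
  ne_outer : ∀ t ∈ Set.Icc (0 : ℝ) 1, ∀ j k, γ t ≠ outerPt q ζ j k
  winding_inner : ∀ j k, winding γ (innerPt q ζ j k) = 1
  winding_outer : ∀ j k, winding γ (outerPt q ζ j k) = 0

/-- `∏_μ ∮_γ dx_μ / (2πi) F(x₁, …, x_m)`. -/
def multiContour {m : ℕ} (γ : ℝ → ℂ) (F : (Fin m → ℂ) → ℂ) : ℂ :=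
  ((2 * Real.pi * Complex.I)⁻¹) ^ m *
    ∫ t in Set.Icc (0 : Fin m → ℝ) 1, (∏ μ, deriv γ (t μ)) * F (fun μ => γ (t μ))

/-- `Ḡ^{(nl)}(ζ)`, the integrals being taken along the curve `γ`. -/
def Gbar (q : ℂ) {m n l : ℕ} (ϑ : (Fin m → ℂ) → (Fin (n + l) → ℂ) → ℂ) (γ : ℝ → ℂ)
    (ζ : Fin (n + l) → ℂ) : (Fin (n + l) → ℤˣ) → ℂ :=
  fun e => ((m.factorial : ℂ))⁻¹ *
    multiContour γ (fun x : Fin m → ℂ => Psi q ϑ x ζ * bracket q x ζ e)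

/-! ### Residues and the recurrence -/

/-- `Res_{x/y=1} G(x) = ρ`, i.e. `G(x) = ρ / (x/y - 1) + O(1)` as `x → y`, `x ≠ y`. -/
def HasRes (G : ℂ → ℂ) (y ρ : ℂ) : Prop :=
  (fun x => G x - ρ / (x / y - 1)) =O[𝓝[≠] y] (fun _ => (1 : ℝ))

/-- The tuple `(ζ'₁, …, ζ'_{n+l}, w, v)`. -/
def ext2 {n l : ℕ} (ζ' : Fin (n + l) → ℂ) (w v : ℂ) : Fin (n + 1 + (l + 1)) → ℂ :=
  fun i => if h : (i : ℕ) < n + l then ζ' ⟨i, h⟩ else if (i : ℕ) = n + l then w else v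

/-- The constant `c^{(nl)}`. -/
def cConst (q : ℂ) (m n l : ℕ) : ℂ :=
  (-q⁻¹) ^ ((m : ℤ) - n - 2 * l + 3) * poch (q ^ 2) (q ^ 2) ^ 2 *
    (poch2 (q ^ 4) (q ^ 4) (q ^ 4) ^ 2 / poch2 (q ^ 2) (q ^ 4) (q ^ 4) ^ 2)

/-- The recurrence relation between `ϑ = ϑ_ε^{(n+1,l+1)}`, in `m + 1` variables `x`, and
`ϑ' = ϑ_{σε}^{(n,l)}`, in `m` variables `x`. -/
def Recurrence (q : ℂ) (σ : ℤˣ) {m n l : ℕ}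
    (ϑ : (Fin (m + 1) → ℂ) → (Fin (n + 1 + (l + 1)) → ℂ) → ℂ)
    (ϑ' : (Fin m → ℂ) → (Fin (n + l) → ℂ) → ℂ) : Prop :=
  ∀ (ζ' : Fin (n + l) → ℂ) (w : ℂ), NonZero ζ' → w ≠ 0 → RegularAt ϑ' ζ' →
    RegularAt ϑ (ext2 ζ' w (-(sgn σ * w * q))) → ∀ x : Fin m → ℂ, NonZero x →
    ϑ (Fin.snoc x (w ^ 2 * q⁻¹)) (ext2 ζ' w (-(sgn σ * w * q))) =
      cConst q (m + 1) (n + 1) (l + 1) *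
        (w ^ 2) ^ (((n + 1 + (l + 1) : ℕ) : ℤ) - ((m + 1 : ℕ) : ℤ) - 1) *
        (∏ μ, thetaFn (q * x μ / w ^ 2) (q ^ 2)) * ϑ' x ζ'

end QKZ

end

noncomputable section

set_option linter.unusedSectionVars false

/-! ### Infinite products and the theta function -/

namespace QKZ

/-! Write `w` for the variable before the last, `v` for the last one, and `v₀ = -σ w τ`. The factors
`ψ` of the integrand have poles at the points `z_j τ^(-1-4k)`, which the contour encircles, and at
`z_j τ^(1+4k)`, which it does not. Since `v₀² = w² τ²`, the inner point `v² τ⁻¹` meets the outer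
point `w² τ` as `v → v₀`, and the contour is pinched; genericity excludes every other collision.

To extract the pole, the contour is replaced by a fixed cycle that also encircles `w² τ` and serves
for all `v` near `v₀` (`exists_cycle`). Each variable moved across `w² τ` produces a residue that
contains `ψ(w² τ / v²)`, which has a simple pole at `v₀`. The integrand is symmetric in the `x_μ`
and vanishes when two of them agree. Hence no second residue arises, and all variables contribute
equally, which turns `1 / (m + 1)!` into `1 / m!` (`multiContour_eq_add_residue`,
`hasRes_multiContour`).

At `v₀` the residue has to be recognised as the smaller integral. For `ϑ`, one step of
quasi-periodicity in `v` leads from the point of the assumed recurrence to `v₀` (`kernel_snoc_eq`).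
The theta functions cancel the two additional factors `ψ` of each variable up to a simple pole at
`w² τ` (`psi_mul_psi_mul_theta_of_mem`), and that pole is cancelled by a zero of `Δ`.

For the polynomial, `Δ` is multiplied by the Vandermonde determinant with nodes `a_j τ³`. Generating
functions evaluate the resulting combinations of the `A_λ` in closed form (`mul_sum_pow_mul_APol`).
At `x = z τ`, with `z` and `z τ²` among the `b_i`, `Δ` then becomes a determinant with one special
column. Expansion along that column gives a sum over `i` of minors that depend on `z`, and the
partial fraction identity `sum_div_mul_det_twist` permits `z` to be exchanged for `a_i` in the
`i`-th minor. These minors are the smaller polynomials with `a_i` moved to the second group. What is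
left over consists of functions that are exact in one variable (`DeltaPol_snoc_eq`). Their integrals
vanish, because each is the difference of an integral over a cycle and over its dilation by `τ⁴`
(`cycInt_exact`).

On the right hand side only components with one displaced sign are needed. The exchange relations
express them linearly by extreme components (`bracket_pat`), and the chain of `R` matrices
telescopes to a similar expression (`Rchain_extreme`). Its coefficients are, up to a common factor,
the Lagrange weights found in the reduction of `Δ` (`cR_mul_prod_eq`). The comparison of the
constants (`recurrence_const`) completes the proof. -/

lemma summable_norm_mul_pow (a : ℂ) {p : ℂ} (hp : ‖p‖ < 1) :
    Summable fun k : ℕ => ‖-(a * p ^ k)‖ := by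
  simpa using (summable_geometric_of_lt_one (norm_nonneg p) hp).mul_left ‖a‖

lemma multipliable_poch (a : ℂ) {p : ℂ} (hp : ‖p‖ < 1) :
    Multipliable fun k : ℕ => 1 - a * p ^ k := by
  simpa [sub_eq_add_neg] using multipliable_one_add_of_summable (summable_norm_mul_pow a hp)

lemma poch_eq_one_sub_mul (a : ℂ) {p : ℂ} (hp : ‖p‖ < 1) :
    poch a p = (1 - a) * poch (a * p) p := by
  have e : ∀ k : ℕ, 1 - a * p * p ^ k = 1 - a * p ^ (k + 1) := fun k => by ring
  have h : Multipliable fun k : ℕ => 1 - a * p ^ (k + 1) :=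
    (multipliable_poch (a * p) hp).congr e
  have h2 : ∏' k : ℕ, (1 - a * p ^ k) = (1 - a * p ^ 0) * ∏' k : ℕ, (1 - a * p ^ (k + 1)) :=
    tprod_eq_zero_mul' (f := fun k : ℕ => 1 - a * p ^ k) h
  have h3 : poch (a * p) p = ∏' k : ℕ, (1 - a * p ^ (k + 1)) := tprod_congr e
  rw [h3, poch, h2, pow_zero, mul_one]

lemma poch_eq_prod_mul (a : ℂ) {p : ℂ} (hp : ‖p‖ < 1) (K : ℕ) :
    poch a p = (∏ k ∈ Finset.range K, (1 - a * p ^ k)) * poch (a * p ^ K) p := by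
  induction K with
  | zero => simp
  | succ K ih =>
    rw [ih, Finset.prod_range_succ, poch_eq_one_sub_mul (a * p ^ K) hp, mul_assoc a, ← pow_succ]
    ring

lemma poch_ne_zero {a p : ℂ} (hp : ‖p‖ < 1) (h : ∀ k : ℕ, 1 - a * p ^ k ≠ 0) : poch a p ≠ 0 := by
  have := tprod_one_add_ne_zero_of_summable (f := fun k : ℕ => -(a * p ^ k))
    (by simpa [sub_eq_add_neg] using h) (summable_norm_mul_pow a hp)
  simpa [poch, sub_eq_add_neg] using this

lemma poch_ne_zero_of_norm_lt {a p : ℂ} (hp : ‖p‖ < 1) (ha : ‖a‖ < 1) : poch a p ≠ 0 := by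
  refine poch_ne_zero hp fun k h => ?_
  have h1 : a * p ^ k = 1 := (sub_eq_zero.mp h).symm
  have h2 : ‖a * p ^ k‖ < 1 := by
    rw [norm_mul, norm_pow]
    exact (mul_le_of_le_one_right (norm_nonneg _) (pow_le_one₀ (norm_nonneg _) hp.le)).trans_lt ha
  rw [h1] at h2; simp at h2

lemma differentiable_poch {p : ℂ} (hp : ‖p‖ < 1) : Differentiable ℂ fun a => poch a p := by
  -- The majorant `R * ‖p‖ ^ k` needs a bound on `a`, hence the exhaustion by balls.
  have key : ∀ R : ℝ, DifferentiableOn ℂ (fun a => poch a p) (Metric.ball 0 R) := by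
    intro R
    have h := Summable.hasProdLocallyUniformlyOn_one_add (f := fun (k : ℕ) (a : ℂ) => -(a * p ^ k))
      (u := fun k => R * ‖p‖ ^ k) (K := Metric.ball (0 : ℂ) R) (hK := Metric.isOpen_ball)
      (hu := (summable_geometric_of_lt_one (norm_nonneg p) hp).mul_left R)
      (Filter.Eventually.of_forall fun k a ha => by
        rw [norm_neg, norm_mul, norm_pow]
        have : ‖a‖ < R := by simpa using ha
        gcongr) (fun k => by fun_prop)
    have h2 := h.differentiableOn
      (.of_forall fun s => by
        simpa [Finset.prod_fn] using DifferentiableOn.finsetProd (fun _ _ ↦ by fun_prop))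
      Metric.isOpen_ball
    simpa [poch, sub_eq_add_neg] using h2
  intro a
  exact (key (‖a‖ + 1)).differentiableAt (Metric.isOpen_ball.mem_nhds (by simp))

/-- Even and odd factors of the product to base `q ^ 2` are separated. This is what merges two
neighbouring factors `ψ`, to base `q ^ 4`, into a theta function to base `q ^ 2`. -/
lemma poch_mul_poch_sq (a : ℂ) {q : ℂ} (hq : ‖q‖ < 1) :
    poch a (q ^ 4) * poch (a * q ^ 2) (q ^ 4) = poch a (q ^ 2) := by
  have h4 : ‖q ^ 4‖ < 1 := by
    rw [norm_pow]; exact pow_lt_one₀ (norm_nonneg _) hq (by norm_num)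
  have e0 : ∀ k : ℕ, 1 - a * (q ^ 4) ^ k = 1 - a * (q ^ 2) ^ (2 * k) := fun k => by
    rw [← pow_mul, ← pow_mul]; congr 3; ring
  have e1 : ∀ k : ℕ, 1 - a * q ^ 2 * (q ^ 4) ^ k = 1 - a * (q ^ 2) ^ (2 * k + 1) := fun k => by
    rw [← pow_mul, ← pow_mul, mul_assoc, ← pow_add]; congr 3; ring
  have h0 : Multipliable fun k : ℕ => 1 - a * (q ^ 2) ^ (2 * k) :=
    (multipliable_poch a h4).congr e0
  have h1 : Multipliable fun k : ℕ => 1 - a * (q ^ 2) ^ (2 * k + 1) :=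
    (multipliable_poch (a * q ^ 2) h4).congr e1
  have h2 := tprod_even_mul_odd (f := fun k : ℕ => 1 - a * (q ^ 2) ^ k) h0 h1
  have h3 : poch a (q ^ 4) = ∏' k : ℕ, (1 - a * (q ^ 2) ^ (2 * k)) := tprod_congr e0
  have h5 : poch (a * q ^ 2) (q ^ 4) = ∏' k : ℕ, (1 - a * (q ^ 2) ^ (2 * k + 1)) :=
    tprod_congr e1
  rw [h3, h5]
  exact h2

lemma one_sub_pow_ne_zero {q : ℂ} (hq : ‖q‖ < 1) {k : ℕ} (hk : k ≠ 0) : 1 - q ^ k ≠ 0 := by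
  intro h
  have h1 : ‖q ^ k‖ < 1 := by rw [norm_pow]; exact pow_lt_one₀ (norm_nonneg _) hq hk
  rw [← sub_eq_zero.mp h] at h1; simp at h1

lemma poch_pow_ne_zero {q : ℂ} (hq : ‖q‖ < 1) {i j : ℕ} (hi : i ≠ 0) (hj : j ≠ 0) :
    poch (q ^ i) (q ^ j) ≠ 0 := by
  have hj' : ‖q ^ j‖ < 1 := by rw [norm_pow]; exact pow_lt_one₀ (norm_nonneg _) hq hj
  refine poch_ne_zero hj' fun k => ?_
  rw [← pow_mul, ← pow_add]
  exact one_sub_pow_ne_zero hq (by omega)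

lemma poch2_pow_ne_zero {q : ℂ} (hq : ‖q‖ < 1) {i : ℕ} (hi : i ≠ 0) :
    poch2 (q ^ i) (q ^ 4) (q ^ 4) ≠ 0 := by
  have h4 : ‖q ^ 4‖ < 1 := by
    rw [norm_pow]; exact pow_lt_one₀ (norm_nonneg _) hq (by norm_num)
  have hs : Summable fun k : ℕ × ℕ => ‖-(q ^ i * (q ^ 4) ^ k.1 * (q ^ 4) ^ k.2)‖ := by
    have h := (summable_geometric_of_lt_one (norm_nonneg (q ^ 4)) h4)
    simpa [mul_assoc] using
      ((h.mul_of_nonneg h (fun _ => by positivity) (fun _ => by positivity)).mul_left ‖q ^ i‖)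
  have := tprod_one_add_ne_zero_of_summable
    (f := fun k : ℕ × ℕ => -(q ^ i * (q ^ 4) ^ k.1 * (q ^ 4) ^ k.2))
    (fun k => by
      rw [← sub_eq_add_neg, ← pow_mul, ← pow_mul, ← pow_add, ← pow_add]
      exact one_sub_pow_ne_zero hq (by omega)) hs
  simpa [poch2, sub_eq_add_neg] using this

/-- `ψ(y) ψ(y q²) θ(q y | q²) = q y / (q y - 1)` away from the zeros of the theta function. -/
lemma psi_mul_psi_mul_theta {q y : ℂ} (hq : ‖q‖ < 1) (hq0 : q ≠ 0) (hy : y ≠ 0)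
    (h1 : q * y ≠ 1) (hθ : thetaFn (q * y) (q ^ 2) ≠ 0) :
    psi q y * psi q (y * q ^ 2) * thetaFn (q * y) (q ^ 2) = q * y / (q * y - 1) := by
  have h4 : ‖q ^ 4‖ < 1 := by
    rw [norm_pow]; exact pow_lt_one₀ (norm_nonneg _) hq (by norm_num)
  have e1 : poch (y * q) (q ^ 4) * poch (y * q ^ 2 * q) (q ^ 4) = poch (q * y) (q ^ 2) := by
    rw [← poch_mul_poch_sq _ hq]; congr 2 <;> ring
  -- The second product starts one step too early, at `(q y)⁻¹`. Its leading factor is split off and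
  -- is the source of the pole at `q y = 1`.
  have e2 : poch (y⁻¹ * q) (q ^ 4) * poch ((y * q ^ 2)⁻¹ * q) (q ^ 4) =
      (1 - (q * y)⁻¹) * poch (q ^ 2 / (q * y)) (q ^ 2) := by
    rw [← poch_mul_poch_sq (q ^ 2 / (q * y)) hq, poch_eq_one_sub_mul ((y * q ^ 2)⁻¹ * q) h4,
      show y⁻¹ * q = q ^ 2 / (q * y) by field_simp,
      show (y * q ^ 2)⁻¹ * q * q ^ 4 = q ^ 2 / (q * y) * q ^ 2 by field_simp,
      show (y * q ^ 2)⁻¹ * q = (q * y)⁻¹ by field_simp]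
    ring
  have h3 : q * y - 1 ≠ 0 := sub_ne_zero.mpr h1
  have : psi q y * psi q (y * q ^ 2) =
      1 / (thetaFn (q * y) (q ^ 2) * (1 - (q * y)⁻¹)) := by
    rw [psi, psi, thetaFn, div_mul_div_comm, one_mul]
    congr 1
    calc _ = (poch (y * q) (q ^ 4) * poch (y * q ^ 2 * q) (q ^ 4)) *
          (poch (y⁻¹ * q) (q ^ 4) * poch ((y * q ^ 2)⁻¹ * q) (q ^ 4)) := by ring
      _ = _ := by rw [e1, e2]; ring
  rw [this, show 1 - (q * y)⁻¹ = (q * y - 1) / (q * y) by field_simp]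
  have hqy : q * y ≠ 0 := mul_ne_zero hq0 hy
  generalize thetaFn (q * y) (q ^ 2) = T at hθ
  field_simp

end QKZ

/-! ### Loops, winding numbers and Cauchy's formula on an annulus -/

namespace QKZ
open Set MeasureTheory Metric

/-- A closed piecewise regular curve in `ℂ \ {0}`, parametrised by `[0,1]`, with derivative `D`. -/
structure Loop where
  γ : ℝ → ℂ
  D : ℝ → ℂ
  contD : ContinuousOn D (Icc 0 1)
  hasDeriv : ∀ t ∈ Ioo (0 : ℝ) 1, HasDerivAt γ (D t) t
  cont : ContinuousOn γ (Icc 0 1)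
  closed : γ 0 = γ 1
  ne_zero : ∀ t ∈ Icc (0 : ℝ) 1, γ t ≠ 0

namespace Loop

/-- The image of a loop. -/
def supp (Γ : Loop) : Set ℂ := Γ.γ '' Icc 0 1

/-- `(2πi)⁻¹ ∮ f(x) dx`. -/
def int (Γ : Loop) (f : ℂ → ℂ) : ℂ :=
  (2 * Real.pi * Complex.I)⁻¹ * ∫ t in (0 : ℝ)..1, Γ.D t * f (Γ.γ t)

/-- Winding number. -/
def wind (Γ : Loop) (p : ℂ) : ℂ := Γ.int fun x => (x - p)⁻¹

variable (Γ : Loop)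

lemma mem_supp {t : ℝ} (ht : t ∈ Icc (0 : ℝ) 1) : Γ.γ t ∈ Γ.supp := mem_image_of_mem _ ht

lemma isCompact_supp : IsCompact Γ.supp := isCompact_Icc.image_of_continuousOn Γ.cont

lemma zero_notMem_supp : (0 : ℂ) ∉ Γ.supp := by
  rintro ⟨t, ht, h⟩; exact Γ.ne_zero t ht h

lemma ne_zero_of_mem_supp {x : ℂ} (hx : x ∈ Γ.supp) : x ≠ 0 := by
  rintro rfl; exact Γ.zero_notMem_supp hx

variable {Γ}

lemma continuousOn_integrand {f : ℂ → ℂ} (hf : ContinuousOn f Γ.supp) :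
    ContinuousOn (fun t => Γ.D t * f (Γ.γ t)) (Icc 0 1) :=
  Γ.contD.mul (hf.comp Γ.cont fun _ ht => Γ.mem_supp ht)

lemma intervalIntegrable {f : ℂ → ℂ} (hf : ContinuousOn f Γ.supp) :
    IntervalIntegrable (fun t => Γ.D t * f (Γ.γ t)) volume 0 1 :=
  ContinuousOn.intervalIntegrable (by simpa using continuousOn_integrand hf)

lemma int_congr {f g : ℂ → ℂ} (h : ∀ x ∈ Γ.supp, f x = g x) : Γ.int f = Γ.int g := by
  unfold int
  congr 1
  refine intervalIntegral.integral_congr fun t ht => ?_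
  simp only [zero_le_one, uIcc_of_le] at ht
  simp only [h _ (Γ.mem_supp ht)]

lemma int_add {f g : ℂ → ℂ} (hf : ContinuousOn f Γ.supp) (hg : ContinuousOn g Γ.supp) :
    Γ.int (fun x => f x + g x) = Γ.int f + Γ.int g := by
  unfold int
  rw [← mul_add, ← intervalIntegral.integral_add (intervalIntegrable hf) (intervalIntegrable hg)]
  simp only [mul_add]

lemma int_const_mul (c : ℂ) (f : ℂ → ℂ) : Γ.int (fun x => c * f x) = c * Γ.int f := by
  unfold int
  rw [mul_left_comm, ← intervalIntegral.integral_const_mul c]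
  simp only [mul_left_comm]

lemma int_eq_zero_of_hasDerivAt {F f : ℂ → ℂ} (hf : ContinuousOn f Γ.supp)
    (h : ∀ x ∈ Γ.supp, HasDerivAt F (f x) x) : Γ.int f = 0 := by
  unfold int
  rw [intervalIntegral.integral_eq_sub_of_hasDerivAt_of_le (f := fun t => F (Γ.γ t)) zero_le_one,
    Γ.closed]
  · simp
  · intro t ht
    exact (h _ (Γ.mem_supp ht)).continuousAt.comp_continuousWithinAt (Γ.cont t ht)
  · intro t ht
    have := (h _ (Γ.mem_supp (Ioo_subset_Icc_self ht))).comp t (Γ.hasDeriv t ht)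
    simpa [mul_comm] using! this
  · exact intervalIntegrable hf

lemma continuousOn_inv_sub {p : ℂ} (hp : p ∉ Γ.supp) :
    ContinuousOn (fun x => (x - p)⁻¹) Γ.supp :=
  ContinuousOn.inv₀ (by fun_prop) fun x hx h => hp (by rwa [← sub_eq_zero.mp h])

lemma one_sub_mem_slitPlane {w : ℂ} (hw : ‖w‖ < 1) : 1 - w ∈ Complex.slitPlane := by
  refine Or.inl ?_
  have := (Complex.re_le_norm w).trans_lt hw
  simp only [Complex.sub_re, Complex.one_re]; linarith

/-- Where `‖x‖ < ‖u‖`, the principal branch of `log (1 - x / u)` is a primitive of `1 / (x - u)`. -/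
lemma wind_far {u : ℂ} (hu : ∀ x ∈ Γ.supp, ‖x‖ < ‖u‖) : Γ.wind u = 0 := by
  have hu' : u ∉ Γ.supp := fun h => lt_irrefl _ (hu u h)
  refine int_eq_zero_of_hasDerivAt (F := fun x => Complex.log (1 - x / u))
    (continuousOn_inv_sub hu') fun x hx => ?_
  have h0 : u ≠ 0 := by rintro rfl; exact absurd (hu x hx) (by simp)
  have h1 : ‖x / u‖ < 1 := by
    rw [norm_div, div_lt_one (norm_pos_iff.mpr h0)]; exact hu x hx
  have h2 : HasDerivAt (fun x : ℂ => 1 - x / u) (-(1 / u)) x :=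
    ((hasDerivAt_id x).div_const u).const_sub 1
  have h3 := h2.clog (one_sub_mem_slitPlane h1)
  convert! h3 using 1
  have h4 : x - u ≠ 0 := fun h => hu' (by rwa [← sub_eq_zero.mp h])
  have h5 : u - x ≠ 0 := fun h => h4 (by rw [← neg_sub, h, neg_zero])
  have h6 : 1 - x / u ≠ 0 := by rw [one_sub_div h0]; exact div_ne_zero h5 h0
  rw [one_sub_div h0]
  field_simp
  ring

/-- Where `‖u‖ < ‖x‖`, the principal branch of `log (1 - u / x)` is a primitive of `1 / (x - u) - 1
/ x`. -/
lemma wind_near {u : ℂ} (hu : ∀ x ∈ Γ.supp, ‖u‖ < ‖x‖) : Γ.wind u = Γ.wind 0 := by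
  have hu' : u ∉ Γ.supp := fun h => lt_irrefl _ (hu u h)
  have c1 := continuousOn_inv_sub hu'
  have c0 := continuousOn_inv_sub Γ.zero_notMem_supp
  have key : Γ.int (fun x => (x - u)⁻¹ + (-1) * (x - 0)⁻¹) = 0 := by
    refine int_eq_zero_of_hasDerivAt (F := fun x => Complex.log (1 - u / x))
      (c1.add (continuousOn_const.mul c0)) fun x hx => ?_
    have h0 : x ≠ 0 := Γ.ne_zero_of_mem_supp hx
    have h1 : ‖u / x‖ < 1 := by
      rw [norm_div, div_lt_one (norm_pos_iff.mpr h0)]; exact hu x hx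
    have h2 : HasDerivAt (fun x : ℂ => 1 - u / x) (u / x ^ 2) x := by
      have := ((hasDerivAt_inv h0).const_mul u).const_sub 1
      convert! this using 1
      field_simp
    have h3 := h2.clog (one_sub_mem_slitPlane h1)
    convert! h3 using 1
    have h4 : x - u ≠ 0 := fun h => hu' (by rwa [← sub_eq_zero.mp h])
    rw [one_sub_div h0]
    field_simp
    ring
  rw [int_add (g := fun x => -1 * (x - 0)⁻¹) c1 (continuousOn_const.mul c0), int_const_mul] at key
  unfold wind
  linear_combination key

end Loop

/-- Cauchy's formula for an annulus. -/
lemma annulus_cauchy {h : ℂ → ℂ} {r R : ℝ} (hr : 0 < r) {x : ℂ}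
    (hx : r < ‖x‖) (hx' : ‖x‖ < R)
    (hh : ∀ y, r ≤ ‖y‖ → ‖y‖ ≤ R → DifferentiableAt ℂ h y) :
    2 * Real.pi * Complex.I * h x =
      (∮ u in C(0, R), h u * (u - x)⁻¹) - ∮ u in C(0, r), h u * (u - x)⁻¹ := by
  have hR : 0 < R := hr.trans (hx.trans hx')
  have hdx : DifferentiableAt ℂ h x := hh x hx.le hx'.le
  have hcont : ∀ y, r ≤ ‖y‖ → ‖y‖ ≤ R → ContinuousAt (dslope h x) y := fun y hy hy' => by
    by_cases e : y = x
    · subst e; exact continuousAt_dslope_same.mpr hdx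
    · exact (continuousAt_dslope_of_ne e).mpr (hh y hy hy').continuousAt
  -- The divided difference of `h` at `x` is continuous on the closed annulus and holomorphic off
  -- `x`, so its integrals over the two bounding circles agree.
  have h1 : (∮ u in C(0, R), dslope h x u) = ∮ u in C(0, r), dslope h x u := by
    refine Complex.circleIntegral_eq_of_differentiable_on_annulus_off_countable hr
      (hx.le.trans hx'.le) (countable_singleton x) ?_ ?_
    · intro y hy
      simp only [mem_sdiff, mem_closedBall, dist_zero_right, mem_ball, not_lt] at hy
      exact (hcont y hy.2 hy.1).continuousWithinAt
    · rintro y ⟨hy, hyx⟩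
      simp only [mem_sdiff, mem_closedBall, dist_zero_right, mem_ball, not_le] at hy
      exact (differentiableAt_dslope_of_ne hyx).mpr (hh y hy.2.le hy.1.le)
  have h2 : ∀ ρ : ℝ, 0 < ρ → r ≤ ρ → ρ ≤ R → ρ ≠ ‖x‖ → (∮ u in C(0, ρ), dslope h x u) =
      (∮ u in C(0, ρ), h u * (u - x)⁻¹) - h x * ∮ u in C(0, ρ), (u - x)⁻¹ := by
    intro ρ h0 hρ hρ' hne
    have hs : ∀ u ∈ sphere (0 : ℂ) ρ, u - x ≠ 0 := fun u hu e => hne (by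
      rw [← sub_eq_zero.mp e]; simpa using hu.symm)
    have ci : ContinuousOn (fun u => (u - x)⁻¹) (sphere (0 : ℂ) ρ) :=
      ContinuousOn.inv₀ (by fun_prop) hs
    have ch : ContinuousOn h (sphere (0 : ℂ) ρ) := fun u hu => by
      have : ‖u‖ = ρ := by simpa using hu
      exact (hh u (this ▸ hρ) (this ▸ hρ')).continuousAt.continuousWithinAt
    rw [← circleIntegral.integral_const_mul, ← circleIntegral.integral_sub]
    · refine circleIntegral.integral_congr h0.le fun u hu => ?_
      have := hs u hu
      rw [dslope_of_ne _ (sub_ne_zero.mp this), slope_def_field]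
      field_simp
    · exact (ch.mul ci).circleIntegrable h0.le
    · exact (continuousOn_const.mul ci).circleIntegrable h0.le
  have h3 : (∮ u in C(0, R), (u - x)⁻¹) = 2 * Real.pi * Complex.I :=
    circleIntegral.integral_sub_inv_of_mem_ball (by simpa using hx')
  have h4 : (∮ u in C(0, r), (u - x)⁻¹) = 0 := by
    refine Complex.circleIntegral_eq_zero_of_differentiable_on_off_countable hr.le
      countable_empty ?_ ?_
    · refine ContinuousOn.inv₀ (by fun_prop) fun u hu e => ?_
      rw [sub_eq_zero.mp e] at hu
      exact absurd hx (not_lt.mpr (by simpa using hu))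
    · rintro u ⟨hu, -⟩
      refine DifferentiableAt.inv (by fun_prop) fun e => ?_
      rw [sub_eq_zero.mp e] at hu
      exact absurd hx (not_lt.mpr (by simpa using hu : ‖x‖ < r).le)
  rw [h2 R hR (hx.le.trans hx'.le) le_rfl hx'.ne', h2 r hr le_rfl (hx.le.trans hx'.le) hx.ne,
    h3, h4] at h1
  linear_combination -h1

/-- Exchange of the integrals over a loop and over a circle. -/
lemma Loop.int_circleIntegral_inv_sub {Γ : Loop} {h : ℂ → ℂ} {ρ : ℝ} (hρ : 0 < ρ)
    (hh : ContinuousOn h (sphere 0 ρ)) (hΓ : ∀ x ∈ Γ.supp, ‖x‖ ≠ ρ) :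
    IntervalIntegrable (fun t => Γ.D t * ∮ u in C(0, ρ), h u * (u - Γ.γ t)⁻¹) volume 0 1 ∧
    Γ.int (fun x => ∮ u in C(0, ρ), h u * (u - x)⁻¹) =
      -∮ u in C(0, ρ), h u * Γ.wind u := by
  have hcm : ∀ θ : ℝ, circleMap 0 ρ θ ∈ sphere (0 : ℂ) ρ := fun θ =>
    circleMap_mem_sphere 0 hρ.le θ
  have hcc : Continuous fun θ : ℝ => h (circleMap 0 ρ θ) :=
    hh.comp_continuous (continuous_circleMap 0 ρ) hcm
  have hc : ContinuousOn (Function.uncurry fun (t θ : ℝ) => Γ.D t *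
      (deriv (circleMap 0 ρ) θ * (h (circleMap 0 ρ θ) * (circleMap 0 ρ θ - Γ.γ t)⁻¹)))
      (Icc (0 : ℝ) 1 ×ˢ Icc (0 : ℝ) (2 * Real.pi)) := by
    have c1 : ContinuousOn (fun p : ℝ × ℝ => Γ.D p.1)
        (Icc (0 : ℝ) 1 ×ˢ Icc (0 : ℝ) (2 * Real.pi)) :=
      Γ.contD.comp continuousOn_fst fun p hp => hp.1
    have c2 : ContinuousOn (fun p : ℝ × ℝ => Γ.γ p.1)
        (Icc (0 : ℝ) 1 ×ˢ Icc (0 : ℝ) (2 * Real.pi)) :=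
      Γ.cont.comp continuousOn_fst fun p hp => hp.1
    have c3 : Continuous (fun p : ℝ × ℝ => circleMap 0 ρ p.2) :=
      (continuous_circleMap 0 ρ).comp continuous_snd
    have c4 : Continuous (fun p : ℝ × ℝ => deriv (circleMap 0 ρ) p.2) := by
      simp only [deriv_circleMap]; fun_prop
    refine c1.mul (c4.continuousOn.mul ((hcc.comp continuous_snd).continuousOn.mul
      (ContinuousOn.inv₀ (c3.continuousOn.sub c2) ?_)))
    rintro ⟨t, θ⟩ hp e
    refine hΓ _ (Γ.mem_supp hp.1) ?_
    rw [← sub_eq_zero.mp e]; simpa using hcm θ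
  have hint : Integrable (Function.uncurry fun (t θ : ℝ) => Γ.D t *
      (deriv (circleMap 0 ρ) θ * (h (circleMap 0 ρ θ) * (circleMap 0 ρ θ - Γ.γ t)⁻¹)))
      ((volume.restrict (uIoc (0 : ℝ) 1)).prod
        (volume.restrict (Ioc (0 : ℝ) (2 * Real.pi)))) := by
    rw [Measure.prod_restrict, uIoc_of_le zero_le_one]
    exact (hc.integrableOn_compact (isCompact_Icc.prod isCompact_Icc)).mono_set
      (prod_mono Ioc_subset_Icc_self Ioc_subset_Icc_self)
  have hsw := intervalIntegral_integral_swap hint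
  have e1 : Γ.int (fun x => ∮ u in C(0, ρ), h u * (u - x)⁻¹) =
      (2 * Real.pi * Complex.I)⁻¹ * ∫ t in (0 : ℝ)..1, ∫ θ in Ioc (0 : ℝ) (2 * Real.pi),
        Γ.D t * (deriv (circleMap 0 ρ) θ * (h (circleMap 0 ρ θ) *
          (circleMap 0 ρ θ - Γ.γ t)⁻¹)) := by
    simp only [int, circleIntegral, smul_eq_mul, intervalIntegral.integral_of_le
      Real.two_pi_pos.le, integral_const_mul]
  refine ⟨?_, ?_⟩
  · rw [intervalIntegrable_iff]
    have := hint.integral_prod_left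
    simpa only [Function.uncurry, circleIntegral, smul_eq_mul, intervalIntegral.integral_of_le
      Real.two_pi_pos.le, integral_const_mul] using! this
  rw [e1, hsw, circleIntegral, intervalIntegral.integral_of_le Real.two_pi_pos.le,
    ← integral_const_mul, ← integral_neg]
  refine setIntegral_congr_fun measurableSet_Ioc fun θ _ => ?_
  simp only [wind, int, smul_eq_mul, ← intervalIntegral.integral_const_mul,
    ← intervalIntegral.integral_neg]
  refine intervalIntegral.integral_congr fun t ht => ?_
  rw [show (circleMap 0 ρ θ - Γ.γ t)⁻¹ = -(Γ.γ t - circleMap 0 ρ θ)⁻¹ by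
    rw [← neg_sub, inv_neg]]
  ring

end QKZ

/-! ### The residue theorem for cycles -/

namespace QKZ
open Set MeasureTheory Metric Filter

lemma Loop.supp_nonempty (Γ : Loop) : Γ.supp.Nonempty := ⟨_, Γ.mem_supp ⟨le_rfl, zero_le_one⟩⟩

lemma Loop.eventually_lt_norm (Γ : Loop) {r : ℝ} (h : ∀ x ∈ Γ.supp, r < ‖x‖) :
    ∀ᶠ r' in 𝓝[>] r, ∀ x ∈ Γ.supp, r' < ‖x‖ := by
  obtain ⟨x, hx, hmin⟩ := Γ.isCompact_supp.exists_isMinOn Γ.supp_nonempty continuous_norm.continuousOn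
  filter_upwards [Ioo_mem_nhdsGT (h x hx)] with r' hr' y hy
  exact hr'.2.trans_le (hmin hy)

lemma Loop.eventually_norm_lt (Γ : Loop) {R : ℝ} (h : ∀ x ∈ Γ.supp, ‖x‖ < R) :
    ∀ᶠ R' in 𝓝[<] R, ∀ x ∈ Γ.supp, ‖x‖ < R' := by
  obtain ⟨x, hx, hmax⟩ := Γ.isCompact_supp.exists_isMaxOn Γ.supp_nonempty continuous_norm.continuousOn
  filter_upwards [Ioo_mem_nhdsLT (h x hx)] with r' hr' y hy
  exact (hmax hy).trans_lt hr'.1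

/-- The open annulus. -/
def annulus (r R : ℝ) : Set ℂ := {y | r < ‖y‖ ∧ ‖y‖ < R}

lemma isOpen_annulus (r R : ℝ) : IsOpen (annulus r R) :=
  (isOpen_lt continuous_const continuous_norm).inter (isOpen_lt continuous_norm continuous_const)

/-- Cauchy's formula writes `h` on the loop as a difference of circle integrals of `h u / (u - x)`.
After the exchange of integrations these are circle integrals of `h` against the winding number,
which is zero on the outer circle and equal to `Γ.wind 0` on the inner one. No homotopy of curves is
involved. -/
lemma Loop.int_holomorphic (Γ : Loop) {h : ℂ → ℂ} {r R r' : ℝ} (hr : 0 ≤ r)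
    (hΓ : Γ.supp ⊆ annulus r R) (hh : DifferentiableOn ℂ h (annulus r R)) (hr' : r < r')
    (hΓ' : ∀ x ∈ Γ.supp, r' < ‖x‖) :
    Γ.int h = Γ.wind 0 * ((2 * Real.pi * Complex.I)⁻¹ * ∮ u in C(0, r'), h u) := by
  obtain ⟨x0, hx0⟩ := Γ.supp_nonempty
  have hR0 : 0 < R := ((norm_nonneg x0).trans_lt (hΓ hx0).2)
  obtain ⟨R', hR', hR'R⟩ := ((Γ.eventually_norm_lt fun x hx => (hΓ hx).2).and
    self_mem_nhdsWithin).exists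
  have hr'0 : 0 < r' := hr.trans_lt hr'
  have hR'0 : 0 < R' := (norm_nonneg x0).trans_lt (hR' x0 hx0)
  have hr'R' : r' < R' := (hΓ' x0 hx0).trans (hR' x0 hx0)
  have hd : ∀ y, r' ≤ ‖y‖ → ‖y‖ ≤ R' → DifferentiableAt ℂ h y := fun y hy hy' =>
    hh.differentiableAt ((isOpen_annulus r R).mem_nhds ⟨hr'.trans_le hy, hy'.trans_lt hR'R⟩)
  have hc : ∀ ρ, r' ≤ ρ → ρ ≤ R' → ContinuousOn h (sphere 0 ρ) := fun ρ h1 h2 u hu => by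
    have : ‖u‖ = ρ := by simpa using hu
    exact (hd u (this ▸ h1) (this ▸ h2)).continuousAt.continuousWithinAt
  obtain ⟨i1, e1⟩ := Loop.int_circleIntegral_inv_sub hR'0 (hc R' hr'R'.le le_rfl)
    fun x hx => (hR' x hx).ne
  obtain ⟨i2, e2⟩ := Loop.int_circleIntegral_inv_sub hr'0 (hc r' le_rfl hr'R'.le)
    fun x hx => (hΓ' x hx).ne'
  have e3 : (∮ u in C(0, R'), h u * Γ.wind u) = 0 := by
    rw [circleIntegral.integral_congr (g := fun _ => 0) hR'0.le]
    · simp [circleIntegral]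
    · intro u hu
      have : ‖u‖ = R' := by simpa using hu
      simp only
      rw [Γ.wind_far fun x hx => this ▸ hR' x hx, mul_zero]
  have e4 : (∮ u in C(0, r'), h u * Γ.wind u) = (∮ u in C(0, r'), h u) * Γ.wind 0 := by
    rw [mul_comm, ← circleIntegral.integral_const_mul]
    refine circleIntegral.integral_congr hr'0.le fun u hu => ?_
    have : ‖u‖ = r' := by simpa using hu
    rw [Γ.wind_near fun x hx => this ▸ hΓ' x hx, mul_comm]
  have key : Γ.int (fun x => 2 * Real.pi * Complex.I * h x) =
      Γ.int (fun x => ∮ u in C(0, R'), h u * (u - x)⁻¹) -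
      Γ.int (fun x => ∮ u in C(0, r'), h u * (u - x)⁻¹) := by
    rw [Loop.int_congr (g := fun x => (∮ u in C(0, R'), h u * (u - x)⁻¹) -
      ∮ u in C(0, r'), h u * (u - x)⁻¹) fun x hx =>
      annulus_cauchy hr'0 (hΓ' x hx) (hR' x hx) hd]
    simp only [Loop.int, mul_sub]
    rw [intervalIntegral.integral_sub i1 i2, mul_sub]
  rw [Loop.int_const_mul, e1, e2, e3, e4] at key
  have hpi : (2 * Real.pi * Complex.I : ℂ) ≠ 0 := Complex.two_pi_I_ne_zero
  rw [mul_left_comm, eq_inv_mul_iff_mul_eq₀ hpi, key]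
  ring

variable {ι : Type*} [Fintype ι]

/-- The integral over the cycle `∑ᵢ Wᵢ Γᵢ`, divided by `2πi`. -/
def cycInt (Γ : ι → Loop) (W : ι → ℂ) (f : ℂ → ℂ) : ℂ := ∑ i, W i * (Γ i).int f

/-- The winding number of a cycle. -/
def cycWind (Γ : ι → Loop) (W : ι → ℂ) (p : ℂ) : ℂ := ∑ i, W i * (Γ i).wind p

lemma cycInt_congr {Γ : ι → Loop} {W : ι → ℂ} {f g : ℂ → ℂ}
    (h : ∀ i, ∀ x ∈ (Γ i).supp, f x = g x) : cycInt Γ W f = cycInt Γ W g :=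
  Finset.sum_congr rfl fun i _ => by rw [Loop.int_congr (h i)]

lemma cycInt_add {Γ : ι → Loop} {W : ι → ℂ} {f g : ℂ → ℂ}
    (hf : ∀ i, ContinuousOn f (Γ i).supp) (hg : ∀ i, ContinuousOn g (Γ i).supp) :
    cycInt Γ W (fun x => f x + g x) = cycInt Γ W f + cycInt Γ W g := by
  simp only [cycInt, ← Finset.sum_add_distrib, ← mul_add]
  exact Finset.sum_congr rfl fun i _ => by rw [Loop.int_add (hf i) (hg i)]

lemma cycInt_const_mul {Γ : ι → Loop} {W : ι → ℂ} (c : ℂ) (f : ℂ → ℂ) :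
    cycInt Γ W (fun x => c * f x) = c * cycInt Γ W f := by
  simp only [cycInt, Finset.mul_sum, Loop.int_const_mul, mul_left_comm]

lemma cycInt_inv_sub {Γ : ι → Loop} {W : ι → ℂ} (p : ℂ) :
    cycInt Γ W (fun x => (x - p)⁻¹) = cycWind Γ W p := rfl

/-- One inner circle serves all the loops, so the integral is `cycWind Γ W 0` times a single circle
integral. -/
lemma cycInt_eq_zero_of_holomorphic {Γ : ι → Loop} {W : ι → ℂ} {h : ℂ → ℂ} {r R : ℝ} (hr : 0 ≤ r)
    (hΓ : ∀ i, (Γ i).supp ⊆ annulus r R) (hh : DifferentiableOn ℂ h (annulus r R))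
    (h0 : cycWind Γ W 0 = 0) : cycInt Γ W h = 0 := by
  have h1 : ∀ᶠ r' in 𝓝[>] r, ∀ i, ∀ x ∈ (Γ i).supp, r' < ‖x‖ :=
    eventually_all.mpr fun i => (Γ i).eventually_lt_norm fun x hx => (hΓ i hx).1
  obtain ⟨r', hr', hrr'⟩ := (h1.and self_mem_nhdsWithin).exists
  have : ∀ i, W i * (Γ i).int h = W i * (Γ i).wind 0 *
      ((2 * Real.pi * Complex.I)⁻¹ * ∮ u in C(0, r'), h u) := fun i => by
    rw [(Γ i).int_holomorphic hr (hΓ i) hh hrr' (hr' i)]; ring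
  rw [cycInt, Finset.sum_congr rfl fun i _ => this i, ← Finset.sum_mul]
  rw [cycWind] at h0
  rw [h0, zero_mul]

/-- A form of the residue theorem: the integral of `h / ∏ (x - p)` over a cycle vanishes
when at every pole either the winding number or the numerator is zero. -/
theorem cycInt_eq_zero_of_poles {Γ : ι → Loop} {W : ι → ℂ} {r R : ℝ} (hr : 0 ≤ r)
    (hΓ : ∀ i, (Γ i).supp ⊆ annulus r R) (h0 : cycWind Γ W 0 = 0) (S : Finset ℂ) :
    ∀ h : ℂ → ℂ, DifferentiableOn ℂ h (annulus r R) → (∀ p ∈ S, ∀ i, p ∉ (Γ i).supp) →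
    (∀ p ∈ S, p ∈ annulus r R → cycWind Γ W p = 0 ∨ h p = 0) →
    cycInt Γ W (fun x => h x / ∏ p ∈ S, (x - p)) = 0 := by
  induction S using Finset.induction_on with
  | empty =>
    intro h hh _ _
    simpa using cycInt_eq_zero_of_holomorphic hr hΓ hh h0
  | insert p S hpS ih =>
    intro h hh hS hw
    have hS' : ∀ p' ∈ S, ∀ i, p' ∉ (Γ i).supp := fun p' hp' => hS p' (Finset.mem_insert_of_mem hp')
    have hne : ∀ p' ∈ insert p S, ∀ i, ∀ x ∈ (Γ i).supp, x - p' ≠ 0 := fun p' hp' i x hx e =>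
      hS p' hp' i (by rwa [← sub_eq_zero.mp e])
    by_cases hp : p ∈ annulus r R
    · set Q : ℂ → ℂ := fun x => ∏ p ∈ S, (x - p) with hQ
      have hQd : Differentiable ℂ Q := by rw [hQ]; fun_prop
      have hQp : Q p ≠ 0 := Finset.prod_ne_zero_iff.mpr fun p' hp' e => hpS (by
        rwa [sub_eq_zero.mp e])
      -- `α` is the residue at `p`. Removing `α / (x - p)` leaves `k / Q`, a quotient with one pole
      -- fewer.
      set α : ℂ := h p / Q p with hα
      set k : ℂ → ℂ := dslope (fun x => h x - α * Q x) p with hk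
      have hval : h p - α * Q p = 0 := by
        rw [hα]; rw [div_mul_cancel₀ _ hQp, sub_self]
      have hkmul : ∀ x, (x - p) * k x = h x - α * Q x := fun x => by
        have := sub_smul_dslope (fun x => h x - α * Q x) p x
        rw [hval, sub_zero] at this
        simpa using this
      have hkd : DifferentiableOn ℂ k (annulus r R) :=
        (Complex.differentiableOn_dslope ((isOpen_annulus r R).mem_nhds hp)).mpr
          (hh.sub (hQd.differentiableOn.const_mul α))
      -- At the remaining poles `Q` vanishes, so `k` vanishes wherever `h` does and the alternative
      -- in the hypothesis is inherited.
      have hkS := ih k hkd hS' fun p' hp' hpa => by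
        have hne' : p' - p ≠ 0 := fun e => hpS (by rwa [← sub_eq_zero.mp e])
        have hQ' : Q p' = 0 := Finset.prod_eq_zero hp' (sub_self _)
        refine (hw p' (Finset.mem_insert_of_mem hp') hpa).imp id fun h2 => ?_
        have := hkmul p'
        rw [h2, hQ', mul_zero, sub_zero] at this
        exact (mul_eq_zero.mp this).resolve_left hne'
      have hsplit : cycInt Γ W (fun x => h x / ∏ p ∈ insert p S, (x - p)) =
          cycInt Γ W (fun x => k x / Q x + α * (x - p)⁻¹) := by
        refine cycInt_congr fun i x hx => ?_
        have h1 : x - p ≠ 0 := hne p (Finset.mem_insert_self _ _) i x hx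
        have h2 : Q x ≠ 0 := Finset.prod_ne_zero_iff.mpr fun p' hp' =>
          hne p' (Finset.mem_insert_of_mem hp') i x hx
        rw [Finset.prod_insert hpS]
        have h3 : h x = (x - p) * k x + α * Q x := by rw [hkmul]; ring
        change h x / ((x - p) * Q x) = _
        rw [h3]
        field_simp
      have hα0 : α * cycWind Γ W p = 0 := by
        rcases hw p (Finset.mem_insert_self _ _) hp with h1 | h1
        · rw [h1, mul_zero]
        · rw [hα, h1, zero_div, zero_mul]
      have hc : ∀ i, ContinuousOn (fun x => (x - p)⁻¹) (Γ i).supp := fun i =>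
        Loop.continuousOn_inv_sub (hS p (Finset.mem_insert_self _ _) i)
      rw [hsplit, cycInt_add (g := fun x => α * (x - p)⁻¹), hkS, cycInt_const_mul, cycInt_inv_sub,
        hα0, add_zero]
      · exact fun i => (hkd.continuousOn.mono (hΓ i)).div hQd.continuous.continuousOn fun x hx =>
          Finset.prod_ne_zero_iff.mpr fun p' hp' => hne p' (Finset.mem_insert_of_mem hp') i x hx
      · exact fun i => continuousOn_const.mul (hc i)
    -- A point outside the annulus causes no pole there, and its factor is absorbed into the
    -- numerator.
    · have hd : DifferentiableOn ℂ (fun x => h x / (x - p)) (annulus r R) :=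
        hh.div (by fun_prop) fun x hx e => hp (by rwa [← sub_eq_zero.mp e])
      rw [← ih _ hd hS' fun p' hp' hpa =>
        (hw p' (Finset.mem_insert_of_mem hp') hpa).imp id fun h2 => by rw [h2, zero_div]]
      refine cycInt_congr fun i x hx => ?_
      rw [Finset.prod_insert hpS, div_div]

end QKZ

/-! ### The kernel with two geometric families of poles -/

namespace QKZ
open Set MeasureTheory Metric Filter

/-- The meromorphic function `∏ⱼ 1 / ((αⱼ x; p)_∞ (βⱼ / x; p)_∞)`. -/
def kern (p : ℂ) {N : ℕ} (α β : Fin N → ℂ) (x : ℂ) : ℂ :=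
  ∏ j, 1 / (poch (x * α j) p * poch (β j / x) p)

/-- The poles of `kern`: those tending to infinity and those tending to zero. -/
def kernPole (p : ℂ) {N : ℕ} (α β : Fin N → ℂ) : (Fin N × ℕ) ⊕ (Fin N × ℕ) → ℂ :=
  Sum.elim (fun a => (α a.1)⁻¹ * p⁻¹ ^ a.2) (fun a => β a.1 * p ^ a.2)

variable {ι : Type*} [Fintype ι]

lemma exists_annulus (Γ : ι → Loop) : ∃ r R, 0 < r ∧ ∀ i, (Γ i).supp ⊆ annulus r R := by
  have h1 : ∀ᶠ r in 𝓝[>] (0 : ℝ), ∀ i, ∀ x ∈ (Γ i).supp, r < ‖x‖ :=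
    eventually_all.mpr fun i => (Γ i).eventually_lt_norm fun x hx =>
      norm_pos_iff.mpr ((Γ i).ne_zero_of_mem_supp hx)
  have h2 : ∀ᶠ R in atTop, ∀ i, ∀ x ∈ (Γ i).supp, ‖x‖ < R := by
    refine eventually_all.mpr fun i => ?_
    obtain ⟨C, hC⟩ := (Γ i).isCompact_supp.isBounded.exists_norm_le
    filter_upwards [eventually_gt_atTop C] with R hR x hx using (hC x hx).trans_lt hR
  obtain ⟨r, hr, hr0⟩ := (h1.and self_mem_nhdsWithin).exists
  obtain ⟨R, hR⟩ := h2.exists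
  exact ⟨r, R, hr0, fun i x hx => ⟨hr i x hx, hR i x hx⟩⟩

/-- The first `K` factors of every infinite product are split off. They account for finitely many
poles, while for large `K` the tails have no zeros on a given annulus. The power `x ^ K` clears the
denominators of the factors `1 - β_j p ^ k / x`. At zeros of a denominator both sides are zero by
the convention for division. -/
lemma kern_eq_div {p : ℂ} (hp : ‖p‖ < 1) (hp0 : p ≠ 0) {N : ℕ} {α β : Fin N → ℂ}
    (hα : ∀ j, α j ≠ 0) (K : ℕ) {x : ℂ} (hx : x ≠ 0) :
    kern p α β x = (∏ j, ((x ^ K * ∏ k ∈ Finset.range K, (-(α j * p ^ k))⁻¹) *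
      (poch (x * α j * p ^ K) p * poch (β j / x * p ^ K) p)⁻¹)) /
      ∏ j, ((∏ k ∈ Finset.range K, (x - (α j)⁻¹ * p⁻¹ ^ k)) *
        ∏ k ∈ Finset.range K, (x - β j * p ^ k)) := by
  rw [kern, ← Finset.prod_div_distrib]
  refine Finset.prod_congr rfl fun j _ => ?_
  have e1 : ∏ k ∈ Finset.range K, (1 - x * α j * p ^ k) =
      (∏ k ∈ Finset.range K, (-(α j * p ^ k))) *
        ∏ k ∈ Finset.range K, (x - (α j)⁻¹ * p⁻¹ ^ k) := by
    rw [← Finset.prod_mul_distrib]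
    refine Finset.prod_congr rfl fun k _ => ?_
    have := hα j
    rw [inv_pow]
    field_simp
    ring
  have e2 : x ^ K * ∏ k ∈ Finset.range K, (1 - β j / x * p ^ k) =
      ∏ k ∈ Finset.range K, (x - β j * p ^ k) := by
    rw [← Finset.card_range K, ← Finset.prod_const, Finset.card_range, ← Finset.prod_mul_distrib]
    refine Finset.prod_congr rfl fun k _ => ?_
    field_simp
  rw [poch_eq_prod_mul (x * α j) hp K, poch_eq_prod_mul (β j / x) hp K, e1, ← e2,
    Finset.prod_inv_distrib]
  have h0 : ∏ k ∈ Finset.range K, (-(α j * p ^ k)) ≠ 0 :=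
    Finset.prod_ne_zero_iff.mpr fun k _ => neg_ne_zero.mpr (mul_ne_zero (hα j) (pow_ne_zero _ hp0))
  have hxK : x ^ K ≠ 0 := pow_ne_zero _ hx
  generalize (∏ k ∈ Finset.range K, (-(α j * p ^ k))) = A at *
  generalize (∏ k ∈ Finset.range K, (x - (α j)⁻¹ * p⁻¹ ^ k)) = B at *
  generalize (∏ k ∈ Finset.range K, (1 - β j / x * p ^ k)) = C at *
  generalize poch (x * α j * p ^ K) p = D
  generalize poch (β j / x * p ^ K) p = E
  by_cases hB : B = 0
  · simp [hB]
  by_cases hC : C = 0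
  · simp [hC]
  by_cases hD : D = 0
  · simp [hD]
  by_cases hE : E = 0
  · simp [hE]
  field_simp

/-- The loops lie in an annulus on which all but finitely many factors of the products have no
zeros. These regular factors join the numerator, and `cycInt_eq_zero_of_poles` applies to the rest;
injectivity of `kernPole` makes the poles simple. -/
theorem cycInt_kern_eq_zero {p : ℂ} (hp : ‖p‖ < 1) (hp0 : p ≠ 0) {N : ℕ} {α β : Fin N → ℂ}
    (hα : ∀ j, α j ≠ 0) (hinj : Function.Injective (kernPole p α β))
    {Γ : ι → Loop} {W : ι → ℂ} (hav : ∀ a i, kernPole p α β a ∉ (Γ i).supp)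
    (h0 : cycWind Γ W 0 = 0) {g : ℂ → ℂ} (hg : DifferentiableOn ℂ g {0}ᶜ)
    (hw : ∀ a, cycWind Γ W (kernPole p α β a) = 0 ∨ g (kernPole p α β a) = 0) :
    cycInt Γ W (fun x => g x * kern p α β x) = 0 := by
  classical
  obtain ⟨r, R, hr, hΓ⟩ := exists_annulus Γ
  have hlim : Tendsto (fun K : ℕ => ‖p‖ ^ K) atTop (𝓝 0) :=
    tendsto_pow_atTop_nhds_zero_of_lt_one (norm_nonneg _) hp
  have hK1 : ∀ᶠ K : ℕ in atTop, ∀ j, R * ‖α j‖ * ‖p‖ ^ K < 1 := eventually_all.mpr fun j => by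
    have := hlim.const_mul (R * ‖α j‖)
    rw [mul_zero] at this
    exact this.eventually (gt_mem_nhds one_pos)
  have hK2 : ∀ᶠ K : ℕ in atTop, ∀ j, ‖β j‖ * ‖p‖ ^ K < r := eventually_all.mpr fun j => by
    have := hlim.const_mul ‖β j‖
    rw [mul_zero] at this
    exact this.eventually (gt_mem_nhds hr)
  obtain ⟨K, hK1, hK2⟩ := (hK1.and hK2).exists
  have hx0 : ∀ x ∈ annulus r R, x ≠ 0 := fun x hx => norm_pos_iff.mp (hr.trans hx.1)
  have hn1 : ∀ x ∈ annulus r R, ∀ j, poch (x * α j * p ^ K) p ≠ 0 := fun x hx j =>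
    poch_ne_zero_of_norm_lt hp (by
      rw [norm_mul, norm_mul, norm_pow]
      refine lt_of_le_of_lt ?_ (hK1 j)
      have := hx.2.le
      gcongr)
  have hn2 : ∀ x ∈ annulus r R, ∀ j, poch (β j / x * p ^ K) p ≠ 0 := fun x hx j =>
    poch_ne_zero_of_norm_lt hp (by
      rw [norm_mul, norm_div, norm_pow, div_mul_eq_mul_div,
        div_lt_one (norm_pos_iff.mpr (hx0 x hx))]
      exact (hK2 j).trans hx.1)
  set h : ℂ → ℂ := fun x => g x * ∏ j, ((x ^ K * ∏ k ∈ Finset.range K, (-(α j * p ^ k))⁻¹) *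
      (poch (x * α j * p ^ K) p * poch (β j / x * p ^ K) p)⁻¹) with hh
  have hdp := differentiable_poch hp
  have hhd : DifferentiableOn ℂ h (annulus r R) := by
    refine (hg.mono fun x hx => hx0 x hx).mul ?_
    refine DifferentiableOn.fun_finsetProd fun j _ => ?_
    refine DifferentiableOn.mul (by fun_prop) (DifferentiableOn.inv ?_ fun x hx =>
      mul_ne_zero (hn1 x hx j) (hn2 x hx j))
    refine DifferentiableOn.mul ?_ ?_
    · exact (hdp.comp (by fun_prop : Differentiable ℂ fun x : ℂ => x * α j * p ^ K)).differentiableOn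
    · refine hdp.comp_differentiableOn (f := fun x : ℂ => β j / x * p ^ K) ?_
      exact (DifferentiableOn.div (differentiableOn_const _) differentiableOn_id hx0).mul_const _
  set A : Finset (Fin N × ℕ) := Finset.univ ×ˢ Finset.range K
  set S : Finset ℂ := (A.disjSum A).image (kernPole p α β) with hS
  have hprod : ∀ x : ℂ, ∏ s ∈ S, (x - s) = ∏ j, ((∏ k ∈ Finset.range K, (x - (α j)⁻¹ * p⁻¹ ^ k)) *
        ∏ k ∈ Finset.range K, (x - β j * p ^ k)) := fun x => by
    rw [hS, Finset.prod_image hinj.injOn, Finset.prod_disjSum, Finset.prod_product,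
      Finset.prod_product, ← Finset.prod_mul_distrib]
    rfl
  have hmem : ∀ s ∈ S, ∃ a, kernPole p α β a = s := fun s hs => by
    obtain ⟨a, -, ha⟩ := Finset.mem_image.mp hs
    exact ⟨a, ha⟩
  have key := cycInt_eq_zero_of_poles (W := W) hr.le hΓ h0 S h hhd
    (fun s hs i => by obtain ⟨a, rfl⟩ := hmem s hs; exact hav a i)
    (fun s hs _ => by
      obtain ⟨a, rfl⟩ := hmem s hs
      exact (hw a).imp id fun h2 => by simp only [hh, h2, zero_mul])
  rw [← key]
  refine cycInt_congr fun i x hx => ?_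
  rw [kern_eq_div hp hp0 hα K (hx0 x (hΓ i hx)), hprod, hh, mul_div_assoc]

lemma kern_denominator_ne_zero {p : ℂ} (hp : ‖p‖ < 1) {N : ℕ} {α β : Fin N → ℂ}
    (hα : ∀ j, α j ≠ 0) {x : ℂ} (hx : x ≠ 0) (h : ∀ a, kernPole p α β a ≠ x) (j : Fin N) :
    poch (x * α j) p * poch (β j / x) p ≠ 0 := by
  refine mul_ne_zero (poch_ne_zero hp fun k e => h (Sum.inl (j, k)) ?_)
    (poch_ne_zero hp fun k e => h (Sum.inr (j, k)) ?_)
  · have := hα j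
    have h1 : x * α j * p ^ k = 1 := (sub_eq_zero.mp e).symm
    simp only [kernPole, Sum.elim_inl, inv_pow]
    rw [← mul_inv]
    exact inv_eq_of_mul_eq_one_right (by rw [← h1]; ring)
  · have h1 : β j / x * p ^ k = 1 := (sub_eq_zero.mp e).symm
    simp only [kernPole, Sum.elim_inr]
    field_simp at h1
    exact h1

lemma continuousOn_kern {p : ℂ} (hp : ‖p‖ < 1) {N : ℕ} {α β : Fin N → ℂ}
    (hα : ∀ j, α j ≠ 0) {s : Set ℂ} (hs : ∀ x ∈ s, x ≠ 0)
    (h : ∀ x ∈ s, ∀ a, kernPole p α β a ≠ x) : ContinuousOn (kern p α β) s := by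
  have hdp := (differentiable_poch hp).continuous
  refine continuousOn_finsetProd _ fun j _ => ContinuousOn.div continuousOn_const ?_
    fun x hx => kern_denominator_ne_zero hp hα (hs x hx) (h x hx) j
  refine ContinuousOn.mul (hdp.comp (by fun_prop : Continuous fun x : ℂ => x * α j)).continuousOn ?_
  exact hdp.comp_continuousOn (f := fun x : ℂ => β j / x)
    (continuousOn_const.div continuousOn_id hs)

end QKZ

/-! ### Multiple integrals over cycles -/

namespace QKZ
open Set MeasureTheory Metric Filter

/-- Fubini's theorem on the unit cube, the `k`-th variable being integrated first. -/
lemma setIntegral_cube_insertNth {m : ℕ} (k : Fin (m + 1)) {G : (Fin (m + 1) → ℝ) → ℂ}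
    (hG : ContinuousOn G (Icc 0 1)) :
    ∫ t in Icc (0 : Fin (m + 1) → ℝ) 1, G t =
      ∫ t in Icc (0 : Fin m → ℝ) 1, ∫ u in (0 : ℝ)..1, G (k.insertNth u t) := by
  have hpres := volume_preserving_piFinSuccAbove (fun _ : Fin (m + 1) => ℝ) k
  set e := MeasurableEquiv.piFinSuccAbove (fun _ : Fin (m + 1) => ℝ) k
  have hpre : (e ⁻¹' (Icc (0 : ℝ) 1 ×ˢ Icc (0 : Fin m → ℝ) 1)) = Icc (0 : Fin (m + 1) → ℝ) 1 := by
    ext t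
    simp only [e, mem_preimage, mem_prod, mem_Icc, MeasurableEquiv.piFinSuccAbove_apply,
      Pi.le_def, Fin.removeNth, Fin.insertNthEquiv, Pi.zero_apply, Pi.one_apply,
      Equiv.coe_fn_symm_mk, Fin.forall_iff_succAbove k]
    tauto
  have hinv : ∀ t, k.insertNth (e t).1 (e t).2 = t := fun t => Fin.insertNth_self_removeNth k t
  have h1 := hpres.setIntegral_preimage_emb e.measurableEmbedding
    (fun p : ℝ × (Fin m → ℝ) => G (k.insertNth p.1 p.2)) (Icc (0 : ℝ) 1 ×ˢ Icc (0 : Fin m → ℝ) 1)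
  rw [hpre] at h1
  simp only [hinv] at h1
  rw [h1]
  have hc : ContinuousOn (fun p : ℝ × (Fin m → ℝ) => G (k.insertNth p.1 p.2))
      (Icc (0 : ℝ) 1 ×ˢ Icc (0 : Fin m → ℝ) 1) := by
    refine hG.comp (Continuous.finInsertNth (A := fun _ => ℝ) k continuous_fst continuous_snd).continuousOn fun p hp => ?_
    · simp only [mem_Icc, Pi.le_def, Fin.forall_iff_succAbove k, Fin.insertNth_apply_same,
        Fin.insertNth_apply_succAbove, Pi.zero_apply, Pi.one_apply]
      exact ⟨⟨hp.1.1, hp.2.1⟩, hp.1.2, hp.2.2⟩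
  have hint := hc.integrableOn_compact (μ := volume.prod volume) (isCompact_Icc.prod isCompact_Icc)
  rw [IntegrableOn, ← Measure.prod_restrict] at hint
  rw [Measure.volume_eq_prod, ← Measure.prod_restrict, integral_prod_symm _ hint]
  refine integral_congr_ae (Eventually.of_forall fun t => ?_)
  simp only
  rw [intervalIntegral.integral_of_le zero_le_one, integral_Icc_eq_integral_Ioc]

variable {ι : Type*} [Fintype ι]

/-- The union of the curves of a finite family. -/
def unionSupp (Γ : ι → Loop) : Set ℂ := ⋃ i, (Γ i).supp

lemma isCompact_unionSupp (Γ : ι → Loop) : IsCompact (unionSupp Γ) :=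
  isCompact_iUnion fun i => (Γ i).isCompact_supp

lemma mem_unionSupp (Γ : ι → Loop) (i : ι) {t : ℝ} (ht : t ∈ Icc (0 : ℝ) 1) :
    (Γ i).γ t ∈ unionSupp Γ := mem_iUnion.mpr ⟨i, (Γ i).mem_supp ht⟩

lemma supp_subset_unionSupp (Γ : ι → Loop) (i : ι) : (Γ i).supp ⊆ unionSupp Γ :=
  subset_iUnion (fun i => (Γ i).supp) i

/-- The domain of integration of `cycMulti`. -/
def cube (Γ : ι → Loop) (m : ℕ) : Set (Fin m → ℂ) := {x | ∀ μ, x μ ∈ unionSupp Γ}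

lemma isCompact_cube (Γ : ι → Loop) (m : ℕ) : IsCompact (cube Γ m) := by
  have := isCompact_univ_pi fun _ : Fin m => isCompact_unionSupp Γ
  convert this using 1
  ext x; simp [cube]

lemma insertNth_mem_cube {Γ : ι → Loop} {m : ℕ} {k : Fin (m + 1)} {y : ℂ} {x : Fin m → ℂ}
    (hy : y ∈ unionSupp Γ) (hx : x ∈ cube Γ m) : k.insertNth y x ∈ cube Γ (m + 1) := by
  simp only [cube, mem_ofPred_eq, Fin.forall_iff_succAbove k, Fin.insertNth_apply_same,
    Fin.insertNth_apply_succAbove]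
  exact ⟨hy, hx⟩

/-- The integral over a product of curves. -/
def loopMulti {m : ℕ} (Γ : Fin m → Loop) (F : (Fin m → ℂ) → ℂ) : ℂ :=
  (2 * Real.pi * Complex.I)⁻¹ ^ m * ∫ t in Icc (0 : Fin m → ℝ) 1,
    (∏ μ, (Γ μ).D (t μ)) * F fun μ => (Γ μ).γ (t μ)

lemma continuousOn_loopMulti_integrand {m : ℕ} {Γ : Fin m → Loop} {F : (Fin m → ℂ) → ℂ}
    (hF : ContinuousOn F {x | ∀ μ, x μ ∈ (Γ μ).supp}) :
    ContinuousOn (fun t : Fin m → ℝ => (∏ μ, (Γ μ).D (t μ)) * F fun μ => (Γ μ).γ (t μ))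
      (Icc 0 1) := by
  have hm : ∀ t ∈ Icc (0 : Fin m → ℝ) 1, ∀ μ, t μ ∈ Icc (0 : ℝ) 1 := fun t ht μ =>
    ⟨ht.1 μ, ht.2 μ⟩
  refine ContinuousOn.mul (continuousOn_finsetProd _ fun μ _ =>
    (Γ μ).contD.comp (continuous_apply μ).continuousOn fun t ht => hm t ht μ)
    (hF.comp (continuousOn_pi.mpr fun μ =>
      (Γ μ).cont.comp (continuous_apply μ).continuousOn fun t ht => hm t ht μ) fun t ht μ =>
        (Γ μ).mem_supp (hm t ht μ))

lemma loopMulti_insertNth {m : ℕ} {Γ : Fin (m + 1) → Loop} (k : Fin (m + 1))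
    {F : (Fin (m + 1) → ℂ) → ℂ} (hF : ContinuousOn F {x | ∀ μ, x μ ∈ (Γ μ).supp}) :
    loopMulti Γ F = loopMulti (fun μ => Γ (k.succAbove μ))
      fun x => (Γ k).int fun y => F (k.insertNth y x) := by
  rw [loopMulti, setIntegral_cube_insertNth k (continuousOn_loopMulti_integrand hF), loopMulti,
    pow_succ, mul_assoc]
  congr 1
  refine (integral_const_mul (L := ℂ) _ _).symm.trans ?_
  refine setIntegral_congr_fun measurableSet_Icc fun t _ => ?_
  simp only [Loop.int]
  rw [mul_left_comm]
  refine congrArg (fun y => (2 * Real.pi * Complex.I : ℂ)⁻¹ * y) ?_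
  rw [← intervalIntegral.integral_const_mul]
  refine intervalIntegral.integral_congr fun u _ => ?_
  simp only [Fin.prod_univ_succAbove _ k, Fin.insertNth_apply_same, Fin.insertNth_apply_succAbove]
  have : (fun μ => (Γ μ).γ ((k.insertNth u t : Fin (m + 1) → ℝ) μ)) =
      (k.insertNth ((Γ k).γ u) fun μ => (Γ (k.succAbove μ)).γ (t μ) : Fin (m + 1) → ℂ) := by
    funext μ
    refine Fin.succAboveCases k ?_ (fun j => ?_) μ <;> simp
  rw [this]
  ring

/-- The multiple integral in which the variable `x_μ` runs over the cycle `∑ᵢ W μ i • Γ i`. -/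
def cycMulti {m : ℕ} (Γ : ι → Loop) (W : Fin m → ι → ℂ) (F : (Fin m → ℂ) → ℂ) : ℂ :=
  ∑ s : Fin m → ι, (∏ μ, W μ (s μ)) * loopMulti (fun μ => Γ (s μ)) F

lemma supp_subset_cube (Γ : ι → Loop) {m : ℕ} (s : Fin m → ι) :
    {x : Fin m → ℂ | ∀ μ, x μ ∈ (Γ (s μ)).supp} ⊆ cube Γ m := fun _ hx μ =>
  supp_subset_unionSupp Γ (s μ) (hx μ)

lemma loopMulti_congr {m : ℕ} {Γ : Fin m → Loop} {F G : (Fin m → ℂ) → ℂ}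
    (h : ∀ x, (∀ μ, x μ ∈ (Γ μ).supp) → F x = G x) : loopMulti Γ F = loopMulti Γ G := by
  unfold loopMulti
  congr 1
  refine setIntegral_congr_fun measurableSet_Icc fun t ht => ?_
  rw [h _ fun μ => (Γ μ).mem_supp ⟨ht.1 μ, ht.2 μ⟩]

lemma cycMulti_congr {m : ℕ} {Γ : ι → Loop} {W : Fin m → ι → ℂ} {F G : (Fin m → ℂ) → ℂ}
    (h : ∀ x ∈ cube Γ m, F x = G x) : cycMulti Γ W F = cycMulti Γ W G :=
  Finset.sum_congr rfl fun s _ => by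
    rw [loopMulti_congr fun x hx => h x (supp_subset_cube Γ s hx)]

lemma cycMulti_insertNth {m : ℕ} {Γ : ι → Loop} {W : Fin (m + 1) → ι → ℂ} (k : Fin (m + 1))
    {F : (Fin (m + 1) → ℂ) → ℂ} (hF : ContinuousOn F (cube Γ (m + 1))) :
    cycMulti Γ W F = cycMulti Γ (fun μ => W (k.succAbove μ))
      fun x => cycInt Γ (W k) fun y => F (k.insertNth y x) := by
  classical
  unfold cycMulti
  rw [← (Fin.insertNthEquiv (fun _ => ι) k).sum_comp, Fintype.sum_prod_type_right]
  refine Finset.sum_congr rfl fun s _ => ?_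
  have e : ∀ i, loopMulti (fun μ => Γ (Fin.insertNthEquiv (fun _ => ι) k (i, s) μ)) F =
      loopMulti (fun μ => Γ (s μ)) fun x => (Γ i).int fun y => F (k.insertNth y x) := fun i => by
    rw [loopMulti_insertNth k (hF.mono (supp_subset_cube Γ _))]
    simp [Fin.insertNthEquiv]
  -- Integrability of the inner integrals is needed to exchange the sum over the loops of the `k`-th
  -- variable with the outer integral.
  have hint : ∀ i ∈ Finset.univ, IntegrableOn (fun t : Fin m → ℝ => W k i *
      ((∏ μ, (Γ (s μ)).D (t μ)) * (Γ i).int fun y => F (k.insertNth y fun μ => (Γ (s μ)).γ (t μ))))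
      (Icc 0 1) := fun i _ => by
    refine Integrable.const_mul ?_ _
    set s' : Fin (m + 1) → ι := k.insertNth i s
    have hc := continuousOn_loopMulti_integrand (Γ := fun μ => Γ (s' μ))
      (hF.mono (supp_subset_cube Γ _))
    have hpres := volume_preserving_piFinSuccAbove (fun _ : Fin (m + 1) => ℝ) k
    have hc' : ContinuousOn (fun p : (Fin m → ℝ) × ℝ => (∏ μ, (Γ (s μ)).D (p.1 μ)) *
        ((Γ i).D p.2 * F (k.insertNth ((Γ i).γ p.2) fun μ => (Γ (s μ)).γ (p.1 μ))))
        (Icc (0 : Fin m → ℝ) 1 ×ˢ Icc (0 : ℝ) 1) := by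
      have := hc.comp (s := Icc (0 : Fin m → ℝ) 1 ×ˢ Icc (0 : ℝ) 1)
        (f := fun p : (Fin m → ℝ) × ℝ => (k.insertNth p.2 p.1 : Fin (m + 1) → ℝ))
        (Continuous.finInsertNth (A := fun _ => ℝ) k continuous_snd continuous_fst).continuousOn (fun p hp => by
            simp only [mem_Icc, Pi.le_def, Fin.forall_iff_succAbove k, Fin.insertNth_apply_same,
              Fin.insertNth_apply_succAbove, Pi.zero_apply, Pi.one_apply]
            exact ⟨⟨hp.2.1, hp.1.1⟩, hp.2.2, hp.1.2⟩)
      refine this.congr fun p _ => ?_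
      simp only [Function.comp, Fin.prod_univ_succAbove _ k, Fin.insertNth_apply_same,
        Fin.insertNth_apply_succAbove, s']
      have : (fun μ => (Γ ((k.insertNth i s : Fin (m + 1) → ι) μ)).γ
          ((k.insertNth p.2 p.1 : Fin (m + 1) → ℝ) μ)) =
          (k.insertNth ((Γ i).γ p.2) fun μ => (Γ (s μ)).γ (p.1 μ) : Fin (m + 1) → ℂ) := by
        funext μ
        refine Fin.succAboveCases k ?_ (fun j => ?_) μ <;> simp
      rw [this]
      ring
    have h2 := hc'.integrableOn_compact (μ := volume.prod volume)
      (isCompact_Icc.prod isCompact_Icc)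
    rw [IntegrableOn, ← Measure.prod_restrict] at h2
    have h3 := (h2.integral_prod_left).const_mul (2 * Real.pi * Complex.I)⁻¹
    refine h3.congr (Eventually.of_forall fun t => ?_)
    simp only [Loop.int, integral_const_mul, intervalIntegral.integral_of_le zero_le_one,
      integral_Icc_eq_integral_Ioc]
    ring
  have e2 : loopMulti (fun μ => Γ (s μ)) (fun x => cycInt Γ (W k) fun y => F (k.insertNth y x)) =
      ∑ i, W k i * loopMulti (fun μ => Γ (s μ)) fun x => (Γ i).int fun y =>
        F (k.insertNth y x) := by
    simp only [loopMulti, cycInt, Finset.mul_sum, mul_left_comm _ (W k _)]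
    rw [integral_finsetSum _ hint, Finset.mul_sum]
    simp only [integral_const_mul, mul_left_comm]
  rw [e2, Finset.mul_sum]
  refine Finset.sum_congr rfl fun i _ => ?_
  rw [e]
  simp only [Fin.prod_univ_succAbove _ k, Fin.insertNthEquiv, Equiv.coe_fn_mk,
    Fin.insertNth_apply_same, Fin.insertNth_apply_succAbove]
  ring

lemma integrableOn_loopMulti {m : ℕ} {Γ : Fin m → Loop} {F : (Fin m → ℂ) → ℂ}
    (hF : ContinuousOn F {x | ∀ μ, x μ ∈ (Γ μ).supp}) :
    IntegrableOn (fun t : Fin m → ℝ => (∏ μ, (Γ μ).D (t μ)) * F fun μ => (Γ μ).γ (t μ))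
      (Icc 0 1) :=
  (continuousOn_loopMulti_integrand hF).integrableOn_compact isCompact_Icc

lemma cycMulti_add {m : ℕ} {Γ : ι → Loop} {W : Fin m → ι → ℂ} {F G : (Fin m → ℂ) → ℂ}
    (hF : ContinuousOn F (cube Γ m)) (hG : ContinuousOn G (cube Γ m)) :
    cycMulti Γ W (fun x => F x + G x) = cycMulti Γ W F + cycMulti Γ W G := by
  simp only [cycMulti, ← Finset.sum_add_distrib, ← mul_add, loopMulti]
  refine Finset.sum_congr rfl fun s _ => ?_
  simp only [mul_add (∏ μ, (Γ (s μ)).D _)]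
  rw [← integral_add (integrableOn_loopMulti (hF.mono (supp_subset_cube Γ s)))
    (integrableOn_loopMulti (hG.mono (supp_subset_cube Γ s)))]

lemma cycMulti_const_mul {m : ℕ} {Γ : ι → Loop} {W : Fin m → ι → ℂ} (c : ℂ)
    (F : (Fin m → ℂ) → ℂ) : cycMulti Γ W (fun x => c * F x) = c * cycMulti Γ W F := by
  simp only [cycMulti, loopMulti, Finset.mul_sum, mul_left_comm _ c, integral_const_mul]

lemma cycMulti_sum {m : ℕ} {Γ : ι → Loop} {W : Fin m → ι → ℂ} {κ : Type*} (s : Finset κ)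
    {F : κ → (Fin m → ℂ) → ℂ} (hF : ∀ k ∈ s, ContinuousOn (F k) (cube Γ m)) :
    cycMulti Γ W (fun x => ∑ k ∈ s, F k x) = ∑ k ∈ s, cycMulti Γ W (F k) := by
  classical
  induction s using Finset.induction_on with
  | empty => simpa using cycMulti_const_mul (Γ := Γ) (W := W) 0 (fun _ => 0)
  | insert a s ha ih =>
    simp only [Finset.sum_insert ha]
    rw [cycMulti_add (hF a (Finset.mem_insert_self _ _)) (continuousOn_finsetSum _ fun k hk =>
      hF k (Finset.mem_insert_of_mem hk)), ih fun k hk => hF k (Finset.mem_insert_of_mem hk)]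

lemma cycMulti_sub {m : ℕ} {Γ : ι → Loop} {W : Fin m → ι → ℂ} {F G : (Fin m → ℂ) → ℂ}
    (hF : ContinuousOn F (cube Γ m)) (hG : ContinuousOn G (cube Γ m)) :
    cycMulti Γ W (fun x => F x - G x) = cycMulti Γ W F - cycMulti Γ W G := by
  have := cycMulti_add (G := fun x => -1 * G x) (W := W) hF (continuousOn_const.mul hG : ContinuousOn (fun x => -1 * G x) _)
  rw [cycMulti_const_mul] at this
  rw [sub_eq_add_neg, ← neg_one_mul (cycMulti Γ W G), ← this]
  exact cycMulti_congr fun x _ => by ring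

/-- The constant depends on the cycles only. This uniformity turns estimates of the integrand near
the pole into an estimate of the remainder of the integral. -/
lemma exists_norm_cycMulti_le {m : ℕ} (Γ : ι → Loop) (W : Fin m → ι → ℂ) :
    ∃ C : ℝ, 0 ≤ C ∧ ∀ (F : (Fin m → ℂ) → ℂ) (M : ℝ), 0 ≤ M → (∀ x ∈ cube Γ m, ‖F x‖ ≤ M) →
      ‖cycMulti Γ W F‖ ≤ C * M := by
  have hD : ∀ i, ∃ B, 0 ≤ B ∧ ∀ t ∈ Icc (0 : ℝ) 1, ‖(Γ i).D t‖ ≤ B := fun i => by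
    obtain ⟨B, hB⟩ := isCompact_Icc.exists_bound_of_continuousOn (Γ i).contD
    exact ⟨B, (norm_nonneg _).trans (hB 0 (by simp)), hB⟩
  choose B hB0 hB using hD
  refine ⟨∑ s : Fin m → ι, ‖∏ μ, W μ (s μ)‖ * (‖(2 * Real.pi * Complex.I : ℂ)⁻¹ ^ m‖ *
    ((∏ μ, B (s μ)) * volume.real (Icc (0 : Fin m → ℝ) 1))), ?_, ?_⟩
  · refine Finset.sum_nonneg fun s _ => ?_
    have := Finset.prod_nonneg fun μ (_ : μ ∈ Finset.univ) => hB0 (s μ)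
    positivity
  intro F M hM hF
  rw [cycMulti, Finset.sum_mul]
  refine (norm_sum_le _ _).trans (Finset.sum_le_sum fun s _ => ?_)
  rw [norm_mul, mul_assoc, loopMulti, norm_mul, mul_assoc]
  have hfin : volume (Icc (0 : Fin m → ℝ) 1) < ⊤ := isCompact_Icc.measure_lt_top
  have := norm_setIntegral_le_of_norm_le_const (C := (∏ μ, B (s μ)) * M)
    (f := fun t : Fin m → ℝ => (∏ μ, (Γ (s μ)).D (t μ)) * F fun μ => (Γ (s μ)).γ (t μ)) hfin
    (fun t ht => by
      rw [norm_mul, norm_prod]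
      have h1 : ∏ μ, ‖(Γ (s μ)).D (t μ)‖ ≤ ∏ μ, B (s μ) :=
        Finset.prod_le_prod (fun _ _ => norm_nonneg _) fun μ _ => hB _ _ ⟨ht.1 μ, ht.2 μ⟩
      exact mul_le_mul h1 (hF _ fun μ => mem_unionSupp Γ _ ⟨ht.1 μ, ht.2 μ⟩) (norm_nonneg _)
        (Finset.prod_nonneg fun μ _ => hB0 _))
  have h2 : (∏ μ, B (s μ)) * M * volume.real (Icc (0 : Fin m → ℝ) 1) =
      (∏ μ, B (s μ)) * volume.real (Icc (0 : Fin m → ℝ) 1) * M := by ring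
  refine mul_le_mul_of_nonneg_left ?_ (norm_nonneg _)
  rw [mul_assoc ‖_‖]
  exact mul_le_mul_of_nonneg_left (h2 ▸ this) (norm_nonneg _)

end QKZ

/-! ### Exchange of cycles; contours and circles as loops -/

namespace QKZ
open Set MeasureTheory Metric Filter

variable {ι : Type*} [Fintype ι]

lemma cycInt_sub_weight {Γ : ι → Loop} (a b : ι → ℂ) (f : ℂ → ℂ) :
    cycInt Γ (a - b) f = cycInt Γ a f - cycInt Γ b f := by
  simp only [cycInt, ← Finset.sum_sub_distrib, Pi.sub_apply, sub_mul]

lemma cycMulti_eq_zero {m : ℕ} {Γ : ι → Loop} {W : Fin (m + 1) → ι → ℂ} (k : Fin (m + 1))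
    {F : (Fin (m + 1) → ℂ) → ℂ} (hF : ContinuousOn F (cube Γ (m + 1)))
    (h : ∀ x ∈ cube Γ m, cycInt Γ (W k) (fun y => F (k.insertNth y x)) = 0) :
    cycMulti Γ W F = 0 := by
  rw [cycMulti_insertNth k hF, cycMulti_congr h]
  simpa using cycMulti_const_mul (Γ := Γ) (W := fun μ => W (k.succAbove μ)) 0 (fun _ => 0)

lemma cycMulti_update_sub {m : ℕ} {Γ : ι → Loop} {W : Fin m → ι → ℂ} (k : Fin m)
    (a b : ι → ℂ) (F : (Fin m → ℂ) → ℂ) :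
    cycMulti Γ (Function.update W k (a - b)) F =
      cycMulti Γ (Function.update W k a) F - cycMulti Γ (Function.update W k b) F := by
  simp only [cycMulti, ← Finset.sum_sub_distrib, ← sub_mul]
  refine Finset.sum_congr rfl fun s _ => ?_
  congr 1
  have e : ∀ c : ι → ℂ, ∏ μ, Function.update W k c μ (s μ) =
      c (s k) * ∏ μ ∈ Finset.univ.erase k, W μ (s μ) := fun c => by
    rw [← Finset.mul_prod_erase _ _ (Finset.mem_univ k), Function.update_self]
    congr 1
    refine Finset.prod_congr rfl fun μ hμ => ?_
    rw [Function.update_of_ne (Finset.ne_of_mem_erase hμ)]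
  rw [e, e, e, ← sub_mul, Pi.sub_apply]

/-- Two families of cycles may be exchanged when their one-variable integrals agree. -/
lemma cycMulti_replace {m : ℕ} {Γ : ι → Loop} {W W' : Fin (m + 1) → ι → ℂ}
    {F : (Fin (m + 1) → ℂ) → ℂ} (hF : ContinuousOn F (cube Γ (m + 1)))
    (h : ∀ k, ∀ x ∈ cube Γ m, cycInt Γ (W k) (fun y => F (k.insertNth y x)) =
      cycInt Γ (W' k) fun y => F (k.insertNth y x)) :
    cycMulti Γ W F = cycMulti Γ W' F := by
  classical
  have key : ∀ s : Finset (Fin (m + 1)), cycMulti Γ (s.piecewise W' W) F = cycMulti Γ W F := by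
    intro s
    induction s using Finset.induction_on with
    | empty => simp
    | insert k s hk ih =>
      rw [← ih, cycMulti_insertNth k hF, cycMulti_insertNth k hF]
      have e : (fun μ => (insert k s).piecewise W' W (k.succAbove μ)) =
          fun μ => s.piecewise W' W (k.succAbove μ) := by
        funext μ
        by_cases hμ : k.succAbove μ ∈ s
        · simp [hμ]
        · simp [hμ, Fin.succAbove_ne]
      rw [e]
      refine cycMulti_congr fun x hx => ?_
      rw [Finset.piecewise_eq_of_mem _ _ _ (Finset.mem_insert_self _ _),
        Finset.piecewise_eq_of_notMem _ _ _ hk, h k x hx]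
  have := key Finset.univ
  rwa [Finset.piecewise_univ, eq_comm] at this

/-- Completing `x` by an arbitrary point of a curve turns insertion into an update of a full tuple,
so that later hypotheses can be stated with `Function.update`. -/
lemma cube_nonempty_of {Γ : ι → Loop} (i : ι) (m : ℕ) {k : Fin (m + 1)} {x : Fin m → ℂ}
    (hx : x ∈ cube Γ m) : ∃ x' ∈ cube Γ (m + 1), ∀ y, k.insertNth y x = Function.update x' k y := by
  obtain ⟨y0, hy0⟩ := (Γ i).supp_nonempty
  exact ⟨k.insertNth y0 x, insertNth_mem_cube (supp_subset_unionSupp Γ i hy0) hx, fun y => by simp⟩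

lemma cycInt_of_isEmpty [IsEmpty ι] {Γ : ι → Loop} {w : ι → ℂ} (f : ℂ → ℂ) : cycInt Γ w f = 0 := by
  simp [cycInt]

lemma cycMulti_eq_zero_of_update {m : ℕ} {Γ : ι → Loop} {W : Fin m → ι → ℂ} (k : Fin m)
    {F : (Fin m → ℂ) → ℂ} (hF : ContinuousOn F (cube Γ m))
    (h : ∀ x ∈ cube Γ m, cycInt Γ (W k) (fun y => F (Function.update x k y)) = 0) :
    cycMulti Γ W F = 0 := by
  cases m with
  | zero => exact k.elim0
  | succ m =>
    refine cycMulti_eq_zero k hF fun x hx => ?_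
    rcases isEmpty_or_nonempty ι with hι | ⟨⟨i⟩⟩
    · exact cycInt_of_isEmpty _
    · obtain ⟨x', hx', e⟩ := cube_nonempty_of i m (k := k) hx
      simpa only [e] using h x' hx'

lemma cycMulti_replace_of_update {m : ℕ} {Γ : ι → Loop} {W W' : Fin m → ι → ℂ}
    {F : (Fin m → ℂ) → ℂ} (hF : ContinuousOn F (cube Γ m))
    (h : ∀ k, ∀ x ∈ cube Γ m, cycInt Γ (W k - W' k) (fun y => F (Function.update x k y)) = 0) :
    cycMulti Γ W F = cycMulti Γ W' F := by
  cases m with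
  | zero => rw [Subsingleton.elim W W']
  | succ m =>
    refine cycMulti_replace hF fun k x hx => ?_
    rcases isEmpty_or_nonempty ι with hι | ⟨⟨i⟩⟩
    · rw [cycInt_of_isEmpty, cycInt_of_isEmpty]
    · obtain ⟨x', hx', e⟩ := cube_nonempty_of i m (k := k) hx
      simp only [e]
      rw [← sub_eq_zero, ← cycInt_sub_weight, h k x' hx']

/-- The change of a multiple integral of a symmetric function when all the cycles
are moved across a simple pole, the residue having no further pole. -/
lemma cycMulti_sub_of_residue {m : ℕ} {Γ : ι → Loop} (w w' : ι → ℂ)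
    {F : (Fin (m + 1) → ℂ) → ℂ} (hF : ContinuousOn F (cube Γ (m + 1))) {R : (Fin m → ℂ) → ℂ}
    (h : ∀ k : Fin (m + 1), ∀ x ∈ cube Γ m, cycInt Γ (w - w') (fun y => F (k.insertNth y x)) = R x)
    (hR : ∀ W : Fin m → ι → ℂ, (∀ μ, W μ = w ∨ W μ = w') →
      cycMulti Γ W R = cycMulti Γ (fun _ => w') R) :
    cycMulti Γ (fun _ => w) F =
      cycMulti Γ (fun _ => w') F + (m + 1 : ℕ) * cycMulti Γ (fun _ => w') R := by
  classical
  -- `s` collects the variables already on `w`. One more move adds an integral of `R` in which some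
  -- variables run over `w` and others over `w'`. By `hR` its value does not depend on this
  -- distribution, so all moves contribute the same amount.
  have key : ∀ s : Finset (Fin (m + 1)), cycMulti Γ (s.piecewise (fun _ => w) fun _ => w') F =
      cycMulti Γ (fun _ => w') F + (s.card : ℂ) * cycMulti Γ (fun _ => w') R := by
    intro s
    induction s using Finset.induction_on with
    | empty => simp
    | insert k s hk ih =>
      set W := s.piecewise (fun _ => w) (fun _ => w') with hW
      have e1 : (insert k s).piecewise (fun _ => w) (fun _ => w') = Function.update W k w := by
        rw [Finset.piecewise_insert]
      have e2 : W = Function.update W k w' := by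
        have hk' : W k = w' := Finset.piecewise_eq_of_notMem _ _ _ hk
        rw [← hk', Function.update_eq_self]
      have e3 := cycMulti_update_sub (Γ := Γ) (W := W) k w w' F
      rw [← e1, ← e2, ih, cycMulti_insertNth k hF, Function.update_self, cycMulti_congr (h k),
        hR] at e3
      · rw [Finset.card_insert_of_notMem hk, Nat.cast_succ, add_mul, one_mul]
        linear_combination -e3
      · intro μ
        rw [Function.update_of_ne (Fin.succAbove_ne k μ), hW]
        by_cases hμ : k.succAbove μ ∈ s <;> simp [hμ]
  have := key Finset.univ
  rwa [Finset.piecewise_univ, Finset.card_univ, Fintype.card_fin] at this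

lemma cycMulti_single [DecidableEq ι] {m : ℕ} {Γ : ι → Loop} (i : ι) (F : (Fin m → ℂ) → ℂ) :
    cycMulti Γ (fun _ => Pi.single i 1) F = loopMulti (fun _ => Γ i) F := by
  rw [cycMulti, Finset.sum_eq_single (fun _ => i)]
  · simp
  · intro s _ hs
    obtain ⟨μ, hμ⟩ := Function.ne_iff.mp hs
    rw [Finset.prod_eq_zero (Finset.mem_univ μ) (by simp [hμ]), zero_mul]
  · simp

/-- The loop given by a contour. -/
lemma IsContour.exists_loop {q : ℂ} {N : ℕ} {ζ : Fin N → ℂ} {γ : ℝ → ℂ} (h : IsContour q ζ γ) :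
    ∃ Γ : Loop, Γ.γ = γ ∧ (∀ p, winding γ p = Γ.wind p) ∧
      ∀ (m : ℕ) (F : (Fin m → ℂ) → ℂ), multiContour γ F = loopMulti (fun _ => Γ) F := by
  -- At the endpoints `deriv γ` depends on values outside the interval. The derivative within
  -- `[0,1]` is continuous up to the endpoints and differs from it on a null set only.
  have hD : ∀ t ∈ Ioo (0 : ℝ) 1, derivWithin γ (Icc 0 1) t = deriv γ t := fun t ht =>
    derivWithin_of_mem_nhds (Icc_mem_nhds ht.1 ht.2)
  let Γ : Loop :=
    { γ := γ
      D := derivWithin γ (Icc 0 1)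
      contD := h.contDiffOn.continuousOn_derivWithin (uniqueDiffOn_Icc zero_lt_one) le_rfl
      hasDeriv := fun t ht => by
        rw [hD t ht]
        exact ((h.contDiffOn.differentiableOn one_ne_zero).differentiableAt
          (Icc_mem_nhds ht.1 ht.2)).hasDerivAt
      cont := h.contDiffOn.continuousOn
      closed := h.closed
      ne_zero := h.ne_zero }
  refine ⟨Γ, rfl, fun p => ?_, fun m F => ?_⟩
  · simp only [winding, Loop.wind, Loop.int, Γ]
    congr 1
    rw [intervalIntegral.integral_of_le zero_le_one, intervalIntegral.integral_of_le zero_le_one,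
      integral_Ioc_eq_integral_Ioo, integral_Ioc_eq_integral_Ioo]
    refine setIntegral_congr_fun measurableSet_Ioo fun t ht => ?_
    simp only [hD t ht, div_eq_mul_inv]
  · simp only [multiContour, loopMulti, Γ]
    congr 1
    have hae : (Set.pi univ fun _ : Fin m => Ioo (0 : ℝ) 1) =ᵐ[volume] Icc (0 : Fin m → ℝ) 1 :=
      Measure.univ_pi_Ioo_ae_eq_Icc (f := 0) (g := 1)
    rw [← setIntegral_congr_set hae, ← setIntegral_congr_set hae]
    refine setIntegral_congr_fun (MeasurableSet.univ_pi fun _ => measurableSet_Ioo) fun t ht => ?_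
    rw [Finset.prod_congr rfl fun μ _ => (hD (t μ) (ht μ (mem_univ _))).symm]

/-- A circle as a loop. -/
def circleLoop (c : ℂ) (ρ : ℝ) (h0 : ‖c‖ ≠ |ρ|) : Loop where
  γ t := circleMap c ρ (2 * Real.pi * t)
  D t := 2 * Real.pi * deriv (circleMap c ρ) (2 * Real.pi * t)
  contD := by simp only [deriv_circleMap]; fun_prop
  hasDeriv t _ := by
    have h1 : HasDerivAt (fun t : ℝ => 2 * Real.pi * t) (2 * Real.pi) t := by
      simpa using (hasDerivAt_id t).const_mul (2 * Real.pi)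
    have := ((differentiable_circleMap c ρ).differentiableAt.hasDerivAt (x := 2 * Real.pi * t)).scomp t h1
    simpa using! this
  cont := by fun_prop
  closed := by
    have := periodic_circleMap c ρ 0
    simpa using this.symm
  ne_zero t _ h := h0 (by
    have : ‖circleMap c ρ (2 * Real.pi * t) - c‖ = |ρ| := by simp
    rw [← this, h, zero_sub, norm_neg])

lemma circleLoop_int (c : ℂ) (ρ : ℝ) (h0 : ‖c‖ ≠ |ρ|) (f : ℂ → ℂ) :
    (circleLoop c ρ h0).int f = (2 * Real.pi * Complex.I)⁻¹ * ∮ x in C(c, ρ), f x := by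
  simp only [Loop.int, circleLoop, circleIntegral]
  congr 1
  have := intervalIntegral.integral_comp_mul_left (a := 0) (b := 1)
    (fun θ => deriv (circleMap c ρ) θ * f (circleMap c ρ θ)) Real.two_pi_pos.ne'
  simp only [mul_zero, mul_one] at this
  simp only [mul_assoc, intervalIntegral.integral_const_mul, smul_eq_mul] at this ⊢
  rw [this]
  simp only [deriv_circleMap, Complex.real_smul]
  push_cast
  field_simp
  exact intervalIntegral.integral_congr fun t _ => by ring

lemma circleLoop_supp (c : ℂ) {ρ : ℝ} (hρ : 0 ≤ ρ) (h0 : ‖c‖ ≠ |ρ|) :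
    (circleLoop c ρ h0).supp ⊆ sphere c ρ := by
  rintro _ ⟨t, -, rfl⟩
  exact circleMap_mem_sphere c hρ _

lemma circleLoop_wind_in {c : ℂ} {ρ : ℝ} (h0 : ‖c‖ ≠ |ρ|) {p : ℂ} (hp : ‖p - c‖ < ρ) :
    (circleLoop c ρ h0).wind p = 1 := by
  rw [Loop.wind, circleLoop_int, circleIntegral.integral_sub_inv_of_mem_ball
    (by rwa [mem_ball, dist_eq_norm])]
  exact inv_mul_cancel₀ Complex.two_pi_I_ne_zero

lemma circleLoop_wind_out {c : ℂ} {ρ : ℝ} (hρ : 0 ≤ ρ) (h0 : ‖c‖ ≠ |ρ|) {p : ℂ}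
    (hp : ρ < ‖p - c‖) : (circleLoop c ρ h0).wind p = 0 := by
  have hne : ∀ u ∈ closedBall c ρ, u - p ≠ 0 := fun u hu e => by
    rw [sub_eq_zero.mp e, mem_closedBall, dist_eq_norm] at hu
    exact absurd hp (not_lt.mpr hu)
  rw [Loop.wind, circleLoop_int,
    Complex.circleIntegral_eq_zero_of_differentiable_on_off_countable hρ countable_empty, mul_zero]
  · exact ContinuousOn.inv₀ (by fun_prop) hne
  · rintro u ⟨hu, -⟩
    exact DifferentiableAt.inv (by fun_prop) (hne u (ball_subset_closedBall hu))

end QKZ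

/-! ### Separating cycles and stability of geometric sequences -/

namespace QKZ
open Set MeasureTheory Metric Filter

/-- Points accumulating only at `0` can be separated by a finite family of circles from points
accumulating only at `∞`. -/
theorem exists_separating_cycle {A B : Set ℂ} (hA : ∀ ε : ℝ, 0 < ε → {x ∈ A | ε ≤ ‖x‖}.Finite)
    (hB : ∀ R : ℝ, {x ∈ B | ‖x‖ ≤ R}.Finite) (hB0 : (0 : ℂ) ∉ B) (hAB : Disjoint A B) :
    ∃ (κ : Type) (_ : Fintype κ) (Γ : κ → Loop) (T T' : Set ℂ), IsOpen T ∧ IsOpen T' ∧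
      (0 : ℂ) ∈ T ∧ A ⊆ T ∧ B ⊆ T' ∧ (∃ R : ℝ, ∀ x : ℂ, R < ‖x‖ → x ∈ T') ∧
      (∀ x ∈ T, (∀ i, x ∉ (Γ i).supp) ∧ cycWind Γ 1 x = 1) ∧
      ∀ x ∈ T', (∀ i, x ∉ (Γ i).supp) ∧ cycWind Γ 1 x = 0 := by
  classical
  have hAc : ((fun x : ℂ => ‖x‖) '' A).Countable := by
    have h1 : A ⊆ {0} ∪ ⋃ n : ℕ, {x ∈ A | (1 / ((n : ℝ) + 1)) ≤ ‖x‖} := fun x hx => by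
      by_cases h0 : x = 0
      · exact Or.inl h0
      · obtain ⟨n, hn⟩ := exists_nat_one_div_lt (norm_pos_iff.mpr h0)
        exact Or.inr (mem_iUnion.mpr ⟨n, hx, hn.le⟩)
    exact (((countable_singleton 0).union (countable_iUnion fun n =>
      (hA _ (by positivity)).countable)).mono h1).image _
  have hr : ∀ᶠ r in 𝓝[>] (0 : ℝ), ∀ x ∈ B, r < ‖x‖ := by
    have h1 : ∀ᶠ r in 𝓝[>] (0 : ℝ), ∀ x ∈ {x ∈ B | ‖x‖ ≤ 1}, r < ‖x‖ :=
      (eventually_all_finite (hB 1)).mpr fun x hx => by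
        have : 0 < ‖x‖ := norm_pos_iff.mpr fun h => hB0 (h ▸ hx.1)
        exact (eventually_lt_nhds this).filter_mono nhdsWithin_le_nhds
    filter_upwards [h1, (eventually_lt_nhds (zero_lt_one' ℝ)).filter_mono nhdsWithin_le_nhds]
      with r h1 h2 x hx
    by_cases h : ‖x‖ ≤ 1
    · exact h1 x ⟨hx, h⟩
    · exact h2.trans (not_le.mp h)
  obtain ⟨c, hc0, hc⟩ := mem_nhdsGT_iff_exists_Ioo_subset.mp hr
  -- The moduli of points of `A` form a countable set, so some radius below all moduli of `B` avoids
  -- them.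
  obtain ⟨r0, hr0A, hr0⟩ := (hAc.dense_compl ℝ).exists_between hc0
  have hr0B : ∀ x ∈ B, r0 < ‖x‖ := hc hr0
  have hr0A' : ∀ x ∈ A, ‖x‖ ≠ r0 := fun x hx e => hr0A ⟨x, hx, e⟩
  set I : Finset ℂ := (hA r0 hr0.1).toFinset with hI
  have hIA : ∀ p ∈ I, p ∈ A ∧ r0 < ‖p‖ := fun p hp => by
    have := (hA r0 hr0.1).mem_toFinset.mp hp
    exact ⟨this.1, lt_of_le_of_ne this.2 (hr0A' p this.1).symm⟩
  have hlt : ∀ a : ℝ, 0 < a → ∀ᶠ δ in 𝓝[>] (0 : ℝ), δ < a := fun a ha =>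
    (eventually_lt_nhds ha).filter_mono nhdsWithin_le_nhds
  have e1 : ∀ᶠ δ in 𝓝[>] (0 : ℝ), ∀ p ∈ I, δ < ‖p‖ - r0 :=
    (eventually_all_finset I).mpr fun p hp => hlt _ (sub_pos.mpr (hIA p hp).2)
  have e2 : ∀ᶠ δ in 𝓝[>] (0 : ℝ), ∀ p ∈ I, ∀ p' ∈ I, p ≠ p' → δ < ‖p - p'‖ / 2 :=
    (eventually_all_finset I).mpr fun p _ => (eventually_all_finset I).mpr fun p' _ => by
      by_cases h : p = p'
      · simp [h]
      · filter_upwards [hlt _ (half_pos (norm_pos_iff.mpr (sub_ne_zero.mpr h)))] with δ hδ _ using hδ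
  have e3 : ∀ᶠ δ in 𝓝[>] (0 : ℝ), ∀ p ∈ I, ∀ x ∈ B, δ < ‖x - p‖ :=
    (eventually_all_finset I).mpr fun p hp => by
      have h1 : ∀ᶠ δ in 𝓝[>] (0 : ℝ), ∀ x ∈ {x ∈ B | ‖x‖ ≤ ‖p‖ + 1}, δ < ‖x - p‖ :=
        (eventually_all_finite (hB _)).mpr fun x hx => hlt _ (norm_pos_iff.mpr
          (sub_ne_zero.mpr fun h => disjoint_left.mp hAB (hIA p hp).1 (h ▸ hx.1)))
      filter_upwards [h1, hlt 1 one_pos] with δ h1 h2 x hx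
      by_cases h : ‖x‖ ≤ ‖p‖ + 1
      · exact h1 x ⟨hx, h⟩
      · have := norm_sub_norm_le x p
        linarith [not_le.mp h]
  obtain ⟨δ, ⟨⟨e1, e2⟩, e3⟩, hδ⟩ := (((e1.and e2).and e3).and self_mem_nhdsWithin).exists
  have hδ0 : (0 : ℝ) < δ := hδ
  have hrr : 0 < r0 := hr0.1
  have hne : ∀ p : I, ‖(p : ℂ)‖ ≠ |δ| := fun p => by
    rw [abs_of_pos hδ0]; exact (by linarith [e1 p p.2] : δ < ‖(p : ℂ)‖).ne'
  have hne0 : ‖(0 : ℂ)‖ ≠ |r0| := by rw [norm_zero, abs_of_pos hrr]; exact hrr.ne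
  -- The central circle encloses all but finitely many points of `A`. Each of the others receives a
  -- small circle of its own, whose closed disc avoids the central disc, the other small discs and
  -- `B`.
  let Γ : Option I → Loop := fun o => o.elim (circleLoop 0 r0 hne0) fun p => circleLoop p δ (hne p)
  have hΓ0 : ∀ x : ℂ, ‖x‖ ≠ r0 → x ∉ (Γ none).supp := fun x hx h => hx (by
    simpa using circleLoop_supp 0 hrr.le hne0 h)
  have hΓ1 : ∀ (p : I) (x : ℂ), ‖x - p‖ ≠ δ → x ∉ (Γ (some p)).supp := fun p x hx h => hx (by
    simpa [dist_eq_norm] using circleLoop_supp (p : ℂ) hδ0.le (hne p) h)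
  have wsum : ∀ x, cycWind Γ 1 x = (Γ none).wind x + ∑ p : I, (Γ (some p)).wind x := fun x => by
    simp [cycWind, Fintype.sum_option]
  have w0in : ∀ x : ℂ, ‖x‖ < r0 → (Γ none).wind x = 1 := fun x hx =>
    circleLoop_wind_in hne0 (by simpa using hx)
  have w0out : ∀ x : ℂ, r0 < ‖x‖ → (Γ none).wind x = 0 := fun x hx =>
    circleLoop_wind_out hrr.le hne0 (by simpa using hx)
  have w1in : ∀ (p : I) (x : ℂ), ‖x - p‖ < δ → (Γ (some p)).wind x = 1 := fun p x hx =>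
    circleLoop_wind_in (hne p) hx
  have w1out : ∀ (p : I) (x : ℂ), δ < ‖x - p‖ → (Γ (some p)).wind x = 0 := fun p x hx =>
    circleLoop_wind_out hδ0.le (hne p) hx
  refine ⟨Option I, inferInstance, Γ, ball 0 r0 ∪ ⋃ p ∈ I, ball p δ,
    {x | r0 < ‖x‖} ∩ ⋂ p ∈ I, {x | δ < ‖x - p‖}, ?_, ?_, ?_, ?_, ?_, ?_, ?_, ?_⟩
  · exact isOpen_ball.union (isOpen_biUnion fun _ _ => isOpen_ball)
  · refine (isOpen_lt continuous_const continuous_norm).inter (isOpen_biInter_finset fun p _ => ?_)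
    exact isOpen_lt continuous_const (by fun_prop)
  · exact Or.inl (mem_ball_self hrr)
  · intro x hx
    by_cases h : ‖x‖ < r0
    · exact Or.inl (by simpa using h)
    · have : x ∈ I := (hA r0 hr0.1).mem_toFinset.mpr ⟨hx, not_lt.mp h⟩
      exact Or.inr (mem_biUnion (by exact this) (mem_ball_self hδ0))
  · intro x hx
    exact ⟨hr0B x hx, mem_iInter₂.mpr fun p hp => e3 p hp x hx⟩
  · refine ⟨r0 + ∑ p ∈ I, (‖p‖ + δ), fun x hx => ⟨?_, mem_iInter₂.mpr fun p hp => ?_⟩⟩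
    · have : 0 ≤ ∑ p ∈ I, (‖p‖ + δ) := Finset.sum_nonneg fun p _ => by positivity
      exact (by linarith : r0 < ‖x‖)
    · have h1 : ‖p‖ + δ ≤ ∑ p ∈ I, (‖p‖ + δ) :=
        Finset.single_le_sum (f := fun p : ℂ => ‖p‖ + δ) (fun p _ => by positivity) hp
      have h2 := norm_sub_norm_le x p
      exact (by linarith : δ < ‖x - p‖)
  · rintro x (hx | hx)
    · have hx' : ‖x‖ < r0 := by simpa using hx
      have h2 : ∀ p : I, δ < ‖x - p‖ := fun p => by
        have h3 := e1 p p.2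
        have h4 := norm_sub_norm_le (p : ℂ) x
        rw [norm_sub_rev] at h4
        linarith
      refine ⟨?_, ?_⟩
      · rintro (_ | p)
        · exact hΓ0 x hx'.ne
        · exact hΓ1 p x (h2 p).ne'
      · rw [wsum, w0in x hx', Finset.sum_eq_zero fun p _ => w1out p x (h2 p), add_zero]
    · obtain ⟨p, hp, hxp⟩ := mem_iUnion₂.mp hx
      rw [mem_ball, dist_eq_norm] at hxp
      have h1 : r0 < ‖x‖ := by
        have h3 := e1 p hp
        have h4 := norm_sub_norm_le p x
        rw [norm_sub_rev] at h4
        linarith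
      have h2 : ∀ p' : I, p' ≠ ⟨p, hp⟩ → δ < ‖x - p'‖ := fun p' hp' => by
        have h3 := e2 p hp p' p'.2 fun h => hp' (Subtype.ext h.symm)
        have h4 := norm_sub_le_norm_sub_add_norm_sub p x (p' : ℂ)
        rw [norm_sub_rev p x] at h4
        linarith
      refine ⟨?_, ?_⟩
      · rintro (_ | p')
        · exact hΓ0 x h1.ne'
        · by_cases h : p' = ⟨p, hp⟩
          · exact hΓ1 p' x (by rw [h]; exact hxp.ne)
          · exact hΓ1 p' x (h2 p' h).ne'
      · rw [wsum, w0out x h1, Finset.sum_eq_single ⟨p, hp⟩, w1in ⟨p, hp⟩ x hxp, zero_add]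
        · exact fun p' _ hp' => w1out p' x (h2 p' hp')
        · simp
  · rintro x ⟨h1, h2⟩
    have h2' : ∀ p : I, δ < ‖x - p‖ := fun p => mem_iInter₂.mp h2 p p.2
    refine ⟨?_, ?_⟩
    · rintro (_ | p)
      · exact hΓ0 x (ne_of_gt h1)
      · exact hΓ1 p x (h2' p).ne'
    · rw [wsum, w0out x h1, Finset.sum_eq_zero fun p _ => w1out p x (h2' p), add_zero]

/-- A geometric sequence tending to zero and contained in an open neighbourhood of zero stays
there when its first term is moved slightly. -/
lemma eventually_forall_mul_pow_mem {T : Set ℂ} (hT : IsOpen T) (h0 : (0 : ℂ) ∈ T) {p c : ℂ}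
    (hp : ‖p‖ < 1) (h : ∀ k : ℕ, c * p ^ k ∈ T) : ∀ᶠ c' in 𝓝 c, ∀ k : ℕ, c' * p ^ k ∈ T := by
  obtain ⟨r, hr, hrT⟩ := Metric.isOpen_iff.mp hT 0 h0
  have hlim : Tendsto (fun K : ℕ => (‖c‖ + 1) * ‖p‖ ^ K) atTop (𝓝 0) := by
    simpa using (tendsto_pow_atTop_nhds_zero_of_lt_one (norm_nonneg _) hp).const_mul (‖c‖ + 1)
  obtain ⟨K, hK⟩ := eventually_atTop.mp (hlim.eventually (gt_mem_nhds hr))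
  have e1 : ∀ᶠ c' in 𝓝 c, ∀ k ∈ Finset.range K, c' * p ^ k ∈ T :=
    (eventually_all_finset _).mpr fun k _ =>
      (continuous_id.mul continuous_const).continuousAt.eventually (hT.mem_nhds (h k))
  have e2 : ∀ᶠ c' in 𝓝 c, ‖c'‖ < ‖c‖ + 1 :=
    continuous_norm.continuousAt.eventually (gt_mem_nhds (lt_add_one _))
  filter_upwards [e1, e2] with c' h1 h2 k
  by_cases hk : k < K
  · exact h1 k (Finset.mem_range.mpr hk)
  · refine hrT ?_
    rw [mem_ball, dist_zero_right, norm_mul, norm_pow]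
    exact (mul_le_mul_of_nonneg_right h2.le (by positivity)).trans_lt (hK k (not_lt.mp hk))

/-- The same for a geometric sequence tending to infinity. -/
lemma eventually_forall_mul_inv_pow_mem {T : Set ℂ} (hT : IsOpen T)
    (hR : ∃ R : ℝ, ∀ x : ℂ, R < ‖x‖ → x ∈ T) {p c : ℂ} (hc : c ≠ 0)
    (hp : ‖p‖ < 1) (hp0 : p ≠ 0) (h : ∀ k : ℕ, c * p⁻¹ ^ k ∈ T) :
    ∀ᶠ c' in 𝓝 c, ∀ k : ℕ, c' * p⁻¹ ^ k ∈ T := by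
  obtain ⟨R, hR⟩ := hR
  have hc2 : 0 < ‖c‖ / 2 := half_pos (norm_pos_iff.mpr hc)
  have hlim : Tendsto (fun K : ℕ => (‖c‖ / 2) * ‖p⁻¹‖ ^ K) atTop atTop :=
    (tendsto_pow_atTop_atTop_of_one_lt (by
      rw [norm_inv]; exact one_lt_inv_iff₀.mpr ⟨norm_pos_iff.mpr hp0, hp⟩)).const_mul_atTop hc2
  obtain ⟨K, hK⟩ := eventually_atTop.mp (hlim.eventually (eventually_gt_atTop R))
  have e1 : ∀ᶠ c' in 𝓝 c, ∀ k ∈ Finset.range K, c' * p⁻¹ ^ k ∈ T :=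
    (eventually_all_finset _).mpr fun k _ =>
      (continuous_id.mul continuous_const).continuousAt.eventually (hT.mem_nhds (h k))
  have e2 : ∀ᶠ c' in 𝓝 c, ‖c‖ / 2 < ‖c'‖ :=
    continuous_norm.continuousAt.eventually (lt_mem_nhds (half_lt_self (norm_pos_iff.mpr hc)))
  filter_upwards [e1, e2] with c' h1 h2 k
  by_cases hk : k < K
  · exact h1 k (Finset.mem_range.mpr hk)
  · refine hR _ ?_
    rw [norm_mul, norm_pow]
    exact (hK k (not_lt.mp hk)).trans_le (mul_le_mul_of_nonneg_right h2.le (by positivity))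

lemma finite_geometric_large {N : ℕ} {p : ℂ} (hp : ‖p‖ < 1) (c : Fin N → ℂ) {ε : ℝ} (hε : 0 < ε) :
    {x ∈ range (fun a : Fin N × ℕ => c a.1 * p ^ a.2) | ε ≤ ‖x‖}.Finite := by
  have hfin : ∀ j, {k : ℕ | ε ≤ ‖c j * p ^ k‖}.Finite := fun j => by
    have hlim : Tendsto (fun K : ℕ => ‖c j * p ^ K‖) atTop (𝓝 0) := by
      simpa using (tendsto_pow_atTop_nhds_zero_of_lt_one (norm_nonneg _) hp).const_mul ‖c j‖
    obtain ⟨K, hK⟩ := eventually_atTop.mp (hlim.eventually (gt_mem_nhds hε))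
    refine (finite_lt_nat K).subset fun k hk => ?_
    by_contra h
    exact absurd (show ε ≤ ‖c j * p ^ k‖ from hk) (not_le.mpr (hK k (not_lt.mp h)))
  refine (finite_iUnion fun j => (hfin j).image fun k => c j * p ^ k).subset ?_
  rintro _ ⟨⟨⟨j, k⟩, rfl⟩, h⟩
  exact mem_iUnion.mpr ⟨j, k, h, rfl⟩

lemma finite_geometric_small {N : ℕ} {p : ℂ} (hp : ‖p‖ < 1) (hp0 : p ≠ 0) {c : Fin N → ℂ}
    (hc : ∀ j, c j ≠ 0) (R : ℝ) :
    {x ∈ range (fun a : Fin N × ℕ => c a.1 * p⁻¹ ^ a.2) | ‖x‖ ≤ R}.Finite := by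
  have hfin : ∀ j, {k : ℕ | ‖c j * p⁻¹ ^ k‖ ≤ R}.Finite := fun j => by
    have hlim : Tendsto (fun K : ℕ => ‖c j‖ * ‖p⁻¹‖ ^ K) atTop atTop :=
      (tendsto_pow_atTop_atTop_of_one_lt (by
        rw [norm_inv]; exact one_lt_inv_iff₀.mpr ⟨norm_pos_iff.mpr hp0, hp⟩)).const_mul_atTop
        (norm_pos_iff.mpr (hc j))
    obtain ⟨K, hK⟩ := eventually_atTop.mp (hlim.eventually (eventually_gt_atTop R))
    refine (finite_lt_nat K).subset fun k hk => ?_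
    by_contra h
    refine absurd (show ‖c j * p⁻¹ ^ k‖ ≤ R from hk) (not_le.mpr ?_)
    rw [norm_mul, norm_pow]
    exact hK k (not_lt.mp h)
  refine (finite_iUnion fun j => (hfin j).image fun k => c j * p⁻¹ ^ k).subset ?_
  rintro _ ⟨⟨⟨j, k⟩, rfl⟩, h⟩
  exact mem_iUnion.mpr ⟨j, k, h, rfl⟩

end QKZ

/-! ### Generating functions for the polynomials `A_λ` -/

namespace QKZ
open PowerSeries

/-- The geometric series `1 / (1 - y X)`. -/
def geom (y : ℂ) : PowerSeries ℂ := PowerSeries.mk fun k => y ^ k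

/-- The polynomial `∏_{i ∈ s} (1 - c_i X)`. -/
def revProd {ι : Type*} (s : Finset ι) (c : ι → ℂ) : PowerSeries ℂ := ∏ i ∈ s, (1 - C (c i) * X)

lemma coeff_geom (y : ℂ) (k : ℕ) : coeff k (geom y) = y ^ k := coeff_mk _ _

lemma one_sub_mul_geom (y : ℂ) : (1 - C y * X) * geom y = 1 := by
  ext k
  rw [sub_mul, one_mul, map_sub, mul_assoc, coeff_C_mul, coeff_geom, coeff_one]
  cases k with
  | zero => simp
  | succ k => rw [coeff_succ_X_mul, coeff_geom]; simp [pow_succ']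

lemma sub_mul_geom_mul_geom (u y : ℂ) :
    C (u - y) * (X * (geom u * geom y)) = geom u - geom y := by
  have h1 := one_sub_mul_geom u
  have h2 := one_sub_mul_geom y
  rw [map_sub]
  linear_combination geom u * h2 - geom y * h1

lemma coeff_revProd_of_card_lt {ι : Type*} (s : Finset ι) (c : ι → ℂ) :
    ∀ k, s.card < k → coeff k (revProd s c) = 0 := by
  classical
  induction s using Finset.induction_on with
  | empty => intro k hk; rw [revProd, Finset.prod_empty, coeff_one, if_neg (by simp at hk; omega)]
  | insert i s hi ih =>
    intro k hk
    rw [Finset.card_insert_of_notMem hi] at hk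
    obtain ⟨k, rfl⟩ := Nat.exists_eq_succ_of_ne_zero (by omega : k ≠ 0)
    rw [revProd, Finset.prod_insert hi, ← revProd, sub_mul, one_mul, map_sub, mul_assoc, coeff_C_mul,
      coeff_succ_X_mul, ih _ (by omega), ih _ (by omega), mul_zero, sub_zero]

/-- The polynomial has degree at most `s.card`. From this degree on, the coefficients of its
quotient by `1 - y X` form a geometric sequence, and the first of them is the reversed polynomial at
`y`. -/
lemma coeff_revProd_mul_geom {ι : Type*} (s : Finset ι) (c : ι → ℂ) (y : ℂ) :
    coeff s.card (revProd s c * geom y) = ∏ i ∈ s, (y - c i) := by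
  classical
  have key : ∀ s : Finset ι, coeff (s.card + 1) (revProd s c * geom y) =
      y * coeff s.card (revProd s c * geom y) := fun s => by
    have h : revProd s c * geom y = revProd s c + C y * (X * (revProd s c * geom y)) := by
      linear_combination revProd s c * one_sub_mul_geom y
    nth_rewrite 1 [h]
    rw [map_add, coeff_revProd_of_card_lt s c _ (Nat.lt_succ_self _), coeff_C_mul,
      coeff_succ_X_mul, zero_add]
  induction s using Finset.induction_on with
  | empty => simp [revProd, coeff_geom]
  | insert i s hi ih =>
    rw [Finset.card_insert_of_notMem hi, revProd, Finset.prod_insert hi, ← revProd, sub_mul, one_mul,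
      sub_mul, map_sub, mul_assoc, mul_assoc, coeff_C_mul, coeff_succ_X_mul, key s, ih,
      Finset.prod_insert hi]
    ring

lemma revProd_mul_geom_of_mem {ι : Type*} [DecidableEq ι] {s : Finset ι} {i : ι} (hi : i ∈ s)
    (c : ι → ℂ) : revProd s c * geom (c i) = revProd (s.erase i) c := by
  rw [revProd, ← Finset.mul_prod_erase s _ hi, ← revProd]
  linear_combination revProd (s.erase i) c * one_sub_mul_geom (c i)

lemma coeff_revProd {k : ℕ} (a : Fin k → ℂ) (t : ℂ) (r : ℕ) :
    coeff r (revProd Finset.univ fun i => a i * t) = (-t) ^ r * esym a r := by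
  have h : (revProd Finset.univ fun i => a i * t) =
      ∑ s : Finset (Fin k), C (∏ i ∈ s, -(a i * t)) * X ^ s.card := by
    rw [revProd]
    simp only [sub_eq_add_neg, Finset.prod_one_add, Finset.powerset_univ]
    refine Finset.sum_congr rfl fun s _ => ?_
    rw [map_prod, ← Finset.prod_const, ← Finset.prod_mul_distrib]
    simp
  rw [h, map_sum]
  simp only [coeff_C_mul, coeff_X_pow, mul_ite, mul_one, mul_zero]
  rw [← Finset.sum_filter, esym, Finset.mul_sum]
  refine Finset.sum_congr ?_ fun s hs => ?_
  · ext s; simp [Finset.mem_powersetCard, eq_comm]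
  · rw [← (Finset.mem_powersetCard.mp hs).2, ← Finset.prod_const, ← Finset.prod_mul_distrib]
    exact Finset.prod_congr rfl fun i _ => by ring

/-- The multisets that index `hsym` correspond to the exponent vectors in the coefficient of a
product of geometric series. -/
lemma prod_geom {k : ℕ} (a : Fin k → ℂ) (t : ℂ) :
    ∏ i, geom (a i * t) = PowerSeries.mk fun r => t ^ r * hsym a r := by
  ext r
  rw [coeff_prod, coeff_mk, hsym, Finset.mul_sum]
  symm
  refine Finset.sum_bij' (fun s _ => ((Sym.equivNatSum (Fin k) r s : _) : Fin k →₀ ℕ))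
    (fun f hf => (Sym.equivNatSum (Fin k) r).symm ⟨f, ?_⟩) ?_ ?_ ?_ ?_ ?_
  · have := (Finset.mem_finsuppAntidiag.mp hf).1
    rw [Finsupp.sum_fintype _ _ (by simp)]; exact this
  · intro s _
    rw [Finset.mem_finsuppAntidiag]
    refine ⟨?_, Finset.subset_univ _⟩
    have := (Sym.equivNatSum (Fin k) r s).2
    rwa [Finsupp.sum_fintype _ _ (by simp)] at this
  · intro f hf; exact Finset.mem_univ _
  · intro s _; simp
  · intro f hf; simp
  · intro s _
    simp only [coeff_geom, Sym.coe_equivNatSum_apply_apply, mul_pow, Finset.prod_mul_distrib]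
    rw [Finset.prod_multiset_map_count, Finset.prod_pow_eq_pow_sum, mul_comm]
    congr 1
    · rw [← Finset.prod_subset (Finset.subset_univ (s : Multiset (Fin k)).toFinset)]
      intro i _ hi
      rw [Multiset.count_eq_zero_of_notMem (by simpa using hi), pow_zero]
    · congr 1
      have := s.2
      rw [← Multiset.sum_count_eq_card (s := Finset.univ) (fun a _ => Finset.mem_univ a)] at this
      exact this.symm

/-- This is the defining generating function of `β_k` with its variable rescaled by `τ` and its
denominator cleared. -/
lemma mk_beta_mul (q : ℂ) {n l : ℕ} (a : Fin n → ℂ) (b : Fin l → ℂ) :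
    (PowerSeries.mk fun k => beta q a b k * q⁻¹ ^ k) *
        revProd Finset.univ (fun i => a i * q⁻¹ ^ 3) =
      revProd Finset.univ (fun i => b i * q⁻¹) := by
  have h : (PowerSeries.mk fun k => beta q a b k * q⁻¹ ^ k) =
      revProd Finset.univ (fun i => b i * q⁻¹) * ∏ i, geom (a i * q⁻¹ ^ 3) := by
    ext k
    rw [prod_geom, coeff_mk, coeff_mul, Finset.Nat.sum_antidiagonal_eq_sum_range_succ_mk, beta,
      Finset.sum_mul]
    refine Finset.sum_congr rfl fun i hi => ?_
    have hik : i ≤ k := Nat.lt_succ_iff.mp (Finset.mem_range.mp hi)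
    rw [coeff_revProd, coeff_mk]
    have : q⁻¹ ^ k = q⁻¹ ^ i * q⁻¹ ^ (k - i) := by rw [← pow_add, Nat.add_sub_cancel' hik]
    rw [this, neg_pow (q⁻¹) i]
    ring
  rw [h, mul_assoc]
  have h1 : (∏ i, geom (a i * q⁻¹ ^ 3)) * revProd Finset.univ (fun i => a i * q⁻¹ ^ 3) = 1 := by
    rw [revProd, ← Finset.prod_mul_distrib]
    exact Finset.prod_eq_one fun i _ => by rw [mul_comm, one_sub_mul_geom]
  rw [h1, mul_one]

/-- Summing a truncated product against powers of a root. -/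
lemma sum_pow_mul_coeff {k : ℕ} (c : Fin k → ℂ) (j : Fin k) (G : PowerSeries ℂ) :
    ∑ r ∈ Finset.range k, c j ^ (k - 1 - r) * coeff r (revProd Finset.univ c * G) =
      coeff (k - 1) (revProd (Finset.univ.erase j) c * G) := by
  classical
  obtain ⟨k, rfl⟩ := Nat.exists_eq_succ_of_ne_zero (Fin.pos j).ne'
  rw [← revProd_mul_geom_of_mem (Finset.mem_univ j), mul_right_comm, coeff_mul,
    Finset.Nat.sum_antidiagonal_eq_sum_range_succ_mk]
  refine Finset.sum_congr rfl fun r _ => ?_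
  rw [coeff_geom, mul_comm, Nat.succ_sub_one]

lemma fPol_eq_coeff (q : ℂ) {n l : ℕ} (r : ℕ) (x : ℂ) (a : Fin n → ℂ) (b : Fin l → ℂ) :
    fPol q (r + 1) x a b = coeff r (revProd Finset.univ (fun i => a i * q⁻¹ ^ 3) *
      PowerSeries.mk fun k => phi q (k + 1) x a b) := by
  rw [fPol, coeff_mul, Finset.Nat.sum_antidiagonal_eq_sum_range_succ_mk]
  refine Finset.sum_congr rfl fun i hi => ?_
  have hik : i ≤ r := Nat.lt_succ_iff.mp (Finset.mem_range.mp hi)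
  rw [coeff_revProd, coeff_mk]
  congr 2
  omega

/-- The power `τ^(2r)` is the part of the prefactor of `g_λ` in `A_λ` that varies with `λ`. With it,
`g` involves the same product `∏ (1 - a_i τ³ X)` as `f`. For `k = 0` the exponent `k - 1` is
truncated, but its coefficient is zero. -/
lemma gPol_eq_coeff (q : ℂ) {n : ℕ} (r : ℕ) (x : ℂ) (a : Fin n → ℂ) :
    q⁻¹ ^ (2 * r) * gPol q (r + 1) x a = coeff r (revProd Finset.univ (fun i => a i * q⁻¹ ^ 3) *
      PowerSeries.mk fun k => (q⁻¹ ^ (2 * k) - q⁻¹ ^ (4 * k)) * x ^ (k - 1)) := by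
  rw [gPol, coeff_mul, Finset.Nat.sum_antidiagonal_eq_sum_range_succ_mk, Finset.sum_range_succ,
    Nat.add_sub_cancel, Finset.mul_sum]
  have h0 : coeff r (revProd Finset.univ fun i => a i * q⁻¹ ^ 3) *
      coeff (r - r) (PowerSeries.mk fun k => (q⁻¹ ^ (2 * k) - q⁻¹ ^ (4 * k)) * x ^ (k - 1)) = 0 := by
    simp
  rw [h0, add_zero]
  refine Finset.sum_congr rfl fun i hi => ?_
  have hik : i < r := Finset.mem_range.mp hi
  obtain ⟨s, rfl⟩ := Nat.exists_eq_add_of_lt hik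
  rw [coeff_revProd, coeff_mk, show i + s + 1 - i = s + 1 by omega,
    show i + s + 1 + 1 - 2 - i = s by omega, show s + 1 - 1 = s by omega]
  rw [neg_pow, neg_pow (q⁻¹ ^ 3)]
  ring

/-- The power series whose coefficients are the `phi q j x a b`, without restriction on `j`. -/
def phiSeries (q : ℂ) {n l : ℕ} (x : ℂ) (a : Fin n → ℂ) (b : Fin l → ℂ) : PowerSeries ℂ :=
  X * ((PowerSeries.mk fun k => beta q a b k * q⁻¹ ^ k) *
    (geom x - C (q⁻¹ ^ 2) * geom (q⁻¹ ^ 2 * x)))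

lemma coeff_phiSeries (q : ℂ) {n l : ℕ} (h : n ≤ l) (r : ℕ) (x : ℂ) (a : Fin n → ℂ)
    (b : Fin l → ℂ) : coeff (l - n + r) (phiSeries q x a b) = phi q (r + 1) x a b := by
  rw [phi, show l + (r + 1) - 1 - n = l - n + r by omega, phiSeries]
  generalize l - n + r = J
  cases J with
  | zero => simp
  | succ J =>
    rw [coeff_succ_X_mul, coeff_mul, Finset.Nat.sum_antidiagonal_eq_sum_range_succ_mk]
    refine Finset.sum_congr rfl fun i hi => ?_
    have hik : i ≤ J := Nat.lt_succ_iff.mp (Finset.mem_range.mp hi)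
    obtain ⟨s, rfl⟩ := Nat.exists_eq_add_of_le hik
    rw [coeff_mk, map_sub, coeff_C_mul, coeff_geom, coeff_geom, show i + s - i = s by omega,
      show i + s + 1 - 1 - i = s by omega, show 2 * (i + s + 1) - i = i + 2 * s + 2 by omega]
    rw [pow_add, pow_add]
    ring

/-- Without its `j`-th factor the product has degree at most `n - 1`. Hence the coefficient of
degree `l - 1` only meets coefficients of `phiSeries` of degree at least `l - n`, and these are the
`φ_1, …, φ_n`. -/
lemma coeff_erase_mul_phi (q : ℂ) {n l : ℕ} (h : n ≤ l) (j : Fin n) (x : ℂ)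
    (a : Fin n → ℂ) (b : Fin l → ℂ) :
    coeff (n - 1) (revProd (Finset.univ.erase j) (fun i => a i * q⁻¹ ^ 3) *
        PowerSeries.mk fun k => phi q (k + 1) x a b) =
      coeff (l - 1) (X * (revProd Finset.univ (fun i => b i * q⁻¹) * geom (a j * q⁻¹ ^ 3) *
        (geom x - C (q⁻¹ ^ 2) * geom (q⁻¹ ^ 2 * x)))) := by
  classical
  have hn : 0 < n := Fin.pos j
  have e : X * (revProd Finset.univ (fun i => b i * q⁻¹) * geom (a j * q⁻¹ ^ 3) *
        (geom x - C (q⁻¹ ^ 2) * geom (q⁻¹ ^ 2 * x))) =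
      revProd (Finset.univ.erase j) (fun i => a i * q⁻¹ ^ 3) * phiSeries q x a b := by
    rw [phiSeries, ← mk_beta_mul q a b,
      ← revProd_mul_geom_of_mem (Finset.mem_univ j) fun i => a i * q⁻¹ ^ 3]
    ring
  rw [e, coeff_mul, coeff_mul, Finset.Nat.sum_antidiagonal_eq_sum_range_succ_mk,
    Finset.Nat.sum_antidiagonal_eq_sum_range_succ_mk]
  have hsub : Finset.range (n - 1).succ ⊆ Finset.range (l - 1).succ :=
    Finset.range_subset_range.mpr (by omega)
  rw [← Finset.sum_subset hsub]
  · refine Finset.sum_congr rfl fun i hi => ?_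
    have : i ≤ n - 1 := Nat.lt_succ_iff.mp (Finset.mem_range.mp hi)
    rw [coeff_mk, ← coeff_phiSeries q h, show l - n + (n - 1 - i) = l - 1 - i by omega]
  · intro i _ hi
    rw [coeff_revProd_of_card_lt, zero_mul]
    rw [Finset.card_erase_of_mem (Finset.mem_univ _), Finset.card_univ, Fintype.card_fin]
    simpa using hi

/-- Partial fractions reduce the two geometric series to one. The coefficient just below the top
degree is then the value of the reversed polynomial minus the top coefficient, divided by the node.
The top coefficient cancels when the lemma is applied twice. -/
lemma coeff_X_mul_revProd_mul_geom_mul_geom {l : ℕ} (hl : 0 < l) (c : Fin l → ℂ) {u y : ℂ}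
    (hu : u ≠ 0) (hy : y ≠ 0) (huy : u ≠ y) :
    coeff (l - 1) (X * (revProd Finset.univ c * (geom u * geom y))) =
      ((∏ i, (u - c i)) / u - (∏ i, (y - c i)) / y +
        coeff l (revProd Finset.univ c) * (1 / y - 1 / u)) / (u - y) := by
  have h1 : ∀ v : ℂ, v ≠ 0 → coeff (l - 1) (revProd Finset.univ c * geom v) =
      (∏ i, (v - c i) - coeff l (revProd Finset.univ c)) / v := fun v hv => by
    have h := coeff_revProd_mul_geom Finset.univ c v
    have h2 : revProd Finset.univ c * geom v =
        revProd Finset.univ c + C v * (X * (revProd Finset.univ c * geom v)) := by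
      linear_combination revProd Finset.univ c * one_sub_mul_geom v
    obtain ⟨l, rfl⟩ := Nat.exists_eq_succ_of_ne_zero hl.ne'
    rw [Finset.card_univ, Fintype.card_fin, h2, map_add, coeff_C_mul, coeff_succ_X_mul] at h
    rw [eq_div_iff hv, Nat.succ_sub_one, ← h]
    ring
  have h3 := congrArg (fun F => coeff (l - 1) (revProd Finset.univ c * F))
    (sub_mul_geom_mul_geom u y)
  simp only [mul_sub, map_sub, h1 u hu, h1 y hy] at h3
  rw [eq_div_iff (sub_ne_zero.mpr huy)]
  have h4 : revProd Finset.univ c * ((C u - C y) * (X * (geom u * geom y))) =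
      C (u - y) * (X * (revProd Finset.univ c * (geom u * geom y))) := by
    rw [map_sub]; ring
  rw [h4, coeff_C_mul] at h3
  rw [mul_comm, h3]
  field_simp
  ring

/-- The combination `∑_λ u^{n-λ} A_λ` at the points `u = a_j τ³`. -/
theorem mul_sum_pow_mul_APol (q : ℂ) (hq : q ≠ 0) {n l : ℕ} (h : n ≤ l) (j : Fin n) {x : ℂ}
    (a : Fin n → ℂ) (b : Fin l → ℂ) (haj : a j ≠ 0) (hx : x ≠ 0) (hx1 : x ≠ a j * q⁻¹)
    (hx3 : x ≠ a j * q⁻¹ ^ 3) (hx0 : x ≠ a j * q) :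
    a j * q⁻¹ ^ 3 * ∑ r ∈ Finset.range n, (a j * q⁻¹ ^ 3) ^ (n - 1 - r) * APol q (r + 1) x a b =
      (∏ i, (x - a i * q⁻¹)) * (∏ i, (a j * q⁻¹ ^ 3 - b i * q⁻¹)) *
          (1 / (x - a j * q⁻¹) - 1 / (x - a j * q⁻¹ ^ 3)) +
        (∏ i, (x - a i * q⁻¹)) * (∏ i, (x - b i * q⁻¹)) * (1 / (x - a j * q⁻¹ ^ 3) - 1 / x) -
        q⁻¹ ^ (2 * (n + l)) * (∏ i, (x - a i * q)) * (∏ i, (x - b i * q)) *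
          (1 / (x - a j * q) - 1 / x) := by
  classical
  have hn : 0 < n := Fin.pos j
  have hτ : q⁻¹ ≠ 0 := inv_ne_zero hq
  have hF : a j * q⁻¹ ^ 3 * ∑ r ∈ Finset.range n, (a j * q⁻¹ ^ 3) ^ (n - 1 - r) *
        fPol q (r + 1) x a b =
      (∏ i, (a j * q⁻¹ ^ 3 - b i * q⁻¹)) * (1 / (x - a j * q⁻¹) - 1 / (x - a j * q⁻¹ ^ 3)) +
        (∏ i, (x - b i * q⁻¹)) * (1 / (x - a j * q⁻¹ ^ 3) - 1 / x) -
        (∏ i, (q⁻¹ ^ 2 * x - b i * q⁻¹)) * (1 / (x - a j * q⁻¹) - 1 / x) := by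
    simp only [fPol_eq_coeff]
    have h0 := sum_pow_mul_coeff (fun i => a i * q⁻¹ ^ 3) j
      (PowerSeries.mk fun k => phi q (k + 1) x a b)
    rw [h0, coeff_erase_mul_phi q h]
    have hu : a j * q⁻¹ ^ 3 ≠ 0 := mul_ne_zero haj (pow_ne_zero _ hτ)
    have hux : a j * q⁻¹ ^ 3 ≠ x := hx3.symm
    have huy : a j * q⁻¹ ^ 3 ≠ q⁻¹ ^ 2 * x := fun e => hx1
      (mul_left_cancel₀ (pow_ne_zero 2 hτ) (by linear_combination -e))
    have e : X * (revProd Finset.univ (fun i => b i * q⁻¹) * geom (a j * q⁻¹ ^ 3) *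
        (geom x - C (q⁻¹ ^ 2) * geom (q⁻¹ ^ 2 * x))) =
        X * (revProd Finset.univ (fun i => b i * q⁻¹) * (geom (a j * q⁻¹ ^ 3) * geom x)) -
        C (q⁻¹ ^ 2) * (X * (revProd Finset.univ (fun i => b i * q⁻¹) * (geom (a j * q⁻¹ ^ 3) *
          geom (q⁻¹ ^ 2 * x)))) := by ring
    rw [e, map_sub, coeff_C_mul, coeff_X_mul_revProd_mul_geom_mul_geom (by omega) _ hu hx hux,
      coeff_X_mul_revProd_mul_geom_mul_geom (by omega) _ hu (mul_ne_zero (pow_ne_zero _ hτ) hx) huy]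
    generalize (coeff (R := ℂ) l) (revProd Finset.univ fun i => b i * q⁻¹) = c
    generalize (∏ i, (a j * q⁻¹ ^ 3 - b i * q⁻¹)) = P1
    generalize (∏ i, (x - b i * q⁻¹)) = P2
    generalize (∏ i, (q⁻¹ ^ 2 * x - b i * q⁻¹)) = P3
    generalize q⁻¹ = t at *
    have e1 : a j * t ^ 3 - x ≠ 0 := sub_ne_zero.mpr hux
    have e2 : a j * t ^ 3 - t ^ 2 * x ≠ 0 := sub_ne_zero.mpr huy
    have e3 : x - a j * t ≠ 0 := sub_ne_zero.mpr hx1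
    have e4 : x - a j * t ^ 3 ≠ 0 := sub_ne_zero.mpr hx3
    have e5 : a j * t ^ 3 - t ^ 2 * x = - t ^ 2 * (x - a j * t) := by ring
    have e6 : a j * t ^ 3 - x = - (x - a j * t ^ 3) := by ring
    rw [e5, e6]
    field_simp
    ring
  have hG : a j * q⁻¹ ^ 3 * ∑ r ∈ Finset.range n, (a j * q⁻¹ ^ 3) ^ (n - 1 - r) *
        (q⁻¹ ^ (2 * r) * gPol q (r + 1) x a) =
      q⁻¹ ^ (2 * n) * ((∏ i, (x - a i * q⁻¹)) * (1 / (x - a j * q⁻¹) - 1 / x) -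
        q⁻¹ ^ (2 * n) * (∏ i, (x - a i * q)) * (1 / (x - a j * q) - 1 / x)) := by
    simp only [gPol_eq_coeff]
    have h0 := sum_pow_mul_coeff (fun i => a i * q⁻¹ ^ 3) j
      (PowerSeries.mk fun k => (q⁻¹ ^ (2 * k) - q⁻¹ ^ (4 * k)) * x ^ (k - 1))
    rw [h0]
    have e0 : C x * (PowerSeries.mk fun k => (q⁻¹ ^ (2 * k) - q⁻¹ ^ (4 * k)) * x ^ (k - 1)) =
        geom (q⁻¹ ^ 2 * x) - geom (q⁻¹ ^ 4 * x) := by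
      ext k
      rw [coeff_C_mul, coeff_mk, map_sub, coeff_geom, coeff_geom]
      cases k with
      | zero => simp
      | succ k => rw [Nat.succ_sub_one, mul_pow, mul_pow, ← pow_mul, ← pow_mul]; ring
    have hcard : (Finset.univ.erase j).card = n - 1 := by
      rw [Finset.card_erase_of_mem (Finset.mem_univ _), Finset.card_univ, Fintype.card_fin]
    have e1 : x * coeff (n - 1) (revProd (Finset.univ.erase j) (fun i => a i * q⁻¹ ^ 3) *
        PowerSeries.mk fun k => (q⁻¹ ^ (2 * k) - q⁻¹ ^ (4 * k)) * x ^ (k - 1)) =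
        ∏ i ∈ Finset.univ.erase j, (q⁻¹ ^ 2 * x - a i * q⁻¹ ^ 3) -
        ∏ i ∈ Finset.univ.erase j, (q⁻¹ ^ 4 * x - a i * q⁻¹ ^ 3) := by
      rw [← coeff_C_mul, mul_left_comm, e0, mul_sub, map_sub, ← hcard, coeff_revProd_mul_geom,
        coeff_revProd_mul_geom]
    have e2 : ∏ i ∈ Finset.univ.erase j, (q⁻¹ ^ 2 * x - a i * q⁻¹ ^ 3) =
        q⁻¹ ^ (2 * (n - 1)) * ∏ i ∈ Finset.univ.erase j, (x - a i * q⁻¹) := by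
      rw [pow_mul, ← hcard, ← Finset.prod_const, ← Finset.prod_mul_distrib]
      exact Finset.prod_congr rfl fun i _ => by ring
    have e3 : ∏ i ∈ Finset.univ.erase j, (q⁻¹ ^ 4 * x - a i * q⁻¹ ^ 3) =
        q⁻¹ ^ (4 * (n - 1)) * ∏ i ∈ Finset.univ.erase j, (x - a i * q) := by
      rw [pow_mul, ← hcard, ← Finset.prod_const, ← Finset.prod_mul_distrib]
      exact Finset.prod_congr rfl fun i _ => by field_simp
    have e4 := Finset.mul_prod_erase Finset.univ (fun i => x - a i * q⁻¹) (Finset.mem_univ j)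
    have e5 := Finset.mul_prod_erase Finset.univ (fun i => x - a i * q) (Finset.mem_univ j)
    rw [← e4, ← e5]
    rw [e2, e3] at e1
    obtain ⟨k, rfl⟩ := Nat.exists_eq_succ_of_ne_zero hn.ne'
    simp only [Nat.succ_sub_one] at e1 ⊢
    generalize (coeff (R := ℂ) k) _ = c at *
    generalize ∏ i ∈ Finset.univ.erase j, (x - a i * q⁻¹) = P1 at *
    generalize ∏ i ∈ Finset.univ.erase j, (x - a i * q) = P2 at *
    have d1 : x - a j * q⁻¹ ≠ 0 := sub_ne_zero.mpr hx1
    have d2 : x - a j * q ≠ 0 := sub_ne_zero.mpr hx0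
    have g : ∀ e P : ℂ, x - e ≠ 0 → (x - e) * P * (1 / (x - e) - 1 / x) = P * e / x :=
      fun e P he => by field_simp; ring
    have g1 := g _ P1 d1
    have g2 := g _ P2 d2
    have g3 : c = (q⁻¹ ^ (2 * k) * P1 - q⁻¹ ^ (4 * k) * P2) / x := by
      rw [eq_div_iff hx, ← e1]; ring
    have g4 : q⁻¹ * q = 1 := inv_mul_cancel₀ hq
    rw [g1, mul_assoc (q⁻¹ ^ (2 * k.succ)) _ (1 / (x - a j * q) - 1 / x), g2, g3]
    simp only [Nat.succ_eq_add_one, mul_add, pow_add, show 4 * k = 2 * k + 2 * k by ring, mul_one]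
    linear_combination (a j * q⁻¹ ^ (2 * k) * q⁻¹ ^ (2 * k) * P2 * q⁻¹ ^ 3 / x) * g4
  have hsum : ∑ r ∈ Finset.range n, (a j * q⁻¹ ^ 3) ^ (n - 1 - r) * APol q (r + 1) x a b =
      (∏ i, (x - a i * q⁻¹)) * (∑ r ∈ Finset.range n, (a j * q⁻¹ ^ 3) ^ (n - 1 - r) *
        fPol q (r + 1) x a b) + q⁻¹ ^ (2 * (l - n)) * (∏ i, (x - b i * q)) *
        ∑ r ∈ Finset.range n, (a j * q⁻¹ ^ 3) ^ (n - 1 - r) *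
          (q⁻¹ ^ (2 * r) * gPol q (r + 1) x a) := by
    rw [Finset.mul_sum, Finset.mul_sum, ← Finset.sum_add_distrib]
    refine Finset.sum_congr rfl fun r _ => ?_
    rw [APol, show 2 * (l + (r + 1) - 1 - n) = 2 * (l - n) + 2 * r by omega, pow_add]
    ring
  -- In this form the last term of `hF`, multiplied by `∏ (x - a_i τ)`, cancels the contribution of
  -- the first term of `hG`.
  have hB : ∏ i, (q⁻¹ ^ 2 * x - b i * q⁻¹) = q⁻¹ ^ (2 * l) * ∏ i, (x - b i * q) := by
    rw [Finset.prod_congr rfl fun i _ => show q⁻¹ ^ 2 * x - b i * q⁻¹ = q⁻¹ ^ 2 * (x - b i * q) by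
      field_simp, Finset.prod_mul_distrib, Finset.prod_const, Finset.card_univ, Fintype.card_fin,
      pow_mul]
  have hln : q⁻¹ ^ (2 * (l - n)) * q⁻¹ ^ (2 * n) = q⁻¹ ^ (2 * l) := by
    rw [← pow_add]; congr 1; omega
  have hln2 : q⁻¹ ^ (2 * (n + l)) = q⁻¹ ^ (2 * l) * q⁻¹ ^ (2 * n) := by
    rw [← pow_add]; congr 1; omega
  rw [hB] at hF
  rw [hsum, mul_add, mul_left_comm, hF, mul_left_comm, hG, hln2, ← hln]
  ring

/-- For `n = l` both defining sums are empty at `λ = 1`; accordingly the determinant starts at `λ =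
2`. -/
lemma APol_one_of_eq (q x : ℂ) {n : ℕ} (a b : Fin n → ℂ) : APol q 1 x a b = 0 := by
  simp [APol, fPol, gPol, phi]

end QKZ

/-! ### Vandermonde factors and a determinant identity -/

namespace QKZ
open Matrix

/-- The Vandermonde determinant `det (u_j^{k-1-r})`. -/
def vdet {k : ℕ} (u : Fin k → ℂ) : ℂ :=
  Matrix.det (Matrix.of fun j r : Fin k => u j ^ (k - 1 - (r : ℕ)))

lemma vdet_eq {k : ℕ} (u : Fin k → ℂ) : vdet u = ∏ i, ∏ j ∈ Finset.Ioi i, (u i - u j) := by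
  have h := Matrix.det_projVandermonde (1 : Fin k → ℂ) u
  simp only [Pi.one_apply, one_mul] at h
  rw [← h, vdet]
  congr 1
  ext j r
  rw [Matrix.of_apply, Matrix.projVandermonde_apply, Pi.one_apply, one_pow, one_mul, Fin.val_rev]
  congr 1
  omega

lemma vdet_ne_zero {k : ℕ} {u : Fin k → ℂ} (hu : Function.Injective u) : vdet u ≠ 0 := by
  rw [vdet_eq]
  refine Finset.prod_ne_zero_iff.mpr fun i _ => Finset.prod_ne_zero_iff.mpr fun j hj => ?_
  exact sub_ne_zero.mpr fun e => (Finset.mem_Ioi.mp hj).ne (hu e)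

/-- A cycle of sign `(-1)^i` brings row `i` to the front, where its differences with the other nodes
split off. -/
lemma vdet_succAbove {k : ℕ} (u : Fin (k + 1) → ℂ) (i : Fin (k + 1)) :
    (-1) ^ (i : ℕ) * vdet (u ∘ i.succAbove) * ∏ j, (u i - u (i.succAbove j)) = vdet u := by
  have h1 : vdet (u ∘ i.cycleRange.symm) = (-1) ^ (i : ℕ) * vdet u := by
    have := Matrix.det_permute i.cycleRange.symm (Matrix.of fun j r : Fin (k + 1) =>
      u j ^ (k + 1 - 1 - (r : ℕ)))
    rw [Equiv.Perm.sign_symm, Fin.sign_cycleRange] at this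
    rw [vdet, vdet]
    refine Eq.trans ?_ (this.trans (by push_cast; rfl))
    rfl
  have h2 : vdet (u ∘ i.cycleRange.symm) =
      (∏ j, (u i - u (i.succAbove j))) * vdet (u ∘ i.succAbove) := by
    rw [vdet_eq, vdet_eq, Fin.prod_univ_succ, Fin.prod_Ioi_zero]
    simp [Fin.prod_Ioi_succ]
  have h3 : ((-1 : ℂ) ^ (i : ℕ)) * (-1) ^ (i : ℕ) = 1 := by rw [← mul_pow]; simp
  linear_combination (-1) ^ (i : ℕ) * h1 - (-1) ^ (i : ℕ) * h2 + vdet u * h3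

lemma vdet_smul_mul_det {k : ℕ} (u : Fin k → ℂ) (M : Fin k → Fin k → ℂ) :
    vdet u * Matrix.det (Matrix.of fun μ r => M μ r) =
      Matrix.det (Matrix.of fun j μ => ∑ r : Fin k, u j ^ (k - 1 - (r : ℕ)) * M μ r) := by
  rw [vdet, ← Matrix.det_transpose (Matrix.of fun μ r => M μ r), ← Matrix.det_mul]
  rfl

/-- The index `λ` is traded for nodes `u_j`. At `u_j = a_j τ³` the sums over `λ` have closed forms.
-/
lemma vdet_mul_DeltaPol (q : ℂ) {k l : ℕ} (u x a : Fin k → ℂ) (b : Fin l → ℂ) :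
    vdet u * DeltaPol q x a b = Matrix.det (Matrix.of fun j μ : Fin k =>
      ∑ r ∈ Finset.range k, u j ^ (k - 1 - r) * APol q (r + 1) (x μ) a b) := by
  have h := vdet_smul_mul_det u fun μ r => APol q ((r : ℕ) + 1) (x μ) a b
  have h2 : DeltaPol q x a b =
      Matrix.det (Matrix.of fun μ r : Fin k => APol q ((r : ℕ) + 1) (x μ) a b) := by
    rw [DeltaPol]
    congr 1
    ext μ r
    rw [Matrix.of_apply, Matrix.of_apply]
    congr 1
    omega
  rw [h2, h]
  congr 1
  ext j μ
  rw [Matrix.of_apply, Matrix.of_apply,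
    Fin.sum_univ_eq_sum_range (fun r => u j ^ (k - 1 - r) * APol q (r + 1) (x μ) a b)]

/-- For `n = l` the matrix of the `A_λ` is one size smaller than the Vandermonde matrix. As `A_1 =
0`, a border row `v` with `v 0 = 1` leaves the determinant unchanged. The freedom in `v` is used to
make the large and the small determinants match. -/
lemma vdet_mul_DeltaPol_of_eq (q : ℂ) {m : ℕ} (x : Fin m → ℂ) (u a b : Fin (m + 1) → ℂ)
    (v : ℕ → ℂ) (hv : v 0 = 1) :
    vdet u * DeltaPol q x a b = Matrix.det (Matrix.of fun j (μ : Fin (m + 1)) =>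
      (Fin.cons (∑ r ∈ Finset.range (m + 1), u j ^ (m - r) * v r)
        (fun μ => ∑ r ∈ Finset.range (m + 1), u j ^ (m - r) * APol q (r + 1) (x μ) a b) :
        Fin (m + 1) → ℂ) μ) := by
  have h := vdet_smul_mul_det u (Fin.cons (fun r : Fin (m + 1) => v r)
    (fun μ (r : Fin (m + 1)) => APol q ((r : ℕ) + 1) (x μ) a b))
  have h2 : DeltaPol q x a b = Matrix.det (Matrix.of fun μ r : Fin (m + 1) =>
      (Fin.cons (fun r : Fin (m + 1) => v r)
        (fun μ (r : Fin (m + 1)) => APol q ((r : ℕ) + 1) (x μ) a b) :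
        Fin (m + 1) → Fin (m + 1) → ℂ) μ r) := by
    rw [Matrix.det_succ_column_zero, Fin.sum_univ_succ, Finset.sum_eq_zero, DeltaPol]
    · simp only [Matrix.of_apply, Fin.cons_zero, Fin.val_zero, hv, pow_zero, mul_one, one_mul,
        add_zero]
      congr 1
      ext μ r
      simp only [Matrix.submatrix_apply, Matrix.of_apply, Fin.zero_succAbove, Fin.cons_succ,
        Fin.val_succ]
      congr 1
      omega
    · intro μ _
      simp only [Matrix.of_apply, Fin.cons_succ, Fin.val_zero, zero_add, APol_one_of_eq, mul_zero,
        zero_mul]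
  rw [h2, h]
  congr 1
  ext j μ
  rw [Matrix.of_apply, Matrix.of_apply]
  cases μ using Fin.cases with
  | zero =>
    simp only [Fin.cons_zero, Nat.add_sub_cancel]
    rw [Fin.sum_univ_eq_sum_range (fun r => u j ^ (m - r) * v r)]
  | succ μ =>
    simp only [Fin.cons_succ, Nat.add_sub_cancel]
    rw [Fin.sum_univ_eq_sum_range (fun r => u j ^ (m - r) * APol q (r + 1) (x μ) a b)]

/-- Columns altered by multiples of a fixed vector. -/
lemma det_add_mul_col {k : ℕ} (G : Matrix (Fin k) (Fin k) ℂ) (v d : Fin k → ℂ) :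
    Matrix.det (Matrix.of fun j c => G j c + v j * d c) =
      G.det + ∑ c, d c * (G.updateCol c v).det := by
  have key : ∀ s : Finset (Fin k),
      Matrix.det (Matrix.of fun j c => G j c + if c ∈ s then v j * d c else 0) =
        G.det + ∑ c ∈ s, d c * (G.updateCol c v).det := by
    intro s
    induction s using Finset.induction_on with
    | empty => simp; rfl
    | insert i s hi ih =>
      rw [Finset.sum_insert hi, add_left_comm, ← ih]
      set A : Matrix (Fin k) (Fin k) ℂ :=
        Matrix.of fun j c => G j c + if c ∈ s then v j * d c else 0 with hA
      have h1 : (Matrix.of fun j c => G j c + if c ∈ insert i s then v j * d c else 0) =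
          A.updateCol i ((fun j => A j i) + d i • v) := by
        ext j c
        by_cases hc : c = i
        · subst hc; simp [hA, hi, mul_comm]
        · simp [hA, hc]
      have h2 : A.updateCol i v = (Matrix.of fun j c => (G.updateCol i v) j c +
          v j * if c ∈ s then d c else 0) := by
        ext j c
        by_cases hc : c = i
        · subst hc; simp [hi]
        · simp [hA, hc]
      -- Once column `i` equals `v`, the multiples of `v` in the other columns are removed by column
      -- operations.
      have h3 : (A.updateCol i v).det = (G.updateCol i v).det := by
        rw [h2]
        rw [← Matrix.det_transpose, ← Matrix.det_transpose (G.updateCol i v)]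
        refine Matrix.det_eq_of_forall_row_eq_smul_add_const (fun c => if c ∈ s then d c else 0) i
          (by simp [hi]) fun c j => ?_
        simp [mul_comm]
      rw [h1, Matrix.det_updateCol_add, Matrix.det_updateCol_smul, h3, Matrix.updateCol_eq_self]
      ring
  simpa using key Finset.univ

/-- Partial fractions in `a` of a divided difference of `∏ 1 / (x_c - a t)`. -/
lemma exists_partialFractions {n : ℕ} (x : Fin n → ℂ) (t z : ℂ) (s : Finset (Fin n))
    (hx : ∀ c ∈ s, ∀ c' ∈ s, c ≠ c' → x c ≠ x c') (hz : ∀ c ∈ s, x c ≠ z * t) :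
    ∃ g : Fin n → ℂ, ∀ a : ℂ, a ≠ z → (∀ c ∈ s, x c ≠ a * t) →
      (∏ c ∈ s, (x c - a * t)⁻¹ - ∏ c ∈ s, (x c - z * t)⁻¹) / (a - z) =
        ∑ c ∈ s, g c * (x c - a * t)⁻¹ := by
  classical
  induction s using Finset.induction_on with
  | empty => exact ⟨0, fun a _ _ => by simp⟩
  | insert i s hi ih =>
    obtain ⟨g, hg⟩ := ih (fun c hc c' hc' => hx c (Finset.mem_insert_of_mem hc) c'
      (Finset.mem_insert_of_mem hc')) fun c hc => hz c (Finset.mem_insert_of_mem hc)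
    refine ⟨Function.update (fun c => g c / (x i - x c)) i
      (t * (x i - z * t)⁻¹ * ∏ c ∈ s, (x c - z * t)⁻¹ - ∑ c ∈ s, g c / (x i - x c)),
      fun a ha hxa => ?_⟩
    have hi1 : x i - a * t ≠ 0 := sub_ne_zero.mpr (hxa i (Finset.mem_insert_self _ _))
    have hi2 : x i - z * t ≠ 0 := sub_ne_zero.mpr (hz i (Finset.mem_insert_self _ _))
    have haz : a - z ≠ 0 := sub_ne_zero.mpr ha
    have h := hg a ha fun c hc => hxa c (Finset.mem_insert_of_mem hc)
    have e1 : ∑ c ∈ s, Function.update (fun c => g c / (x i - x c)) i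
        (t * (x i - z * t)⁻¹ * ∏ c ∈ s, (x c - z * t)⁻¹ - ∑ c ∈ s, g c / (x i - x c)) c *
          (x c - a * t)⁻¹ = ∑ c ∈ s, g c / (x i - x c) * (x c - a * t)⁻¹ :=
      Finset.sum_congr rfl fun c hc => by
        rw [Function.update_of_ne (fun e : c = i => hi (e ▸ hc))]
    have e2 : ∑ c ∈ s, g c / (x i - x c) * (x c - a * t)⁻¹ -
        (∑ c ∈ s, g c / (x i - x c)) * (x i - a * t)⁻¹ =
        (x i - a * t)⁻¹ * ∑ c ∈ s, g c * (x c - a * t)⁻¹ := by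
      rw [Finset.sum_mul, ← Finset.sum_sub_distrib, Finset.mul_sum]
      refine Finset.sum_congr rfl fun c hc => ?_
      have h1 : x i - x c ≠ 0 := sub_ne_zero.mpr (hx i (Finset.mem_insert_self _ _) c
        (Finset.mem_insert_of_mem hc) fun e : i = c => hi (e ▸ hc))
      have h2 : x c - a * t ≠ 0 := sub_ne_zero.mpr (hxa c (Finset.mem_insert_of_mem hc))
      field_simp
      ring
    rw [Finset.sum_insert hi, Function.update_self, e1, Finset.prod_insert hi,
      Finset.prod_insert hi, sub_mul, add_comm, ← add_sub_assoc, add_sub_right_comm, e2, ← h]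
    have hAZ : (x i - a * t)⁻¹ - (x i - z * t)⁻¹ =
        (a - z) * t * (x i - a * t)⁻¹ * (x i - z * t)⁻¹ := by
      rw [inv_sub_inv hi1 hi2, div_eq_mul_inv, mul_inv]; ring
    rw [div_eq_iff haz]
    generalize ∏ c ∈ s, (x c - a * t)⁻¹ = Pa
    generalize ∏ c ∈ s, (x c - z * t)⁻¹ = Pz
    have hq : (Pa - Pz) / (a - z) * (a - z) = Pa - Pz := div_mul_cancel₀ _ haz
    linear_combination Pz * hAZ - (x i - a * t)⁻¹ * hq

/-- A sum of minors in which each row's parameter may be replaced by a common one. -/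
theorem sum_div_mul_det_twist {n : ℕ} (a : Fin (n + 1) → ℂ) (z t : ℂ) (D : Fin (n + 1) → Fin n → ℂ)
    (y x : Fin n → ℂ) (hxx : ∀ c c', y c ≠ 0 → y c' ≠ 0 → c ≠ c' → x c ≠ x c')
    (hz : ∀ c, y c ≠ 0 → x c ≠ z * t) (ha : ∀ c, y c ≠ 0 → ∀ j, x c ≠ a j * t)
    (haz : ∀ j, a j ≠ z) :
    ∑ i : Fin (n + 1), (-1) ^ (i : ℕ) / (a i - z) * Matrix.det (Matrix.of fun r c => D (i.succAbove r) c -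
        y c * (x c - a i * t)⁻¹ * (x c - a (i.succAbove r) * t)⁻¹) =
    ∑ i : Fin (n + 1), (-1) ^ (i : ℕ) / (a i - z) * Matrix.det (Matrix.of fun r c => D (i.succAbove r) c -
        y c * (x c - z * t)⁻¹ * (x c - a (i.succAbove r) * t)⁻¹) := by
  classical
  -- The columns are expanded by multilinearity. The parameter `w` then occurs in a scalar factor
  -- only, not in the remaining determinants.
  have exp : ∀ (i : Fin (n + 1)) (w : ℂ), Matrix.det (Matrix.of fun r c => D (i.succAbove r) c -
        y c * (x c - w * t)⁻¹ * (x c - a (i.succAbove r) * t)⁻¹) =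
      ∑ s : Finset (Fin n), (∏ c ∈ s, -y c * (x c - w * t)⁻¹) *
        Matrix.det (Matrix.of fun r c => if c ∈ s then (x c - a (i.succAbove r) * t)⁻¹
          else D (i.succAbove r) c) := by
    intro i w
    have h := (Matrix.detRowAlternating (R := ℂ) (n := Fin n)).map_add_univ
      (fun c => (-y c * (x c - w * t)⁻¹) • fun r => (x c - a (i.succAbove r) * t)⁻¹)
      (fun c r => D (i.succAbove r) c)
    rw [← Matrix.det_transpose]
    refine Eq.trans ?_ (h.trans (Finset.sum_congr rfl fun s _ => ?_))
    · congr 1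
      ext c r
      simp only [Matrix.transpose_apply, Matrix.of_apply, Pi.add_apply, Pi.smul_apply, smul_eq_mul]
      ring
    · have h2 := (Matrix.detRowAlternating (R := ℂ) (n := Fin n)).map_piecewise_smul
        (fun c => -y c * (x c - w * t)⁻¹)
        (s.piecewise (fun c r => (x c - a (i.succAbove r) * t)⁻¹) fun c r => D (i.succAbove r) c) s
      have e : s.piecewise (fun c => (-y c * (x c - w * t)⁻¹) •
          s.piecewise (fun c r => (x c - a (i.succAbove r) * t)⁻¹)
            (fun c r => D (i.succAbove r) c) c)
          (s.piecewise (fun c r => (x c - a (i.succAbove r) * t)⁻¹)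
            fun c r => D (i.succAbove r) c) =
          s.piecewise (fun c => (-y c * (x c - w * t)⁻¹) •
            fun r => (x c - a (i.succAbove r) * t)⁻¹) fun c r => D (i.succAbove r) c := by
        ext c r
        by_cases hc : c ∈ s <;> simp [hc]
      rw [e] at h2
      refine h2.trans ?_
      rw [smul_eq_mul, ← Matrix.det_transpose (Matrix.of _)]
      congr 1
      refine congrArg Matrix.det ?_
      ext c r
      by_cases hc : c ∈ s <;> simp [hc]
  simp only [exp, Finset.mul_sum]
  rw [Finset.sum_comm, Finset.sum_comm (s := Finset.univ (α := Fin (n + 1)))]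
  refine Finset.sum_congr rfl fun s _ => ?_
  by_cases hy : ∃ c ∈ s, y c = 0
  · obtain ⟨c, hc, h0⟩ := hy
    have : ∀ w : ℂ, ∏ c ∈ s, -y c * (x c - w * t)⁻¹ = 0 := fun w =>
      Finset.prod_eq_zero hc (by rw [h0]; simp)
    simp only [this, zero_mul, mul_zero]
  push Not at hy
  obtain ⟨g, hg⟩ := exists_partialFractions x t z s
    (fun c hc c' hc' => hxx c c' (hy c hc) (hy c' hc')) fun c hc => hz c (hy c hc)
  set K : Fin (n + 1) → Fin n → ℂ := fun j c => if c ∈ s then (x c - a j * t)⁻¹ else D j c with hK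
  -- The first column is a combination of the columns in `s`. Laplace expansion along it, with
  -- partial fractions for its entries, is the difference of the two sums belonging to `s`.
  have hdet : Matrix.det (Matrix.of fun j => (Fin.cons (∑ c ∈ s, g c * (x c - a j * t)⁻¹) (K j) :
      Fin (n + 1) → ℂ)) = 0 := by
    refine Matrix.exists_mulVec_eq_zero_iff.mp
      ⟨Fin.cons 1 fun c => if c ∈ s then -g c else 0, fun h => ?_, ?_⟩
    · simpa using congrFun h 0
    · ext j
      simp only [Matrix.mulVec, dotProduct, Matrix.of_apply, Fin.sum_univ_succ, Fin.cons_zero,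
        Fin.cons_succ, mul_one, Pi.zero_apply, mul_ite, mul_zero, Finset.sum_ite_mem,
        Finset.univ_inter, hK]
      rw [← Finset.sum_add_distrib]
      exact Finset.sum_eq_zero fun c hc => by rw [if_pos hc]; ring
  rw [Matrix.det_succ_column_zero] at hdet
  rw [← sub_eq_zero, ← Finset.sum_sub_distrib, ← mul_zero (∏ c ∈ s, -y c), ← hdet, Finset.mul_sum]
  refine Finset.sum_congr rfl fun i _ => ?_
  have e : (Matrix.of fun j => (Fin.cons (∑ c ∈ s, g c * (x c - a j * t)⁻¹) (K j) :
      Fin (n + 1) → ℂ)).submatrix i.succAbove Fin.succ =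
      Matrix.of fun r c => K (i.succAbove r) c := by
    ext r c; simp
  rw [e, Matrix.of_apply, Fin.cons_zero, ← hg (a i) (haz i) fun c hc => ha c (hy c hc) i,
    Finset.prod_mul_distrib, Finset.prod_mul_distrib]
  ring

end QKZ

/-! ### Node values of the large and the small polynomials -/

namespace QKZ
open Matrix

/-- The multiples of the vector `a` are split off with `det_add_mul_col`. In the other term the row
factors `a_j - z` are extracted and the determinant is expanded along its last column. The minors
carry the parameter `z`, which `sum_div_mul_det_twist` exchanges for `a_i`. Columns with `y c = 0`
are exempt from the assumptions on `x c`, which leaves room for a border column. -/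
lemma det_snoc_twist {n : ℕ} (a e : Fin (n + 1) → ℂ) (z t : ℂ) (D : Fin (n + 1) → Fin n → ℂ)
    (y x d : Fin n → ℂ) (hxx : ∀ c c', y c ≠ 0 → y c' ≠ 0 → c ≠ c' → x c ≠ x c')
    (hz : ∀ c, y c ≠ 0 → x c ≠ z * t) (ha : ∀ c, y c ≠ 0 → ∀ j, x c ≠ a j * t)
    (haz : ∀ j, a j ≠ z) (he : ∀ j, e j ≠ 0) (H : Fin (n + 1) → ℂ → Fin n → ℂ)
    (hH : ∀ j s c, H j s c = D j c - e j * (y c * (x c - s * t)⁻¹ * (x c - a j * t)⁻¹)) :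
    Matrix.det (Matrix.of fun j => (Fin.snoc (fun c => (a j - z) * H j z c + a j * d c) (e j) :
        Fin (n + 1) → ℂ)) =
      (-1) ^ n * (∏ j, (a j - z)) * (∑ i : Fin (n + 1), (-1) ^ (i : ℕ) / (a i - z) * e i *
        Matrix.det (Matrix.of fun r c => H (i.succAbove r) (a i) c)) +
      ∑ c, d c * ((Matrix.of fun j => (Fin.snoc (fun c => (a j - z) * H j z c) (e j) :
        Fin (n + 1) → ℂ)).updateCol (Fin.castSucc c) a).det := by
  have h1 := det_add_mul_col (Matrix.of fun j => (Fin.snoc (fun c => (a j - z) * H j z c) (e j) :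
        Fin (n + 1) → ℂ)) a (Fin.snoc d 0)
  rw [Fin.sum_univ_castSucc] at h1
  simp only [Fin.snoc_castSucc, Fin.snoc_last, zero_mul, add_zero] at h1
  have h2 : (Matrix.of fun j c => (Matrix.of fun j => (Fin.snoc (fun c => (a j - z) * H j z c)
        (e j) : Fin (n + 1) → ℂ)) j c + a j * (Fin.snoc d 0 : Fin (n + 1) → ℂ) c) =
      Matrix.of fun j => (Fin.snoc (fun c => (a j - z) * H j z c + a j * d c) (e j) :
        Fin (n + 1) → ℂ) := by
    ext j c
    cases c using Fin.lastCases <;> simp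
  rw [← h2, h1]
  congr 1
  have h3 : (Matrix.of fun j => (Fin.snoc (fun c => (a j - z) * H j z c) (e j) :
      Fin (n + 1) → ℂ)) = Matrix.of fun j c => (a j - z) *
        (Matrix.of fun j => (Fin.snoc (fun c => H j z c) (e j / (a j - z)) :
          Fin (n + 1) → ℂ)) j c := by
    ext j c
    cases c using Fin.lastCases with
    | last => simp [mul_div_cancel₀ _ (sub_ne_zero.mpr (haz j))]
    | cast c => simp
  rw [h3, Matrix.det_mul_column, Matrix.det_succ_column _ (Fin.last n), mul_comm ((-1) ^ n),
    mul_assoc]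
  congr 1
  have h4 : ∀ (i : Fin (n + 1)) (w : ℂ),
      e i * Matrix.det (Matrix.of fun r c => H (i.succAbove r) w c) =
      (∏ j, e j) * Matrix.det (Matrix.of fun r c => D (i.succAbove r) c / e (i.succAbove r) -
        y c * (x c - w * t)⁻¹ * (x c - a (i.succAbove r) * t)⁻¹) := fun i w => by
    rw [Fin.prod_univ_succAbove e i, mul_assoc, ← Matrix.det_mul_column]
    congr 3
    ext r c
    rw [Matrix.of_apply, hH, mul_sub, mul_div_cancel₀ _ (he _)]
  have h5 := sum_div_mul_det_twist a z t (fun j c => D j c / e j) y x hxx hz ha haz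
  have h6 : ∀ i : Fin (n + 1), (-1) ^ n * ((-1) ^ (i : ℕ) / (a i - z) * e i *
        Matrix.det (Matrix.of fun r c => H (i.succAbove r) (a i) c)) =
      (-1) ^ n * (∏ j, e j) * ((-1) ^ (i : ℕ) / (a i - z) * Matrix.det (Matrix.of fun r c =>
        D (i.succAbove r) c / e (i.succAbove r) -
        y c * (x c - a i * t)⁻¹ * (x c - a (i.succAbove r) * t)⁻¹)) := fun i => by
    rw [mul_assoc _ (e i), h4]; ring
  rw [Finset.mul_sum, Finset.sum_congr rfl fun i _ => h6 i, ← Finset.mul_sum, h5, Finset.mul_sum]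
  refine Finset.sum_congr rfl fun i _ => ?_
  have h7 : (Matrix.of fun j => (Fin.snoc (fun c => H j z c) (e j / (a j - z)) :
      Fin (n + 1) → ℂ)).submatrix i.succAbove (Fin.last n).succAbove =
      Matrix.of fun r c => H (i.succAbove r) z c := by
    ext r c; simp
  rw [h7, Matrix.of_apply, Fin.snoc_last, Fin.val_last, pow_add]
  linear_combination (-1) ^ (i : ℕ) * (-1) ^ n / (a i - z) * h4 i z

/-- Points off which the functions below are regular. -/
def goodPts (q : ℂ) {k : ℕ} (a : Fin k → ℂ) (z : ℂ) : Set ℂ :=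
  {x | x ≠ 0 ∧ x ≠ z * q⁻¹ ∧ ∀ j, x ≠ a j * q⁻¹ ∧ x ≠ a j * q⁻¹ ^ 3 ∧ x ≠ a j * q}

/-- A function whose integrals against the kernel vanish. -/
def exactFn (q : ℂ) {k l : ℕ} (a : Fin k → ℂ) (b : Fin l → ℂ) (x : ℂ) : ℂ :=
  1 / x * ((∏ i, (x - a i * q⁻¹)) * (∏ i, (x - b i * q⁻¹)) -
    q⁻¹ ^ (2 * (k + l)) * ((∏ i, (x - a i * q)) * ∏ i, (x - b i * q)))

/-- The product `∏ (u - b_i τ)` at the node `u = y τ³`. -/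
def betaVal (q : ℂ) {l : ℕ} (b : Fin l → ℂ) (y : ℂ) : ℂ := ∏ i, (y * q⁻¹ ^ 3 - b i * q⁻¹)

def colBase (q : ℂ) {k l : ℕ} (a : Fin k → ℂ) (b : Fin l → ℂ) (j : Fin k) (x : ℂ) : ℂ :=
  (∏ i, (x - a i * q⁻¹)) * (∏ i, (x - b i * q⁻¹)) * (1 / (x - a j * q⁻¹ ^ 3)) -
    q⁻¹ ^ (2 * (k + l)) * ((∏ i, (x - a i * q)) * ∏ i, (x - b i * q)) * (1 / (x - a j * q)) +
    (∏ i, (x - a i * q⁻¹)) * betaVal q b (a j) * (1 / (x - a j * q⁻¹) - 1 / (x - a j * q⁻¹ ^ 3)) -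
    exactFn q a b x

/-- The parameter `s` enters the last term only. It is `a_i` in the small determinants and `z` in
the large one. -/
def colFn (q : ℂ) {k l : ℕ} (a : Fin k → ℂ) (b : Fin l → ℂ) (j : Fin k) (s x : ℂ) : ℂ :=
  colBase q a b j x - a j * betaVal q b (a j) * (q⁻¹ * (1 - q⁻¹ ^ 2) * (∏ i, (x - a i * q⁻¹)) *
    (x - s * q⁻¹)⁻¹ * (x - a j * q⁻¹)⁻¹)

/-- Moving `a_i` to the second group merely regroups the products at `x`. In the term evaluated at
the node, however, `x - a_i τ` is replaced by `a_j τ³ - a_i τ`, and the difference is the twist with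
parameter `a_i`. -/
lemma sum_APol_small {q : ℂ} (hq : q ≠ 0) {n l : ℕ} (h : n ≤ l + 1) (a : Fin (n + 1) → ℂ)
    (b : Fin l → ℂ) (z : ℂ) (ha : ∀ j, a j ≠ 0) (i : Fin (n + 1)) (r : Fin n) {x : ℂ}
    (hx : x ∈ goodPts q a z) :
    a (i.succAbove r) * q⁻¹ ^ 3 * ∑ k ∈ Finset.range n, (a (i.succAbove r) * q⁻¹ ^ 3) ^ (n - 1 - k) *
        APol q (k + 1) x (a ∘ i.succAbove) (Fin.cons (a i) b : Fin (l + 1) → ℂ) =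
      colFn q a b (i.succAbove r) (a i) x := by
  obtain ⟨hx0, hxz, hxa⟩ := hx
  have h0 := mul_sum_pow_mul_APol q hq h r (a ∘ i.succAbove) (Fin.cons (a i) b : Fin (l + 1) → ℂ)
    (ha _) hx0 (hxa _).1 (hxa _).2.1 (hxa _).2.2
  simp only [Function.comp_apply] at h0
  have hc : ∀ f : ℂ → ℂ, ∏ k, f ((Fin.cons (a i) b : Fin (l + 1) → ℂ) k) =
      f (a i) * ∏ k, f (b k) := fun f => by rw [Fin.prod_univ_succ]; simp
  rw [h0, hc fun y => x - y * q⁻¹, hc fun y => x - y * q,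
    hc fun y => a (i.succAbove r) * q⁻¹ ^ 3 - y * q⁻¹]
  simp only [colFn, colBase, exactFn, betaVal]
  rw [Fin.prod_univ_succAbove (fun j => x - a j * q⁻¹) i, Fin.prod_univ_succAbove _ i,
    show n + (l + 1) = n + 1 + l by ring]
  have d1 : x - a (i.succAbove r) * q⁻¹ ≠ 0 := sub_ne_zero.mpr (hxa _).1
  have d2 : x - a (i.succAbove r) * q⁻¹ ^ 3 ≠ 0 := sub_ne_zero.mpr (hxa _).2.1
  have d3 : x - a i * q⁻¹ ≠ 0 := sub_ne_zero.mpr (hxa _).1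
  generalize a (i.succAbove r) = u at *
  generalize ∏ j, (x - a (i.succAbove j) * q⁻¹) = P1
  generalize ∏ j, (x - a (i.succAbove j) * q) = P2
  generalize ∏ j, (x - b j * q⁻¹) = P3
  generalize ∏ j, (x - b j * q) = P4
  generalize ∏ j, (u * q⁻¹ ^ 3 - b j * q⁻¹) = P5
  generalize q⁻¹ ^ (2 * (n + 1 + l)) = T
  have e : P1 * ((u * q⁻¹ ^ 3 - a i * q⁻¹) * P5) * (1 / (x - u * q⁻¹) - 1 / (x - u * q⁻¹ ^ 3)) =
      (x - a i * q⁻¹) * P1 * P5 * (1 / (x - u * q⁻¹) - 1 / (x - u * q⁻¹ ^ 3)) -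
      u * P5 * (q⁻¹ * (1 - q⁻¹ ^ 2) * ((x - a i * q⁻¹) * P1) * (x - a i * q⁻¹)⁻¹ *
        (x - u * q⁻¹)⁻¹) := by
    have w1 := mul_inv_cancel₀ d1
    have w2 := mul_inv_cancel₀ d2
    have w3 := mul_inv_cancel₀ d3
    rw [one_div, one_div]
    linear_combination P1 * P5 * (w2 - w1) +
      u * P5 * q⁻¹ * (1 - q⁻¹ ^ 2) * P1 * (x - u * q⁻¹)⁻¹ * w3
  rw [e]
  ring

/-- The pair `z`, `z τ²` contributes `(x - z τ)(x - z τ³)` to one product over the second group and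
`(x - z q)(x - z τ)` to the other, whence the common factor `x - z τ`. Reducing the second linear
factor against the simple fractions gives `a_j - z` and an exact term. In the term at the node, `a_j
τ³ - z τ` in place of `x - z τ` produces the twist with parameter `z`. -/
lemma sum_APol_big {q : ℂ} (hq : q ≠ 0) {n l : ℕ} (h : n ≤ l + 1) (a : Fin (n + 1) → ℂ)
    (b : Fin l → ℂ) (z : ℂ) (ha : ∀ j, a j ≠ 0) (B : Fin (l + 1 + 1) → ℂ)
    (hB : ∀ f : ℂ → ℂ, ∏ i, f (B i) = (∏ i, f (b i)) * (f z * f (z * q⁻¹ ^ 2)))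
    (j : Fin (n + 1)) {x : ℂ} (hx : x ∈ goodPts q a z) :
    a j * q⁻¹ ^ 3 * ∑ k ∈ Finset.range (n + 1), (a j * q⁻¹ ^ 3) ^ (n - k) * APol q (k + 1) x a B =
      (x - z * q⁻¹) * q⁻¹ ^ 3 * ((a j - z) * colFn q a b j z x + a j * exactFn q a b x) := by
  obtain ⟨hx0, hxz, hxa⟩ := hx
  have h0 := mul_sum_pow_mul_APol q hq (by omega : n + 1 ≤ l + 1 + 1) j a B
    (ha _) hx0 (hxa _).1 (hxa _).2.1 (hxa _).2.2
  simp only [Nat.add_sub_cancel] at h0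
  rw [h0, hB fun y => x - y * q⁻¹, hB fun y => x - y * q, hB fun y => a j * q⁻¹ ^ 3 - y * q⁻¹]
  simp only [colFn, colBase, exactFn, betaVal]
  have d1 : x - a j * q⁻¹ ≠ 0 := sub_ne_zero.mpr (hxa _).1
  have d2 : x - a j * q⁻¹ ^ 3 ≠ 0 := sub_ne_zero.mpr (hxa _).2.1
  have d3 : x - a j * q ≠ 0 := sub_ne_zero.mpr (hxa _).2.2
  have d4 : x - z * q⁻¹ ≠ 0 := sub_ne_zero.mpr hxz
  have hT : q⁻¹ ^ (2 * (n + 1 + (l + 1 + 1))) = q⁻¹ ^ (2 * (n + 1 + l)) * q⁻¹ ^ 4 := by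
    rw [← pow_add]; congr 1
  rw [hT]
  generalize a j = u at *
  generalize ∏ j, (x - a j * q⁻¹) = P1
  generalize ∏ j, (x - a j * q) = P2
  generalize ∏ j, (x - b j * q⁻¹) = P3
  generalize ∏ j, (x - b j * q) = P4
  generalize ∏ j, (u * q⁻¹ ^ 3 - b j * q⁻¹) = P5
  generalize q⁻¹ ^ (2 * (n + 1 + l)) = T
  have hqq : q = (q⁻¹)⁻¹ := (inv_inv q).symm
  have ht : q⁻¹ ≠ 0 := inv_ne_zero hq
  generalize q⁻¹ = t at *
  subst hqq
  have e1 : P1 * (P5 * ((u * t ^ 3 - z * t) * (u * t ^ 3 - z * t ^ 2 * t))) *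
        (1 / (x - u * t) - 1 / (x - u * t ^ 3)) =
      (x - z * t) * t ^ 3 * (u - z) * (P1 * P5 * (1 / (x - u * t) - 1 / (x - u * t ^ 3)) -
        u * P5 * (t * (1 - t ^ 2) * P1 * (x - z * t)⁻¹ * (x - u * t)⁻¹)) := by
    have w1 := mul_inv_cancel₀ d1
    have w2 := mul_inv_cancel₀ d2
    have w3 := mul_inv_cancel₀ d4
    rw [one_div, one_div]
    linear_combination t ^ 3 * (u - z) * P1 * P5 * (w2 - w1) +
      t ^ 3 * (u - z) * u * P5 * t * (1 - t ^ 2) * P1 * (x - u * t)⁻¹ * w3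
  have e2 : P1 * (P3 * ((x - z * t) * (x - z * t ^ 2 * t))) * (1 / (x - u * t ^ 3) - 1 / x) =
      (x - z * t) * t ^ 3 * ((u - z) * (P1 * P3 * (1 / (x - u * t ^ 3)) - 1 / x * (P1 * P3)) +
        u * (1 / x * (P1 * P3))) := by
    have w2 := mul_inv_cancel₀ d2
    have w0 := mul_inv_cancel₀ hx0
    rw [one_div, one_div]
    linear_combination P1 * P3 * (x - z * t) * (w2 - w0)
  have e3 : T * t ^ 4 * P2 * (P4 * ((x - z * t⁻¹) * (x - z * t ^ 2 * t⁻¹))) *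
        (1 / (x - u * t⁻¹) - 1 / x) =
      (x - z * t) * t ^ 3 * ((u - z) * (T * (P2 * P4) * (1 / (x - u * t⁻¹)) - 1 / x *
        (T * (P2 * P4))) + u * (1 / x * (T * (P2 * P4)))) := by
    have w3 := mul_inv_cancel₀ d3
    have w0 := mul_inv_cancel₀ hx0
    have hr := mul_inv_cancel₀ ht
    rw [one_div, one_div]
    linear_combination T * P2 * P4 * t ^ 3 * ((x - z * t) * t * (w3 - w0)) +
      T * P2 * P4 * t ^ 3 * ((x - z * t) * u * (x - u * t⁻¹)⁻¹ + ((x - u * t⁻¹)⁻¹ - x⁻¹) *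
        (-z * (x - z * t) - (t * x - z) * z * t + z * z * t * (t * t⁻¹ - 1))) * hr
  rw [e1, e2, e3]
  ring

/-- At `x = z τ` both products over the second group vanish, and only the term evaluated at the node
survives. It supplies the special column of the large determinant. -/
lemma sum_APol_pole {q : ℂ} (hq : q ≠ 0) {n l : ℕ} (h : n ≤ l + 1) (a : Fin (n + 1) → ℂ)
    (b : Fin l → ℂ) {z : ℂ} (ha : ∀ j, a j ≠ 0) (B : Fin (l + 1 + 1) → ℂ)
    (hB : ∀ f : ℂ → ℂ, ∏ i, f (B i) = (∏ i, f (b i)) * (f z * f (z * q⁻¹ ^ 2)))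
    (hz : z ≠ 0) (haz : ∀ j, a j ≠ z) (haz2 : ∀ j, a j * q⁻¹ ^ 2 ≠ z)
    (haz3 : ∀ j, a j ≠ z * q⁻¹ ^ 2) (j : Fin (n + 1)) :
    a j * q⁻¹ ^ 3 * ∑ k ∈ Finset.range (n + 1), (a j * q⁻¹ ^ 3) ^ (n - k) *
        APol q (k + 1) (z * q⁻¹) a B =
      q⁻¹ ^ 3 * (1 - q⁻¹ ^ 2) * (∏ i, (z * q⁻¹ - a i * q⁻¹)) * (a j * betaVal q b (a j)) := by
  have ht : q⁻¹ ≠ 0 := inv_ne_zero hq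
  have h1 : z * q⁻¹ ≠ a j * q⁻¹ := fun e => haz j (mul_right_cancel₀ ht e).symm
  have h3 : z * q⁻¹ ≠ a j * q⁻¹ ^ 3 := fun e => haz2 j (mul_right_cancel₀ ht (by rw [e]; ring))
  have h0 : z * q⁻¹ ≠ a j * q := fun e => haz3 j (mul_right_cancel₀ hq (by
    rw [← e]; field_simp))
  have h0 := mul_sum_pow_mul_APol q hq (by omega : n + 1 ≤ l + 1 + 1) j a B
    (ha _) (mul_ne_zero hz ht) h1 h3 h0
  simp only [Nat.add_sub_cancel] at h0
  rw [h0, hB fun y => z * q⁻¹ - y * q⁻¹, hB fun y => z * q⁻¹ - y * q,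
    hB fun y => a j * q⁻¹ ^ 3 - y * q⁻¹, show z * q⁻¹ - z * q⁻¹ ^ 2 * q = 0 by field_simp; ring,
    sub_self (z * q⁻¹), betaVal]
  have d1 := sub_ne_zero.mpr h1
  have d3 := sub_ne_zero.mpr h3
  generalize q⁻¹ = t at *
  generalize ∏ i, (z * t - a i * t) = P1
  generalize ∏ i, (a j * t ^ 3 - b i * t) = P2
  have w1 := mul_inv_cancel₀ d1
  have w2 := mul_inv_cancel₀ d3
  rw [one_div, one_div]
  linear_combination P1 * P2 * (-t ^ 2 * (a j * t ^ 3 - z * t) * w1 +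
    (a j * t ^ 3 - z * t ^ 3) * w2)

end QKZ

/-! ### Reduction of `Δ` modulo exact functions -/

namespace QKZ
open Matrix

lemma continuousOn_exactFn (q : ℂ) {k l : ℕ} (a : Fin k → ℂ) (b : Fin l → ℂ) :
    ContinuousOn (exactFn q a b) {0}ᶜ := by
  unfold exactFn
  refine ContinuousOn.mul (continuousOn_const.div continuousOn_id fun x hx => hx) ?_
  fun_prop

lemma continuousOn_colFn (q : ℂ) {k l : ℕ} (a : Fin k → ℂ) (b : Fin l → ℂ) (j : Fin k) (z : ℂ) :
    ContinuousOn (colFn q a b j z) (goodPts q a z) := by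
  have h0 : ContinuousOn (exactFn q a b) (goodPts q a z) :=
    (continuousOn_exactFn q a b).mono fun x hx => hx.1
  have h1 : ContinuousOn (fun x => (x - a j * q⁻¹)⁻¹) (goodPts q a z) :=
    (continuousOn_id.sub continuousOn_const).inv₀ fun x hx => sub_ne_zero.mpr (hx.2.2 j).1
  have h2 : ContinuousOn (fun x => (x - a j * q⁻¹ ^ 3)⁻¹) (goodPts q a z) :=
    (continuousOn_id.sub continuousOn_const).inv₀ fun x hx => sub_ne_zero.mpr (hx.2.2 j).2.1
  have h3 : ContinuousOn (fun x => (x - a j * q)⁻¹) (goodPts q a z) :=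
    (continuousOn_id.sub continuousOn_const).inv₀ fun x hx => sub_ne_zero.mpr (hx.2.2 j).2.2
  have h4 : ContinuousOn (fun x => (x - z * q⁻¹)⁻¹) (goodPts q a z) :=
    (continuousOn_id.sub continuousOn_const).inv₀ fun x hx => sub_ne_zero.mpr hx.2.1
  unfold colFn colBase
  simp only [one_div]
  fun_prop

lemma prod_const_mul_fin {k : ℕ} (c : ℂ) (f : Fin k → ℂ) : ∏ i, c * f i = c ^ k * ∏ i, f i := by
  simp [Finset.prod_mul_distrib]

lemma updateCol_of_congr {k : ℕ} {M M' : Fin k → Fin k → ℂ} (c : Fin k) (v : Fin k → ℂ)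
    (h : ∀ j c', c' ≠ c → M j c' = M' j c') :
    (Matrix.of M).updateCol c v = (Matrix.of M').updateCol c v := by
  ext j c'
  simp only [Matrix.updateCol_apply, Matrix.of_apply]
  split_ifs with hc
  · rfl
  · exact h j c' hc

lemma continuousOn_det_updateCol {X : Type*} [TopologicalSpace X] {k : ℕ} {s : Set X}
    {M : X → Fin k → Fin k → ℂ} (c : Fin k) (v : Fin k → ℂ)
    (h : ∀ j c', c' ≠ c → ContinuousOn (fun x => M x j c') s) :
    ContinuousOn (fun x => ((Matrix.of (M x)).updateCol c v).det) s := by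
  refine (Continuous.matrix_det continuous_id).comp_continuousOn
    (f := fun x => (Matrix.of (M x)).updateCol c v) ?_
  refine continuousOn_pi.mpr fun j => continuousOn_pi.mpr fun c' => ?_
  simp only [Matrix.updateCol_apply, Matrix.of_apply]
  split_ifs with hc
  · exact continuousOn_const
  · exact h j c' hc

/-- The Vandermonde factors are removed. The quotient of the full one by the one without the `i`-th
node yields the Lagrange denominator `∏ (a_i - a_r)`. The factor `S` accounts for a border column
and is `1` if there is none. -/
lemma DeltaPol_of_vdet {q : ℂ} (hq : q ≠ 0) {n : ℕ} {a : Fin (n + 1) → ℂ} (ha : ∀ j, a j ≠ 0)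
    (hinj : Function.Injective a) (z : ℂ) {Δ X S K R : ℂ} {Δs Dt e : Fin (n + 1) → ℂ} (hS : S ≠ 0)
    (h1 : vdet (fun j => a j * q⁻¹ ^ 3) * (∏ j, a j * q⁻¹ ^ 3) * Δ =
      X * (S * (q⁻¹ ^ (3 * n + 3) * (1 - q⁻¹ ^ 2) * ∏ i, (z * q⁻¹ - a i * q⁻¹))) *
        ((-1) ^ n * (∏ j, (a j - z)) * (∑ i : Fin (n + 1), (-1) ^ (i : ℕ) / (a i - z) *
          (a i * e i) * Dt i) + R))
    (h2 : ∀ i : Fin (n + 1), vdet (fun r => a (i.succAbove r) * q⁻¹ ^ 3) *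
      (∏ r, a (i.succAbove r) * q⁻¹ ^ 3) * Δs i = S * Dt i)
    (hK : K = S * (q⁻¹ ^ (3 * n + 3) * (1 - q⁻¹ ^ 2) * ∏ i, (z * q⁻¹ - a i * q⁻¹)) /
      (vdet (fun j => a j * q⁻¹ ^ 3) * ∏ j, a j * q⁻¹ ^ 3)) :
    Δ = X * ((q⁻¹ ^ 2 - 1) * q⁻¹ ^ (n + 1) * (∏ j, (a j - z)) ^ 2 *
      (∑ i, e i / ((a i - z) * ∏ r, (a i - a (i.succAbove r))) * Δs i) + K * R) := by
  have ht : q⁻¹ ≠ 0 := inv_ne_zero hq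
  have hu : Function.Injective fun j => a j * q⁻¹ ^ 3 := fun i j h =>
    hinj (mul_right_cancel₀ (pow_ne_zero 3 ht) h)
  have hV := vdet_ne_zero hu
  have hU : ∏ j, a j * q⁻¹ ^ 3 ≠ 0 :=
    Finset.prod_ne_zero_iff.mpr fun j _ => mul_ne_zero (ha j) (pow_ne_zero 3 ht)
  set V := vdet fun j => a j * q⁻¹ ^ 3
  set U := ∏ j, a j * q⁻¹ ^ 3
  have hA : ∏ i, (z * q⁻¹ - a i * q⁻¹) = (-1) ^ (n + 1) * q⁻¹ ^ (n + 1) * ∏ j, (a j - z) := by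
    rw [← mul_pow, ← prod_const_mul_fin]
    exact Finset.prod_congr rfl fun i _ => by ring
  have h3 : ∀ i : Fin (n + 1), S * ((-1) ^ (i : ℕ) * (a i * Dt i)) =
      V * U * (Δs i / (q⁻¹ ^ (3 * n + 3) * ∏ r, (a i - a (i.succAbove r)))) := fun i => by
    have hπ : ∏ r, (a i - a (i.succAbove r)) ≠ 0 := Finset.prod_ne_zero_iff.mpr fun r _ =>
      sub_ne_zero.mpr fun e => (Fin.succAbove_ne i r) (hinj e).symm
    have e1 := vdet_succAbove (fun j => a j * q⁻¹ ^ 3) i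
    have e2 : ∏ r, (a i * q⁻¹ ^ 3 - a (i.succAbove r) * q⁻¹ ^ 3) =
        q⁻¹ ^ (3 * n) * ∏ r, (a i - a (i.succAbove r)) := by
      rw [pow_mul, ← prod_const_mul_fin]
      exact Finset.prod_congr rfl fun i _ => by ring
    have e3 : U = a i * q⁻¹ ^ 3 * ∏ r, a (i.succAbove r) * q⁻¹ ^ 3 :=
      Fin.prod_univ_succAbove _ i
    rw [e2] at e1
    rw [show V = _ from e1.symm, e3, pow_add]
    have e4 := h2 i
    have e5 : (fun j => a j * q⁻¹ ^ 3) ∘ i.succAbove = fun r => a (i.succAbove r) * q⁻¹ ^ 3 := rfl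
    rw [e5]
    have e6 : q⁻¹ ^ (3 * n) * q⁻¹ ^ 3 * (∏ r, (a i - a (i.succAbove r))) *
        (Δs i / (q⁻¹ ^ (3 * n) * q⁻¹ ^ 3 * ∏ r, (a i - a (i.succAbove r)))) = Δs i :=
      mul_div_cancel₀ _ (mul_ne_zero (mul_ne_zero (pow_ne_zero _ ht) (pow_ne_zero _ ht)) hπ)
    linear_combination -((-1) ^ (i : ℕ) * a i) * e4 - (-1) ^ (i : ℕ) * a i *
      (vdet fun r => a (i.succAbove r) * q⁻¹ ^ 3) * (∏ r, a (i.succAbove r) * q⁻¹ ^ 3) * e6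
  have h4 : S * (∑ i : Fin (n + 1), (-1) ^ (i : ℕ) / (a i - z) * (a i * e i) * Dt i) =
      V * U / q⁻¹ ^ (3 * n + 3) *
        ∑ i, e i / ((a i - z) * ∏ r, (a i - a (i.succAbove r))) * Δs i := by
    rw [Finset.mul_sum, Finset.mul_sum]
    refine Finset.sum_congr rfl fun i _ => ?_
    have := h3 i
    calc _ = e i / (a i - z) * (S * ((-1) ^ (i : ℕ) * (a i * Dt i))) := by ring
      _ = _ := by
        rw [this, div_mul_eq_div_div, div_mul_eq_div_div]; ring
  have hVU : V * U ≠ 0 := mul_ne_zero hV hU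
  refine mul_left_cancel₀ hVU ?_
  have hKV : V * U * K = S * (q⁻¹ ^ (3 * n + 3) * (1 - q⁻¹ ^ 2) * ∏ i, (z * q⁻¹ - a i * q⁻¹)) := by
    rw [hK]; field_simp
  have hs : ((-1 : ℂ) ^ n) * (-1) ^ n = 1 := by rw [← mul_pow]; simp
  have hp : V * U / q⁻¹ ^ (3 * n + 3) * q⁻¹ ^ (3 * n + 3) = V * U :=
    div_mul_cancel₀ _ (pow_ne_zero _ ht)
  rw [h1, mul_add, mul_add, mul_add]
  generalize (∑ i : Fin (n + 1), (-1) ^ (i : ℕ) / (a i - z) * (a i * e i) * Dt i) = X1 at *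
  generalize (∑ i, e i / ((a i - z) * ∏ r, (a i - a (i.succAbove r))) * Δs i) = X2 at *
  congr 1
  · rw [hA]
    generalize ∏ j, (a j - z) = Z at *
    generalize V * U / q⁻¹ ^ (3 * n + 3) = Y at *
    generalize q⁻¹ ^ (3 * n + 3) = T at *
    rw [← hp]
    linear_combination X * T * (1 - q⁻¹ ^ 2) * q⁻¹ ^ (n + 1) * (-1) ^ (n + 1) * (-1) ^ n * Z ^ 2 * h4
      - X * Y * T * (1 - q⁻¹ ^ 2) * q⁻¹ ^ (n + 1) * Z ^ 2 * X2 * hs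
  · rw [← hKV]; ring

/-- Reduction of `Δ` at coinciding arguments, up to functions with vanishing integral. -/
theorem DeltaPol_snoc_eq {q : ℂ} (hq : q ≠ 0) {m n l : ℕ}
    (hm : (n < l + 1 ∧ m = n) ∨ (n = l + 1 ∧ m + 1 = n)) (a : Fin (n + 1) → ℂ) (b : Fin l → ℂ)
    {z : ℂ} (ha : ∀ j, a j ≠ 0) (hinj : Function.Injective a) (hz : z ≠ 0) (haz : ∀ j, a j ≠ z)
    (haz2 : ∀ j, a j * q⁻¹ ^ 2 ≠ z) (haz3 : ∀ j, a j ≠ z * q⁻¹ ^ 2)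
    (hab : ∀ j, betaVal q b (a j) ≠ 0) (B : Fin (l + 1 + 1) → ℂ)
    (hB : ∀ f : ℂ → ℂ, ∏ i, f (B i) = (∏ i, f (b i)) * (f z * f (z * q⁻¹ ^ 2))) :
    ∃ Rem : Fin m → (Fin m → ℂ) → ℂ,
      (∀ c x y, (∀ c', c' ≠ c → x c' = y c') → Rem c x = Rem c y) ∧
      (∀ c, ContinuousOn (Rem c) {x | ∀ μ, x μ ∈ goodPts q a z}) ∧
      ∀ x : Fin m → ℂ, (∀ μ, x μ ∈ goodPts q a z) → Function.Injective x →
        DeltaPol q (Fin.snoc x (z * q⁻¹) : Fin (m + 1) → ℂ) a B = (∏ μ, (x μ - z * q⁻¹)) *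
          ((q⁻¹ ^ 2 - 1) * q⁻¹ ^ (n + 1) * (∏ j, (a j - z)) ^ 2 *
            (∑ i, betaVal q b (a i) / ((a i - z) * ∏ r, (a i - a (i.succAbove r))) *
              DeltaPol q x (a ∘ i.succAbove) (Fin.cons (a i) b : Fin (l + 1) → ℂ)) +
            ∑ c, exactFn q a b (x c) * Rem c x) := by
  have ht : q⁻¹ ≠ 0 := inv_ne_zero hq
  have hcont : ∀ j μ, ContinuousOn (fun x : Fin m → ℂ => colFn q a b j z (x μ))
      {x | ∀ μ, x μ ∈ goodPts q a z} := fun j μ =>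
    (continuousOn_colFn q a b j z).comp (continuous_apply μ).continuousOn fun x hx => hx μ
  rcases hm with ⟨hm, rfl⟩ | ⟨hm, hm'⟩
  · set K : ℂ := 1 * (q⁻¹ ^ (3 * m + 3) * (1 - q⁻¹ ^ 2) * ∏ i, (z * q⁻¹ - a i * q⁻¹)) /
      (vdet (fun j => a j * q⁻¹ ^ 3) * ∏ j, a j * q⁻¹ ^ 3) with hK
    refine ⟨fun c x => K * ((Matrix.of fun j => (Fin.snoc (fun c => (a j - z) *
      colFn q a b j z (x c)) (a j * betaVal q b (a j)) : Fin (m + 1) → ℂ)).updateCol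
        (Fin.castSucc c) a).det, ?_, ?_, ?_⟩
    · intro c x y h
      simp only
      rw [updateCol_of_congr]
      intro j c' hc
      cases c' using Fin.lastCases with
      | last => simp only [Fin.snoc_last]
      | cast c' => simp only [Fin.snoc_castSucc]; rw [h c' fun e => hc (e ▸ rfl)]
    · intro c
      refine continuousOn_const.mul (continuousOn_det_updateCol _ _ fun j c' hc => ?_)
      cases c' using Fin.lastCases with
      | last => simp only [Fin.snoc_last]; exact continuousOn_const
      | cast c' => simp only [Fin.snoc_castSucc]; exact continuousOn_const.mul (hcont _ _)
    · intro x hx hxinj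
      have h2 : ∀ i : Fin (m + 1), vdet (fun r => a (i.succAbove r) * q⁻¹ ^ 3) *
          (∏ r, a (i.succAbove r) * q⁻¹ ^ 3) *
          DeltaPol q x (a ∘ i.succAbove) (Fin.cons (a i) b : Fin (l + 1) → ℂ) =
          1 * Matrix.det (Matrix.of fun r c => colFn q a b (i.succAbove r) (a i) (x c)) := by
        intro i
        rw [mul_right_comm, vdet_mul_DeltaPol, mul_comm, ← Matrix.det_mul_column, one_mul]
        congr 1
        ext r c
        simp only [Matrix.of_apply]
        exact sum_APol_small hq hm.le a b z ha i r (hx c)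
      have h1 : vdet (fun j => a j * q⁻¹ ^ 3) * (∏ j, a j * q⁻¹ ^ 3) *
          DeltaPol q (Fin.snoc x (z * q⁻¹) : Fin (m + 1) → ℂ) a B =
          (∏ μ, (x μ - z * q⁻¹)) * (1 * (q⁻¹ ^ (3 * m + 3) * (1 - q⁻¹ ^ 2) *
            ∏ i, (z * q⁻¹ - a i * q⁻¹))) *
          Matrix.det (Matrix.of fun j => (Fin.snoc (fun c => (a j - z) * colFn q a b j z (x c) +
            a j * exactFn q a b (x c)) (a j * betaVal q b (a j)) : Fin (m + 1) → ℂ)) := by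
        rw [mul_right_comm, vdet_mul_DeltaPol, mul_comm, ← Matrix.det_mul_column]
        have e1 : (∏ μ, (x μ - z * q⁻¹)) * (1 * (q⁻¹ ^ (3 * m + 3) * (1 - q⁻¹ ^ 2) *
            ∏ i, (z * q⁻¹ - a i * q⁻¹))) = ∏ μ : Fin (m + 1),
            (Fin.snoc (fun c => (x c - z * q⁻¹) * q⁻¹ ^ 3)
              (q⁻¹ ^ 3 * (1 - q⁻¹ ^ 2) * ∏ i, (z * q⁻¹ - a i * q⁻¹)) : Fin (m + 1) → ℂ) μ := by
          rw [Fin.prod_snoc]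
          simp only [Finset.prod_mul_distrib, Finset.prod_const,
            Finset.card_univ, Fintype.card_fin]
          rw [pow_add, pow_mul]
          ring
        rw [e1, ← Matrix.det_mul_row]
        congr 1
        ext j μ
        simp only [Matrix.of_apply, Nat.add_sub_cancel]
        cases μ using Fin.lastCases with
        | last =>
          simp only [Fin.snoc_last]
          exact sum_APol_pole hq hm.le a b ha B hB hz haz haz2 haz3 j
        | cast μ =>
          simp only [Fin.snoc_castSucc]
          exact sum_APol_big hq hm.le a b z ha B hB j (hx μ)
      rw [det_snoc_twist a (fun j => a j * betaVal q b (a j)) z q⁻¹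
        (fun j c => colBase q a b j (x c))
        (fun c => q⁻¹ * (1 - q⁻¹ ^ 2) * ∏ i, (x c - a i * q⁻¹)) x (fun c => exactFn q a b (x c))
        (fun c c' _ _ hc => fun e => hc (hxinj e)) (fun c _ => (hx c).2.1)
        (fun c _ j => ((hx c).2.2 j).1) haz (fun j => mul_ne_zero (ha j) (hab j))
        (fun j s c => colFn q a b j s (x c)) (fun j s c => rfl)] at h1
      rw [DeltaPol_of_vdet hq ha hinj z one_ne_zero h1 h2 hK]
      congr 2
      rw [Finset.mul_sum]
      refine Finset.sum_congr rfl fun c _ => ?_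
      simp only
      ring
  · subst hm'
    obtain rfl : m = l := by omega
    set S : ℂ := q⁻¹ ^ (3 * (m + 1)) with hS
    have hS0 : S ≠ 0 := pow_ne_zero _ ht
    set K : ℂ := S * (q⁻¹ ^ (3 * (m + 1) + 3) * (1 - q⁻¹ ^ 2) * ∏ i, (z * q⁻¹ - a i * q⁻¹)) /
      (vdet (fun j => a j * q⁻¹ ^ 3) * ∏ j, a j * q⁻¹ ^ 3) with hK
    set H : (Fin m → ℂ) → Fin (m + 1 + 1) → ℂ → Fin (m + 1) → ℂ := fun x j s =>
      Fin.cons (a j ^ (m + 1)) fun c => colFn q a b j s (x c) with hH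
    refine ⟨fun c x => K * ((Matrix.of fun j => (Fin.snoc (fun c => (a j - z) *
      H x j z c) (a j * betaVal q b (a j)) : Fin (m + 1 + 1) → ℂ)).updateCol
        (Fin.castSucc c.succ) a).det, ?_, ?_, ?_⟩
    · intro c x y h
      simp only
      rw [updateCol_of_congr]
      intro j c' hc
      cases c' using Fin.lastCases with
      | last => simp only [Fin.snoc_last]
      | cast c' =>
        cases c' using Fin.cases with
        | zero => simp only [Fin.snoc_castSucc, hH, Fin.cons_zero]
        | succ c' =>
          simp only [Fin.snoc_castSucc, hH, Fin.cons_succ]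
          rw [h c' fun e => hc (e ▸ rfl)]
    · intro c
      refine continuousOn_const.mul (continuousOn_det_updateCol _ _ fun j c' hc => ?_)
      cases c' using Fin.lastCases with
      | last => simp only [Fin.snoc_last]; exact continuousOn_const
      | cast c' =>
        cases c' using Fin.cases with
        | zero => simp only [Fin.snoc_castSucc, hH, Fin.cons_zero]; exact continuousOn_const
        | succ c' =>
          simp only [Fin.snoc_castSucc, hH, Fin.cons_succ]
          exact continuousOn_const.mul (hcont _ _)
    · intro x hx hxinj
      have h2 : ∀ i : Fin (m + 1 + 1), vdet (fun r => a (i.succAbove r) * q⁻¹ ^ 3) *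
          (∏ r, a (i.succAbove r) * q⁻¹ ^ 3) *
          DeltaPol q x (a ∘ i.succAbove) (Fin.cons (a i) b : Fin (m + 1) → ℂ) =
          S * Matrix.det (Matrix.of fun r c => H x (i.succAbove r) (a i) c) := by
        intro i
        -- The border `(1, 0, …)` gives the entry `(a_j τ³)^m`, hence `S a_j^(m+1)` after
        -- multiplication by `a_j τ³`.
        rw [mul_right_comm, vdet_mul_DeltaPol_of_eq q x _ _ _ (fun r => if r = 0 then 1 else 0)
          rfl, mul_comm, ← Matrix.det_mul_column]
        have e1 : S = ∏ c : Fin (m + 1), (Fin.cons S (fun _ => 1) : Fin (m + 1) → ℂ) c := by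
          simp [Fin.prod_univ_succ]
        rw [e1, ← Matrix.det_mul_row]
        congr 1
        ext r c
        simp only [Matrix.of_apply]
        cases c using Fin.cases with
        | zero =>
          simp only [hH, Fin.cons_zero, hS]
          rw [Finset.sum_eq_single 0 (fun r _ hr => by simp [hr]) (by simp)]
          simp only [if_true, Nat.sub_zero, mul_one, mul_pow, ← pow_mul]
          rw [show 3 * (m + 1) = 3 + 3 * m by ring, pow_add]
          ring
        | succ c =>
          simp only [hH, Fin.cons_succ, one_mul]
          exact sum_APol_small hq le_rfl a b z ha i r (hx c)
      have h1 : vdet (fun j => a j * q⁻¹ ^ 3) * (∏ j, a j * q⁻¹ ^ 3) *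
          DeltaPol q (Fin.snoc x (z * q⁻¹) : Fin (m + 1) → ℂ) a B =
          (∏ μ, (x μ - z * q⁻¹)) * (S * (q⁻¹ ^ (3 * (m + 1) + 3) * (1 - q⁻¹ ^ 2) *
            ∏ i, (z * q⁻¹ - a i * q⁻¹))) *
          Matrix.det (Matrix.of fun j => (Fin.snoc (fun c => (a j - z) * H x j z c +
            a j * (Fin.cons 0 (fun c => exactFn q a b (x c)) : Fin (m + 1) → ℂ) c)
            (a j * betaVal q b (a j)) : Fin (m + 1 + 1) → ℂ)) := by
        -- The border `(1, -z τ³, 0, …)` gives `(a_j τ³)^m (a_j τ³ - z τ³)`. This has the factor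
        -- `a_j - z` that `det_snoc_twist` requires, and otherwise agrees with the border of the
        -- small determinants up to a constant.
        rw [mul_right_comm, vdet_mul_DeltaPol_of_eq q _ _ _ _
          (fun r => if r = 0 then 1 else if r = 1 then -(z * q⁻¹ ^ 3) else 0) rfl, mul_comm,
          ← Matrix.det_mul_column]
        have e1 : (∏ μ, (x μ - z * q⁻¹)) * (S * (q⁻¹ ^ (3 * (m + 1) + 3) * (1 - q⁻¹ ^ 2) *
            ∏ i, (z * q⁻¹ - a i * q⁻¹))) = ∏ μ : Fin (m + 1 + 1),
            (Fin.snoc (Fin.cons (q⁻¹ ^ 3 * S) (fun c => (x c - z * q⁻¹) * q⁻¹ ^ 3) :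
                Fin (m + 1) → ℂ)
              (q⁻¹ ^ 3 * (1 - q⁻¹ ^ 2) * ∏ i, (z * q⁻¹ - a i * q⁻¹)) : Fin (m + 1 + 1) → ℂ) μ := by
          rw [Fin.prod_snoc, Fin.prod_cons]
          simp only [
            Finset.prod_mul_distrib, Finset.prod_const, Finset.card_univ, Fintype.card_fin]
          rw [pow_add, mul_add 3 m 1, pow_add, pow_mul _ 3 m]
          ring
        rw [e1, ← Matrix.det_mul_row]
        congr 1
        ext j μ
        simp only [Matrix.of_apply]
        cases μ using Fin.lastCases with
        | last =>
          have e2 : ∀ f : Fin (m + 1) → ℂ, ∀ y : ℂ,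
              (Fin.cons y f : Fin (m + 1 + 1) → ℂ) (Fin.last (m + 1)) = f (Fin.last m) :=
            fun f y => rfl
          rw [e2]
          simp only [Fin.snoc_last]
          exact sum_APol_pole hq le_rfl a b ha B hB hz haz haz2 haz3 j
        | cast μ =>
          cases μ using Fin.cases with
          | zero =>
            have e2 : ∀ f : Fin (m + 1) → ℂ, ∀ y : ℂ,
                (Fin.cons y f : Fin (m + 1 + 1) → ℂ) (Fin.castSucc 0) = y := fun f y => rfl
            rw [e2]
            simp only [Fin.snoc_castSucc, Fin.cons_zero, hH, hS]
            rw [Finset.sum_range_succ', Finset.sum_range_succ', Finset.sum_eq_zero fun r _ => by simp]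
            simp only [Nat.sub_zero, if_true, zero_add, one_ne_zero, if_false, Nat.add_sub_cancel]
            simp only [mul_pow, ← pow_mul]
            rw [mul_add 3 m 1, pow_add _ (3 * m)]
            ring
          | succ μ =>
            have e2 : ∀ f : Fin (m + 1) → ℂ, ∀ y : ℂ,
                (Fin.cons y f : Fin (m + 1 + 1) → ℂ) (Fin.castSucc μ.succ) = f (Fin.castSucc μ) :=
              fun f y => rfl
            rw [e2]
            simp only [Fin.snoc_castSucc, Fin.cons_succ, hH]
            exact sum_APol_big hq le_rfl a b z ha B hB j (hx μ)
      -- The border column is not twisted: its `y` is zero, and the value `0` chosen for its `x` is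
      -- irrelevant.
      rw [det_snoc_twist a (fun j => a j * betaVal q b (a j)) z q⁻¹
        (fun j => Fin.cons (a j ^ (m + 1)) fun c => colBase q a b j (x c))
        (Fin.cons 0 fun c => q⁻¹ * (1 - q⁻¹ ^ 2) * ∏ i, (x c - a i * q⁻¹)) (Fin.cons 0 x) _
        ?_ ?_ ?_ haz (fun j => mul_ne_zero (ha j) (hab j)) (H x) ?_] at h1
      · rw [DeltaPol_of_vdet hq ha hinj z hS0 h1 h2 hK]
        congr 2
        rw [Fin.sum_univ_succ]
        simp only [Fin.cons_zero, zero_mul, zero_add, Fin.cons_succ]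
        rw [Finset.mul_sum]
        refine Finset.sum_congr rfl fun c _ => ?_
        ring
      · intro c c' hc hc' hcc
        cases c using Fin.cases with
        | zero => simp at hc
        | succ c =>
          cases c' using Fin.cases with
          | zero => simp at hc'
          | succ c' =>
            simp only [Fin.cons_succ]
            exact fun e => hcc (by rw [hxinj e])
      · intro c hc
        cases c using Fin.cases with
        | zero => simp at hc
        | succ c => simpa using (hx c).2.1
      · intro c hc j
        cases c using Fin.cases with
        | zero => simp at hc
        | succ c => simpa using ((hx c).2.2 j).1
      · intro j s c
        cases c using Fin.cases with
        | zero => simp [hH]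
        | succ c => simp only [hH, Fin.cons_succ]; rfl

end QKZ

namespace QKZ

/-! ### Symmetry of `Δ` -/

lemma esym_comp_perm {k : ℕ} (a : Fin k → ℂ) (ρ : Equiv.Perm (Fin k)) (r : ℕ) :
    esym (a ∘ ρ) r = esym a r := by
  unfold esym
  refine Finset.sum_equiv (Equiv.finsetCongr ρ) (fun s => ?_) fun s _ => ?_
  · simp [Finset.mem_powersetCard]
  · simp [Equiv.finsetCongr_apply, Finset.prod_map]

lemma hsym_comp_perm {k : ℕ} (a : Fin k → ℂ) (ρ : Equiv.Perm (Fin k)) (r : ℕ) :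
    hsym (a ∘ ρ) r = hsym a r := by
  unfold hsym
  refine Fintype.sum_equiv (Sym.equivCongr ρ) _ _ fun s => ?_
  simp [Sym.equivCongr]

lemma APol_comp_perm (q : ℂ) {n l : ℕ} (lam : ℕ) (x : ℂ) (a : Fin n → ℂ) (b : Fin l → ℂ)
    (ρ : Equiv.Perm (Fin n)) : APol q lam x (a ∘ ρ) b = APol q lam x a b := by
  have h : ∏ j, (x - (a ∘ ρ) j * q⁻¹) = ∏ j, (x - a j * q⁻¹) :=
    Equiv.prod_comp ρ fun j => x - a j * q⁻¹
  unfold APol fPol gPol phi beta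
  simp only [esym_comp_perm, hsym_comp_perm, h]

lemma DeltaPol_comp_perm (q : ℂ) {m n l : ℕ} (x : Fin m → ℂ) (a : Fin n → ℂ) (b : Fin l → ℂ)
    (ρ : Equiv.Perm (Fin n)) : DeltaPol q x (a ∘ ρ) b = DeltaPol q x a b := by
  unfold DeltaPol
  simp only [APol_comp_perm]

lemma exists_perm_comp_eq {X : Type*} {n : ℕ} {f g : Fin n → X} (hf : Function.Injective f)
    (h : ∀ j, ∃ k, g k = f j) : ∃ ρ : Equiv.Perm (Fin n), f = g ∘ ρ := by
  choose ρ hρ using h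
  have hinj : Function.Injective ρ := fun i j e => hf (by rw [← hρ, ← hρ, e])
  exact ⟨Equiv.ofBijective ρ (Finite.injective_iff_bijective.mp hinj), funext fun j => (hρ j).symm⟩

lemma bracketExt_comp_of_castAdd (q : ℂ) {m n l : ℕ} (x : Fin m → ℂ) {ζ ζ₂ : Fin (n + l) → ℂ}
    (ρ : Equiv.Perm (Fin n)) (h1 : ∀ j, ζ₂ (Fin.castAdd l j) = ζ (Fin.castAdd l (ρ j)))
    (h2 : ∀ i, ζ₂ (Fin.natAdd n i) = ζ (Fin.natAdd n i)) :
    bracketExt q x ζ₂ = bracketExt q x ζ := by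
  unfold bracketExt
  simp only [h1, h2]
  rw [Equiv.prod_comp ρ (fun j => ζ (Fin.castAdd l j)),
    Equiv.prod_comp ρ (fun j => ∏ i : Fin l, (ζ (Fin.natAdd n i) ^ 2 -
      ζ (Fin.castAdd l j) ^ 2 * q⁻¹ ^ 2))]
  congr 2
  exact DeltaPol_comp_perm q x (fun j => ζ (Fin.castAdd l j) ^ 2) _ ρ

/-- A permutation that fixes each of the last `l` places permutes the first `n` among themselves,
and there the expression is symmetric. -/
lemma bracketExt_comp_perm (q : ℂ) {m n l : ℕ} (x : Fin m → ℂ) (ζ : Fin (n + l) → ℂ)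
    (π : Equiv.Perm (Fin (n + l))) (hπ : ∀ i, π (Fin.natAdd n i) = Fin.natAdd n i) :
    bracketExt q x (ζ ∘ π) = bracketExt q x ζ := by
  obtain ⟨ρ, hρ⟩ := exists_perm_comp_eq (f := fun j => π (Fin.castAdd l j)) (g := Fin.castAdd l)
    (fun i j e => Fin.castAdd_injective n l (π.injective e)) fun j => by
      have : ((π (Fin.castAdd l j) : Fin (n + l)) : ℕ) < n := by
        by_contra hlt
        push Not at hlt
        have e : π (Fin.castAdd l j) =
            Fin.natAdd n ⟨(π (Fin.castAdd l j) : ℕ) - n, by omega⟩ := by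
          ext; simp; omega
        have e2 := π.injective (e.trans (hπ _).symm)
        have := congrArg Fin.val e2
        simp at this
        omega
      exact ⟨⟨_, this⟩, rfl⟩
  refine bracketExt_comp_of_castAdd q x ρ (fun j => ?_) fun i => ?_
  · exact congrArg ζ (congrFun hρ j)
  · exact congrArg ζ (hπ i)

/-! ### Identities for the entries of the `R` matrix -/

/-- One exchange step gives two contributions to each earlier coefficient; this identity merges them
into a single term of the same product form. -/
lemma cR_div_bR_mul {q X Y : ℂ} (hq : q ≠ 0) (hY0 : Y ≠ 0) (hX : 1 - X ^ 2 ≠ 0)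
    (hY : 1 - Y ^ 2 ≠ 0) (hXY : 1 - (X * Y) ^ 2 ≠ 0) (hXq : 1 - X ^ 2 * q ^ 2 ≠ 0)
    (hYq : 1 - Y ^ 2 * q ^ 2 ≠ 0) (hXYq : 1 - (X * Y) ^ 2 * q ^ 2 ≠ 0) (hYq' : Y ^ 2 - q ^ 2 ≠ 0) :
    (cR q (X * Y) / bR q (X * Y) - cR q X * (cR q Y / bR q Y)) / bR q X =
      cR q (X * Y) / bR q (X * Y) * (bR q (1 / Y))⁻¹ := by
  have e : bR q (1 / Y) = (Y ^ 2 - 1) * q / (Y ^ 2 - q ^ 2) := by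
    unfold bR
    rw [div_eq_div_iff _ hYq']
    · field_simp
    · intro h
      apply hYq'
      field_simp at h
      linear_combination h
  have hY' : Y ^ 2 - 1 ≠ 0 := fun h => hY (by linear_combination -h)
  have f : ∀ x : ℂ, 1 - x ^ 2 ≠ 0 → 1 - x ^ 2 * q ^ 2 ≠ 0 →
      cR q x / bR q x = (1 - q ^ 2) * x / ((1 - x ^ 2) * q) := fun x _ h2 => by
    rw [cR, bR, div_div_div_cancel_right₀ h2]
  rw [e, f _ hXY hXYq, f _ hY hYq, cR, bR, inv_div]
  have d1 : (1 - (X * Y) ^ 2) * q ≠ 0 := mul_ne_zero hXY hq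
  have d2 : (1 - Y ^ 2) * q ≠ 0 := mul_ne_zero hY hq
  have d3 : (1 - X ^ 2) * q ≠ 0 := mul_ne_zero hX hq
  have d4 : (Y ^ 2 - 1) * q ≠ 0 := mul_ne_zero hY' hq
  rw [div_mul_div_comm, div_sub_div _ _ d1 (mul_ne_zero hXq d2), div_div_div_eq,
    div_mul_div_comm, div_eq_div_iff (mul_ne_zero (mul_ne_zero d1 (mul_ne_zero hXq d2)) d3)
      (mul_ne_zero d1 d4)]
  ring

/-- The analogous identity for the action of one more factor of the chain. -/
lemma cR_mul_bR_div {q W s : ℂ} (hq : q ≠ 0) (hs0 : s ≠ 0) (hs : 1 - s ^ 2 ≠ 0)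
    (hW : 1 - W ^ 2 * q ^ 2 ≠ 0) (hWs : 1 - (W * s) ^ 2 * q ^ 2 ≠ 0)
    (hsq : 1 - s ^ 2 * q ^ 2 ≠ 0) (hsq' : s ^ 2 - q ^ 2 ≠ 0) :
    cR q (W * s) * (bR q W * (bR q (1 / s))⁻¹) =
      cR q (W * s) - bR q (W * s) * cR q W * (cR q s / bR q s) := by
  have e : bR q (1 / s) = (s ^ 2 - 1) * q / (s ^ 2 - q ^ 2) := by
    unfold bR
    rw [div_eq_div_iff _ hsq']
    · field_simp
    · intro h
      apply hsq'
      field_simp at h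
      linear_combination h
  have hs' : s ^ 2 - 1 ≠ 0 := fun h => hs (by linear_combination -h)
  have f : cR q s / bR q s = (1 - q ^ 2) * s / ((1 - s ^ 2) * q) := by
    rw [cR, bR, div_div_div_cancel_right₀ hsq]
  rw [e, f, cR, bR, cR, bR, inv_div]
  have d2 : (1 - s ^ 2) * q ≠ 0 := mul_ne_zero hs hq
  have d4 : (s ^ 2 - 1) * q ≠ 0 := mul_ne_zero hs' hq
  rw [div_mul_div_comm, div_mul_div_comm, div_mul_div_comm, div_mul_div_comm,
    div_sub_div _ _ hWs (mul_ne_zero (mul_ne_zero hWs hW) d2),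
    div_eq_div_iff (mul_ne_zero hWs (mul_ne_zero hW d4))
      (mul_ne_zero hWs (mul_ne_zero (mul_ne_zero hWs hW) d2))]
  ring

/-! ### The two recursions -/

/-- A component of the vector in terms of the extreme ones. -/
def compFn (q : ℂ) {M : ℕ} (ζ Z : Fin M → ℂ) (S : Finset (Fin M)) (k : Fin M) : ℂ :=
  Z k * ∏ t ∈ S, (bR q (ζ k / ζ t))⁻¹ - ∑ i ∈ S, cR q (ζ k / ζ i) / bR q (ζ k / ζ i) *
    (∏ t ∈ S.erase i, (bR q (ζ i / ζ t))⁻¹) * Z i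

/-- The resulting value of `R_{N-1|1,…,N-2}`. -/
def chainFn (q w : ℂ) {M : ℕ} (ζ Z : Fin M → ℂ) (S : Finset (Fin M)) : ℂ :=
  ∑ i ∈ S, cR q (w / ζ i) * (∏ t ∈ S.erase i, bR q (w / ζ t) * (bR q (ζ i / ζ t))⁻¹) * Z i

/-- Genericity of the parameters of the `R` matrices. -/
def GenR (q : ℂ) {M : ℕ} (ζ : Fin M → ℂ) : Prop :=
  ∀ i j, i ≠ j → 1 - (ζ i / ζ j) ^ 2 ≠ 0 ∧ 1 - (ζ i / ζ j) ^ 2 * q ^ 2 ≠ 0 ∧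
    (ζ i / ζ j) ^ 2 - q ^ 2 ≠ 0

/-- The right hand side is the exchange relation for the sites `k` and `k'`, solved as in
`bracketAux`. Coefficient by coefficient it reduces to `cR_div_bR_mul`. -/
lemma compFn_insert {q : ℂ} (hq : q ≠ 0) {M : ℕ} {ζ : Fin M → ℂ} (hζ : NonZero ζ) (h : GenR q ζ)
    (Z : Fin M → ℂ) {S : Finset (Fin M)} {k k' : Fin M} (hk : k ∉ S) (hk' : k' ∉ S)
    (hkk : k ≠ k') :
    compFn q ζ Z (insert k' S) k =
      (compFn q ζ Z S k - cR q (ζ k / ζ k') * compFn q ζ Z S k') / bR q (ζ k / ζ k') := by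
  have hb : bR q (ζ k / ζ k') ≠ 0 :=
    div_ne_zero (mul_ne_zero (h k k' hkk).1 hq) (h k k' hkk).2.1
  have h1 : ∀ i ∈ S, cR q (ζ k / ζ i) / bR q (ζ k / ζ i) *
      (∏ t ∈ (insert k' S).erase i, (bR q (ζ i / ζ t))⁻¹) * Z i =
      (cR q (ζ k / ζ i) / bR q (ζ k / ζ i) * (∏ t ∈ S.erase i, (bR q (ζ i / ζ t))⁻¹) * Z i -
        cR q (ζ k / ζ k') * (cR q (ζ k' / ζ i) / bR q (ζ k' / ζ i) *
          (∏ t ∈ S.erase i, (bR q (ζ i / ζ t))⁻¹) * Z i)) / bR q (ζ k / ζ k') := by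
    intro i hi
    have hik : i ≠ k := fun e => hk (e ▸ hi)
    have hik' : i ≠ k' := fun e => hk' (e ▸ hi)
    rw [Finset.erase_insert_of_ne hik'.symm, Finset.prod_insert (fun e => hk' (Finset.mem_of_mem_erase e))]
    have e1 : ζ k / ζ i = ζ k / ζ k' * (ζ k' / ζ i) := by
      have := hζ k'; have := hζ i; field_simp
    have e2 : ζ i / ζ k' = 1 / (ζ k' / ζ i) := by rw [one_div_div]
    have h3 := cR_div_bR_mul hq (div_ne_zero (hζ k') (hζ i)) (h k k' hkk).1 (h k' i hik'.symm).1
      (e1 ▸ (h k i hik.symm).1) (h k k' hkk).2.1 (h k' i hik'.symm).2.1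
      (e1 ▸ (h k i hik.symm).2.1) (h k' i hik'.symm).2.2
    rw [← e1, ← e2] at h3
    linear_combination -((∏ t ∈ S.erase i, (bR q (ζ i / ζ t))⁻¹) * Z i) * h3
  unfold compFn
  rw [Finset.prod_insert hk', Finset.sum_insert hk', Finset.erase_insert hk',
    Finset.sum_congr rfl h1, ← Finset.sum_div, Finset.sum_sub_distrib, ← Finset.mul_sum]
  field_simp
  ring

/-- The displaced sign is picked up at site `k` with weight `cR`, and the factors at the sites in
`S` then contribute `bR`. The coefficients agree by `cR_mul_bR_div`. -/
lemma chainFn_insert {q w : ℂ} (hq : q ≠ 0) {M : ℕ} {ζ : Fin M → ℂ}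
    (hζ : NonZero ζ) (h : GenR q ζ) (hw : ∀ i, 1 - (w / ζ i) ^ 2 * q ^ 2 ≠ 0) (Z : Fin M → ℂ)
    {S : Finset (Fin M)} {k : Fin M} (hk : k ∉ S) :
    chainFn q w ζ Z (insert k S) = chainFn q w ζ Z S +
      (∏ t ∈ S, bR q (w / ζ t)) * (cR q (w / ζ k) * compFn q ζ Z S k) := by
  have h1 : ∀ i ∈ S, cR q (w / ζ i) *
      (∏ t ∈ (insert k S).erase i, bR q (w / ζ t) * (bR q (ζ i / ζ t))⁻¹) * Z i =
      cR q (w / ζ i) * (∏ t ∈ S.erase i, bR q (w / ζ t) * (bR q (ζ i / ζ t))⁻¹) * Z i -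
        (∏ t ∈ S, bR q (w / ζ t)) * cR q (w / ζ k) * (cR q (ζ k / ζ i) / bR q (ζ k / ζ i) *
          (∏ t ∈ S.erase i, (bR q (ζ i / ζ t))⁻¹) * Z i) := by
    intro i hi
    have hik : i ≠ k := fun e => hk (e ▸ hi)
    rw [Finset.erase_insert_of_ne hik.symm,
      Finset.prod_insert (fun e => hk (Finset.mem_of_mem_erase e)), Finset.prod_mul_distrib,
      ← Finset.mul_prod_erase S _ hi]
    have e1 : w / ζ i = w / ζ k * (ζ k / ζ i) := by
      have := hζ k; have := hζ i; field_simp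
    have e2 : ζ i / ζ k = 1 / (ζ k / ζ i) := by rw [one_div_div]
    have h3 := cR_mul_bR_div hq (div_ne_zero (hζ k) (hζ i)) (h k i hik.symm).1 (hw k)
      (e1 ▸ hw i) (h k i hik.symm).2.1 (h k i hik.symm).2.2
    rw [← e1, ← e2] at h3
    linear_combination (∏ t ∈ S.erase i, bR q (w / ζ t)) *
      (∏ t ∈ S.erase i, (bR q (ζ i / ζ t))⁻¹) * Z i * h3
  unfold chainFn compFn
  rw [Finset.sum_insert hk, Finset.erase_insert hk, Finset.sum_congr rfl h1,
    Finset.sum_sub_distrib, ← Finset.mul_sum, Finset.prod_mul_distrib]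
  ring

end QKZ

/-! ### Components of the vector with one sign moved -/

namespace QKZ

/-- The index with signs `-` at the first `n + 1` places except `k`. -/
def pat (n M k : ℕ) : Fin M → ℤˣ := fun j => if (j : ℕ) < n + 1 ∧ (j : ℕ) ≠ k then -1 else 1

lemma neg_one_ne_one_units : (-1 : ℤˣ) ≠ 1 := by decide

lemma pat_self_extreme (n M : ℕ) : pat n M n = extreme M n := by
  funext j
  unfold pat extreme
  congr 1
  simp only [eq_iff_iff]
  omega

lemma card_pat {n M k : ℕ} (hM : n + 1 ≤ M) (hk : k ≤ n) :
    (Finset.univ.filter fun j => pat n M k j = -1).card = n := by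
  have e : (Finset.univ.filter fun j : Fin M => pat n M k j = -1) =
      (Finset.univ.filter fun j : Fin M => (j : ℕ) < n + 1).erase ⟨k, by omega⟩ := by
    ext j
    have hp : pat n M k j = -1 ↔ (j : ℕ) < n + 1 ∧ (j : ℕ) ≠ k := by
      unfold pat
      split_ifs with h
      · exact iff_of_true rfl h
      · exact iff_of_false neg_one_ne_one_units.symm h
    rw [Finset.mem_filter, hp]
    simp only [Finset.mem_filter, Finset.mem_univ, true_and, Finset.mem_erase, ne_eq, Fin.ext_iff]
    exact and_comm
  rw [e, Finset.card_erase_of_mem (by simp; omega), Fin.card_filter_val_lt]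
  omega

lemma not_isDescent_extreme (N n : ℕ) : ¬ ∃ j, IsDescent (extreme N n) j := by
  rintro ⟨j, h, h1, h2⟩
  simp only [extreme] at h1 h2
  split_ifs at h1 h2 <;> first | omega | exact absurd h1 neg_one_ne_one_units |
    exact absurd h2.symm neg_one_ne_one_units

lemma bracketAux_extreme (q : ℂ) {m n l : ℕ} (x : Fin m → ℂ) (s : ℕ) (ζ : Fin (n + l) → ℂ) :
    bracketAux q x s ζ (extreme (n + l) n) = bracketExt q x ζ := by
  cases s with
  | zero => rfl
  | succ s => rw [bracketAux, dif_neg (not_isDescent_extreme _ _)]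

lemma isDescent_pat {n M k : ℕ} (hM : n + 1 ≤ M) (hk : k < n) (j : ℕ) :
    IsDescent (pat n M k) j ↔ j = k := by
  constructor
  · rintro ⟨h, h1, h2⟩
    simp only [pat] at h1 h2
    by_contra hj
    split_ifs at h1 h2 with h3 h4 h4
    · exact neg_one_ne_one_units h1
    · exact neg_one_ne_one_units h1
    · omega
    · exact neg_one_ne_one_units h2.symm
  · rintro rfl
    refine ⟨by omega, ?_, ?_⟩
    · simp [pat]
    · simp only [pat]; rw [if_pos]; omega

lemma pat_comp_swap {n M k : ℕ} (hM : n + 1 ≤ M) (hk : k < n) :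
    pat n M k ∘ Equiv.swap (⟨k, by omega⟩ : Fin M) ⟨k + 1, by omega⟩ = pat n M (k + 1) := by
  funext j
  by_cases h1 : j = ⟨k, by omega⟩
  · subst h1
    rw [Function.comp_apply, Equiv.swap_apply_left]
    simp only [pat]
    rw [if_pos (by omega), if_pos (by omega)]
  by_cases h2 : j = ⟨k + 1, by omega⟩
  · subst h2
    rw [Function.comp_apply, Equiv.swap_apply_right]
    simp only [pat]
    rw [if_neg (by omega), if_neg (by omega)]
  · rw [Function.comp_apply, Equiv.swap_apply_of_ne_of_ne h1 h2]
    simp only [pat]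
    have h1' : (j : ℕ) ≠ k := fun e => h1 (Fin.ext e)
    have h2' : (j : ℕ) ≠ k + 1 := fun e => h2 (Fin.ext e)
    congr 1
    simp only [eq_iff_iff]
    omega

/-- These indices have a single descent, at `k`, so the choice made by the recursion is forced and
the result is again of the form `pat`. -/
lemma bracketAux_pat_succ (q : ℂ) {m n l k : ℕ} (hl : 0 < l) (hk : k < n) (x : Fin m → ℂ) (s : ℕ)
    (ζ : Fin (n + l) → ℂ) :
    bracketAux q x (s + 1) ζ (pat n (n + l) k) =
      (bracketAux q x s (ζ ∘ Equiv.swap (⟨k, by omega⟩ : Fin (n + l)) ⟨k + 1, by omega⟩)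
          (pat n (n + l) (k + 1)) -
        cR q (ζ ⟨k, by omega⟩ / ζ ⟨k + 1, by omega⟩) *
          bracketAux q x s ζ (pat n (n + l) (k + 1))) /
        bR q (ζ ⟨k, by omega⟩ / ζ ⟨k + 1, by omega⟩) := by
  classical
  have hM : n + 1 ≤ n + l := by omega
  have h : ∃ j, IsDescent (pat n (n + l) k) j := ⟨k, (isDescent_pat hM hk k).mpr rfl⟩
  have hf : Nat.find h = k := (isDescent_pat hM hk _).mp (Nat.find_spec h)
  rw [bracketAux, dif_pos h]
  have hpat := pat_comp_swap hM hk
  simp only [hf]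
  rw [hpat]

/-- The components of the vector with one sign moved. -/
theorem bracketAux_pat {q : ℂ} (hq : q ≠ 0) {m n l : ℕ} (hl : 0 < l) (x : Fin m → ℂ)
    {ζ : Fin (n + l) → ℂ} (hζ : NonZero ζ) (hgen : GenR q ζ) :
    ∀ (d k s : ℕ) (_ : k + d = n) (_ : d ≤ s) (π : Equiv.Perm (Fin (n + l)))
      (_ : ∀ j : Fin (n + l), n < (j : ℕ) → π j = j),
      bracketAux q x s (ζ ∘ π) (pat n (n + l) k) =
        compFn q ζ (fun i => bracketExt q x (ζ ∘ Equiv.swap i ⟨n, by omega⟩))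
          ((Finset.univ.filter fun j : Fin (n + l) => k < (j : ℕ) ∧ (j : ℕ) ≤ n).image π)
          (π ⟨k, by omega⟩) := by
  classical
  intro d
  -- A permutation of the variables is carried along, since each step also calls the component at
  -- exchanged variables. In the end only the variable sent to place `n` matters, because the
  -- extreme component is symmetric in the first `n`.
  induction d with
  | zero =>
    intro k s hk _ π hπ
    obtain rfl : k = n := by omega
    have e : (Finset.univ.filter fun j : Fin (k + l) => k < (j : ℕ) ∧ (j : ℕ) ≤ k) = ∅ :=
      Finset.filter_eq_empty_iff.mpr fun j _ => by omega
    rw [pat_self_extreme, bracketAux_extreme, e, Finset.image_empty, compFn, Finset.prod_empty,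
      Finset.sum_empty, mul_one, sub_zero]
    set j0 : Fin (k + l) := ⟨k, by omega⟩ with hj0
    have h1 := bracketExt_comp_perm q x (ζ ∘ Equiv.swap (π j0) j0)
      (Equiv.swap (π j0) j0 * π) (fun i => by
        rw [Equiv.Perm.mul_apply]
        by_cases hi : Fin.natAdd k i = j0
        · rw [hi, Equiv.swap_apply_left]
        · have hi2 : k < (Fin.natAdd k i : ℕ) := by
            have : (Fin.natAdd k i : ℕ) ≠ k := fun e => hi (Fin.ext e)
            have := Fin.le_coe_natAdd k i
            omega
          rw [hπ _ hi2, Equiv.swap_apply_of_ne_of_ne _ hi]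
          intro e
          have := π.injective ((hπ _ hi2).trans e)
          exact hi this)
    rw [← h1]
    congr 1
    funext i
    simp
  | succ d ih =>
    intro k s hk hs π hπ
    obtain ⟨s, rfl⟩ := Nat.exists_eq_succ_of_ne_zero (by omega : s ≠ 0)
    have hkn : k < n := by omega
    set j0 : Fin (n + l) := ⟨k, by omega⟩ with hj0
    set j1 : Fin (n + l) := ⟨k + 1, by omega⟩ with hj1
    have hj01 : j0 ≠ j1 := fun e => by simpa [hj0, hj1] using congrArg Fin.val e
    set T := Finset.univ.filter fun j : Fin (n + l) => k + 1 < (j : ℕ) ∧ (j : ℕ) ≤ n with hT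
    have hT0 : j0 ∉ T := by simp [hT, hj0]
    have hT1 : j1 ∉ T := by simp [hT, hj1]
    have hins : (Finset.univ.filter fun j : Fin (n + l) => k < (j : ℕ) ∧ (j : ℕ) ≤ n) =
        insert j1 T := by
      ext j
      simp only [hT, hj1, Finset.mem_filter, Finset.mem_univ, true_and, Finset.mem_insert,
        Fin.ext_iff]
      omega
    rw [bracketAux_pat_succ q hl hkn, hins, Finset.image_insert]
    have hsw : ∀ j : Fin (n + l), n < (j : ℕ) → (Equiv.swap j0 j1) j = j := fun j hj =>
      Equiv.swap_apply_of_ne_of_ne (fun e => by rw [e, hj0] at hj; simp at hj; omega)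
        fun e => by rw [e, hj1] at hj; simp at hj; omega
    have h1 := ih (k + 1) s (by omega) (by omega) (π * Equiv.swap j0 j1) fun j hj => by
      rw [Equiv.Perm.mul_apply, hsw j hj, hπ j hj]
    have h2 := ih (k + 1) s (by omega) (by omega) π hπ
    have himg : T.image (π * Equiv.swap j0 j1) = T.image π := by
      refine Finset.image_congr fun j hj => ?_
      rw [Equiv.Perm.mul_apply, Equiv.swap_apply_of_ne_of_ne (fun e : j = j0 => hT0 (by rw [← e]; exact hj))
        fun e : j = j1 => hT1 (by rw [← e]; exact hj)]
    rw [himg, Equiv.Perm.mul_apply, ← hj1, Equiv.swap_apply_right] at h1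
    have h3 : ζ ∘ ⇑(π * Equiv.swap j0 j1) = (ζ ∘ π) ∘ Equiv.swap j0 j1 := rfl
    rw [h3] at h1
    rw [h1, h2, compFn_insert hq hζ hgen]
    · rfl
    · exact fun h => hT0 (by
        obtain ⟨j, hj, e⟩ := Finset.mem_image.mp h
        exact π.injective e ▸ hj)
    · exact fun h => hT1 (by
        obtain ⟨j, hj, e⟩ := Finset.mem_image.mp h
        exact π.injective e ▸ hj)
    · exact fun e => hj01 (π.injective e)

theorem bracket_pat {q : ℂ} (hq : q ≠ 0) {m n l : ℕ} (hl : 0 < l) (x : Fin m → ℂ)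
    {ζ : Fin (n + l) → ℂ} (hζ : NonZero ζ) (hgen : GenR q ζ) {k : ℕ} (hk : k ≤ n) :
    bracket q x ζ (pat n (n + l) k) =
      compFn q ζ (fun i => bracketExt q x (ζ ∘ Equiv.swap i ⟨n, by omega⟩))
        (Finset.univ.filter fun j : Fin (n + l) => k < (j : ℕ) ∧ (j : ℕ) ≤ n) ⟨k, by omega⟩ := by
  -- The sign is `n - k` exchanges away from its place, and `n - k ≤ n * l` because `l` is positive.
  have h := bracketAux_pat hq hl x hζ hgen (n - k) k (n * l) (by omega)
    ((Nat.sub_le n k).trans (Nat.le_mul_of_pos_right n hl)) 1 fun _ _ => rfl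
  rw [bracket, if_pos (card_pat (by omega) hk)]
  simpa using! h

end QKZ

namespace QKZ

/-! ### The extreme component of `R_{N-1|1,…,N-2} (F ⊗ u_σ)` -/

/-- The product of the first `k` factors of `R_{N-1|1,…,N-2}`. -/
def partialRchain (q w : ℂ) {M : ℕ} (ζ' : Fin M → ℂ) (F : (Fin (M + 2) → ℤˣ) → ℂ) (k : ℕ) :
    (Fin (M + 2) → ℤˣ) → ℂ :=
  ((List.finRange M).take k).foldl
    (fun H j => Rop q (w / ζ' j) (Fin.castSucc (Fin.last M)) (Fin.castAdd 2 j) H) F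

lemma partialRchain_succ (q w : ℂ) {M : ℕ} (ζ' : Fin M → ℂ) (F : (Fin (M + 2) → ℤˣ) → ℂ)
    {k : ℕ} (hk : k < M) :
    partialRchain q w ζ' F (k + 1) = Rop q (w / ζ' ⟨k, hk⟩) (Fin.castSucc (Fin.last M))
      (Fin.castAdd 2 ⟨k, hk⟩) (partialRchain q w ζ' F k) := by
  rw [partialRchain, List.take_succ_eq_append_getElem (by simpa using hk), List.foldl_append]
  simp [partialRchain]

lemma sum_units {f : ℤˣ → ℂ} : ∑ d : ℤˣ, f d = f 1 + f (-1) := by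
  have : (Finset.univ : Finset ℤˣ) = {1, -1} := by decide
  rw [this, Finset.sum_pair (by decide)]

lemma Rop_of_eq (q ζ : ℂ) {N : ℕ} {j k : Fin N} (F : (Fin N → ℤˣ) → ℂ)
    {e : Fin N → ℤˣ} (h : e j = e k) : Rop q ζ j k F e = F e := by
  have hu : Function.update (Function.update e j (e j)) k (e k) = e := by simp
  rw [Rop, Finset.sum_eq_single (e j), Finset.sum_eq_single (e k)]
  · rw [hu, REntry, if_pos h, if_pos ⟨rfl, rfl⟩, one_mul]
  · intro d _ hd
    rw [REntry, if_pos h, if_neg fun h' => hd h'.2, zero_mul]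
  · exact fun h => absurd (Finset.mem_univ _) h
  · intro d _ hd
    exact Finset.sum_eq_zero fun d' _ => by
      rw [REntry, if_pos h, if_neg fun h' => hd h'.1, zero_mul]
  · exact fun h => absurd (Finset.mem_univ _) h

lemma Rop_of_one_neg_one (q ζ : ℂ) {N : ℕ} {j k : Fin N} (F : (Fin N → ℤˣ) → ℂ)
    {e : Fin N → ℤˣ} (hj : e j = 1) (hk : e k = -1) :
    Rop q ζ j k F e = bR q ζ * F e +
      cR q ζ * F (Function.update (Function.update e j (-1)) k 1) := by
  have hu : Function.update (Function.update e j 1) k (-1) = e := by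
    conv_lhs => rw [← hk]
    rw [show (1 : ℤˣ) = e j from hj.symm]; simp
  have h1 := neg_one_ne_one_units
  rw [Rop, sum_units, sum_units, sum_units, hj, hk, hu]
  simp [REntry, h1, h1.symm]

section

variable {q w : ℂ} {n M : ℕ} (σ : ℤˣ) (ζ' : Fin M → ℂ) (F : (Fin M → ℤˣ) → ℂ)

/-- On two equal signs `R` acts as the identity. -/
lemma partialRchain_of_neg {k : ℕ} (hk : k ≤ M) {e : Fin (M + 2) → ℤˣ}
    (h0 : e (Fin.castSucc (Fin.last M)) = -1)
    (he : ∀ j : Fin M, (j : ℕ) < k → e (Fin.castAdd 2 j) = -1) :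
    partialRchain q w ζ' (tensorU σ F) k e = tensorU σ F e := by
  induction k with
  | zero => rfl
  | succ k ih =>
    rw [partialRchain_succ q w ζ' _ hk, Rop_of_eq, ih (by omega) fun j hj => he j (by omega)]
    rw [h0, he ⟨k, hk⟩ (by simp)]

/-- The site `N - 1` carries `+`. Against a `-` the new factor keeps the signs or exchanges them.
After an exchange the earlier factors only meet pairs of signs `-`, and the value of `F` at `pat n M
k` remains. Against a `+` the factor is the identity. -/
lemma partialRchain_extreme_succ (hM : n + 1 ≤ M) {k : ℕ} (hk : k < M) :
    partialRchain q w ζ' (tensorU σ F) (k + 1) (extreme (M + 2) (n + 1)) =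
      if k < n + 1 then
        bR q (w / ζ' ⟨k, hk⟩) * partialRchain q w ζ' (tensorU σ F) k (extreme (M + 2) (n + 1)) +
          cR q (w / ζ' ⟨k, hk⟩) * F (pat n M k)
      else partialRchain q w ζ' (tensorU σ F) k (extreme (M + 2) (n + 1)) := by
  have hl : extreme (M + 2) (n + 1) (Fin.castSucc (Fin.last M)) = 1 := by
    simp only [extreme, Fin.val_castSucc, Fin.val_last]
    rw [if_neg (by omega)]
  rw [partialRchain_succ q w ζ' _ hk]
  split_ifs with h
  · have hk' : extreme (M + 2) (n + 1) (Fin.castAdd 2 ⟨k, hk⟩) = -1 := by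
      simp only [extreme, Fin.val_castAdd]
      rw [if_pos h]
    rw [Rop_of_one_neg_one q _ _ hl hk', partialRchain_of_neg (e := Function.update (Function.update (extreme (M + 2) (n + 1))
        (Fin.castSucc (Fin.last M)) (-1)) (Fin.castAdd 2 ⟨k, hk⟩) 1)]
    · congr 2
      have hne : (Fin.castSucc (Fin.last M)) ≠ Fin.castAdd 2 ⟨k, hk⟩ := fun e => by
        have := congrArg Fin.val e
        simp at this; omega
      have e1 : (fun j => Function.update (Function.update (extreme (M + 2) (n + 1))
          (Fin.castSucc (Fin.last M)) (-1)) (Fin.castAdd 2 ⟨k, hk⟩) 1 (Fin.castAdd 2 j)) =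
          pat n M k := by
        funext j
        by_cases hj : j = ⟨k, hk⟩
        · subst hj
          rw [Function.update_self]
          simp [pat]
        · rw [Function.update_of_ne (fun e => hj (Fin.castAdd_injective M 2 e)),
            Function.update_of_ne fun e => by
              have := congrArg Fin.val e
              simp at this; omega]
          simp only [extreme, pat, Fin.val_castAdd]
          congr 1
          have : (j : ℕ) ≠ k := fun e => hj (Fin.ext e)
          simp only [eq_iff_iff]
          omega
      rw [tensorU, e1, Function.update_of_ne hne, Function.update_self,
        Function.update_of_ne (fun e => by have := congrArg Fin.val e; simp at this; omega),
        Function.update_of_ne (fun e => by have := congrArg Fin.val e; simp at this)]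
      have hlast : extreme (M + 2) (n + 1) (Fin.last (M + 1)) = 1 := by
        simp only [extreme, Fin.val_last]
        rw [if_neg (by omega)]
      rw [hlast]
      simp [uVec]
    · exact hk.le
    · rw [Function.update_of_ne (fun e => by have := congrArg Fin.val e; simp at this; omega),
        Function.update_self]
    · intro j hj
      rw [Function.update_of_ne (fun e => by have := congrArg Fin.val e; simp at this; omega),
        Function.update_of_ne (fun e => by have := congrArg Fin.val e; simp at this; omega)]
      simp only [extreme, Fin.val_castAdd]
      rw [if_pos (by omega)]
  · rw [Rop_of_eq]
    rw [hl]
    simp only [extreme, Fin.val_castAdd]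
    rw [if_neg h]

theorem Rchain_extreme (hq : q ≠ 0) (hM : n + 1 ≤ M) (hζ : NonZero ζ') (hgen : GenR q ζ')
    (hw : ∀ i, 1 - (w / ζ' i) ^ 2 * q ^ 2 ≠ 0) (Z : Fin M → ℂ)
    (hF : ∀ k (hk : k ≤ n), F (pat n M k) = compFn q ζ' Z
      (Finset.univ.filter fun j : Fin M => k < (j : ℕ) ∧ (j : ℕ) ≤ n) ⟨k, by omega⟩) :
    Rchain q w ζ' (tensorU σ F) (extreme (M + 2) (n + 1)) =
      chainFn q w ζ' Z (Finset.univ.filter fun j : Fin M => (j : ℕ) ≤ n) := by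
  classical
  set V := fun k => partialRchain q w ζ' (tensorU σ F) k (extreme (M + 2) (n + 1)) with hV
  -- The vector `u_σ` has no component with two signs `+`.
  have hV0 : V 0 = 0 := by
    simp only [hV, partialRchain, List.take_zero, List.foldl_nil, tensorU]
    have h1 : extreme (M + 2) (n + 1) (Fin.castSucc (Fin.last M)) = 1 := by
      simp only [extreme, Fin.val_castSucc, Fin.val_last]
      rw [if_neg (by omega)]
    have h2 : extreme (M + 2) (n + 1) (Fin.last (M + 1)) = 1 := by
      simp only [extreme, Fin.val_last]
      rw [if_neg (by omega)]
    rw [h1, h2]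
    simp [uVec, neg_one_ne_one_units.symm]
  set S : ℕ → Finset (Fin M) := fun k => Finset.univ.filter fun j : Fin M => k ≤ (j : ℕ) ∧ (j : ℕ) ≤ n
    with hS
  -- An invariant: `V K` accounts for the sites before `K`, and `chainFn` for those from `K` on. At
  -- `K = n + 1` no site is left in `S K`.
  have key : ∀ K, K ≤ n + 1 → chainFn q w ζ' Z (S 0) =
      chainFn q w ζ' Z (S K) + (∏ j ∈ S K, bR q (w / ζ' j)) * V K := by
    intro K hK
    induction K with
    | zero => rw [hV0, mul_zero, add_zero]
    | succ K ih =>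
      have hins : S K = insert ⟨K, by omega⟩ (S (K + 1)) := by
        ext j
        simp only [hS, Finset.mem_filter, Finset.mem_univ, true_and, Finset.mem_insert, Fin.ext_iff]
        omega
      have hnot : (⟨K, by omega⟩ : Fin M) ∉ S (K + 1) := by simp [hS]
      rw [ih (by omega), hins, chainFn_insert hq hζ hgen hw Z hnot, Finset.prod_insert hnot]
      have e := partialRchain_extreme_succ (q := q) (w := w) σ ζ' F hM (k := K) (by omega)
      rw [if_pos (by omega), hF K (by omega)] at e
      have e' : V (K + 1) = bR q (w / ζ' ⟨K, by omega⟩) * V K + cR q (w / ζ' ⟨K, by omega⟩) *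
        compFn q ζ' Z (S (K + 1)) ⟨K, by omega⟩ := e
      rw [e']
      ring
  have hlast : ∀ d, n + 1 + d ≤ M → V (n + 1 + d) = V (n + 1) := by
    intro d
    induction d with
    | zero => intro _; rfl
    | succ d ih =>
      intro hd
      have e := partialRchain_extreme_succ (q := q) (w := w) σ ζ' F hM (k := n + 1 + d) (by omega)
      rw [if_neg (by omega)] at e
      exact e.trans (ih (by omega))
  have hVM : Rchain q w ζ' (tensorU σ F) (extreme (M + 2) (n + 1)) = V M := by
    simp only [hV, partialRchain, Rchain]
    rw [List.take_of_length_le (by simp)]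
  have h2 := key (n + 1) le_rfl
  have h3 := hlast (M - (n + 1)) (by omega)
  rw [Nat.add_sub_cancel' hM] at h3
  have hS0 : S (n + 1) = ∅ := Finset.filter_eq_empty_iff.mpr fun j _ => by omega
  have hc : chainFn q w ζ' Z ∅ = 0 := Finset.sum_empty
  rw [hS0, hc, Finset.prod_empty, zero_add, one_mul] at h2
  rw [hVM, h3, ← h2]
  simp only [hS, Nat.zero_le, true_and]

end

end QKZ

namespace QKZ
open Set Filter

/-! ### Generic parameters -/

/-- The parameters are nonzero and the ratios of their squares are no even powers of `q`. -/
def Generic (q : ℂ) {N : ℕ} (ζ : Fin N → ℂ) : Prop :=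
  NonZero ζ ∧ ∀ i j, i ≠ j → ∀ k : ℤ, ζ i ^ 2 ≠ ζ j ^ 2 * q ^ (2 * k)

section

variable {q : ℂ} (hq0 : q ≠ 0) (hq1 : ‖q‖ < 1)

include hq0 hq1

lemma zpow_eq_one_iff_of_norm_lt {k : ℤ} : q ^ k = 1 ↔ k = 0 := by
  refine ⟨fun h => ?_, fun h => by rw [h, zpow_zero]⟩
  have h1 : ‖q‖ ^ k = 1 := by rw [← norm_zpow, h, norm_one]
  exact (zpow_eq_one_iff_right₀ (norm_nonneg q) hq1.ne).mp h1

lemma mul_zpow_injective {c : ℂ} (hc : c ≠ 0) {a b : ℤ} (h : c * q ^ a = c * q ^ b) : a = b := by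
  have h1 := mul_left_cancel₀ hc h
  have h2 : q ^ (a - b) = 1 := by
    rw [zpow_sub₀ hq0, h1, div_self (zpow_ne_zero _ hq0)]
  have := (zpow_eq_one_iff_of_norm_lt hq0 hq1).mp h2
  omega

lemma Generic.eq_of_mul_zpow {N : ℕ} {ζ : Fin N → ℂ} (hζ : Generic q ζ) {i j : Fin N} {a b : ℤ}
    (hab : Even (b - a)) (h : ζ i ^ 2 * q ^ a = ζ j ^ 2 * q ^ b) : i = j ∧ a = b := by
  obtain ⟨k, hk⟩ := hab
  have hij : i = j := by
    by_contra hij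
    refine hζ.2 i j hij k ?_
    have e : (2 * k : ℤ) = b - a := by omega
    rw [e, zpow_sub₀ hq0, ← mul_div_assoc, ← h, mul_div_assoc, div_self (zpow_ne_zero _ hq0),
      mul_one]
  subst hij
  exact ⟨rfl, mul_zpow_injective hq0 hq1 (pow_ne_zero 2 (hζ.1 i)) h⟩

omit hq1 in
lemma innerPt_eq_zpow {N : ℕ} (ζ : Fin N → ℂ) (j : Fin N) (k : ℕ) :
    innerPt q ζ j k = ζ j ^ 2 * q ^ (1 + 4 * (k : ℤ)) := by
  rw [innerPt]; norm_cast

omit hq1 in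
lemma outerPt_eq_zpow {N : ℕ} (ζ : Fin N → ℂ) (j : Fin N) (k : ℕ) :
    outerPt q ζ j k = ζ j ^ 2 * q ^ (-(1 + 4 * (k : ℤ))) := by
  rw [outerPt, zpow_neg, inv_pow]; norm_cast

/-- Inner and outer points are odd powers of `q` times some `z_j`. Genericity forces equal indices,
and then a positive exponent would have to equal a negative one. -/
lemma Generic.noPinch {N : ℕ} {ζ : Fin N → ℂ} (hζ : Generic q ζ) : NoPinch q ζ := by
  intro i j k k' h
  rw [innerPt_eq_zpow hq0, outerPt_eq_zpow hq0] at h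
  have := (hζ.eq_of_mul_zpow hq0 hq1 ⟨-1 - 2 * k - 2 * k', by ring⟩ h).2
  omega

omit hq1 in
lemma Generic.genR {N : ℕ} {ζ : Fin N → ℂ} (hζ : Generic q ζ) : GenR q ζ := by
  intro i j hij
  have hj := hζ.1 j
  have h := hζ.2 i j hij
  rw [div_pow]
  refine ⟨fun e => h 0 ?_, fun e => h (-1) ?_, fun e => h 1 ?_⟩
  · field_simp at e
    simp only [mul_zero, zpow_zero, mul_one]
    linear_combination -e
  · have h1 : (q : ℂ) ^ (2 * -1 : ℤ) = (q ^ 2)⁻¹ := by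
      rw [show (2 * -1 : ℤ) = -((2 : ℕ) : ℤ) from rfl, zpow_neg, zpow_natCast]
    rw [h1]
    field_simp at e ⊢
    linear_combination -e
  · have h1 : (q : ℂ) ^ (2 * 1 : ℤ) = q ^ 2 := by
      rw [mul_one]; norm_cast
    rw [h1]
    field_simp at e
    linear_combination e

end

/-! ### The kernel `∏ⱼ ψ(x / zⱼ)` -/

/-- `∏ⱼ ψ(x / zⱼ)`. -/
def psiProd (q : ℂ) {N : ℕ} (ζ : Fin N → ℂ) (x : ℂ) : ℂ :=
  kern (q ^ 4) (fun j => q / ζ j ^ 2) (fun j => ζ j ^ 2 * q) x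

lemma psi_div_eq (q x z : ℂ) :
    psi q (x / z) = 1 / (poch (x * (q / z)) (q ^ 4) * poch (z * q / x) (q ^ 4)) := by
  rw [psi, inv_div, div_mul_eq_mul_div, div_mul_eq_mul_div, mul_div_assoc]

lemma psiProd_eq (q : ℂ) {N : ℕ} (ζ : Fin N → ℂ) (x : ℂ) :
    psiProd q ζ x = ∏ j, psi q (x / ζ j ^ 2) := by
  rw [psiProd, kern]
  exact Finset.prod_congr rfl fun j _ => (psi_div_eq q x (ζ j ^ 2)).symm

lemma Psi_eq (q : ℂ) {m N : ℕ} (ϑ : (Fin m → ℂ) → (Fin N → ℂ) → ℂ) (x : Fin m → ℂ)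
    (ζ : Fin N → ℂ) : Psi q ϑ x ζ = ϑ x ζ * ∏ μ, psiProd q ζ (x μ) := by
  simp only [Psi, psiProd_eq]

lemma kernPole_inl (q : ℂ) {N : ℕ} (ζ : Fin N → ℂ) (a : Fin N × ℕ) :
    kernPole (q ^ 4) (fun j => q / ζ j ^ 2) (fun j => ζ j ^ 2 * q) (Sum.inl a) =
      outerPt q ζ a.1 a.2 := by
  simp only [kernPole, Sum.elim_inl, outerPt, inv_div, pow_add, pow_mul, pow_one, inv_pow]
  ring

lemma kernPole_inr (q : ℂ) {N : ℕ} (ζ : Fin N → ℂ) (a : Fin N × ℕ) :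
    kernPole (q ^ 4) (fun j => q / ζ j ^ 2) (fun j => ζ j ^ 2 * q) (Sum.inr a) =
      innerPt q ζ a.1 a.2 := by
  simp only [kernPole, Sum.elim_inr, innerPt, pow_add, pow_mul, pow_one]
  ring

lemma Generic.injective_kernPole {q : ℂ} (hq0 : q ≠ 0) (hq1 : ‖q‖ < 1) {N : ℕ} {ζ : Fin N → ℂ}
    (hζ : Generic q ζ) :
    Function.Injective (kernPole (q ^ 4) (fun j => q / ζ j ^ 2) (fun j => ζ j ^ 2 * q)) := by
  rintro (a | a) (b | b) h
  · rw [kernPole_inl, kernPole_inl, outerPt_eq_zpow hq0, outerPt_eq_zpow hq0] at h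
    have := hζ.eq_of_mul_zpow hq0 hq1 ⟨2 * a.2 - 2 * b.2, by ring⟩ h
    exact congrArg Sum.inl (Prod.ext this.1 (by omega))
  · rw [kernPole_inl, kernPole_inr] at h
    exact absurd h.symm (hζ.noPinch hq0 hq1 _ _ _ _)
  · rw [kernPole_inl, kernPole_inr] at h
    exact absurd h (hζ.noPinch hq0 hq1 _ _ _ _)
  · rw [kernPole_inr, kernPole_inr, innerPt_eq_zpow hq0, innerPt_eq_zpow hq0] at h
    have := hζ.eq_of_mul_zpow hq0 hq1 ⟨2 * b.2 - 2 * a.2, by ring⟩ h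
    exact congrArg Sum.inr (Prod.ext this.1 (by omega))

lemma norm_pow_four_lt {q : ℂ} (hq1 : ‖q‖ < 1) : ‖q ^ 4‖ < 1 := by
  rw [norm_pow]; exact pow_lt_one₀ (norm_nonneg _) hq1 (by norm_num)

/-- A set free of the poles of `psiProd`. -/
def poleFree (q : ℂ) {N : ℕ} (ζ : Fin N → ℂ) : Set ℂ :=
  {x | x ≠ 0 ∧ (∀ j k, x ≠ innerPt q ζ j k) ∧ ∀ j k, x ≠ outerPt q ζ j k}

lemma ne_kernPole {q : ℂ} {N : ℕ} {ζ : Fin N → ℂ} {x : ℂ} (hx : x ∈ poleFree q ζ) (a) :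
    kernPole (q ^ 4) (fun j => q / ζ j ^ 2) (fun j => ζ j ^ 2 * q) a ≠ x := by
  rcases a with a | a
  · rw [kernPole_inl]; exact (hx.2.2 _ _).symm
  · rw [kernPole_inr]; exact (hx.2.1 _ _).symm

lemma psi_denominator_ne_zero {q : ℂ} (hq0 : q ≠ 0) (hq1 : ‖q‖ < 1) {N : ℕ} {ζ : Fin N → ℂ}
    (hζ : NonZero ζ) {x : ℂ} (hx : x ∈ poleFree q ζ) (j : Fin N) :
    poch (x * (q / ζ j ^ 2)) (q ^ 4) * poch (ζ j ^ 2 * q / x) (q ^ 4) ≠ 0 :=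
  kern_denominator_ne_zero (α := fun j => q / ζ j ^ 2) (β := fun j => ζ j ^ 2 * q)
    (norm_pow_four_lt hq1) (fun j => div_ne_zero hq0 (pow_ne_zero 2 (hζ j))) hx.1 (ne_kernPole hx) j

lemma continuousOn_psiProd {q : ℂ} (hq0 : q ≠ 0) (hq1 : ‖q‖ < 1) {N : ℕ} {ζ : Fin N → ℂ}
    (hζ : NonZero ζ) : ContinuousOn (psiProd q ζ) (poleFree q ζ) :=
  continuousOn_kern (norm_pow_four_lt hq1) (fun j => div_ne_zero hq0 (pow_ne_zero 2 (hζ j)))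
    (fun _ hx => hx.1) fun _ hx => ne_kernPole hx

/-! ### Regular kernels -/

section

variable {m N : ℕ} {ϑ : (Fin m → ℂ) → (Fin N → ℂ) → ℂ} {ζ : Fin N → ℂ}

lemma RegularAt.eventually (h : RegularAt ϑ ζ) : ∀ᶠ ζ₂ in 𝓝 ζ, RegularAt ϑ ζ₂ := by
  obtain ⟨U, hU, hA⟩ := h
  filter_upwards [eventually_mem_nhds_iff.mpr hU] with ζ₂ h2 using ⟨U, h2, hA⟩

lemma RegularAt.differentiableAt (h : RegularAt ϑ ζ) {x : Fin m → ℂ} (hx : NonZero x) :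
    DifferentiableAt ℂ (fun y : (Fin m → ℂ) × (Fin N → ℂ) => ϑ y.1 y.2) (x, ζ) := by
  obtain ⟨U, hU, hA⟩ := h
  exact (hA (x, ζ) ⟨hx, mem_of_mem_nhds hU⟩).differentiableAt

lemma RegularAt.continuousOn (h : RegularAt ϑ ζ) :
    ContinuousOn (fun x => ϑ x ζ) {x | NonZero x} := fun x hx =>
  ((h.differentiableAt hx).continuousAt.comp (f := fun x => (x, ζ))
    (by fun_prop)).continuousWithinAt

lemma NonZero.update {k : ℕ} {x : Fin k → ℂ} (hx : NonZero x) (j : Fin k) {y : ℂ} (hy : y ≠ 0) :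
    NonZero (Function.update x j y) := fun i => by
  by_cases h : i = j
  · subst h; rwa [Function.update_self]
  · rw [Function.update_of_ne h]; exact hx i

lemma differentiable_update {k : ℕ} (x : Fin k → ℂ) (j : Fin k) :
    Differentiable ℂ fun y : ℂ => Function.update x j y :=
  differentiable_pi.mpr fun i => by
    by_cases h : i = j
    · subst h; simp only [Function.update_self]; exact differentiable_id
    · simp only [Function.update_of_ne h]; exact differentiable_const _

lemma RegularAt.differentiableOn_update (h : RegularAt ϑ ζ) {x : Fin m → ℂ} (hx : NonZero x)
    (k : Fin m) : DifferentiableOn ℂ (fun y => ϑ (Function.update x k y) ζ) {0}ᶜ := fun y hy =>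
  ((h.differentiableAt (hx.update k hy)).comp (f := fun y => (Function.update x k y, ζ)) y
    ((differentiable_update x k).differentiableAt.prodMk
      (differentiableAt_const ζ))).differentiableWithinAt

end

/-! ### Smoothness of `DeltaPol` -/

lemma differentiable_DeltaPol {E : Type*} [NormedAddCommGroup E] [NormedSpace ℂ E] (q : ℂ)
    {m n l : ℕ} {x : E → Fin m → ℂ} (a : Fin n → ℂ) {b : E → Fin l → ℂ}
    (hx : Differentiable ℂ x) (hb : Differentiable ℂ b) :
    Differentiable ℂ fun e => DeltaPol q (x e) a (b e) := by
  have hx' := differentiable_pi.mp hx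
  have hb' := differentiable_pi.mp hb
  simp only [DeltaPol, Matrix.det_apply, Matrix.of_apply, APol, fPol, gPol, phi, beta, esym]
  fun_prop

end QKZ

namespace QKZ
open Set Filter

/-! ### The right hand side of the recurrence -/

/-- The first `n + 1` places. -/
def headIdx {n l : ℕ} (j : Fin (n + 1)) : Fin (n + (l + 1)) := ⟨j, by omega⟩

/-- The last `l` places. -/
def tailIdx {n l : ℕ} (i : Fin l) : Fin (n + (l + 1)) := ⟨n + 1 + i, by omega⟩

lemma headIdx_injective {n l : ℕ} : Function.Injective (headIdx : Fin (n + 1) → Fin (n + (l + 1))) :=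
  fun _ _ h => Fin.ext (by simpa [headIdx] using h)

/-- The sum over the small polynomials `Δ`. -/
def sumDelta (q z : ℂ) {m n l : ℕ} (a : Fin (n + 1) → ℂ) (b : Fin l → ℂ) (x : Fin m → ℂ) : ℂ :=
  ∑ i, betaVal q b (a i) / ((a i - z) * ∏ r, (a i - a (i.succAbove r))) *
    DeltaPol q x (a ∘ i.succAbove) (Fin.cons (a i) b)

/-- The exchange brings the `i`-th variable to the front of the second group. The others may appear
in a different order than in `i.succAbove`, which is harmless by symmetry. -/
lemma bracketExt_comp_swap (q : ℂ) {m n l : ℕ} (x : Fin m → ℂ) (ζ : Fin (n + (l + 1)) → ℂ)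
    (i : Fin (n + 1)) :
    bracketExt q x (ζ ∘ Equiv.swap (headIdx i) ⟨n, by omega⟩) =
      DeltaPol q x ((fun j => ζ (headIdx j) ^ 2) ∘ i.succAbove)
        (Fin.cons (ζ (headIdx i) ^ 2) fun t => ζ (tailIdx t) ^ 2) /
      (∏ r, ((ζ (headIdx i) ^ 2 - ζ (headIdx (i.succAbove r)) ^ 2 * q⁻¹ ^ 2) *
        ∏ t : Fin l, (ζ (tailIdx t) ^ 2 - ζ (headIdx (i.succAbove r)) ^ 2 * q⁻¹ ^ 2))) *
      ∏ r, ζ (headIdx (i.succAbove r)) := by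
  obtain ⟨ρ, hρ⟩ := exists_perm_comp_eq (f := fun j : Fin n => Equiv.swap i (Fin.last n) j.castSucc)
    (g := i.succAbove) (fun j k e => Fin.castSucc_injective n (Equiv.injective _ e)) fun j =>
      Fin.exists_succAbove_eq (fun e => by
        have := (Equiv.swap i (Fin.last n)).injective (e.trans (Equiv.swap_apply_right i _).symm)
        exact absurd this (Fin.castSucc_lt_last j).ne)
  have hn : (⟨n, by omega⟩ : Fin (n + (l + 1))) = headIdx (Fin.last n) := rfl
  have h1 : ∀ j : Fin n, Equiv.swap (headIdx i) ⟨n, by omega⟩ (Fin.castAdd (l + 1) j) =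
      headIdx (i.succAbove (ρ j)) := fun j => by
    have e : Fin.castAdd (l + 1) j = headIdx j.castSucc := rfl
    rw [hn, e, headIdx_injective.swap_apply]
    exact congrArg headIdx (congrFun hρ j)
  have h2 : ∀ t : Fin (l + 1), ζ (Equiv.swap (headIdx i) ⟨n, by omega⟩ (Fin.natAdd n t)) ^ 2 =
      (Fin.cons (ζ (headIdx i) ^ 2) fun t => ζ (tailIdx t) ^ 2 : Fin (l + 1) → ℂ) t := by
    refine Fin.cases ?_ fun t => ?_
    · have e : Fin.natAdd n (0 : Fin (l + 1)) = ⟨n, by omega⟩ := rfl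
      rw [e, Equiv.swap_apply_right, Fin.cons_zero]
    · have e : Fin.natAdd n t.succ = tailIdx t := Fin.ext (by simp [tailIdx]; omega)
      rw [e, Equiv.swap_apply_of_ne_of_ne, Fin.cons_succ]
      · exact fun e => by
          have := congrArg Fin.val e
          simp only [tailIdx, headIdx] at this; omega
      · exact fun e => by
          have := congrArg Fin.val e
          simp only [tailIdx] at this; omega
  unfold bracketExt
  simp only [Function.comp_apply, h1, h2]
  have e1 := DeltaPol_comp_perm q x ((fun j => ζ (headIdx j) ^ 2) ∘ i.succAbove)
    (Fin.cons (ζ (headIdx i) ^ 2) fun t => ζ (tailIdx t) ^ 2) ρ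
  have e2 : ((fun j : Fin n => ζ (headIdx (i.succAbove (ρ j))) ^ 2)) =
    ((fun j => ζ (headIdx j) ^ 2) ∘ i.succAbove) ∘ ρ := rfl
  rw [e2, e1, Equiv.prod_comp ρ fun j => ζ (headIdx (i.succAbove j)),
    Equiv.prod_comp ρ fun j => ∏ t : Fin (l + 1),
      ((Fin.cons (ζ (headIdx i) ^ 2) fun t => ζ (tailIdx t) ^ 2 : Fin (l + 1) → ℂ) t -
        ζ (headIdx (i.succAbove j)) ^ 2 * q⁻¹ ^ 2)]
  simp only [Fin.prod_univ_succ, Fin.cons_zero, Fin.cons_succ]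

/-- The common factor of all terms on the right hand side. -/
def chainConst (q w : ℂ) {n l : ℕ} (ζ : Fin (n + (l + 1)) → ℂ) : ℂ :=
  (1 - q ^ 2) * w * (∏ j, ζ (headIdx j)) * q ^ (2 * n) * (-q) ^ l *
    (∏ j : Fin (n + 1), (ζ (headIdx j) ^ 2 - w ^ 2)) /
    (∏ j : Fin (n + 1), (ζ (headIdx j) ^ 2 - w ^ 2 * q ^ 2)) /
    ∏ j, ∏ t : Fin l, (ζ (tailIdx t) ^ 2 - ζ (headIdx j) ^ 2 * q⁻¹ ^ 2)

/-- The entries of the `R` matrices cancel against the denominators of the extreme component. Apart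
from a factor common to all `i`, the Lagrange weight of `sumDelta` is left, the one that also arises
in `DeltaPol_snoc_eq`. -/
lemma cR_mul_prod_eq {q w : ℂ} (hq : q ≠ 0) {n l : ℕ} {ζ : Fin (n + (l + 1)) → ℂ}
    (hζ : Generic q ζ) (hw : ∀ i (k : ℤ), ζ i ^ 2 ≠ w ^ 2 * q ^ (2 * k)) (i : Fin (n + 1)) :
    cR q (w / ζ (headIdx i)) * (∏ r, bR q (w / ζ (headIdx (i.succAbove r))) *
        (bR q (ζ (headIdx i) / ζ (headIdx (i.succAbove r))))⁻¹) *
      ((∏ r, ((ζ (headIdx i) ^ 2 - ζ (headIdx (i.succAbove r)) ^ 2 * q⁻¹ ^ 2) *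
        ∏ t : Fin l, (ζ (tailIdx t) ^ 2 - ζ (headIdx (i.succAbove r)) ^ 2 * q⁻¹ ^ 2)))⁻¹ *
      ∏ r, ζ (headIdx (i.succAbove r))) =
    chainConst q w ζ * (betaVal q (fun t : Fin l => ζ (tailIdx t) ^ 2) (ζ (headIdx i) ^ 2) /
      ((ζ (headIdx i) ^ 2 - w ^ 2) *
        ∏ r, (ζ (headIdx i) ^ 2 - ζ (headIdx (i.succAbove r)) ^ 2))) := by
  have hz0 : ∀ j, ζ (headIdx j) ≠ 0 := fun j => hζ.1 _
  have hne : ∀ i j : Fin (n + (l + 1)), i ≠ j → ζ i ^ 2 - ζ j ^ 2 ≠ 0 ∧ ζ i ^ 2 - ζ j ^ 2 * q⁻¹ ^ 2 ≠ 0 := by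
    intro i j hij
    refine ⟨fun e => hζ.2 i j hij 0 ?_, fun e => hζ.2 i j hij (-1) ?_⟩
    · simpa using sub_eq_zero.mp e
    · rw [sub_eq_zero.mp e, inv_pow, show (2 * -1 : ℤ) = -((2 : ℕ) : ℤ) from rfl, zpow_neg,
        zpow_natCast]
  have hw0 : ∀ i, ζ i ^ 2 - w ^ 2 ≠ 0 := fun i e => hw i 0 (by simpa using sub_eq_zero.mp e)
  have hw1 : ∀ i, ζ i ^ 2 - w ^ 2 * q ^ 2 ≠ 0 := fun i e => hw i 1 (by
    rw [sub_eq_zero.mp e, mul_one]; norm_cast)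
  have hA : ∀ r, bR q (w / ζ (headIdx (i.succAbove r))) *
        (bR q (ζ (headIdx i) / ζ (headIdx (i.succAbove r))))⁻¹ *
        (ζ (headIdx i) ^ 2 - ζ (headIdx (i.succAbove r)) ^ 2 * q⁻¹ ^ 2)⁻¹ =
      q ^ 2 * (ζ (headIdx (i.succAbove r)) ^ 2 - w ^ 2) /
        (ζ (headIdx (i.succAbove r)) ^ 2 - w ^ 2 * q ^ 2) *
        (ζ (headIdx i) ^ 2 - ζ (headIdx (i.succAbove r)) ^ 2)⁻¹ := by
    intro r
    have hir : (headIdx i : Fin (n + (l + 1))) ≠ headIdx (i.succAbove r) := fun e =>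
      Fin.succAbove_ne i r (headIdx_injective e).symm
    have h1 := hz0 (i.succAbove r)
    have h2 := (hne _ _ hir).1
    have h3 := (hne _ _ hir).2
    have h4 := hw1 (headIdx (i.succAbove r))
    have h5 := (hne _ _ hir.symm).1
    have h6 : ζ (headIdx (i.succAbove r)) ^ 2 - ζ (headIdx i) ^ 2 * q ^ 2 ≠ 0 := fun e => h3 (by
      field_simp; linear_combination -e)
    generalize ζ (headIdx (i.succAbove r)) = t at *
    generalize ζ (headIdx i) = s at *
    have e1 : bR q (w / t) = q * (t ^ 2 - w ^ 2) / (t ^ 2 - w ^ 2 * q ^ 2) := by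
      have : 1 - (w / t) ^ 2 * q ^ 2 ≠ 0 := fun e => h4 (by field_simp at e; linear_combination e)
      rw [bR, div_eq_div_iff this h4]
      field_simp
    have e2 : (bR q (s / t))⁻¹ = (t ^ 2 - s ^ 2 * q ^ 2) / (q * (t ^ 2 - s ^ 2)) := by
      have : (1 - (s / t) ^ 2) * q ≠ 0 := mul_ne_zero
        (fun e => h5 (by field_simp at e; linear_combination e)) hq
      rw [bR, inv_div, div_eq_div_iff this (mul_ne_zero hq h5)]
      field_simp
    have e3 : (s ^ 2 - t ^ 2 * q⁻¹ ^ 2)⁻¹ = -q ^ 2 / (t ^ 2 - s ^ 2 * q ^ 2) := by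
      rw [inv_eq_iff_eq_inv, inv_div, eq_div_iff (neg_ne_zero.mpr (pow_ne_zero 2 hq))]
      field_simp
      ring
    have e4 : (s ^ 2 - t ^ 2)⁻¹ = -(t ^ 2 - s ^ 2)⁻¹ := by rw [← inv_neg, neg_sub]
    rw [e1, e2, e3, e4]
    rw [mul_comm (s ^ 2)] at h6 ⊢
    field_simp
  have hc : cR q (w / ζ (headIdx i)) = (1 - q ^ 2) * w * ζ (headIdx i) /
      (ζ (headIdx i) ^ 2 - w ^ 2 * q ^ 2) := by
    have h1 := hz0 i
    have h4 := hw1 (headIdx i)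
    generalize ζ (headIdx i) = s at *
    have : 1 - (w / s) ^ 2 * q ^ 2 ≠ 0 := fun e => h4 (by field_simp at e; linear_combination e)
    rw [cR, div_eq_div_iff this h4]
    field_simp
  have hbeta : (-q) ^ l * betaVal q (fun t : Fin l => ζ (tailIdx t) ^ 2) (ζ (headIdx i) ^ 2) =
      ∏ t : Fin l, (ζ (tailIdx t) ^ 2 - ζ (headIdx i) ^ 2 * q⁻¹ ^ 2) := by
    have : (-q) ^ l = ∏ _t : Fin l, (-q) := by simp
    rw [this, betaVal, ← Finset.prod_mul_distrib]
    refine Finset.prod_congr rfl fun t _ => ?_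
    field_simp
    ring
  have hb0 : ∏ t : Fin l, (ζ (tailIdx t) ^ 2 - ζ (headIdx i) ^ 2 * q⁻¹ ^ 2) ≠ 0 :=
    Finset.prod_ne_zero_iff.mpr fun t _ => (hne _ _ fun e => by
      have := congrArg Fin.val e
      simp only [tailIdx, headIdx] at this; omega).2
  have hA' : (∏ r, bR q (w / ζ (headIdx (i.succAbove r))) *
        (bR q (ζ (headIdx i) / ζ (headIdx (i.succAbove r))))⁻¹) *
        (∏ r, (ζ (headIdx i) ^ 2 - ζ (headIdx (i.succAbove r)) ^ 2 * q⁻¹ ^ 2))⁻¹ =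
      q ^ (2 * n) * (∏ r, (ζ (headIdx (i.succAbove r)) ^ 2 - w ^ 2)) /
        (∏ r, (ζ (headIdx (i.succAbove r)) ^ 2 - w ^ 2 * q ^ 2)) *
        (∏ r, (ζ (headIdx i) ^ 2 - ζ (headIdx (i.succAbove r)) ^ 2))⁻¹ := by
    rw [← Finset.prod_inv_distrib, ← Finset.prod_mul_distrib, Finset.prod_congr rfl fun r _ => hA r,
      Finset.prod_mul_distrib, Finset.prod_div_distrib, Finset.prod_mul_distrib, Finset.prod_const,
      Finset.card_univ, Fintype.card_fin, ← pow_mul, Finset.prod_inv_distrib]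
  have hsplit : ∏ r, ((ζ (headIdx i) ^ 2 - ζ (headIdx (i.succAbove r)) ^ 2 * q⁻¹ ^ 2) *
      ∏ t : Fin l, (ζ (tailIdx t) ^ 2 - ζ (headIdx (i.succAbove r)) ^ 2 * q⁻¹ ^ 2)) =
      (∏ r, (ζ (headIdx i) ^ 2 - ζ (headIdx (i.succAbove r)) ^ 2 * q⁻¹ ^ 2)) *
      ∏ r, ∏ t : Fin l, (ζ (tailIdx t) ^ 2 - ζ (headIdx (i.succAbove r)) ^ 2 * q⁻¹ ^ 2) :=
    Finset.prod_mul_distrib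
  rw [chainConst, Fin.prod_univ_succAbove (fun j => ζ (headIdx j)) i,
    Fin.prod_univ_succAbove (fun j : Fin (n + 1) => ζ (headIdx j) ^ 2 - w ^ 2) i,
    Fin.prod_univ_succAbove (fun j : Fin (n + 1) => ζ (headIdx j) ^ 2 - w ^ 2 * q ^ 2) i,
    Fin.prod_univ_succAbove (fun j : Fin (n + 1) => ∏ t : Fin l,
      (ζ (tailIdx t) ^ 2 - ζ (headIdx j) ^ 2 * q⁻¹ ^ 2)) i, hsplit, mul_inv, hc, ← hbeta]
  rw [← hbeta] at hb0
  have hb1 := left_ne_zero_of_mul hb0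
  have hb2 := right_ne_zero_of_mul hb0
  have h7 := hw0 (headIdx i)
  have h8 := hw1 (headIdx i)
  set D1 := ∏ r, (ζ (headIdx (i.succAbove r)) ^ 2 - w ^ 2 * q ^ 2)
  set D2 := ∏ r, (ζ (headIdx i) ^ 2 - ζ (headIdx (i.succAbove r)) ^ 2)
  set D3 := ∏ r, ∏ t : Fin l, (ζ (tailIdx t) ^ 2 - ζ (headIdx (i.succAbove r)) ^ 2 * q⁻¹ ^ 2)
  set D4 := ∏ r, (ζ (headIdx i) ^ 2 - ζ (headIdx (i.succAbove r)) ^ 2 * q⁻¹ ^ 2)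
  set N1 := ∏ r, (bR q (w / ζ (headIdx (i.succAbove r))) *
        (bR q (ζ (headIdx i) / ζ (headIdx (i.succAbove r))))⁻¹)
  set N2 := ∏ r, ζ (headIdx (i.succAbove r))
  set N3 := ∏ r, (ζ (headIdx (i.succAbove r)) ^ 2 - w ^ 2)
  generalize betaVal q (fun t : Fin l => ζ (tailIdx t) ^ 2) (ζ (headIdx i) ^ 2) = Bt at *
  have e : (1 - q ^ 2) * w * ζ (headIdx i) / (ζ (headIdx i) ^ 2 - w ^ 2 * q ^ 2) * N1 *
      (D4⁻¹ * D3⁻¹ * N2) = (1 - q ^ 2) * w * ζ (headIdx i) / (ζ (headIdx i) ^ 2 - w ^ 2 * q ^ 2) *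
      (N1 * D4⁻¹) * D3⁻¹ * N2 := by ring
  rw [e, hA']
  field_simp

lemma IsContour.mem_poleFree {q : ℂ} {N : ℕ} {ζ : Fin N → ℂ} {γ : ℝ → ℂ} (h : IsContour q ζ γ)
    {t : ℝ} (ht : t ∈ Icc (0 : ℝ) 1) : γ t ∈ poleFree q ζ :=
  ⟨h.ne_zero t ht, h.ne_inner t ht, h.ne_outer t ht⟩

lemma multiContour_sum {q : ℂ} {N : ℕ} {ζ : Fin N → ℂ} {γ : ℝ → ℂ} (h : IsContour q ζ γ) {m : ℕ}
    {κ : Type*} (s : Finset κ) (c : κ → ℂ) {F : κ → (Fin m → ℂ) → ℂ}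
    (hF : ∀ k ∈ s, ContinuousOn (F k) {x | ∀ μ, x μ ∈ poleFree q ζ}) :
    multiContour γ (fun x => ∑ k ∈ s, c k * F k x) = ∑ k ∈ s, c k * multiContour γ (F k) := by
  obtain ⟨Γ, hΓ, -, hm⟩ := h.exists_loop
  have e : ∀ G : (Fin m → ℂ) → ℂ, multiContour γ G =
      cycMulti (fun _ : Unit => Γ) (fun _ => Pi.single () 1) G := fun G => by
    rw [hm, cycMulti_single]
  have hsub : cube (fun _ : Unit => Γ) m ⊆ {x | ∀ μ, x μ ∈ poleFree q ζ} := fun x hx μ => by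
    obtain ⟨_, t, ht, hx⟩ := mem_iUnion.mp (hx μ)
    rw [← hx, hΓ]
    exact h.mem_poleFree ht
  rw [e, cycMulti_sum s (F := fun k x => c k * F k x) fun k hk => continuousOn_const.mul ((hF k hk).mono hsub)]
  refine Finset.sum_congr rfl fun k _ => ?_
  rw [cycMulti_const_mul, ← e]

lemma continuousOn_Psi {q : ℂ} (hq0 : q ≠ 0) (hq1 : ‖q‖ < 1) {m N : ℕ}
    {ϑ : (Fin m → ℂ) → (Fin N → ℂ) → ℂ} {ζ : Fin N → ℂ} (hζ : NonZero ζ) (h : RegularAt ϑ ζ) :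
    ContinuousOn (fun x => Psi q ϑ x ζ) {x | ∀ μ, x μ ∈ poleFree q ζ} := by
  simp only [Psi_eq]
  refine ContinuousOn.mul (h.continuousOn.mono fun x hx μ => (hx μ).1)
    (continuousOn_finsetProd _ fun μ _ => ?_)
  exact (continuousOn_psiProd hq0 hq1 hζ).comp (continuous_apply μ).continuousOn fun x hx => hx μ

lemma differentiable_bracketExt (q : ℂ) {m n l : ℕ} (ζ : Fin (n + l) → ℂ) :
    Differentiable ℂ fun x : Fin m → ℂ => bracketExt q x ζ := by
  unfold bracketExt
  have := differentiable_DeltaPol q (x := fun x : Fin m → ℂ => x)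
    (fun j => ζ (Fin.castAdd l j) ^ 2) (b := fun _ i => ζ (Fin.natAdd n i) ^ 2)
    differentiable_id (differentiable_const _)
  fun_prop

/-- The right hand side of the recurrence. -/
theorem Rchain_Gbar_extreme {q w : ℂ} (hq0 : q ≠ 0) (hq1 : ‖q‖ < 1) (σ : ℤˣ) {m n l : ℕ}
    {ϑ : (Fin m → ℂ) → (Fin (n + (l + 1)) → ℂ) → ℂ} {ζ : Fin (n + (l + 1)) → ℂ} {γ : ℝ → ℂ}
    (hζ : Generic q ζ) (hw : ∀ i (k : ℤ), ζ i ^ 2 ≠ w ^ 2 * q ^ (2 * k)) (hϑ : RegularAt ϑ ζ)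
    (hγ : IsContour q ζ γ) :
    Rchain q w ζ (tensorU σ (Gbar q ϑ γ ζ)) (extreme (n + (l + 1) + 2) (n + 1)) =
      chainConst q w ζ * ((m.factorial : ℂ)⁻¹ * multiContour γ fun x => Psi q ϑ x ζ *
        sumDelta q (w ^ 2) (fun j => ζ (headIdx j) ^ 2) (fun t => ζ (tailIdx t) ^ 2) x) := by
  classical
  set Z : Fin (n + (l + 1)) → ℂ := fun i => (m.factorial : ℂ)⁻¹ * multiContour γ fun x =>
    Psi q ϑ x ζ * bracketExt q x (ζ ∘ Equiv.swap i ⟨n, by omega⟩) with hZ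
  have hcP := continuousOn_Psi hq0 hq1 hζ.1 hϑ
  have hb : ∀ i, Continuous fun x : Fin m → ℂ =>
      bracketExt q x (ζ ∘ Equiv.swap i ⟨n, by omega⟩) := fun i =>
    (differentiable_bracketExt q (ζ ∘ Equiv.swap i ⟨n, by omega⟩)).continuous
  have hG : ∀ i, ContinuousOn (fun x : Fin m → ℂ => Psi q ϑ x ζ *
      bracketExt q x (ζ ∘ Equiv.swap i ⟨n, by omega⟩)) {x | ∀ μ, x μ ∈ poleFree q ζ} := fun i =>
    hcP.mul (hb i).continuousOn
  -- All components in question are combinations of extreme components at exchanged variables, with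
  -- coefficients independent of `x`, so the combinations pass through the integral.
  have hlin : ∀ (s : Finset (Fin (n + (l + 1)))) (c : Fin (n + (l + 1)) → ℂ),
      (m.factorial : ℂ)⁻¹ * multiContour γ (fun x => Psi q ϑ x ζ *
        ∑ i ∈ s, c i * bracketExt q x (ζ ∘ Equiv.swap i ⟨n, by omega⟩)) = ∑ i ∈ s, c i * Z i := by
    intro s c
    simp only [hZ, mul_left_comm _ (m.factorial : ℂ)⁻¹, ← Finset.mul_sum]
    congr 1
    have h := multiContour_sum hγ s c (F := fun i x => Psi q ϑ x ζ *
      bracketExt q x (ζ ∘ Equiv.swap i ⟨n, by omega⟩)) fun i _ => hG i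
    refine Eq.trans ?_ h
    congr 1
    funext x
    rw [Finset.mul_sum]
    exact Finset.sum_congr rfl fun i _ => mul_left_comm _ _ _
  have hcomp : ∀ (Y : Fin (n + (l + 1)) → ℂ) (S : Finset (Fin (n + (l + 1)))) (k) (_ : k ∉ S),
      compFn q ζ Y S k = ∑ i ∈ insert k S, (if i = k then ∏ t ∈ S, (bR q (ζ k / ζ t))⁻¹ else
        -(cR q (ζ k / ζ i) / bR q (ζ k / ζ i) * (∏ t ∈ S.erase i, (bR q (ζ i / ζ t))⁻¹))) * Y i := by
    intro Y S k hk
    rw [Finset.sum_insert hk, if_pos rfl, compFn, sub_eq_add_neg, ← Finset.sum_neg_distrib,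
      mul_comm (Y k)]
    congr 1
    refine Finset.sum_congr rfl fun i hi => ?_
    rw [if_neg (fun e : i = k => hk (by rw [← e]; exact hi)), neg_mul]
  have hchain := Rchain_extreme (n := n) σ ζ (Gbar q ϑ γ ζ) (w := w) hq0 (by omega) hζ.1
    (hζ.genR hq0)
    (fun i e => hw i 1 (by
      have := hζ.1 i
      have h1 : (q : ℂ) ^ (2 * 1 : ℤ) = q ^ 2 := by rw [mul_one]; norm_cast
      rw [h1]
      field_simp at e
      linear_combination e)) Z fun k hk => by
      have hnot : (⟨k, by omega⟩ : Fin (n + (l + 1))) ∉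
        Finset.univ.filter fun j : Fin (n + (l + 1)) => k < (j : ℕ) ∧ (j : ℕ) ≤ n := by simp
      rw [hcomp _ _ _ hnot, ← hlin]
      simp only [Gbar]
      congr 2
      funext x
      rw [bracket_pat hq0 (Nat.succ_pos l) x hζ.1 (hζ.genR hq0) hk, hcomp _ _ _ hnot]
  rw [hchain]
  have himg : (Finset.univ.filter fun j : Fin (n + (l + 1)) => (j : ℕ) ≤ n) =
      Finset.univ.map ⟨headIdx, headIdx_injective⟩ := by
    ext j
    simp only [Finset.mem_filter, Finset.mem_univ, true_and, Finset.mem_map,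
      Function.Embedding.coeFn_mk]
    exact ⟨fun h => ⟨⟨j, by omega⟩, rfl⟩, fun ⟨i, hi⟩ => by
      rw [← hi]; exact Nat.lt_succ_iff.mp i.2⟩
  have herase : ∀ (i : Fin (n + 1)) (f : Fin (n + (l + 1)) → ℂ),
      ∏ t ∈ (Finset.univ.map ⟨headIdx, headIdx_injective⟩).erase (headIdx i), f t =
        ∏ r, f (headIdx (i.succAbove r)) := by
    intro i f
    have e : (Finset.univ.map ⟨(headIdx : Fin (n + 1) → Fin (n + (l + 1))), headIdx_injective⟩).erase
        (headIdx i) = (Finset.univ.erase i).map ⟨headIdx, headIdx_injective⟩ := by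
      rw [Finset.map_erase]; rfl
    rw [e, Finset.prod_map]
    have h2 : (Finset.univ.erase i) = Finset.univ.image i.succAbove := by
      rw [Fin.image_succAbove_univ, Finset.compl_singleton]
    rw [h2, Finset.prod_image fun _ _ _ _ h => Fin.succAbove_right_injective h]
    rfl
  have hterm : chainFn q w ζ Z (Finset.univ.map ⟨headIdx, headIdx_injective⟩) =
      ∑ i ∈ Finset.univ.map ⟨(headIdx : Fin (n + 1) → Fin (n + (l + 1))), headIdx_injective⟩,
        (cR q (w / ζ i) * (∏ t ∈ (Finset.univ.map ⟨headIdx, headIdx_injective⟩).erase i,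
          bR q (w / ζ t) * (bR q (ζ i / ζ t))⁻¹)) * Z i := rfl
  rw [himg, hterm, ← hlin, mul_left_comm]
  congr 1
  have hc1 := multiContour_sum hγ (m := m) Finset.univ (fun _ : Unit => chainConst q w ζ)
    (F := fun _ x => Psi q ϑ x ζ *
        sumDelta q (w ^ 2) (fun j => ζ (headIdx j) ^ 2) (fun t => ζ (tailIdx t) ^ 2) x)
    fun _ _ => hcP.mul (Differentiable.continuous (𝕜 := ℂ) (by
      unfold sumDelta
      have := fun i : Fin (n + 1) => differentiable_DeltaPol q (x := fun x : Fin m → ℂ => x)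
        ((fun j => ζ (headIdx j) ^ 2) ∘ i.succAbove)
        (b := fun _ => (Fin.cons (ζ (headIdx i) ^ 2) fun t => ζ (tailIdx t) ^ 2))
        differentiable_id (differentiable_const _)
      fun_prop)).continuousOn
  simp only [Finset.univ_unique, Finset.sum_singleton] at hc1
  rw [← hc1]
  congr 1
  funext x
  rw [mul_left_comm]
  congr 1
  rw [Finset.sum_map, sumDelta, Finset.mul_sum]
  refine Finset.sum_congr rfl fun i _ => ?_
  simp only [Function.Embedding.coeFn_mk]
  rw [herase, bracketExt_comp_swap, ← mul_assoc (chainConst q w ζ), ← cR_mul_prod_eq hq0 hζ hw i]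
  ring

end QKZ

namespace QKZ
open Set Filter

/-! ### Scaled loops -/

/-- The image of a loop under multiplication by a constant. -/
def Loop.scale (Γ : Loop) (c : ℂ) (hc : c ≠ 0) : Loop where
  γ t := c * Γ.γ t
  D t := c * Γ.D t
  contD := continuousOn_const.mul Γ.contD
  hasDeriv t ht := (Γ.hasDeriv t ht).const_mul c
  cont := continuousOn_const.mul Γ.cont
  closed := by rw [Γ.closed]
  ne_zero t ht := mul_ne_zero hc (Γ.ne_zero t ht)

lemma Loop.scale_int (Γ : Loop) {c : ℂ} (hc : c ≠ 0) (f : ℂ → ℂ) :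
    (Γ.scale c hc).int f = c * Γ.int fun x => f (c * x) := by
  rw [← Loop.int_const_mul]
  unfold Loop.int
  congr 1
  refine intervalIntegral.integral_congr fun t _ => ?_
  simp only [Loop.scale]
  ring

lemma Loop.scale_wind (Γ : Loop) {c : ℂ} (hc : c ≠ 0) (p : ℂ) :
    (Γ.scale c hc).wind p = Γ.wind (p / c) := by
  rw [Loop.wind, Loop.scale_int, ← Loop.int_const_mul, Loop.wind]
  congr 1
  funext x
  have e : c * x - p = c * (x - p / c) := by rw [mul_sub, mul_div_cancel₀ _ hc]
  rw [e, mul_inv, ← mul_assoc, mul_inv_cancel₀ hc, one_mul]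

lemma Loop.mem_scale_supp (Γ : Loop) {c : ℂ} (hc : c ≠ 0) {y : ℂ} (hy : y ∈ (Γ.scale c hc).supp) :
    ∃ x ∈ Γ.supp, y = c * x := by
  obtain ⟨t, ht, rfl⟩ := hy
  exact ⟨Γ.γ t, Γ.mem_supp ht, rfl⟩

variable {ι : Type*} [Fintype ι]

lemma cycInt_sub {Γ : ι → Loop} {W : ι → ℂ} {f g : ℂ → ℂ}
    (hf : ∀ i, ContinuousOn f (Γ i).supp) (hg : ∀ i, ContinuousOn g (Γ i).supp) :
    cycInt Γ W (fun x => f x - g x) = cycInt Γ W f - cycInt Γ W g := by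
  have h := cycInt_add (W := W) (g := fun x => -1 * g x) hf fun i => continuousOn_const.mul (hg i)
  rw [cycInt_const_mul] at h
  rw [sub_eq_add_neg, ← neg_one_mul (cycInt Γ W g), ← h]
  exact cycInt_congr fun _ x _ => by ring

lemma mul_one_div_mul_cancel {u a b : ℂ} (hu : u ≠ 0) :
    u * (1 / (a * (u * b))) = 1 / (a * b) := by
  rw [mul_left_comm a, one_div, one_div, mul_inv, mul_inv_cancel_left₀ hu]

section

variable {q : ℂ} (hq0 : q ≠ 0) (hq1 : ‖q‖ < 1) {N : ℕ} {ζ : Fin N → ℂ}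

include hq0

lemma q_pow_four_mul_outerPt (j : Fin N) (k : ℕ) :
    outerPt q ζ j (k + 1) = q⁻¹ ^ 4 * outerPt q ζ j k := by
  rw [outerPt, outerPt]; ring

lemma innerPt_eq_inv_mul (j : Fin N) (k : ℕ) :
    innerPt q ζ j k = q⁻¹ ^ 4 * innerPt q ζ j (k + 1) := by
  rw [innerPt, innerPt, show 1 + 4 * (k + 1) = 1 + 4 * k + 4 by ring, pow_add q _ 4, inv_pow]
  field_simp

include hq1

/-- The additional factors remove the first outer pole `z_j τ` of each family. -/
lemma psiProd_mul_prod_sub {x : ℂ} (hζ : NonZero ζ)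
    (h : ∀ j, x ≠ ζ j ^ 2 * q⁻¹) :
    (∏ j, (1 - x * q / ζ j ^ 2)) * psiProd q ζ x =
      kern (q ^ 4) (fun j => q ^ 5 / ζ j ^ 2) (fun j => ζ j ^ 2 * q) x := by
  rw [psiProd, kern, kern, ← Finset.prod_mul_distrib]
  refine Finset.prod_congr rfl fun j _ => ?_
  have hz := hζ j
  have h1 : 1 - x * q / ζ j ^ 2 ≠ 0 := fun e => h j (by field_simp at e ⊢; linear_combination -e)
  rw [poch_eq_one_sub_mul (x * (q / ζ j ^ 2)) (norm_pow_four_lt hq1), ← mul_div_assoc x q,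
    mul_assoc (1 - x * q / ζ j ^ 2), ← mul_div_assoc, mul_one, ← div_div, div_self h1]
  congr 3
  ring

/-- Dilation by `τ⁴` shifts both families of poles by one step, so that the same kernel becomes
`psiProd` without its first inner poles `z_j q`. -/
lemma kern_mul_inv_pow_four {x : ℂ} (hx : x ≠ 0) (hζ : NonZero ζ)
    (h : ∀ j, x ≠ ζ j ^ 2 * q) :
    kern (q ^ 4) (fun j => q ^ 5 / ζ j ^ 2) (fun j => ζ j ^ 2 * q) (q⁻¹ ^ 4 * x) =
      (∏ j, (1 - ζ j ^ 2 * q / x)) * psiProd q ζ x := by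
  rw [psiProd, kern, kern, ← Finset.prod_mul_distrib]
  refine Finset.prod_congr rfl fun j _ => ?_
  have hz := hζ j
  have h1 : 1 - ζ j ^ 2 * q / x ≠ 0 := fun e => h j (by field_simp at e ⊢; linear_combination e)
  rw [poch_eq_one_sub_mul (ζ j ^ 2 * q / x) (norm_pow_four_lt hq1), mul_one_div_mul_cancel h1]
  congr 3
  · field_simp
  · field_simp

/-- Integrals of exact functions vanish. -/
theorem cycInt_exact (hζ : Generic q ζ) {Γ : ι → Loop} {W : ι → ℂ}
    (hsupp : ∀ i, (Γ i).supp ⊆ poleFree q ζ) (hin : ∀ j k, cycWind Γ W (innerPt q ζ j k) = 1)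
    (hout : ∀ j k, cycWind Γ W (outerPt q ζ j k) = 0) {g : ℂ → ℂ}
    (hg : DifferentiableOn ℂ g {0}ᶜ)
    (hshift : ∀ y, y ≠ 0 → g (y * q⁻¹ ^ 4) = (∏ j, (-(y * q⁻¹) / ζ j ^ 2)) * g y) :
    cycInt Γ W (fun y => 1 / y * ((∏ j, (y - ζ j ^ 2 * q⁻¹)) -
      q⁻¹ ^ (2 * N) * ∏ j, (y - ζ j ^ 2 * q)) * (g y * psiProd q ζ y)) = 0 := by
  have hc : q⁻¹ ^ 4 ≠ 0 := pow_ne_zero 4 (inv_ne_zero hq0)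
  have hq4 := norm_pow_four_lt hq1
  -- The integrand equals `G K` at `y` minus `τ⁴` times `G K` at `τ⁴ y`, where the shift property of
  -- `g` enters in the second term. Its integral is that of `G K` over the cycle minus that over the
  -- dilated cycle.
  set G : ℂ → ℂ := fun y => 1 / y * g y * ∏ j, (-(ζ j ^ 2 * q⁻¹)) with hG
  set K := kern (q ^ 4) (fun j => q ^ 5 / ζ j ^ 2) (fun j => ζ j ^ 2 * q) with hK
  have hGd : DifferentiableOn ℂ G {0}ᶜ := by
    refine DifferentiableOn.mul_const (DifferentiableOn.mul ?_ hg) _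
    exact DifferentiableOn.div (differentiableOn_const _) differentiableOn_id fun x hx => hx
  have hα : ∀ j, q ^ 5 / ζ j ^ 2 ≠ 0 := fun j =>
    div_ne_zero (pow_ne_zero 5 hq0) (pow_ne_zero 2 (hζ.1 j))
  set e : (Fin N × ℕ) ⊕ (Fin N × ℕ) → (Fin N × ℕ) ⊕ (Fin N × ℕ) :=
    Sum.map (fun a => (a.1, a.2 + 1)) id with he
  have hpole : kernPole (q ^ 4) (fun j => q ^ 5 / ζ j ^ 2) (fun j => ζ j ^ 2 * q) =
      kernPole (q ^ 4) (fun j => q / ζ j ^ 2) (fun j => ζ j ^ 2 * q) ∘ e := by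
    funext a
    rcases a with a | a
    · simp only [kernPole, he, Function.comp_apply, Sum.map_inl, Sum.elim_inl, inv_div, pow_succ]
      field_simp
    · rfl
  have hpl : ∀ a, kernPole (q ^ 4) (fun j => q ^ 5 / ζ j ^ 2) (fun j => ζ j ^ 2 * q) (Sum.inl a) =
      outerPt q ζ a.1 (a.2 + 1) := fun a => by
    rw [hpole, Function.comp_apply, he, Sum.map_inl, kernPole_inl]
  have hpr : ∀ a, kernPole (q ^ 4) (fun j => q ^ 5 / ζ j ^ 2) (fun j => ζ j ^ 2 * q) (Sum.inr a) =
      innerPt q ζ a.1 a.2 := fun a => kernPole_inr q ζ a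
  have hinj : Function.Injective
      (kernPole (q ^ 4) (fun j => q ^ 5 / ζ j ^ 2) (fun j => ζ j ^ 2 * q)) := by
    rw [hpole]
    refine (hζ.injective_kernPole hq0 hq1).comp (Function.Injective.sumMap ?_ fun _ _ h => h)
    rintro ⟨j, k⟩ ⟨j', k'⟩ h
    simp only [Prod.mk.injEq, Nat.add_right_cancel_iff] at h
    exact Prod.ext h.1 h.2
  -- Dilation carries each inner pole with `k ≥ 1` to the preceding one and each outer pole to the
  -- next one. The two cycles therefore have equal winding numbers about the origin and about every
  -- pole of `K`.
  have h1 := cycInt_kern_eq_zero (Γ := Sum.elim Γ fun i => (Γ i).scale (q⁻¹ ^ 4) hc)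
    (W := Sum.elim W fun i => -W i) hq4 (pow_ne_zero 4 hq0) hα hinj
    (by
      rintro a (i | i) h
      · rcases a with a | a
        · rw [hpl] at h
          exact (hsupp i h).2.2 _ _ rfl
        · rw [hpr] at h
          exact (hsupp i h).2.1 _ _ rfl
      · obtain ⟨x, hx, h⟩ := (Γ i).mem_scale_supp hc h
        rcases a with a | a
        · rw [hpl, q_pow_four_mul_outerPt hq0] at h
          exact (hsupp i hx).2.2 _ _ (mul_left_cancel₀ hc h).symm
        · rw [hpr, innerPt_eq_inv_mul hq0] at h
          exact (hsupp i hx).2.1 _ _ (mul_left_cancel₀ hc h).symm)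
    (by simp [cycWind, Loop.scale_wind, Fintype.sum_sum_type]) hGd
    (fun a => Or.inl (by
      simp only [cycWind, Fintype.sum_sum_type, Sum.elim_inl, Sum.elim_inr, Loop.scale_wind,
        neg_mul, Finset.sum_neg_distrib]
      rw [← cycWind, ← cycWind]
      rcases a with a | a
      · rw [hpl, hout, q_pow_four_mul_outerPt hq0, mul_div_cancel_left₀ _ hc, hout, neg_zero,
          add_zero]
      · rw [hpr, hin, innerPt_eq_inv_mul hq0, mul_div_cancel_left₀ _ hc, hin, add_neg_cancel]))
  simp only [cycInt, Fintype.sum_sum_type, Sum.elim_inl, Sum.elim_inr, Loop.scale_int, neg_mul,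
    Finset.sum_neg_distrib, mul_left_comm _ (q⁻¹ ^ 4), ← Finset.mul_sum] at h1
  rw [← cycInt, ← cycInt, mul_neg, ← cycInt_const_mul, ← sub_eq_add_neg, ← cycInt_sub] at h1
  · rw [← h1]
    refine cycInt_congr fun i y hy => ?_
    have hp := hsupp i hy
    have hy0 := hp.1
    rw [← psiProd_mul_prod_sub hq0 hq1 hζ.1 fun j => by
      have := hp.2.2 j 0; simpa [outerPt] using this, kern_mul_inv_pow_four hq0 hq1 hy0 hζ.1 fun j => by
      have := hp.2.1 j 0; simpa [innerPt] using this]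
    simp only [hG]
    rw [mul_comm (q⁻¹ ^ 4) y, hshift y hy0]
    have e1 : (∏ j, (y - ζ j ^ 2 * q⁻¹)) =
        (∏ j, (-(ζ j ^ 2 * q⁻¹))) * ∏ j, (1 - y * q / ζ j ^ 2) := by
      rw [← Finset.prod_mul_distrib]
      refine Finset.prod_congr rfl fun j _ => ?_
      have := hζ.1 j
      field_simp
      ring
    have e2 : q⁻¹ ^ (2 * N) * (∏ j, (y - ζ j ^ 2 * q)) = (∏ j, (-(y * q⁻¹) / ζ j ^ 2)) *
        (∏ j, (-(ζ j ^ 2 * q⁻¹))) * ∏ j, (1 - ζ j ^ 2 * q / y) := by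
      have : q⁻¹ ^ (2 * N) = ∏ _j : Fin N, q⁻¹ ^ 2 := by simp [pow_mul]
      rw [this, ← Finset.prod_mul_distrib, ← Finset.prod_mul_distrib, ← Finset.prod_mul_distrib]
      refine Finset.prod_congr rfl fun j _ => ?_
      have := hζ.1 j
      field_simp
    rw [e1, e2]
    field_simp
  all_goals
    intro i
    have hcont : ∀ c : ℂ, c ≠ 0 → (∀ y ∈ (Γ i).supp, ∀ a, kernPole (q ^ 4)
        (fun j => q ^ 5 / ζ j ^ 2) (fun j => ζ j ^ 2 * q) a ≠ c * y) →
        ContinuousOn (fun y => G (c * y) * K (c * y)) (Γ i).supp := fun c hc h => by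
      have hm : MapsTo (fun y => c * y) (Γ i).supp {0}ᶜ := fun y hy =>
        mul_ne_zero hc (hsupp i hy).1
      have hcm : ContinuousOn (fun y => c * y) (Γ i).supp := by fun_prop
      refine (hGd.continuousOn.comp hcm hm).mul
        ((continuousOn_kern hq4 hα (s := (fun y => c * y) '' (Γ i).supp) ?_ ?_).comp hcm
          (mapsTo_image _ _))
      · rintro _ ⟨y, hy, rfl⟩; exact hm hy
      · rintro _ ⟨y, hy, rfl⟩ a; exact h y hy a
  · have := hcont 1 one_ne_zero fun y hy a => by
      rw [one_mul]
      rcases a with a | a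
      · rw [hpl]; exact ((hsupp i hy).2.2 _ _).symm
      · rw [hpr]; exact ((hsupp i hy).2.1 _ _).symm
    simpa only [one_mul] using this
  · refine continuousOn_const.mul (hcont _ hc fun y hy a h => ?_)
    rcases a with a | a
    · rw [hpl, q_pow_four_mul_outerPt hq0] at h
      exact (hsupp i hy).2.2 _ _ (mul_left_cancel₀ hc h).symm
    · rw [hpr, innerPt_eq_inv_mul hq0] at h
      exact (hsupp i hy).2.1 _ _ (mul_left_cancel₀ hc h).symm

end

end QKZ

namespace QKZ
open Set Filter

variable {ι : Type*} [Fintype ι]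

/-! ### Moving a contour across one pole -/

lemma cycInt_psiProd_eq_zero {q : ℂ} (hq0 : q ≠ 0) (hq1 : ‖q‖ < 1) {N : ℕ} {ζ : Fin N → ℂ}
    (hζ : Generic q ζ) {Γ : ι → Loop} {W : ι → ℂ} (hsupp : ∀ i, (Γ i).supp ⊆ poleFree q ζ)
    (h0 : cycWind Γ W 0 = 0) {g : ℂ → ℂ} (hg : DifferentiableOn ℂ g {0}ᶜ)
    (hin : ∀ j k, cycWind Γ W (innerPt q ζ j k) = 0)
    (hout : ∀ j k, cycWind Γ W (outerPt q ζ j k) = 0 ∨ g (outerPt q ζ j k) = 0) :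
    cycInt Γ W (fun y => g y * psiProd q ζ y) = 0 := by
  refine cycInt_kern_eq_zero (norm_pow_four_lt hq1) (pow_ne_zero 4 hq0)
    (fun j => div_ne_zero hq0 (pow_ne_zero 2 (hζ.1 j))) (hζ.injective_kernPole hq0 hq1) ?_ h0 hg ?_
  · exact fun a i h => ne_kernPole (hsupp i h) a rfl
  · rintro (a | a)
    · rw [kernPole_inl]; exact hout _ _
    · rw [kernPole_inr]; exact Or.inl (hin _ _)

lemma differentiableOn_poch_mul_div {p : ℂ} (hp : ‖p‖ < 1) (a b : ℂ) :
    DifferentiableOn ℂ (fun y => poch (y * a) p * poch (b / y) p) {0}ᶜ := by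
  have hd := differentiable_poch hp
  refine DifferentiableOn.mul ?_ ?_
  · exact (hd.comp (by fun_prop : Differentiable ℂ fun y : ℂ => y * a)).differentiableOn
  · exact hd.comp_differentiableOn (f := fun y : ℂ => b / y)
      ((differentiableOn_const b).div differentiableOn_id fun y hy => hy)

/-- The value of the regular factors of `psiProd` at the pole `z_j τ`. -/
def psiRes (q : ℂ) {N : ℕ} (ζ : Fin N → ℂ) (j : Fin N) : ℂ :=
  (poch (q ^ 4) (q ^ 4) * poch (q ^ 2) (q ^ 4))⁻¹ *
    ∏ i ∈ Finset.univ.erase j, psi q (ζ j ^ 2 * q⁻¹ / ζ i ^ 2)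

/-- `D` collects the reciprocals of all regular factors at `P = z_{j₀} τ`, so that `D * psiProd` is
`-P / (y - P)`. Subtracting from `g` the multiple of `D` with the same value at `P` leaves a
numerator that vanishes at the only pole where the winding number may be nonzero. -/
theorem cycInt_psiProd_residue {q : ℂ} (hq0 : q ≠ 0) (hq1 : ‖q‖ < 1) {N : ℕ} {ζ : Fin N → ℂ}
    (hζ : Generic q ζ) {Γ : ι → Loop} {W : ι → ℂ} (hsupp : ∀ i, (Γ i).supp ⊆ poleFree q ζ)
    (h0 : cycWind Γ W 0 = 0) {g : ℂ → ℂ} (hg : DifferentiableOn ℂ g {0}ᶜ)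
    (hin : ∀ j k, cycWind Γ W (innerPt q ζ j k) = 0) (j₀ : Fin N)
    (hout : ∀ j k, (j, k) ≠ (j₀, 0) → cycWind Γ W (outerPt q ζ j k) = 0) :
    cycInt Γ W (fun y => g y * psiProd q ζ y) =
      -(ζ j₀ ^ 2 * q⁻¹) * cycWind Γ W (ζ j₀ ^ 2 * q⁻¹) * (g (ζ j₀ ^ 2 * q⁻¹) * psiRes q ζ j₀) := by
  classical
  have hq4 := norm_pow_four_lt hq1
  have hz := hζ.1 j₀
  set P := ζ j₀ ^ 2 * q⁻¹ with hP
  have hPo : outerPt q ζ j₀ 0 = P := by simp [outerPt, hP]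
  have hP0 : P ≠ 0 := mul_ne_zero (pow_ne_zero 2 hz) (inv_ne_zero hq0)
  set D : ℂ → ℂ := fun y => (poch (y * (q / ζ j₀ ^ 2 * q ^ 4)) (q ^ 4) *
    poch (ζ j₀ ^ 2 * q / y) (q ^ 4)) * ∏ i ∈ Finset.univ.erase j₀,
      (poch (y * (q / ζ i ^ 2)) (q ^ 4) * poch (ζ i ^ 2 * q / y) (q ^ 4)) with hD
  have hDd : DifferentiableOn ℂ D {0}ᶜ :=
    (differentiableOn_poch_mul_div hq4 _ _).mul
      (DifferentiableOn.fun_finsetProd fun i _ => differentiableOn_poch_mul_div hq4 _ _)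
  have hDP : D P = (psiRes q ζ j₀)⁻¹ := by
    have e1 : P * (q / ζ j₀ ^ 2 * q ^ 4) = q ^ 4 := by rw [hP]; field_simp
    have e2 : ζ j₀ ^ 2 * q / P = q ^ 2 := by rw [hP]; field_simp
    simp only [hD, psiRes, e1, e2, psi_div_eq, mul_inv, inv_inv]
    rw [← Finset.prod_inv_distrib]
    simp only [one_div, mul_inv, inv_inv]
    rw [hP]
  have hpsi0 : psiRes q ζ j₀ ≠ 0 := by
    refine mul_ne_zero (inv_ne_zero (mul_ne_zero (poch_pow_ne_zero hq1 (by norm_num) (by norm_num))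
      (poch_pow_ne_zero hq1 (by norm_num) (by norm_num)))) (Finset.prod_ne_zero_iff.mpr fun i hi => ?_)
    rw [psi_div_eq]
    have hz2 := hζ.1 i
    have hne := Finset.ne_of_mem_erase hi
    refine one_div_ne_zero (mul_ne_zero (poch_ne_zero hq4 fun k e => ?_)
      (poch_ne_zero hq4 fun k e => ?_))
    · have h1 : outerPt q ζ i k = outerPt q ζ j₀ 0 := by
        rw [hPo, outerPt, pow_add, pow_mul, pow_one, inv_pow _ 4, inv_pow]
        have h2 : ζ i ^ 2 = ζ j₀ ^ 2 * (q ^ 4) ^ k := by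
          have h3 : ζ j₀ ^ 2 * q⁻¹ * (q / ζ i ^ 2) * (q ^ 4) ^ k = ζ j₀ ^ 2 * (q ^ 4) ^ k / ζ i ^ 2 := by
            field_simp
          have h4 := sub_eq_zero.mp e
          rw [h3, eq_div_iff (pow_ne_zero 2 hz2)] at h4
          linear_combination h4
        rw [h2, hP]
        have h5 : (q ^ 4) ^ k ≠ 0 := pow_ne_zero _ (pow_ne_zero _ hq0)
        field_simp
      rw [← kernPole_inl q ζ (i, k), ← kernPole_inl q ζ (j₀, 0)] at h1
      have := hζ.injective_kernPole hq0 hq1 h1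
      simp only [Sum.inl.injEq, Prod.mk.injEq] at this
      exact hne this.1
    · refine hζ.noPinch hq0 hq1 i j₀ k 0 ?_
      have h4 := sub_eq_zero.mp e
      rw [div_mul_eq_mul_div, eq_div_iff (mul_ne_zero (pow_ne_zero 2 hz) (inv_ne_zero hq0)),
        one_mul] at h4
      rw [hPo, innerPt, pow_add, pow_mul, pow_one, hP, h4]
      ring
  have hDP0 : D P ≠ 0 := by rw [hDP]; exact inv_ne_zero hpsi0
  have hDpsi : ∀ y ∈ poleFree q ζ, D y * psiProd q ζ y = -P * (y - P)⁻¹ := by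
    intro y hy
    have hden := fun i => psi_denominator_ne_zero hq0 hq1 hζ.1 hy i
    have hyP : y - P ≠ 0 := sub_ne_zero.mpr (hPo ▸ hy.2.2 j₀ 0)
    have e1 : psiProd q ζ y = (∏ i, (poch (y * (q / ζ i ^ 2)) (q ^ 4) *
        poch (ζ i ^ 2 * q / y) (q ^ 4)))⁻¹ := by
      rw [psiProd, kern, ← Finset.prod_inv_distrib]
      simp only [one_div]
    have e2 : 1 - y * (q / ζ j₀ ^ 2) = -(y - P) / P := by
      rw [eq_div_iff hP0, hP]
      field_simp
      ring
    have e3 := poch_eq_one_sub_mul (y * (q / ζ j₀ ^ 2)) hq4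
    have hd0 := hden j₀
    have hprod : ∏ i ∈ Finset.univ.erase j₀, (poch (y * (q / ζ i ^ 2)) (q ^ 4) *
        poch (ζ i ^ 2 * q / y) (q ^ 4)) ≠ 0 := Finset.prod_ne_zero_iff.mpr fun i _ => hden i
    rw [e1, ← Finset.mul_prod_erase _ _ (Finset.mem_univ j₀)]
    simp only [hD]
    rw [e3, e2, mul_assoc y] at hd0 ⊢
    have h1 := left_ne_zero_of_mul hd0
    have h2 := right_ne_zero_of_mul hd0
    have h3 := right_ne_zero_of_mul h1
    generalize poch (y * (q / ζ j₀ ^ 2 * q ^ 4)) (q ^ 4) = X at h3 ⊢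
    generalize poch (ζ j₀ ^ 2 * q / y) (q ^ 4) = Y at h2 ⊢
    generalize ∏ i ∈ Finset.univ.erase j₀, (poch (y * (q / ζ i ^ 2)) (q ^ 4) *
      poch (ζ i ^ 2 * q / y) (q ^ 4)) = Z at hprod ⊢
    field_simp
  have key := cycInt_psiProd_eq_zero hq0 hq1 hζ hsupp h0 (g := fun y => g y - g P / D P * D y)
    (hg.sub (hDd.const_mul _)) hin (fun j k => by
      by_cases h : (j, k) = (j₀, 0)
      · simp only [Prod.mk.injEq] at h
        rw [h.1, h.2, hPo, div_mul_cancel₀ _ hDP0, sub_self]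
        exact Or.inr rfl
      · exact Or.inl (hout j k h))
  have hcP := fun i => (continuousOn_psiProd hq0 hq1 hζ.1).mono (hsupp i)
  have hsub : ∀ i, (Γ i).supp ⊆ {0}ᶜ := fun i y hy => (hsupp i hy).1
  have e4 : cycInt Γ W (fun y => (g y - g P / D P * D y) * psiProd q ζ y) =
      cycInt Γ W (fun y => g y * psiProd q ζ y) -
        cycInt Γ W (fun y => (g P / D P) * (D y * psiProd q ζ y)) := by
    rw [← cycInt_sub]
    · exact cycInt_congr fun _ y _ => by ring
    · exact fun i => (hg.continuousOn.mono (hsub i)).mul (hcP i)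
    · exact fun i => continuousOn_const.mul ((hDd.continuousOn.mono (hsub i)).mul (hcP i))
  rw [e4, cycInt_const_mul, sub_eq_zero] at key
  rw [key, cycInt_congr (fun i y hy => hDpsi y (hsupp i hy)), cycInt_const_mul, cycInt_inv_sub, hDP,
    div_inv_eq_mul]
  ring

lemma cycMulti_option {m : ℕ} (Γ₀ : Loop) (Γ : ι → Loop) (F : (Fin m → ℂ) → ℂ) :
    cycMulti (fun o : Option ι => o.elim Γ₀ Γ) (fun _ o => o.elim 0 fun _ => 1) F =
      cycMulti Γ (fun _ => 1) F := by
  classical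
  refine (Fintype.sum_of_injective (fun (s : Fin m → ι) μ => some (s μ))
    (fun s t h => funext fun μ => Option.some_injective _ (congrFun h μ)) _ _ (fun s hs => ?_)
    fun s => rfl).symm
  have : ∃ μ, s μ = none := by
    by_contra h
    push Not at h
    exact hs ⟨fun μ => (s μ).get (Option.isSome_iff_ne_none.mpr (h μ)), funext fun μ => by simp⟩
  obtain ⟨μ, hμ⟩ := this
  rw [Finset.prod_eq_zero (Finset.mem_univ μ) (by rw [hμ]; rfl), zero_mul]

/-- The curve encircles the origin, a limit of points that it encircles. -/
lemma IsContour.winding_zero {q : ℂ} (hq1 : ‖q‖ < 1) {N : ℕ} {ζ : Fin N → ℂ} {γ : ℝ → ℂ}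
    (hγ : IsContour q ζ γ) (j₀ : Fin N) : winding γ 0 = 1 := by
  obtain ⟨Γ₀, hΓ₀, hwind, -⟩ := hγ.exists_loop
  obtain ⟨ρ, hρ, hρ0⟩ := ((Γ₀.eventually_lt_norm fun x hx =>
    norm_pos_iff.mpr (Γ₀.ne_zero_of_mem_supp hx)).and self_mem_nhdsWithin).exists
  have hlim : Tendsto (fun k : ℕ => ‖innerPt q ζ j₀ k‖) atTop (𝓝 0) := by
    have h1 := (tendsto_pow_atTop_nhds_zero_of_lt_one (norm_nonneg _)
      (norm_pow_four_lt hq1)).const_mul ‖ζ j₀ ^ 2 * q‖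
    rw [mul_zero] at h1
    refine h1.congr fun k => ?_
    rw [innerPt, pow_add, pow_mul, pow_one, ← mul_assoc, norm_mul _ ((q ^ 4) ^ k), norm_pow (q ^ 4)]
  obtain ⟨k, hk⟩ := (hlim.eventually (gt_mem_nhds hρ0)).exists
  rw [hwind, ← Γ₀.wind_near fun x hx => lt_trans hk (hρ x hx), ← hwind, hγ.winding_inner]

/-- The integral of a symmetric function over a contour and over a cycle that in addition
encircles the pole `z_{j₀} τ`. -/
theorem multiContour_eq_add_residue {q : ℂ} (hq0 : q ≠ 0) (hq1 : ‖q‖ < 1) {N : ℕ} {ζ : Fin N → ℂ}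
    (hζ : Generic q ζ) {γ : ℝ → ℂ} (hγ : IsContour q ζ γ) {Γ : ι → Loop}
    (hsupp : ∀ i, (Γ i).supp ⊆ poleFree q ζ) (h0 : cycWind Γ 1 0 = 1)
    (hin : ∀ j k, cycWind Γ 1 (innerPt q ζ j k) = 1) (j₀ : Fin N)
    (hout : ∀ j k, (j, k) ≠ (j₀, 0) → cycWind Γ 1 (outerPt q ζ j k) = 0)
    (hP1 : cycWind Γ 1 (ζ j₀ ^ 2 * q⁻¹) = 1) {m : ℕ} {A : (Fin (m + 1) → ℂ) → ℂ}
    (hA : ∀ x, NonZero x → DifferentiableAt ℂ A x)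
    (hsymm : ∀ (k : Fin (m + 1)) (y : ℂ) (x : Fin m → ℂ), y ≠ 0 → NonZero x →
      A (k.insertNth y x) = A (Fin.snoc x y))
    (hzero : ∀ (x : Fin m → ℂ) (k : Fin m), NonZero x → A (Fin.snoc x (x k)) = 0) :
    multiContour γ (fun x => A x * ∏ μ, psiProd q ζ (x μ)) =
      cycMulti Γ (fun _ => 1) (fun x => A x * ∏ μ, psiProd q ζ (x μ)) +
        (m + 1 : ℕ) * cycMulti Γ (fun _ => 1) fun x : Fin m → ℂ =>
          ζ j₀ ^ 2 * q⁻¹ * psiRes q ζ j₀ *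
            (A (Fin.snoc x (ζ j₀ ^ 2 * q⁻¹)) * ∏ μ, psiProd q ζ (x μ)) := by
  classical
  obtain ⟨Γ₀, hΓ₀, hwind, hmulti⟩ := hγ.exists_loop
  set P := ζ j₀ ^ 2 * q⁻¹ with hP
  have hPo : outerPt q ζ j₀ 0 = P := by simp [outerPt, hP]
  have hP0 : P ≠ 0 := mul_ne_zero (pow_ne_zero 2 (hζ.1 j₀)) (inv_ne_zero hq0)
  -- Contour and cycle become one family, in which weights select either of them; their difference
  -- is then again a cycle.
  set Γ' : Option ι → Loop := fun o => o.elim Γ₀ Γ with hΓ'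
  set w : Option ι → ℂ := Pi.single none 1 with hw
  set w' : Option ι → ℂ := fun o => o.elim 0 fun _ => 1 with hw'
  have hsupp' : ∀ o, (Γ' o).supp ⊆ poleFree q ζ := by
    rintro (_ | i)
    · rintro _ ⟨t, ht, rfl⟩
      change Γ₀.γ t ∈ _
      rw [hΓ₀]
      exact hγ.mem_poleFree ht
    · exact hsupp i
  have hcube : ∀ (m : ℕ), cube Γ' m ⊆ {x | ∀ μ, x μ ∈ poleFree q ζ} := fun m x hx μ => by
    obtain ⟨o, ho⟩ := mem_iUnion.mp (hx μ)
    exact hsupp' o ho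
  have hnz : ∀ {m : ℕ} {x : Fin m → ℂ}, x ∈ cube Γ' m → NonZero x := fun hx μ =>
    (hcube _ hx μ).1
  have hwd : ∀ p, cycWind Γ' (w - w') p = winding γ p - cycWind Γ 1 p := fun p => by
    simp [cycWind, hw, hw', hΓ', Fintype.sum_option, hwind]
    ring
  have hw0 := hγ.winding_zero hq1 j₀
  have hwin : ∀ j k, cycWind Γ' (w - w') (innerPt q ζ j k) = 0 := fun j k => by
    rw [hwd, hγ.winding_inner, hin, sub_self]
  have hwout : ∀ j k, (j, k) ≠ (j₀, 0) → cycWind Γ' (w - w') (outerPt q ζ j k) = 0 :=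
    fun j k h => by rw [hwd, hγ.winding_outer, hout j k h, sub_self]
  have hwP : cycWind Γ' (w - w') P = -1 := by
    rw [hwd, hP1, ← hPo, hγ.winding_outer, zero_sub]
  have hwz : cycWind Γ' (w - w') 0 = 0 := by rw [hwd, hw0, h0, sub_self]
  have hpsic : ∀ m : ℕ, ContinuousOn (fun x : Fin m → ℂ => ∏ μ, psiProd q ζ (x μ)) (cube Γ' m) :=
    fun m => continuousOn_finsetProd _ fun μ _ =>
      (continuousOn_psiProd hq0 hq1 hζ.1).comp (continuous_apply μ).continuousOn
        fun x hx => hcube m hx μ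
  have hsnoc : ∀ {x : Fin m → ℂ} {y : ℂ}, NonZero x → y ≠ 0 →
      NonZero (Fin.snoc x y : Fin (m + 1) → ℂ) := fun hx hy => Fin.lastCases
    (by rw [Fin.snoc_last]; exact hy) fun i => by rw [Fin.snoc_castSucc]; exact hx i
  have hsnocd : Differentiable ℂ fun xy : (Fin m → ℂ) × ℂ => (Fin.snoc xy.1 xy.2 : Fin (m + 1) → ℂ) :=
    differentiable_pi.mpr (Fin.lastCases (by simp only [Fin.snoc_last]; fun_prop) fun i => by
      simp only [Fin.snoc_castSucc]; fun_prop)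
  have hF : ContinuousOn (fun x => A x * ∏ μ, psiProd q ζ (x μ)) (cube Γ' (m + 1)) :=
    ContinuousOn.mul (fun x hx => (hA x (hnz hx)).continuousAt.continuousWithinAt) (hpsic _)
  have hR : ContinuousOn (fun x : Fin m → ℂ => P * psiRes q ζ j₀ *
      (A (Fin.snoc x P) * ∏ μ, psiProd q ζ (x μ))) (cube Γ' m) := by
    refine continuousOn_const.mul (ContinuousOn.mul (fun x hx => ?_) (hpsic m))
    exact ((hA _ (hsnoc (hnz hx) hP0)).comp (f := fun x : Fin m → ℂ => (Fin.snoc x P : Fin (m + 1) → ℂ)) x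
      ((hsnocd.comp (differentiable_id.prodMk (differentiable_const P))).differentiableAt)).continuousAt.continuousWithinAt
  have key := cycMulti_sub_of_residue (Γ := Γ') w w' hF
    (R := fun x : Fin m → ℂ => P * psiRes q ζ j₀ * (A (Fin.snoc x P) * ∏ μ, psiProd q ζ (x μ)))
    (fun k x hx => by
      have hx0 := hnz hx
      have e := cycInt_psiProd_residue hq0 hq1 hζ hsupp' hwz
        (g := fun y => A (Fin.snoc x y) * ∏ μ, psiProd q ζ (x μ))
        (fun y hy => DifferentiableAt.differentiableWithinAt (DifferentiableAt.mul_const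
          ((hA _ (hsnoc hx0 hy)).comp (f := fun y => (Fin.snoc x y : Fin (m + 1) → ℂ)) y
          ((hsnocd.comp ((differentiable_const x).prodMk differentiable_id)).differentiableAt)) _))
        hwin j₀ hwout
      rw [← hP, hwP] at e
      refine Eq.trans (cycInt_congr fun i y hy => ?_) (e.trans (by ring))
      rw [hsymm k y x (hsupp' i hy).1 hx0, Fin.prod_univ_succAbove _ k, Fin.insertNth_apply_same]
      simp only [Fin.insertNth_apply_succAbove]
      ring)
    -- Moving a further variable of the residue across `P` yields nothing: at `P` two arguments of
    -- `A` coincide and `A` vanishes.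
    (fun W hW => cycMulti_replace_of_update hR fun k x hx => by
      rcases hW k with h | h
      · have hx0 := hnz hx
        rw [h]
        have e := cycInt_psiProd_eq_zero hq0 hq1 hζ hsupp' hwz
          (g := fun y => P * psiRes q ζ j₀ * (A (Fin.snoc (Function.update x k y) P) *
            ∏ μ ∈ Finset.univ.erase k, psiProd q ζ (x μ)))
          (fun y hy => DifferentiableAt.differentiableWithinAt (DifferentiableAt.const_mul
            (DifferentiableAt.mul_const
            ((hA _ (hsnoc (hx0.update k hy) hP0)).comp
              (f := fun y => (Fin.snoc (Function.update x k y) P : Fin (m + 1) → ℂ)) y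
              ((hsnocd.comp ((differentiable_update x k).prodMk
                (differentiable_const P))).differentiableAt)) _) _))
          hwin (fun j k' => by
            by_cases hjk : (j, k') = (j₀, 0)
            · right
              simp only [Prod.mk.injEq] at hjk
              have hz := hzero (Function.update x k P) k (hx0.update k hP0)
              rw [Function.update_self] at hz
              rw [hjk.1, hjk.2, hPo, hz, zero_mul, mul_zero]
            · exact Or.inl (hwout j k' hjk))
        refine Eq.trans (cycInt_congr fun i y _ => ?_) e
        rw [← Finset.mul_prod_erase _ _ (Finset.mem_univ k), Function.update_self,
          Finset.prod_congr rfl fun μ hμ => by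
            rw [Function.update_of_ne (Finset.ne_of_mem_erase hμ)]]
        ring
      · rw [h, sub_self]
        simp [cycInt])
  rw [hmulti]
  rw [cycMulti_option, cycMulti_option] at key
  rw [← key, cycMulti_single]
  rfl

end QKZ

namespace QKZ
open Set Filter Metric

variable {ι : Type*} [Fintype ι]

/-! ### Simple poles of integrals depending on a parameter -/

/-- Compactness gives a bound on a disc times `K`. Schwarz's lemma in `v` turns it into a Lipschitz
estimate at `v₀` that is uniform in `x`. -/
lemma exists_lipschitz_bound {X : Type*} [NormedAddCommGroup X] [NormedSpace ℂ X] {K : Set X}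
    (hK : IsCompact K) {H : ℂ → X → ℂ} {v₀ : ℂ}
    (hH : ∀ᶠ v in 𝓝 v₀, ∀ x ∈ K, DifferentiableAt ℂ (fun p : ℂ × X => H p.1 p.2) (v, x)) :
    ∃ M, 0 ≤ M ∧ ∀ᶠ v in 𝓝 v₀, ∀ x ∈ K, ‖H v x‖ ≤ M ∧ ‖H v x - H v₀ x‖ ≤ M * ‖v - v₀‖ := by
  obtain ⟨δ, hδ, hU⟩ := nhds_basis_closedBall.mem_iff.mp hH
  have hcont : ContinuousOn (fun p : ℂ × X => H p.1 p.2) (closedBall v₀ δ ×ˢ K) := fun p hp =>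
    (hU hp.1 p.2 hp.2).continuousAt.continuousWithinAt
  obtain ⟨M, hM⟩ := ((isCompact_closedBall v₀ δ).prod hK).exists_bound_of_continuousOn hcont
  have hM' : ∀ v ∈ closedBall v₀ δ, ∀ x ∈ K, ‖H v x‖ ≤ |M| := fun v hv x hx =>
    (hM (v, x) ⟨hv, hx⟩).trans (le_abs_self M)
  have hpos : 0 ≤ (2 * |M| + 1) / δ := by positivity
  refine ⟨max |M| ((2 * |M| + 1) / δ), le_max_of_le_left (abs_nonneg _), ?_⟩
  filter_upwards [ball_mem_nhds v₀ hδ] with v hv x hx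
  refine ⟨(hM' v (ball_subset_closedBall hv) x hx).trans (le_max_left _ _), ?_⟩
  have hd : DifferentiableOn ℂ (fun v => H v x) (ball v₀ δ) := fun v hv =>
    ((hU (ball_subset_closedBall hv) x hx).comp (f := fun v => (v, x)) v
      (differentiableAt_id.prodMk (differentiableAt_const x))).differentiableWithinAt
  have h := Complex.dist_le_div_mul_dist_of_mapsTo_ball (R₂ := 2 * |M| + 1) hd (fun v' hv' => by
    rw [mem_closedBall, dist_eq_norm]
    have h1 := norm_sub_le (H v' x) (H v₀ x)
    have h2 := hM' v' (ball_subset_closedBall hv') x hx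
    have h3 := hM' v₀ (mem_closedBall_self hδ.le) x hx
    linarith) hv
  rw [dist_eq_norm, dist_eq_norm] at h
  exact h.trans (mul_le_mul_of_nonneg_right (le_max_right _ _) (norm_nonneg _))

/-- The difference quotients of `H₂` at `v₀` are bounded uniformly on the cycles, so only the value
at `v₀` contributes to the pole. -/
lemma hasRes_cycMulti {m m' : ℕ} {Γ : ι → Loop} {W : Fin m → ι → ℂ} {W' : Fin m' → ι → ℂ}
    {H₁ : ℂ → (Fin m → ℂ) → ℂ} {H₂ : ℂ → (Fin m' → ℂ) → ℂ} {v₀ : ℂ} (hv₀ : v₀ ≠ 0)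
    (h₁ : ∀ᶠ v in 𝓝 v₀, ∀ x ∈ cube Γ m, DifferentiableAt ℂ (fun p : ℂ × _ => H₁ p.1 p.2) (v, x))
    (h₂ : ∀ᶠ v in 𝓝 v₀, ∀ x ∈ cube Γ m', DifferentiableAt ℂ (fun p : ℂ × _ => H₂ p.1 p.2) (v, x))
    {G : ℂ → ℂ} (hG : ∀ᶠ v in 𝓝[≠] v₀, G v = cycMulti Γ W (H₁ v) +
      cycMulti Γ W' (H₂ v) / (v / v₀ - 1)) : HasRes G v₀ (cycMulti Γ W' (H₂ v₀)) := by
  obtain ⟨M₁, hM₁, hb₁⟩ := exists_lipschitz_bound (isCompact_cube Γ m) h₁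
  obtain ⟨M₂, hM₂, hb₂⟩ := exists_lipschitz_bound (isCompact_cube Γ m') h₂
  obtain ⟨C₁, hC₁, hc₁⟩ := exists_norm_cycMulti_le Γ W
  obtain ⟨C₂, hC₂, hc₂⟩ := exists_norm_cycMulti_le Γ W'
  refine Asymptotics.IsBigO.of_bound (C₁ * M₁ + C₂ * M₂ * ‖v₀‖) ?_
  filter_upwards [hG, nhdsWithin_le_nhds hb₁, nhdsWithin_le_nhds hb₂,
    nhdsWithin_le_nhds h₂, self_mem_nhdsWithin] with v hv hv1 hv2 hd hne
  have hc : ∀ v, (∀ x ∈ cube Γ m', DifferentiableAt ℂ (fun p : ℂ × _ => H₂ p.1 p.2) (v, x)) →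
      ContinuousOn (H₂ v) (cube Γ m') := fun v h x hx =>
    ((h x hx).continuousAt.comp (f := fun x => (v, x)) (by fun_prop)).continuousWithinAt
  rw [norm_one, mul_one, hv, add_sub_assoc, ← sub_div,
    ← cycMulti_sub (hc v hd) (hc v₀ h₂.self_of_nhds)]
  have e : v / v₀ - 1 = (v - v₀) / v₀ := by rw [sub_div, div_self hv₀]
  have hpos : 0 < ‖v - v₀‖ := norm_pos_iff.mpr (sub_ne_zero.mpr hne)
  refine (norm_add_le _ _).trans (add_le_add (hc₁ _ M₁ hM₁ fun x hx => (hv1 x hx).1) ?_)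
  rw [e, norm_div, norm_div, div_div_eq_mul_div, div_le_iff₀ hpos]
  have := hc₂ (fun x => H₂ v x - H₂ v₀ x) (M₂ * ‖v - v₀‖) (by positivity) fun x hx => (hv2 x hx).2
  calc _ ≤ C₂ * (M₂ * ‖v - v₀‖) * ‖v₀‖ := mul_le_mul_of_nonneg_right this (norm_nonneg _)
    _ = _ := by ring

/-! ### The tuple `(ζ', w, v)` -/

section

variable {n l : ℕ}

/-- The place of `w`. -/
def wIdx (n l : ℕ) : Fin (n + 1 + (l + 1)) := ⟨n + l, by omega⟩

/-- The place of `v`. -/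
def vIdx (n l : ℕ) : Fin (n + 1 + (l + 1)) := ⟨n + l + 1, by omega⟩

/-- The places of the other variables. -/
def smallIdx (i : Fin (n + l)) : Fin (n + 1 + (l + 1)) := ⟨i, by omega⟩

@[simp] lemma ext2_smallIdx (ζ' : Fin (n + l) → ℂ) (w v : ℂ) (i : Fin (n + l)) :
    ext2 ζ' w v (smallIdx i) = ζ' i := by
  simp [ext2, smallIdx]

@[simp] lemma ext2_wIdx (ζ' : Fin (n + l) → ℂ) (w v : ℂ) : ext2 ζ' w v (wIdx n l) = w := by
  simp [ext2, wIdx]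

@[simp] lemma ext2_vIdx (ζ' : Fin (n + l) → ℂ) (w v : ℂ) : ext2 ζ' w v (vIdx n l) = v := by
  simp [ext2, vIdx]

lemma wIdx_ne_vIdx : wIdx n l ≠ vIdx n l := by simp [wIdx, vIdx]

lemma smallIdx_ne_wIdx (i : Fin (n + l)) : smallIdx i ≠ wIdx n l := by
  simp only [smallIdx, wIdx, ne_eq, Fin.mk.injEq]; omega

lemma smallIdx_ne_vIdx (i : Fin (n + l)) : smallIdx i ≠ vIdx n l := by
  simp only [smallIdx, vIdx, ne_eq, Fin.mk.injEq]; omega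

lemma smallIdx_injective : Function.Injective (smallIdx : Fin (n + l) → _) := fun i j h =>
  Fin.ext (by simpa [smallIdx] using h)

lemma forall_bigIdx {p : Fin (n + 1 + (l + 1)) → Prop} :
    (∀ i, p i) ↔ (∀ i, p (smallIdx i)) ∧ p (wIdx n l) ∧ p (vIdx n l) := by
  refine ⟨fun h => ⟨fun i => h _, h _, h _⟩, fun ⟨h1, h2, h3⟩ i => ?_⟩
  by_cases hi : (i : ℕ) < n + l
  · exact h1 ⟨i, hi⟩
  by_cases hi2 : (i : ℕ) = n + l
  · have : i = wIdx n l := Fin.ext hi2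
    rwa [this]
  · have : i = vIdx n l := Fin.ext (by simp only [vIdx]; omega)
    rwa [this]

lemma univ_bigIdx : (Finset.univ : Finset (Fin (n + 1 + (l + 1)))) =
    insert (wIdx n l) (insert (vIdx n l) (Finset.univ.map ⟨smallIdx, smallIdx_injective⟩)) := by
  refine (Finset.eq_univ_of_forall (forall_bigIdx.mpr ⟨fun i => ?_, ?_, ?_⟩)).symm
  · simp
  · simp
  · simp

lemma wIdx_notMem : wIdx n l ∉ insert (vIdx n l) (Finset.univ.map ⟨smallIdx, smallIdx_injective⟩) := by
  simp [wIdx_ne_vIdx, smallIdx_ne_wIdx]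

lemma vIdx_notMem : vIdx n l ∉ Finset.univ.map ⟨smallIdx, smallIdx_injective⟩ := by
  simp [smallIdx_ne_vIdx]

lemma prod_erase_wIdx (f : Fin (n + 1 + (l + 1)) → ℂ) :
    ∏ i ∈ Finset.univ.erase (wIdx n l), f i = f (vIdx n l) * ∏ i, f (smallIdx i) := by
  rw [univ_bigIdx, Finset.erase_insert wIdx_notMem, Finset.prod_insert vIdx_notMem, Finset.prod_map]
  rfl

lemma prod_bigIdx (f : Fin (n + 1 + (l + 1)) → ℂ) :
    ∏ i, f i = f (wIdx n l) * (f (vIdx n l) * ∏ i, f (smallIdx i)) := by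
  rw [← Finset.mul_prod_erase _ _ (Finset.mem_univ (wIdx n l)), prod_erase_wIdx]

lemma differentiable_ext2 (ζ' : Fin (n + l) → ℂ) (w : ℂ) :
    Differentiable ℂ fun v => ext2 ζ' w v :=
  differentiable_pi.mpr (forall_bigIdx.mpr ⟨fun i => by simp, by simp, by simp⟩)

end

lemma differentiableAt_finsetProd {E κ : Type*} [NormedAddCommGroup E] [NormedSpace ℂ E] {e : E}
    {f : κ → E → ℂ} {s : Finset κ} (h : ∀ j ∈ s, DifferentiableAt ℂ (f j) e) :
    DifferentiableAt ℂ (fun e => ∏ j ∈ s, f j e) e := by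
  classical
  induction s using Finset.induction_on with
  | empty => simp only [Finset.prod_empty]; exact differentiableAt_const _
  | insert a s ha ih =>
    simp only [Finset.prod_insert ha]
    exact (h a (Finset.mem_insert_self _ _)).mul (ih fun j hj => h j (Finset.mem_insert_of_mem hj))

lemma differentiableAt_psiProd {q : ℂ} (hq0 : q ≠ 0) (hq1 : ‖q‖ < 1) {N : ℕ} {E : Type*}
    [NormedAddCommGroup E] [NormedSpace ℂ E] {Z : E → Fin N → ℂ} {x : E → ℂ} {e : E}
    (hZ : DifferentiableAt ℂ Z e) (hx : DifferentiableAt ℂ x e) (h0 : NonZero (Z e))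
    (hp : x e ∈ poleFree q (Z e)) : DifferentiableAt ℂ (fun e => psiProd q (Z e) (x e)) e := by
  have hd := differentiable_poch (norm_pow_four_lt hq1)
  have hZ' : ∀ j, DifferentiableAt ℂ (fun e => Z e j) e := differentiableAt_pi.mp hZ
  unfold psiProd kern
  refine differentiableAt_finsetProd fun j _ => ?_
  have hz : Z e j ^ 2 ≠ 0 := pow_ne_zero 2 (h0 j)
  have hZj := hZ' j
  have hx0 := hp.1
  have d1 : DifferentiableAt ℂ (fun e => x e * (q / Z e j ^ 2)) e := by
    fun_prop (disch := assumption)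
  have d2 : DifferentiableAt ℂ (fun e => Z e j ^ 2 * q / x e) e := by
    fun_prop (disch := assumption)
  have d3 : DifferentiableAt ℂ (fun e => poch (x e * (q / Z e j ^ 2)) (q ^ 4) *
      poch (Z e j ^ 2 * q / x e) (q ^ 4)) e :=
    (hd.differentiableAt.comp e d1).mul (hd.differentiableAt.comp e d2)
  simp only [one_div]
  exact d3.inv (psi_denominator_ne_zero hq0 hq1 h0 hp j)

/-- The singular factor at `v² = z τ²`. -/
lemma psi_eq_div_sub {q : ℂ} (hq0 : q ≠ 0) (hq1 : ‖q‖ < 1) {u : ℂ} (hu : u ≠ 0) :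
    psi q (q / u ^ 2) = -(1 / ((u + 1) * (poch (q ^ 2 / u ^ 2) (q ^ 4) *
      poch (u ^ 2 * q ^ 4) (q ^ 4)))) / (u - 1) := by
  have e1 : q / u ^ 2 * q = q ^ 2 / u ^ 2 := by ring
  have e2 : (q / u ^ 2)⁻¹ * q = u ^ 2 := by field_simp
  have e3 : (1 - u ^ 2) = -((u - 1) * (u + 1)) := by ring
  rw [psi, e1, e2, poch_eq_one_sub_mul (u ^ 2) (norm_pow_four_lt hq1), e3]
  simp only [mul_inv, neg_mul, mul_neg, inv_neg, div_eq_mul_inv]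
  ring

/-- The pole comes from the pinch between the inner point `v² q` and the outer point `w² q⁻¹`. The
fixed cycle encircles both, so its integral stays regular at `v₀`. The correction is the residue at
`w² q⁻¹`, whose prefactor has the simple pole. The factor `1 / 2` is the value of `1 / (u + 1)` at
`u = v / v₀ = 1`. -/
theorem hasRes_multiContour {q : ℂ} (hq0 : q ≠ 0) (hq1 : ‖q‖ < 1) {m n l : ℕ}
    {ζ' : Fin (n + l) → ℂ} {w v₀ : ℂ} (hζ' : NonZero ζ') (hw : w ≠ 0) (hv₀ : v₀ ≠ 0)
    (hvw : v₀ ^ 2 = w ^ 2 * q⁻¹ ^ 2)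
    (hgen : ∀ᶠ v in 𝓝[≠] v₀, Generic q (ext2 ζ' w v)) {γ : ℂ → ℝ → ℂ}
    (hγ : ∀ᶠ v in 𝓝[≠] v₀, IsContour q (ext2 ζ' w v) (γ v)) {Γ : ι → Loop}
    (hsupp : ∀ᶠ v in 𝓝 v₀, ∀ i, (Γ i).supp ⊆ poleFree q (ext2 ζ' w v))
    (h0 : cycWind Γ 1 0 = 1)
    (hin : ∀ᶠ v in 𝓝 v₀, ∀ j k, cycWind Γ 1 (innerPt q (ext2 ζ' w v) j k) = 1)
    (hout : ∀ᶠ v in 𝓝 v₀, ∀ j k, (j, k) ≠ (wIdx n l, 0) →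
      cycWind Γ 1 (outerPt q (ext2 ζ' w v) j k) = 0)
    (hP : cycWind Γ 1 (w ^ 2 * q⁻¹) = 1) {A : ℂ → (Fin (m + 1) → ℂ) → ℂ}
    (hA : ∀ᶠ v in 𝓝 v₀, ∀ x, NonZero x →
      DifferentiableAt ℂ (fun p : ℂ × (Fin (m + 1) → ℂ) => A p.1 p.2) (v, x))
    (hsymm : ∀ᶠ v in 𝓝 v₀, ∀ (k : Fin (m + 1)) (y : ℂ) (x : Fin m → ℂ), y ≠ 0 → NonZero x →
      A v (k.insertNth y x) = A v (Fin.snoc x y))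
    (hzero : ∀ᶠ v in 𝓝 v₀, ∀ (x : Fin m → ℂ) (k : Fin m), NonZero x →
      A v (Fin.snoc x (x k)) = 0) :
    HasRes (fun v => ((m + 1).factorial : ℂ)⁻¹ * multiContour (γ v) fun x =>
        A v x * ∏ μ, psiProd q (ext2 ζ' w v) (x μ)) v₀
      (-(1 / 2) * (w ^ 2 * q⁻¹) * (((poch (q ^ 4) (q ^ 4) * poch (q ^ 2) (q ^ 4))⁻¹) ^ 2 *
        ∏ i, psi q (w ^ 2 * q⁻¹ / ζ' i ^ 2)) * ((m.factorial : ℂ)⁻¹ * cycMulti Γ (fun _ => 1)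
          fun x => A v₀ (Fin.snoc x (w ^ 2 * q⁻¹)) *
            ∏ μ, psiProd q (ext2 ζ' w v₀) (x μ))) := by
  have hq4 := norm_pow_four_lt hq1
  have hP0 : w ^ 2 * q⁻¹ ≠ 0 := mul_ne_zero (pow_ne_zero 2 hw) (inv_ne_zero hq0)
  have hp42 : poch (q ^ 4) (q ^ 4) * poch (q ^ 2) (q ^ 4) ≠ 0 := mul_ne_zero
    (poch_pow_ne_zero hq1 (by norm_num) (by norm_num)) (poch_pow_ne_zero hq1 (by norm_num) (by norm_num))
  set κ := w ^ 2 * q⁻¹ * ((poch (q ^ 4) (q ^ 4) * poch (q ^ 2) (q ^ 4))⁻¹ *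
        ∏ i, psi q (w ^ 2 * q⁻¹ / ζ' i ^ 2)) with hκ
  set s : ℂ → ℂ := fun v => -(1 / ((v / v₀ + 1) * (poch (q ^ 2 / (v / v₀) ^ 2) (q ^ 4) *
      poch ((v / v₀) ^ 2 * q ^ 4) (q ^ 4)))) with hs
  have hv1 : v₀ / v₀ = 1 := div_self hv₀
  have hs0 : s v₀ = -(1 / 2) * (poch (q ^ 4) (q ^ 4) * poch (q ^ 2) (q ^ 4))⁻¹ := by
    simp only [hs, hv1, one_pow, div_one, one_mul]
    rw [mul_comm (poch (q ^ 2) _), one_div, mul_inv]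
    norm_num
  have hd4 := differentiable_poch hq4
  have hsd : ∀ᶠ v in 𝓝 v₀, DifferentiableAt ℂ s v := by
    have hden : ContinuousAt (fun v => (v / v₀ + 1) * (poch (q ^ 2 / (v / v₀) ^ 2) (q ^ 4) *
      poch ((v / v₀) ^ 2 * q ^ 4) (q ^ 4))) v₀ := by
      have h1 : ContinuousAt (fun v : ℂ => q ^ 2 / (v / v₀) ^ 2) v₀ :=
        ContinuousAt.div (by fun_prop) (by fun_prop) (by rw [hv1]; norm_num)
      have h2 : ContinuousAt (fun v : ℂ => (v / v₀) ^ 2 * q ^ 4) v₀ := by fun_prop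
      exact ContinuousAt.mul (by fun_prop) ((hd4.continuous.continuousAt.comp h1).mul
        (hd4.continuous.continuousAt.comp h2))
    have hne := hden.eventually_ne (by
      rw [hv1, one_pow, div_one, one_mul, mul_comm (poch (q ^ 2) _)]
      exact mul_ne_zero (by norm_num) hp42 : _ ≠ (0 : ℂ))
    filter_upwards [hne, eventually_ne_nhds hv₀] with v hv hv'
    refine DifferentiableAt.neg (DifferentiableAt.div (differentiableAt_const _) ?_ hv)
    have h1 : DifferentiableAt ℂ (fun v : ℂ => q ^ 2 / (v / v₀) ^ 2) v :=
      DifferentiableAt.div (by fun_prop) (by fun_prop) (pow_ne_zero 2 (div_ne_zero hv' hv₀))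
    have h2 : DifferentiableAt ℂ (fun v : ℂ => (v / v₀) ^ 2 * q ^ 4) v := by fun_prop
    exact DifferentiableAt.mul (by fun_prop)
      ((hd4.differentiableAt.comp v h1).mul (hd4.differentiableAt.comp v h2))
  have hnz : ∀ᶠ v in 𝓝 v₀, NonZero (ext2 ζ' w v) := by
    filter_upwards [eventually_ne_nhds hv₀] with v hv
    exact forall_bigIdx.mpr ⟨fun i => by rw [ext2_smallIdx]; exact hζ' i,
      by rwa [ext2_wIdx], by rwa [ext2_vIdx]⟩
  have hpd : ∀ k : ℕ, ∀ᶠ v in 𝓝 v₀, ∀ x ∈ cube Γ k, DifferentiableAt ℂ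
      (fun p : ℂ × (Fin k → ℂ) => ∏ μ, psiProd q (ext2 ζ' w p.1) (p.2 μ)) (v, x) := fun k => by
    filter_upwards [hnz, hsupp] with v hv1 hv2 x hx
    refine differentiableAt_finsetProd fun μ _ => differentiableAt_psiProd hq0 hq1
      (E := ℂ × (Fin k → ℂ)) (e := (v, x))
      (Z := fun p => ext2 ζ' w p.1) (x := fun p => p.2 μ) ?_ (by fun_prop) hv1 ?_
    · exact (differentiable_ext2 ζ' w).differentiableAt.comp (v, x) differentiableAt_fst
    · obtain ⟨i, hi⟩ := mem_iUnion.mp (hx μ)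
      exact hv2 i hi
  have hcube0 : ∀ {k : ℕ} {x : Fin k → ℂ}, x ∈ cube Γ k → NonZero x := fun hx μ => by
    obtain ⟨i, hi⟩ := mem_iUnion.mp (hx μ)
    exact (Γ i).ne_zero_of_mem_supp hi
  have hsnoc : ∀ {x : Fin m → ℂ} {y : ℂ}, NonZero x → y ≠ 0 →
      NonZero (Fin.snoc x y : Fin (m + 1) → ℂ) := fun hx hy => Fin.lastCases
    (by rw [Fin.snoc_last]; exact hy) fun i => by rw [Fin.snoc_castSucc]; exact hx i
  have hsnocd : ∀ y : ℂ, Differentiable ℂ fun p : ℂ × (Fin m → ℂ) =>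
      (p.1, (Fin.snoc p.2 y : Fin (m + 1) → ℂ)) := fun y =>
    differentiable_fst.prodMk (differentiable_pi.mpr (Fin.lastCases
      (by simp only [Fin.snoc_last]; fun_prop) fun i => by simp only [Fin.snoc_castSucc]; fun_prop))
  have hres := hasRes_cycMulti (Γ := Γ) (W := fun _ : Fin (m + 1) => 1) (W' := fun _ : Fin m => 1)
    (H₁ := fun v x => ((m + 1).factorial : ℂ)⁻¹ *
      (A v x * ∏ μ, psiProd q (ext2 ζ' w v) (x μ)))
    (H₂ := fun v x => (m.factorial : ℂ)⁻¹ * κ * (s v * (A v (Fin.snoc x (w ^ 2 * q⁻¹)) *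
      ∏ μ, psiProd q (ext2 ζ' w v) (x μ)))) hv₀
    (G := fun v => ((m + 1).factorial : ℂ)⁻¹ * multiContour (γ v) fun x =>
        A v x * ∏ μ, psiProd q (ext2 ζ' w v) (x μ)) ?_ ?_ ?_
  · convert hres using 1
    rw [cycMulti_const_mul, cycMulti_const_mul, hs0, hκ]
    ring
  · filter_upwards [hA, hpd (m + 1)] with v h1 h2 x hx
    exact ((h1 x (hcube0 hx)).mul (h2 x hx)).const_mul _
  · filter_upwards [hA, hpd m, hsd] with v h1 h2 h3 x hx
    refine DifferentiableAt.const_mul (DifferentiableAt.mul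
      (h3.comp (f := fun p : ℂ × (Fin m → ℂ) => p.1) (v, x) differentiableAt_fst)
      (DifferentiableAt.mul ?_ (h2 x hx))) _
    exact (h1 _ (hsnoc (hcube0 hx) hP0)).comp (f := fun p : ℂ × (Fin m → ℂ) =>
      (p.1, (Fin.snoc p.2 (w ^ 2 * q⁻¹) : Fin (m + 1) → ℂ))) (v, x) (hsnocd _).differentiableAt
  · filter_upwards [hgen, hγ, nhdsWithin_le_nhds hsupp, nhdsWithin_le_nhds hin,
      nhdsWithin_le_nhds hout, nhdsWithin_le_nhds hA, nhdsWithin_le_nhds hsymm,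
      nhdsWithin_le_nhds hzero, nhdsWithin_le_nhds (eventually_ne_nhds hv₀)] with
      v g1 g2 g3 g4 g5 g6 g7 g8 g9
    have key := multiContour_eq_add_residue hq0 hq1 g1 g2 g3 h0 g4 (wIdx n l) g5
      (by rw [ext2_wIdx]; exact hP) (A := A v)
      (fun x hx => (g6 x hx).comp (f := fun x => (v, x)) x (by fun_prop)) g7 g8
    rw [ext2_wIdx] at key
    have hu : v / v₀ ≠ 0 := div_ne_zero g9 hv₀
    -- Among the regular factors at the pole, the one belonging to `v` is `ψ(q / (v / v₀)²)`; it
    -- alone depends on `v` and is singular at `v₀`.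
    have e1 : psiRes q (ext2 ζ' w v) (wIdx n l) * (w ^ 2 * q⁻¹) = κ * (s v / (v / v₀ - 1)) := by
      rw [psiRes, prod_erase_wIdx, hκ]
      simp only [ext2_wIdx, ext2_vIdx, ext2_smallIdx]
      have e2 : w ^ 2 * q⁻¹ / v ^ 2 = q / (v / v₀) ^ 2 := by
        rw [div_pow, hvw]; field_simp
      rw [e2, psi_eq_div_sub hq0 hq1 hu]
      ring
    have e3 : (((m + 1).factorial : ℂ))⁻¹ * ((m + 1 : ℕ) : ℂ) = (m.factorial : ℂ)⁻¹ := by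
      rw [Nat.factorial_succ, Nat.cast_mul, mul_inv, mul_right_comm, inv_mul_cancel₀
        (Nat.cast_ne_zero.mpr (Nat.succ_ne_zero m)), one_mul]
    rw [key, mul_add, ← cycMulti_const_mul]
    congr 1
    rw [← mul_assoc, e3, cycMulti_const_mul, cycMulti_const_mul, cycMulti_const_mul,
      mul_comm (w ^ 2 * q⁻¹), e1]
    ring

end QKZ

namespace QKZ
open Set Filter Metric

/-! ### Symmetry of the integrand -/

lemma DeltaPol_comp_perm_left (q : ℂ) {m n l : ℕ} (x : Fin m → ℂ) (a : Fin n → ℂ) (b : Fin l → ℂ)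
    (π : Equiv.Perm (Fin m)) :
    DeltaPol q (x ∘ π) a b = sgn (Equiv.Perm.sign π) * DeltaPol q x a b := by
  unfold DeltaPol
  exact Matrix.det_permute π (Matrix.of fun μ i : Fin m => APol q (n - m + 1 + (i : ℕ)) (x μ) a b)

lemma bracketExt_comp_perm_left (q : ℂ) {m n l : ℕ} (x : Fin m → ℂ) (ζ : Fin (n + l) → ℂ)
    (π : Equiv.Perm (Fin m)) :
    bracketExt q (x ∘ π) ζ = sgn (Equiv.Perm.sign π) * bracketExt q x ζ := by
  unfold bracketExt
  rw [DeltaPol_comp_perm_left]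
  ring

lemma sgn_mul_self (ε : ℤˣ) : sgn ε * sgn ε = 1 := by
  rcases Int.units_eq_one_or ε with h | h <;> simp [h, sgn]

/-- `ϑ` times the extreme component of the polynomial vector. -/
def integrand (q : ℂ) {m n l : ℕ} (ϑ : (Fin m → ℂ) → (Fin (n + l) → ℂ) → ℂ)
    (ζ : Fin (n + l) → ℂ) (x : Fin m → ℂ) : ℂ := ϑ x ζ * bracketExt q x ζ

section

variable {p q : ℂ} {r : ℂ → ℂ} {ε : ℤˣ} {m N : ℕ} {ϑ : (Fin m → ℂ) → (Fin N → ℂ) → ℂ}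

lemma IsKernel.eq_zero_of_eq (h : IsKernel p q r ε ϑ) {ζ : Fin N → ℂ} (hζ : NonZero ζ)
    (hreg : RegularAt ϑ ζ) {x : Fin m → ℂ} (hx : NonZero x) {i j : Fin m} (hij : i ≠ j)
    (he : x i = x j) : ϑ x ζ = 0 := by
  have h1 := h.antisymm ζ hζ hreg x hx (Equiv.swap i j)
  have h2 : x ∘ Equiv.swap i j = x := by
    funext k
    by_cases hi : k = i
    · subst hi; simp [he]
    by_cases hj : k = j
    · subst hj; simp [he]
    · simp [Equiv.swap_apply_of_ne_of_ne hi hj]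
  rw [h2, Equiv.Perm.sign_swap hij] at h1
  have h3 : sgn (-1) = -1 := by simp [sgn]
  rw [h3] at h1
  linear_combination h1 / 2

lemma exists_perm_insertNth (k : Fin (m + 1)) : ∃ π : Equiv.Perm (Fin (m + 1)),
    ∀ (y : ℂ) (x : Fin m → ℂ), (k.insertNth y x : Fin (m + 1) → ℂ) =
      (Fin.snoc x y : Fin (m + 1) → ℂ) ∘ π := by
  refine ⟨(finSuccEquiv' k).trans (finSuccEquiv' (Fin.last m)).symm, fun y x => ?_⟩
  funext i
  rcases Fin.eq_self_or_eq_succAbove k i with h | ⟨j, h⟩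
  · rw [h, Fin.insertNth_apply_same]
    simp
  · rw [h, Fin.insertNth_apply_succAbove]
    simp

end

section

variable {p q : ℂ} {r : ℂ → ℂ} {ε : ℤˣ} {m n l : ℕ}
  {ϑ : (Fin (m + 1) → ℂ) → (Fin (n + l) → ℂ) → ℂ} {ζ : Fin (n + l) → ℂ}

lemma nonZero_snoc {x : Fin m → ℂ} {y : ℂ} (hx : NonZero x) (hy : y ≠ 0) :
    NonZero (Fin.snoc x y : Fin (m + 1) → ℂ) := Fin.lastCases
  (by rw [Fin.snoc_last]; exact hy) fun i => by rw [Fin.snoc_castSucc]; exact hx i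

/-- Both `ϑ` and the determinant are antisymmetric in `x`, so the signs cancel. -/
lemma integrand_insertNth (h : IsKernel p q r ε ϑ) (hζ : NonZero ζ) (hreg : RegularAt ϑ ζ)
    (k : Fin (m + 1)) {y : ℂ} {x : Fin m → ℂ} (hy : y ≠ 0) (hx : NonZero x) :
    integrand q ϑ ζ (k.insertNth y x) = integrand q ϑ ζ (Fin.snoc x y) := by
  obtain ⟨π, hπ⟩ := exists_perm_insertNth k
  rw [hπ, integrand, integrand, h.antisymm ζ hζ hreg _ (nonZero_snoc hx hy),
    bracketExt_comp_perm_left]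
  linear_combination ϑ (Fin.snoc x y) ζ * bracketExt q (Fin.snoc x y) ζ *
    sgn_mul_self (Equiv.Perm.sign π)

lemma integrand_snoc_eq_zero (h : IsKernel p q r ε ϑ) (hζ : NonZero ζ) (hreg : RegularAt ϑ ζ)
    {x : Fin m → ℂ} (hx : NonZero x) (k : Fin m) :
    integrand q ϑ ζ (Fin.snoc x (x k)) = 0 := by
  rw [integrand, h.eq_zero_of_eq hζ hreg (nonZero_snoc hx (hx k)) (Fin.castSucc_lt_last k).ne
    (by rw [Fin.snoc_castSucc, Fin.snoc_last]), zero_mul]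

end

lemma Gbar_extreme (q : ℂ) {m n l : ℕ} (ϑ : (Fin m → ℂ) → (Fin (n + l) → ℂ) → ℂ) (γ : ℝ → ℂ)
    (ζ : Fin (n + l) → ℂ) :
    Gbar q ϑ γ ζ (extreme (n + l) n) = (m.factorial : ℂ)⁻¹ * multiContour γ fun x =>
      integrand q ϑ ζ x * ∏ μ, psiProd q ζ (x μ) := by
  have hc : (Finset.univ.filter fun j => extreme (n + l) n j = -1).card = n := by
    have e : (Finset.univ.filter fun j : Fin (n + l) => extreme (n + l) n j = -1) =
        Finset.univ.filter fun j : Fin (n + l) => (j : ℕ) < n := by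
      refine Finset.filter_congr fun j _ => ?_
      unfold extreme
      split_ifs with h
      · exact iff_of_true rfl h
      · exact iff_of_false neg_one_ne_one_units.symm h
    rw [e, Fin.card_filter_val_lt]
    omega
  rw [Gbar]
  congr 2
  funext x
  rw [bracket, if_pos hc, bracketAux_extreme, Psi_eq, integrand]
  ring

/-! ### Generic values of the last variable -/

/-- The points `c q^(2k)` accumulate only at zero and infinity, so near `y₀` none of them differs
from `y₀`. -/
lemma eventually_ne_mul_zpow {q : ℂ} (hq0 : q ≠ 0) (hq1 : ‖q‖ < 1) {c y₀ : ℂ} (hc : c ≠ 0)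
    (hy₀ : y₀ ≠ 0) : ∀ᶠ y in 𝓝[≠] y₀, ∀ k : ℤ, y ≠ c * q ^ (2 * k) := by
  have hp : ‖q ^ 2‖ < 1 := by
    rw [norm_pow]; exact pow_lt_one₀ (norm_nonneg _) hq1 (by norm_num)
  have hn : 0 < ‖y₀‖ := norm_pos_iff.mpr hy₀
  have f1 := finite_geometric_large hp (fun _ : Fin 1 => c) (half_pos hn)
  have f2 := finite_geometric_small hp (pow_ne_zero 2 hq0) (c := fun _ : Fin 1 => c)
    (fun _ => hc) (2 * ‖y₀‖)
  have hcl := ((f1.union f2).subset (sdiff_subset (t := {y₀}))).isClosed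
  have hmem := hcl.isOpen_compl.mem_nhds (x := y₀) (fun h => h.2 rfl)
  have e1 : ∀ᶠ y in 𝓝 y₀, ‖y₀‖ / 2 < ‖y‖ :=
    continuous_norm.continuousAt.eventually (lt_mem_nhds (half_lt_self hn))
  have e2 : ∀ᶠ y in 𝓝 y₀, ‖y‖ < 2 * ‖y₀‖ :=
    continuous_norm.continuousAt.eventually (gt_mem_nhds (by linarith))
  filter_upwards [nhdsWithin_le_nhds hmem, nhdsWithin_le_nhds e1, nhdsWithin_le_nhds e2,
    self_mem_nhdsWithin] with y h1 h2 h3 h4 k hk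
  refine h1 ⟨?_, h4⟩
  rcases Int.eq_nat_or_neg k with ⟨K, rfl | rfl⟩
  · refine Or.inl ⟨⟨(0, K), ?_⟩, h2.le⟩
    change c * (q ^ 2) ^ K = y
    rw [hk, ← pow_mul]
    norm_cast
  · refine Or.inr ⟨⟨(0, K), ?_⟩, h3.le⟩
    change c * (q ^ 2)⁻¹ ^ K = y
    rw [hk, inv_pow, ← pow_mul, mul_neg, zpow_neg]
    norm_cast

lemma tendsto_sq_punctured {v₀ : ℂ} (hv₀ : v₀ ≠ 0) :
    Tendsto (fun v : ℂ => v ^ 2) (𝓝[≠] v₀) (𝓝[≠] (v₀ ^ 2)) := by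
  refine tendsto_nhdsWithin_of_tendsto_nhds_of_eventually_within _
    ((continuous_pow 2).continuousAt.tendsto.mono_left nhdsWithin_le_nhds) ?_
  have h : v₀ ≠ -v₀ := fun h => hv₀ (by linear_combination h / 2)
  filter_upwards [self_mem_nhdsWithin, nhdsWithin_le_nhds (eventually_ne_nhds h)] with v h1 h2 h3
  rcases sq_eq_sq_iff_eq_or_eq_neg.mp h3 with h4 | h4
  · exact h1 h4
  · exact h2 h4

lemma eventually_generic_ext2 {q : ℂ} (hq0 : q ≠ 0) (hq1 : ‖q‖ < 1) {n l : ℕ}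
    {ζ' : Fin (n + l) → ℂ} {w v₀ : ℂ} (hζ' : Generic q ζ') (hw : w ≠ 0) (hv₀ : v₀ ≠ 0)
    (hgenw : ∀ i (k : ℤ), ζ' i ^ 2 ≠ w ^ 2 * q ^ (2 * k)) :
    ∀ᶠ v in 𝓝[≠] v₀, Generic q (ext2 ζ' w v) := by
  have hinv : ∀ {a b : ℂ} {k : ℤ}, a = b * q ^ (2 * k) → b = a * q ^ (2 * -k) := fun {a b k} h => by
    rw [h, mul_neg, zpow_neg, mul_assoc, mul_inv_cancel₀ (zpow_ne_zero _ hq0), mul_one]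
  have ev : ∀ c : ℂ, c ≠ 0 → ∀ᶠ v in 𝓝[≠] v₀, ∀ k : ℤ, v ^ 2 ≠ c * q ^ (2 * k) := fun c hc =>
    (tendsto_sq_punctured hv₀).eventually
      (eventually_ne_mul_zpow hq0 hq1 hc (pow_ne_zero 2 hv₀))
  filter_upwards [eventually_all.mpr fun i => ev (ζ' i ^ 2) (pow_ne_zero 2 (hζ'.1 i)),
    ev (w ^ 2) (pow_ne_zero 2 hw), nhdsWithin_le_nhds (eventually_ne_nhds hv₀)] with v h1 h2 h3
  refine ⟨forall_bigIdx.mpr ⟨fun i => by rw [ext2_smallIdx]; exact hζ'.1 i,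
      by rwa [ext2_wIdx], by rwa [ext2_vIdx]⟩, ?_⟩
  rw [forall_bigIdx]
  simp only [ext2_smallIdx, ext2_wIdx, ext2_vIdx]
  refine ⟨fun i => forall_bigIdx.mpr ⟨fun j hij k => ?_, fun _ k => ?_, fun _ k h => ?_⟩,
    forall_bigIdx.mpr ⟨fun j _ k h => ?_, fun h => absurd rfl h, fun _ k h => ?_⟩,
    forall_bigIdx.mpr ⟨fun j _ k h => ?_, fun _ k h => ?_, fun h => absurd rfl h⟩⟩
  · rw [ext2_smallIdx]
    exact hζ'.2 i j (fun h => hij (congrArg smallIdx h)) k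
  · rw [ext2_wIdx]
    exact hgenw i k
  · rw [ext2_vIdx] at h
    exact h1 i _ (hinv h)
  · rw [ext2_smallIdx] at h
    exact hgenw j _ (hinv h)
  · rw [ext2_vIdx] at h
    exact h2 _ (hinv h)
  · rw [ext2_smallIdx] at h
    exact h1 j k h
  · rw [ext2_wIdx] at h
    exact h2 k h

end QKZ

namespace QKZ
open Set Filter Metric

/-! ### A cycle that is independent of the last variable -/

lemma innerPt_eq (q : ℂ) {N : ℕ} (ζ : Fin N → ℂ) (j : Fin N) (k : ℕ) :
    innerPt q ζ j k = ζ j ^ 2 * q * (q ^ 4) ^ k := by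
  rw [innerPt]; ring

lemma outerPt_eq (q : ℂ) {N : ℕ} (ζ : Fin N → ℂ) (j : Fin N) (k : ℕ) :
    outerPt q ζ j k = ζ j ^ 2 * q⁻¹ * (q ^ 4)⁻¹ ^ k := by
  rw [outerPt, ← inv_pow]; ring

lemma generic_snoc {q : ℂ} (hq0 : q ≠ 0) {N : ℕ} {ζ' : Fin N → ℂ} {w : ℂ} (hζ' : Generic q ζ')
    (hw : w ≠ 0) (hgenw : ∀ i (k : ℤ), ζ' i ^ 2 ≠ w ^ 2 * q ^ (2 * k)) :
    Generic q (Fin.snoc ζ' w : Fin (N + 1) → ℂ) := by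
  refine ⟨Fin.lastCases (by rwa [Fin.snoc_last]) fun i => by
    rw [Fin.snoc_castSucc]; exact hζ'.1 i, ?_⟩
  refine Fin.lastCases (Fin.lastCases (fun h => absurd rfl h) fun j _ k h => ?_) fun i =>
    Fin.lastCases (fun _ k => ?_) fun j hij k => ?_
  · rw [Fin.snoc_last, Fin.snoc_castSucc] at h
    refine hgenw j (-k) ?_
    rw [h, mul_neg, zpow_neg, mul_assoc, mul_inv_cancel₀ (zpow_ne_zero _ hq0), mul_one]
  · rw [Fin.snoc_last, Fin.snoc_castSucc]
    exact hgenw i k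
  · rw [Fin.snoc_castSucc, Fin.snoc_castSucc]
    exact hζ'.2 i j (fun h => hij (congrArg _ h)) k

/-- The inner points at `v₀`, among them `P = w² q⁻¹` as the first one of the last variable, are
separated from the outer points other than `P`. Stability of geometric sequences keeps the
separation for `v` near `v₀`. The points `ζ'_j² τ³` are avoided as well, because the exact
remainders in the reduction of `Δ` are singular there. -/
theorem exists_cycle {q : ℂ} (hq0 : q ≠ 0) (hq1 : ‖q‖ < 1) {n l : ℕ} {ζ' : Fin (n + l) → ℂ}
    {w v₀ : ℂ} (hζ' : Generic q ζ') (hw : w ≠ 0) (hv₀ : v₀ ≠ 0)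
    (hgenw : ∀ i (k : ℤ), ζ' i ^ 2 ≠ w ^ 2 * q ^ (2 * k)) (hvw : v₀ ^ 2 = w ^ 2 * q⁻¹ ^ 2) :
    ∃ (κ : Type) (_ : Fintype κ) (Γ : κ → Loop), cycWind Γ 1 0 = 1 ∧
      cycWind Γ 1 (w ^ 2 * q⁻¹) = 1 ∧
      (∀ᶠ v in 𝓝 v₀, ∀ i, (Γ i).supp ⊆ poleFree q (ext2 ζ' w v)) ∧
      (∀ᶠ v in 𝓝 v₀, ∀ j k, cycWind Γ 1 (innerPt q (ext2 ζ' w v) j k) = 1) ∧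
      (∀ᶠ v in 𝓝 v₀, ∀ j k, (j, k) ≠ (wIdx n l, 0) →
        cycWind Γ 1 (outerPt q (ext2 ζ' w v) j k) = 0) ∧
      ∀ i, ∀ x ∈ (Γ i).supp, ∀ j, x ≠ ζ' j ^ 2 * q⁻¹ ^ 3 := by
  set ζ₀ := ext2 ζ' w v₀ with hζ₀
  set P := w ^ 2 * q⁻¹ with hP
  -- Since `v₀² = w² q^(-2)`, all points in question are odd powers of `q` times the square of some
  -- `η c`, and these squares are generic.
  set η : Fin (n + l + 1) → ℂ := Fin.snoc ζ' w with hη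
  have hηg : Generic q η := generic_snoc hq0 hζ' hw hgenw
  have hη1 : ∀ i, η (Fin.castSucc i) = ζ' i := fun i => by rw [hη, Fin.snoc_castSucc]
  have hη2 : η (Fin.last _) = w := by rw [hη, Fin.snoc_last]
  have hnz : NonZero ζ₀ := forall_bigIdx.mpr ⟨fun i => by rw [hζ₀, ext2_smallIdx]; exact hζ'.1 i,
      by rwa [hζ₀, ext2_wIdx], by rwa [hζ₀, ext2_vIdx]⟩
  have hv2 : v₀ ^ 2 = w ^ 2 * q ^ (-2 : ℤ) := by
    rw [hvw, inv_pow, zpow_neg]; norm_cast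
  have hq4 := norm_pow_four_lt hq1
  have hq40 : q ^ 4 ≠ 0 := pow_ne_zero 4 hq0
  set A : Set ℂ := range fun a : Fin (n + 1 + (l + 1)) × ℕ => ζ₀ a.1 ^ 2 * q * (q ^ 4) ^ a.2 with hA
  set B₁ : Set ℂ := range fun a : Fin (n + 1 + (l + 1)) × ℕ => ζ₀ a.1 ^ 2 * q⁻¹ * (q ^ 4)⁻¹ ^ a.2
    with hB₁
  set B₂ : Set ℂ := range fun j => ζ' j ^ 2 * q⁻¹ ^ 3 with hB₂
  set B := (B₁ \ {P}) ∪ B₂ with hB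
  have hAc : ∀ x ∈ A, ∃ c, ∃ a : ℤ, x = η c ^ 2 * q ^ a ∧ Odd a ∧ (1 ≤ a ∨ c = Fin.last _) ∧ -1 ≤ a := by
    rintro _ ⟨⟨j, k⟩, rfl⟩
    dsimp only
    rw [← innerPt_eq, innerPt_eq_zpow hq0]
    revert j
    rw [forall_bigIdx, hζ₀]
    refine ⟨fun i => ⟨Fin.castSucc i, 1 + 4 * k, by rw [ext2_smallIdx, hη1], ⟨2 * k, by ring⟩,
      Or.inl (by omega), by omega⟩, ⟨Fin.last _, 1 + 4 * k, by rw [ext2_wIdx, hη2],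
      ⟨2 * k, by ring⟩, Or.inr rfl, by omega⟩, ⟨Fin.last _, -2 + (1 + 4 * k), ?_, ⟨2 * k - 1, by ring⟩,
      Or.inr rfl, by omega⟩⟩
    rw [ext2_vIdx, hη2, hv2, zpow_add₀ hq0 (-2), mul_assoc]
  have hBc : ∀ x ∈ B, ∃ c, ∃ b : ℤ, x = η c ^ 2 * q ^ b ∧ Odd b ∧ b ≤ -1 ∧ (c = Fin.last _ → b < -1) := by
    rintro x (⟨⟨⟨j, k⟩, rfl⟩, hx⟩ | ⟨j, rfl⟩)
    · dsimp only at hx ⊢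
      rw [← outerPt_eq, outerPt_eq_zpow hq0] at hx ⊢
      revert j
      rw [forall_bigIdx, hζ₀]
      refine ⟨fun i _ => ⟨Fin.castSucc i, -(1 + 4 * k), by rw [ext2_smallIdx, hη1],
        ⟨-1 - 2 * k, by ring⟩, by omega, fun h => absurd h (Fin.castSucc_lt_last i).ne⟩,
        fun hx => ⟨Fin.last _, -(1 + 4 * k), by rw [ext2_wIdx, hη2], ⟨-1 - 2 * k, by ring⟩, by omega,
        fun _ => ?_⟩, fun _ => ⟨Fin.last _, -2 + -(1 + 4 * k), ?_, ⟨-2 - 2 * k, by ring⟩, by omega,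
        fun _ => by omega⟩⟩
      · have hk : k ≠ 0 := by
          rintro rfl
          refine hx ?_
          rw [mem_singleton_iff, ext2_wIdx, hP]
          simp
        omega
      · rw [ext2_vIdx, hη2, hv2, zpow_add₀ hq0 (-2), mul_assoc]
    · refine ⟨Fin.castSucc j, -3, ?_, ⟨-2, by ring⟩, by omega,
        fun h => absurd h (Fin.castSucc_lt_last j).ne⟩
      dsimp only
      rw [hη1, inv_pow, zpow_neg]
      norm_cast
  have hdisj : Disjoint A B := by
    rw [Set.disjoint_left]
    intro x hxA hxB
    obtain ⟨c, a, e1, ⟨a', ha'⟩, h1, h2⟩ := hAc x hxA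
    obtain ⟨c', b, e2, ⟨b', hb'⟩, h3, h4⟩ := hBc x hxB
    obtain ⟨hc, hab⟩ := hηg.eq_of_mul_zpow hq0 hq1 ⟨b' - a', by omega⟩ (e1.symm.trans e2)
    rcases h1 with h1 | h1
    · omega
    · have := h4 (hc.symm.trans h1)
      omega
  have hAf : ∀ ε : ℝ, 0 < ε → {x ∈ A | ε ≤ ‖x‖}.Finite := fun ε hε =>
    finite_geometric_large hq4 (fun j => ζ₀ j ^ 2 * q) hε
  have hc0 : ∀ j, ζ₀ j ^ 2 * q⁻¹ ≠ 0 := fun j =>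
    mul_ne_zero (pow_ne_zero 2 (hnz j)) (inv_ne_zero hq0)
  have hBf : ∀ R : ℝ, {x ∈ B | ‖x‖ ≤ R}.Finite := fun R => by
    refine ((finite_geometric_small hq4 hq40 hc0 R).union (finite_range fun j : Fin (n + l) =>
      ζ' j ^ 2 * q⁻¹ ^ 3)).subset ?_
    rintro x ⟨hx | hx, hR⟩
    · exact Or.inl ⟨hx.1, hR⟩
    · exact Or.inr hx
  have hB0 : (0 : ℂ) ∉ B := fun h => by
    obtain ⟨c, b, e, -⟩ := hBc 0 h
    exact mul_ne_zero (pow_ne_zero 2 (hηg.1 c)) (zpow_ne_zero b hq0) e.symm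
  obtain ⟨κ, hκ, Γ, T, T', hT, hT', h0T, hAT, hBT, hR, hin, hout⟩ :=
    exists_separating_cycle hAf hBf hB0 hdisj
  have hPA : P ∈ A := ⟨(vIdx n l, 0), by
    dsimp only
    rw [hζ₀, ext2_vIdx, hvw, hP, pow_zero, mul_one]
    field_simp⟩
  have hev1 : ∀ᶠ v in 𝓝 v₀, ∀ j k, innerPt q (ext2 ζ' w v) j k ∈ T := by
    refine eventually_all.mpr fun j => ?_
    have h1 := eventually_forall_mul_pow_mem hT h0T hq4 (c := ζ₀ j ^ 2 * q) fun k =>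
      hAT ⟨(j, k), rfl⟩
    have hc : ContinuousAt (fun v => ext2 ζ' w v j ^ 2 * q) v₀ := by
      have := (differentiable_pi.mp (differentiable_ext2 ζ' w) j).continuous
      fun_prop
    filter_upwards [hc.eventually h1] with v hv k
    rw [innerPt_eq]; exact hv k
  have hev2 : ∀ᶠ v in 𝓝 v₀, ∀ j k, (j, k) ≠ (wIdx n l, 0) → outerPt q (ext2 ζ' w v) j k ∈ T' := by
    refine eventually_all.mpr ?_
    have key : ∀ j, j ≠ wIdx n l → ∀ᶠ v in 𝓝 v₀, ∀ k, (j, k) ≠ (wIdx n l, 0) →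
        outerPt q (ext2 ζ' w v) j k ∈ T' := by
      intro j hj
      have h1 := eventually_forall_mul_inv_pow_mem hT' hR (hc0 j) hq4 hq40 fun k => by
        refine hBT (Or.inl ⟨⟨(j, k), rfl⟩, fun h => ?_⟩)
        rw [mem_singleton_iff, ← outerPt_eq, outerPt_eq_zpow hq0] at h
        have e : P = η (Fin.last _) ^ 2 * q ^ (-1 : ℤ) := by rw [hη2, hP, zpow_neg_one]
        rw [e] at h
        revert h hj
        revert j
        rw [forall_bigIdx, hζ₀]
        simp only [ext2_smallIdx, ext2_wIdx, ext2_vIdx]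
        refine ⟨fun i _ h => ?_, fun h => absurd rfl h, fun _ h => ?_⟩
        · rw [← hη1] at h
          exact absurd (hηg.eq_of_mul_zpow hq0 hq1 ⟨2 * k, by ring⟩ h).1 (Fin.castSucc_lt_last i).ne
        · rw [hv2, ← hη2, mul_assoc, ← zpow_add₀ hq0] at h
          have := (hηg.eq_of_mul_zpow hq0 hq1 ⟨2 * k + 1, by ring⟩ h).2
          omega
      have hc : ContinuousAt (fun v => ext2 ζ' w v j ^ 2 * q⁻¹) v₀ := by
        have := (differentiable_pi.mp (differentiable_ext2 ζ' w) j).continuous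
        fun_prop
      filter_upwards [hc.eventually h1] with v hv k _
      rw [outerPt_eq]; exact hv k
    intro j
    by_cases hj : j = wIdx n l
    · subst hj
      refine Eventually.of_forall fun v k hk => ?_
      have hk0 : k ≠ 0 := fun h => hk (by rw [h])
      refine hBT (Or.inl ⟨⟨(wIdx n l, k), ?_⟩, fun h => ?_⟩)
      · dsimp only
        rw [outerPt_eq, hζ₀, ext2_wIdx, ext2_wIdx]
      · have e : P = η (Fin.last _) ^ 2 * q ^ (-1 : ℤ) := by rw [hη2, hP, zpow_neg_one]
        rw [mem_singleton_iff, outerPt_eq_zpow hq0, ext2_wIdx, e, ← hη2] at h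
        have := (hηg.eq_of_mul_zpow hq0 hq1 ⟨2 * k, by ring⟩ h).2
        omega
    · exact key j hj
  refine ⟨κ, hκ, Γ, (hin 0 h0T).2, (hin P (hAT hPA)).2, ?_, ?_, ?_, ?_⟩
  · filter_upwards [hev1, hev2] with v h1 h2 i x hx
    refine ⟨(Γ i).ne_zero_of_mem_supp hx, fun j k h => ?_, fun j k h => ?_⟩
    · exact (hin _ (h1 j k)).1 i (h ▸ hx)
    · by_cases hjk : (j, k) = (wIdx n l, 0)
      · simp only [Prod.mk.injEq] at hjk
        rw [hjk.1, hjk.2, outerPt_eq, ext2_wIdx, pow_zero, mul_one] at h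
        exact (hin P (hAT hPA)).1 i (by rw [h] at hx; exact hx)
      · exact (hout _ (h2 j k hjk)).1 i (h ▸ hx)
  · filter_upwards [hev1] with v h1 j k using (hin _ (h1 j k)).2
  · filter_upwards [hev2] with v h2 j k hjk using (hout _ (h2 j k hjk)).2
  · exact fun i x hx j h => (hout _ (hBT (Or.inr ⟨j, rfl⟩))).1 i (by rw [h] at hx; exact hx)

end QKZ

namespace QKZ
open Set Filter Metric

/-! ### Integrals at the limit point -/

section

variable {ι : Type*} [Fintype ι] {q : ℂ} {m N : ℕ} {ζ : Fin N → ℂ} {Γ : ι → Loop}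

lemma cube_subset_of_supp {S : Set ℂ} (h : ∀ i, (Γ i).supp ⊆ S) :
    cube Γ m ⊆ {x | ∀ μ, x μ ∈ S} := fun x hx μ => by
  obtain ⟨i, hi⟩ := mem_iUnion.mp (hx μ)
  exact h i hi

/-- Contour and cycle have equal winding numbers about every pole and about the origin, and the
variables are exchanged one at a time. -/
lemma multiContour_eq_cycMulti (hq0 : q ≠ 0) (hq1 : ‖q‖ < 1) (hζ : Generic q ζ) {γ : ℝ → ℂ}
    (hγ : IsContour q ζ γ) (j₀ : Fin N) (hsupp : ∀ i, (Γ i).supp ⊆ poleFree q ζ)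
    (h0 : cycWind Γ 1 0 = 1) (hin : ∀ j k, cycWind Γ 1 (innerPt q ζ j k) = 1)
    (hout : ∀ j k, cycWind Γ 1 (outerPt q ζ j k) = 0) {A : (Fin m → ℂ) → ℂ}
    (hA : ∀ x, NonZero x → DifferentiableAt ℂ A x) :
    multiContour γ (fun x => A x * ∏ μ, psiProd q ζ (x μ)) =
      cycMulti Γ (fun _ => 1) fun x => A x * ∏ μ, psiProd q ζ (x μ) := by
  classical
  obtain ⟨Γ₀, hΓ₀, hwind, hmulti⟩ := hγ.exists_loop
  set Γ' : Option ι → Loop := fun o => o.elim Γ₀ Γ with hΓ'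
  set w : Option ι → ℂ := Pi.single none 1 with hw
  set w' : Option ι → ℂ := fun o => o.elim 0 fun _ => 1 with hw'
  have hsupp' : ∀ o, (Γ' o).supp ⊆ poleFree q ζ := by
    rintro (_ | i)
    · rintro _ ⟨t, ht, rfl⟩
      change Γ₀.γ t ∈ _
      rw [hΓ₀]
      exact hγ.mem_poleFree ht
    · exact hsupp i
  have hcube : cube Γ' m ⊆ {x | ∀ μ, x μ ∈ poleFree q ζ} := cube_subset_of_supp hsupp'
  have hnz : ∀ {x : Fin m → ℂ}, x ∈ cube Γ' m → NonZero x := fun hx μ => (hcube hx μ).1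
  have hwd : ∀ p, cycWind Γ' (w - w') p = winding γ p - cycWind Γ 1 p := fun p => by
    simp [cycWind, hw, hw', hΓ', Fintype.sum_option, hwind]
    ring
  have hF : ContinuousOn (fun x => A x * ∏ μ, psiProd q ζ (x μ)) (cube Γ' m) :=
    ContinuousOn.mul (fun x hx => (hA x (hnz hx)).continuousAt.continuousWithinAt)
      (continuousOn_finsetProd _ fun μ _ => (continuousOn_psiProd hq0 hq1 hζ.1).comp
        (continuous_apply μ).continuousOn fun x hx => hcube hx μ)
  have key := cycMulti_replace_of_update (W := fun _ => w) (W' := fun _ => w') hF fun k x hx => by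
    have hx0 := hnz hx
    refine Eq.trans (cycInt_congr fun i y _ => ?_) (cycInt_psiProd_eq_zero hq0 hq1 hζ hsupp'
      (by rw [hwd, hγ.winding_zero hq1 j₀, h0, sub_self])
      (g := fun y => A (Function.update x k y) * ∏ μ ∈ Finset.univ.erase k, psiProd q ζ (x μ))
      (fun y hy => DifferentiableAt.differentiableWithinAt (DifferentiableAt.mul_const
        ((hA _ (hx0.update k hy)).comp (f := fun y => Function.update x k y) y
          (differentiable_update x k).differentiableAt) _))
      (fun j k => by rw [hwd, hγ.winding_inner, hin, sub_self])
      fun j k => Or.inl (by rw [hwd, hγ.winding_outer, hout, sub_self]))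
    rw [← Finset.mul_prod_erase _ _ (Finset.mem_univ k), Function.update_self,
      Finset.prod_congr rfl fun μ hμ => by rw [Function.update_of_ne (Finset.ne_of_mem_erase hμ)]]
    ring
  rw [hmulti, ← cycMulti_option Γ₀ Γ, ← key, cycMulti_single]
  rfl

/-- In the variable `x_c` the factor `R` is constant, and the shift property of `ϑ` by `τ⁴` is the
one required by `cycInt_exact`. -/
lemma cycMulti_exact_eq_zero (hq0 : q ≠ 0) (hq1 : ‖q‖ < 1) (hζ : Generic q ζ)
    (hsupp : ∀ i, (Γ i).supp ⊆ poleFree q ζ) (hin : ∀ j k, cycWind Γ 1 (innerPt q ζ j k) = 1)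
    (hout : ∀ j k, cycWind Γ 1 (outerPt q ζ j k) = 0) {ϑ : (Fin m → ℂ) → (Fin N → ℂ) → ℂ}
    {p : ℂ} {r : ℂ → ℂ} {ε : ℤˣ} (hϑ : IsKernel p q r ε ϑ) (hreg : RegularAt ϑ ζ) (c : Fin m)
    {E : ℂ → ℂ} (hE : ∀ y, E y = 1 / y * ((∏ j, (y - ζ j ^ 2 * q⁻¹)) -
      q⁻¹ ^ (2 * N) * ∏ j, (y - ζ j ^ 2 * q))) {R : (Fin m → ℂ) → ℂ}
    (hR : ∀ x y, (∀ c', c' ≠ c → x c' = y c') → R x = R y) (hRc : ContinuousOn R (cube Γ m)) :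
    cycMulti Γ (fun _ => 1) (fun x => Psi q ϑ x ζ * (E (x c) * R x)) = 0 := by
  have hcube : cube Γ m ⊆ {x | ∀ μ, x μ ∈ poleFree q ζ} := cube_subset_of_supp hsupp
  have hEc : ContinuousOn E {0}ᶜ := by
    have : E = fun y => 1 / y * ((∏ j, (y - ζ j ^ 2 * q⁻¹)) -
      q⁻¹ ^ (2 * N) * ∏ j, (y - ζ j ^ 2 * q)) := funext hE
    rw [this]
    exact ContinuousOn.mul (continuousOn_const.div continuousOn_id fun x hx => hx) (by fun_prop)
  refine cycMulti_eq_zero_of_update c (((continuousOn_Psi hq0 hq1 hζ.1 hreg).mono hcube).mul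
    ((hEc.comp (continuous_apply c).continuousOn fun x hx => (hcube hx c).1).mul hRc)) fun x hx => ?_
  have hx0 : NonZero x := fun μ => (hcube hx μ).1
  have e := cycInt_exact hq0 hq1 hζ hsupp hin hout
    (g := fun y => ϑ (Function.update x c y) ζ) (hreg.differentiableOn_update hx0 c) fun y hy => by
      have := hϑ.x_shift ζ hζ.1 hreg _ (hx0.update c hy) c
      rwa [Function.update_self, Function.update_idem] at this
  refine Eq.trans (cycInt_congr fun i y _ => ?_) ((cycInt_const_mul
    (R x * ∏ μ ∈ Finset.univ.erase c, psiProd q ζ (x μ)) _).trans (by rw [e, mul_zero]))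
  rw [Psi_eq, ← Finset.mul_prod_erase _ _ (Finset.mem_univ c), Function.update_self,
    Finset.prod_congr rfl fun μ hμ => by rw [Function.update_of_ne (Finset.ne_of_mem_erase hμ)],
    hE, hR (Function.update x c y) x fun c' h => Function.update_of_ne h _ _]
  ring

end

end QKZ

namespace QKZ
open Set Filter Metric

/-! ### The integrand at the limit point -/

lemma prod_headIdx_mul_prod_tailIdx {n l : ℕ} (f : Fin (n + (l + 1)) → ℂ) :
    ∏ j, f j = (∏ j : Fin (n + 1), f (headIdx j)) * ∏ t : Fin l, f (tailIdx t) := by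
  have e : n + 1 + l = n + (l + 1) := by omega
  rw [← Equiv.prod_comp (finCongr e), Fin.prod_univ_add]
  rfl

lemma exactFn_eq (q : ℂ) {n l : ℕ} (ζ : Fin (n + (l + 1)) → ℂ) (y : ℂ) :
    exactFn q (fun j : Fin (n + 1) => ζ (headIdx j) ^ 2) (fun t : Fin l => ζ (tailIdx t) ^ 2) y =
      1 / y * ((∏ j, (y - ζ j ^ 2 * q⁻¹)) -
        q⁻¹ ^ (2 * (n + (l + 1))) * ∏ j, (y - ζ j ^ 2 * q)) := by
  rw [exactFn, prod_headIdx_mul_prod_tailIdx fun j => y - ζ j ^ 2 * q⁻¹,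
    prod_headIdx_mul_prod_tailIdx fun j => y - ζ j ^ 2 * q, show n + 1 + l = n + (l + 1) by omega]

lemma ext2_castAdd {n l : ℕ} (ζ' : Fin (n + (l + 1)) → ℂ) (w v : ℂ) (j : Fin (n + 1)) :
    ext2 ζ' w v (Fin.castAdd (l + 1 + 1) j) = ζ' (headIdx j) := by
  have : (Fin.castAdd (l + 1 + 1) j : Fin (n + 1 + (l + 1 + 1))) = smallIdx (headIdx j) := rfl
  rw [this, ext2_smallIdx]

lemma ext2_natAdd {n l : ℕ} (ζ' : Fin (n + (l + 1)) → ℂ) (w v : ℂ) (i : Fin (l + 1 + 1)) :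
    ext2 ζ' w v (Fin.natAdd (n + 1) i) =
      (Fin.snoc (Fin.snoc (fun t : Fin l => ζ' (tailIdx t)) w : Fin (l + 1) → ℂ) v :
        Fin (l + 1 + 1) → ℂ) i := by
  refine Fin.lastCases ?_ (fun i => Fin.lastCases ?_ (fun i => ?_) i) i
  · rw [Fin.snoc_last]
    have : Fin.natAdd (n + 1) (Fin.last (l + 1)) = vIdx n (l + 1) := Fin.ext (by simp [vIdx]; omega)
    rw [this, ext2_vIdx]
  · rw [Fin.snoc_castSucc, Fin.snoc_last]
    have : Fin.natAdd (n + 1) (Fin.last l).castSucc = wIdx n (l + 1) :=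
      Fin.ext (by simp [wIdx]; omega)
    rw [this, ext2_wIdx]
  · rw [Fin.snoc_castSucc, Fin.snoc_castSucc]
    have : Fin.natAdd (n + 1) i.castSucc.castSucc = smallIdx (tailIdx (n := n) i) := rfl
    rw [this, ext2_smallIdx]

lemma prod_natAdd_ext2 {n l : ℕ} (ζ' : Fin (n + (l + 1)) → ℂ) (w v : ℂ) (f : ℂ → ℂ) :
    ∏ i : Fin (l + 1 + 1), f (ext2 ζ' w v (Fin.natAdd (n + 1) i) ^ 2) =
      (∏ t : Fin l, f (ζ' (tailIdx t) ^ 2)) * (f (w ^ 2) * f (v ^ 2)) := by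
  simp only [ext2_natAdd]
  rw [Fin.prod_univ_castSucc, Fin.prod_univ_castSucc]
  simp only [Fin.snoc_castSucc, Fin.snoc_last, mul_assoc]

/-- The denominator of the extreme component. -/
def extDen (q : ℂ) {n l : ℕ} (ζ' : Fin (n + (l + 1)) → ℂ) (w v : ℂ) : ℂ :=
  ∏ j : Fin (n + 1), ((∏ t : Fin l, (ζ' (tailIdx t) ^ 2 - ζ' (headIdx j) ^ 2 * q⁻¹ ^ 2)) *
    ((w ^ 2 - ζ' (headIdx j) ^ 2 * q⁻¹ ^ 2) * (v ^ 2 - ζ' (headIdx j) ^ 2 * q⁻¹ ^ 2)))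

lemma bracketExt_ext2 (q : ℂ) {m n l : ℕ} (x : Fin m → ℂ) (ζ' : Fin (n + (l + 1)) → ℂ) (w v : ℂ) :
    bracketExt q x (ext2 ζ' w v) = DeltaPol q x (fun j : Fin (n + 1) => ζ' (headIdx j) ^ 2)
      (fun i : Fin (l + 1 + 1) => ext2 ζ' w v (Fin.natAdd (n + 1) i) ^ 2) / extDen q ζ' w v *
        ∏ j : Fin (n + 1), ζ' (headIdx j) := by
  rw [bracketExt, extDen]
  simp only [ext2_castAdd]
  congr 3
  exact funext fun j =>
    prod_natAdd_ext2 ζ' w v fun s => s - ζ' (headIdx j) ^ 2 * q⁻¹ ^ 2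

section

variable {q w v₀ : ℂ} {n l : ℕ}

lemma psiProd_ext2 (ζ' : Fin (n + l) → ℂ) (v : ℂ) (y : ℂ) :
    psiProd q (ext2 ζ' w v) y = psi q (y / w ^ 2) * psi q (y / v ^ 2) * psiProd q ζ' y := by
  rw [psiProd_eq, psiProd_eq, prod_bigIdx]
  simp only [ext2_smallIdx, ext2_wIdx, ext2_vIdx, mul_assoc]

lemma poleFree_ext2_subset (ζ' : Fin (n + l) → ℂ) (v : ℂ) :
    poleFree q (ext2 ζ' w v) ⊆ poleFree q ζ' := fun x hx =>
  ⟨hx.1, fun j k h => hx.2.1 (smallIdx j) k (by rw [h, innerPt, innerPt, ext2_smallIdx]),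
    fun j k h => hx.2.2 (smallIdx j) k (by rw [h, outerPt, outerPt, ext2_smallIdx])⟩

lemma ne_of_mem_poleFree_ext2 {ζ' : Fin (n + l) → ℂ} {v y : ℂ}
    (hy : y ∈ poleFree q (ext2 ζ' w v)) : y ≠ w ^ 2 * q⁻¹ := fun h =>
  hy.2.2 (wIdx n l) 0 (by rw [h, outerPt, ext2_wIdx]; ring)

lemma mem_goodPts {ζ' : Fin (n + (l + 1)) → ℂ} {v y : ℂ} (hy : y ∈ poleFree q (ext2 ζ' w v))
    (h3 : ∀ j, y ≠ ζ' j ^ 2 * q⁻¹ ^ 3) :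
    y ∈ goodPts q (fun j : Fin (n + 1) => ζ' (headIdx j) ^ 2) (w ^ 2) := by
  refine ⟨hy.1, ne_of_mem_poleFree_ext2 hy, fun j => ⟨fun h => ?_, h3 _, fun h => ?_⟩⟩
  · exact (poleFree_ext2_subset _ _ hy).2.2 (headIdx j) 0 (by rw [h, outerPt]; ring)
  · exact (poleFree_ext2_subset _ _ hy).2.1 (headIdx j) 0 (by rw [h, innerPt]; ring)

/-- As `v₀² = w² τ²`, the arguments of the two factors `ψ` differ by `q²`, as in
`psi_mul_psi_mul_theta`. What survives is a simple pole at `w² τ`, to be cancelled by the factor `x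
- w² τ` of `Δ`. -/
lemma psi_mul_psi_mul_theta_of_mem (hq0 : q ≠ 0) (hq1 : ‖q‖ < 1) {ζ' : Fin (n + l) → ℂ}
    (hζ : NonZero (ext2 ζ' w v₀)) (hw : w ≠ 0) (hvw : v₀ ^ 2 = w ^ 2 * q⁻¹ ^ 2) {y : ℂ}
    (hy : y ∈ poleFree q (ext2 ζ' w v₀)) :
    -(w ^ 2 * q) / y * thetaFn (q * y / w ^ 2) (q ^ 2) *
      (psi q (y / w ^ 2) * psi q (y / v₀ ^ 2)) = -(q * w ^ 2) / (y - w ^ 2 * q⁻¹) := by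
  have hy0 : y ≠ 0 := hy.1
  have hyP := sub_ne_zero.mpr (ne_of_mem_poleFree_ext2 hy)
  have h4 := norm_pow_four_lt hq1
  have h1 := psi_denominator_ne_zero hq0 hq1 hζ hy (wIdx n l)
  have h2 := psi_denominator_ne_zero hq0 hq1 hζ hy (vIdx n l)
  rw [ext2_wIdx] at h1
  rw [ext2_vIdx, hvw] at h2
  have hz : w ^ 2 ≠ 0 := pow_ne_zero 2 hw
  have e2 : y / v₀ ^ 2 = y / w ^ 2 * q ^ 2 := by rw [hvw]; field_simp
  rw [e2, show q * y / w ^ 2 = q * (y / w ^ 2) by ring]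
  generalize hZ : w ^ 2 = Z at *
  have hne : q * (y / Z) ≠ 1 := fun h => hyP (by
    field_simp at h ⊢
    linear_combination h)
  have hθ : thetaFn (q * (y / Z)) (q ^ 2) ≠ 0 := by
    rw [thetaFn, ← poch_mul_poch_sq _ hq1, ← poch_mul_poch_sq _ hq1]
    rw [poch_eq_one_sub_mul (Z * q⁻¹ ^ 2 * q / y) h4] at h2
    rw [show q * (y / Z) = y * (q / Z) by ring,
      show y * (q / Z) * q ^ 2 = y * (q / (Z * q⁻¹ ^ 2)) by field_simp,
      show q ^ 2 / (y * (q / Z)) = Z * q / y by field_simp,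
      show Z * q / y * q ^ 2 = Z * q⁻¹ ^ 2 * q / y * q ^ 4 by field_simp]
    exact mul_ne_zero (mul_ne_zero (left_ne_zero_of_mul h1) (left_ne_zero_of_mul h2))
      (mul_ne_zero (right_ne_zero_of_mul h1) (right_ne_zero_of_mul (right_ne_zero_of_mul h2)))
  have key := psi_mul_psi_mul_theta hq1 hq0 (div_ne_zero hy0 hz) hne hθ
  have hne' := sub_ne_zero.mpr hne
  calc _ = -(Z * q) / y * (psi q (y / Z) * psi q (y / Z * q ^ 2) *
        thetaFn (q * (y / Z)) (q ^ 2)) := by ring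
    _ = _ := by
      rw [key, div_mul_div_comm, div_eq_div_iff (mul_ne_zero hy0 hne') hyP]
      field_simp

end

end QKZ

namespace QKZ
open Set Filter Metric

/-! ### The kernel at the limit point -/

section

variable {p q : ℂ} {r : ℂ → ℂ} {ε σ : ℤˣ} {m n l : ℕ}
  {ϑ : (Fin (m + 1) → ℂ) → (Fin (n + 1 + (l + 1)) → ℂ) → ℂ}
  {ϑ' : (Fin m → ℂ) → (Fin (n + l) → ℂ) → ℂ}

lemma sgn_sq (σ : ℤˣ) : sgn σ ^ 2 = 1 := by
  rw [pow_two, sgn_mul_self]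

lemma sgn_ne_zero (σ : ℤˣ) : sgn σ ≠ 0 := fun h => by
  have := sgn_sq σ
  rw [h] at this
  norm_num at this

/-- The factor that relates the two kernels. -/
def kernelConst (p q : ℂ) (r : ℂ → ℂ) (ε σ : ℤˣ) (m : ℕ) {n l : ℕ} (ζ' : Fin (n + l) → ℂ)
    (w : ℂ) : ℂ :=
  p⁻¹ ^ (n + 1 + (l + 1)) * (sgn ε * r (-(sgn σ * w * q))) * (sgn σ * q) *
    ((∏ i, ζ' i) / (-(sgn σ * w * q)) ^ (n + l)) * (cConst q (m + 1) (n + 1) (l + 1) *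
      (w ^ 2) ^ (((n + 1 + (l + 1) : ℕ) : ℤ) - ((m + 1 : ℕ) : ℤ) - 1))

lemma kernel_snoc_eq (hq0 : q ≠ 0) (hϑ : IsKernel p q r ε ϑ) (hrec : Recurrence q σ ϑ ϑ')
    {ζ' : Fin (n + l) → ℂ} {w : ℂ} (hζ' : NonZero ζ') (hw : w ≠ 0) (hreg' : RegularAt ϑ' ζ')
    (hreg₁ : RegularAt ϑ (ext2 ζ' w (-(sgn σ * w * q⁻¹))))
    (hreg₂ : RegularAt ϑ (ext2 ζ' w (-(sgn σ * w * q))))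
    (hr : AnalyticAt ℂ r (-(sgn σ * w * q))) {x : Fin m → ℂ} (hx : NonZero x) :
    ϑ (Fin.snoc x (w ^ 2 * q⁻¹)) (ext2 ζ' w (-(sgn σ * w * q⁻¹))) =
      kernelConst p q r ε σ m ζ' w * (∏ μ, (-(w ^ 2 * q) / x μ * thetaFn (q * x μ / w ^ 2) (q ^ 2))) *
        ϑ' x ζ' := by
  have hs := sgn_ne_zero σ
  have hs2 := sgn_sq σ
  have hsi : (sgn σ)⁻¹ = sgn σ := inv_eq_of_mul_eq_one_right (sgn_mul_self σ)
  set v := -(sgn σ * w * q) with hv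
  have hv0 : v ≠ 0 := neg_ne_zero.mpr (mul_ne_zero (mul_ne_zero hs hw) hq0)
  have hnz : NonZero (ext2 ζ' w v) := forall_bigIdx.mpr
    ⟨fun i => by rw [ext2_smallIdx]; exact hζ' i, by rwa [ext2_wIdx], by rwa [ext2_vIdx]⟩
  have hup : Function.update (ext2 ζ' w v) (vIdx n l) (ext2 ζ' w v (vIdx n l) * q⁻¹ ^ 2) =
      ext2 ζ' w (-(sgn σ * w * q⁻¹)) := by
    refine funext (forall_bigIdx.mpr ⟨fun i => ?_, ?_, ?_⟩)
    · rw [Function.update_of_ne (smallIdx_ne_vIdx i), ext2_smallIdx, ext2_smallIdx]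
    · rw [Function.update_of_ne wIdx_ne_vIdx, ext2_wIdx, ext2_wIdx]
    · rw [Function.update_self, ext2_vIdx, ext2_vIdx, hv]
      field_simp
  have hP0 : w ^ 2 * q⁻¹ ≠ 0 := mul_ne_zero (pow_ne_zero 2 hw) (inv_ne_zero hq0)
  have h1 := hϑ.zeta_shift _ hnz (vIdx n l) hreg₂ (by rwa [hup]) (by rwa [ext2_vIdx])
    (Fin.snoc x (w ^ 2 * q⁻¹)) (nonZero_snoc hx hP0)
  rw [hup, hrec ζ' w hζ' hw hreg' hreg₂ x hx, ext2_vIdx, Fin.prod_univ_castSucc] at h1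
  simp only [Fin.snoc_castSucc, Fin.snoc_last] at h1
  have e1 : ∏ k ∈ Finset.univ.erase (vIdx n l), ext2 ζ' w v k / v =
      w / v * ((∏ i, ζ' i) / v ^ (n + l)) := by
    have h := Finset.mul_prod_erase Finset.univ (fun k => ext2 ζ' w v k / v)
      (Finset.mem_univ (vIdx n l))
    rw [prod_bigIdx] at h
    simp only [ext2_smallIdx, ext2_wIdx, ext2_vIdx, div_self hv0, one_mul, Finset.prod_div_distrib,
      Finset.prod_const, Finset.card_univ, Fintype.card_fin] at h
    rw [Finset.prod_div_distrib, Finset.prod_const]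
    exact h
  have hv2 : v ^ 2 = w ^ 2 * q ^ 2 := by rw [hv]; linear_combination w ^ 2 * q ^ 2 * hs2
  have e2 : w / v * (-(v ^ 2 * q⁻¹) / (w ^ 2 * q⁻¹)) = sgn σ * q := by
    rw [hv2, hv, ← hsi]
    field_simp
    exact hs2
  have e3 : ∀ μ, -(v ^ 2 * q⁻¹) / x μ = -(w ^ 2 * q) / x μ := fun μ => by
    rw [hv2]; congr 2; field_simp
  rw [h1, e1, kernelConst, ← hv, Finset.prod_mul_distrib, ← e2]
  simp only [e3]
  ring

end

section

variable {p q : ℂ} {r : ℂ → ℂ} {ε σ : ℤˣ} {m n l : ℕ}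
  {ϑ : (Fin (m + 1) → ℂ) → (Fin (n + 1 + (l + 1 + 1)) → ℂ) → ℂ}
  {ϑ' : (Fin m → ℂ) → (Fin (n + (l + 1)) → ℂ) → ℂ}

/-- The kernel identity, the cancellation of `ψ` against theta functions and the reduction of `Δ`
are combined. The last is available for distinct `x_μ` only; when two coincide, both sides vanish
because `ϑ'` is antisymmetric. -/
lemma integrand_snoc_eq (hq0 : q ≠ 0) (hq1 : ‖q‖ < 1) (hϑ : IsKernel p q r ε ϑ)
    {ε' : ℤˣ} (hϑ' : IsKernel p q r ε' ϑ') (hrec : Recurrence q σ ϑ ϑ')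
    {ζ' : Fin (n + (l + 1)) → ℂ} {w v₀ : ℂ} (hv₀ : v₀ = -(sgn σ * w * q⁻¹)) (hζ' : NonZero ζ')
    (hw : w ≠ 0) (hreg' : RegularAt ϑ' ζ') (hreg₁ : RegularAt ϑ (ext2 ζ' w v₀))
    (hreg₂ : RegularAt ϑ (ext2 ζ' w (-(sgn σ * w * q))))
    (hr : AnalyticAt ℂ r (-(sgn σ * w * q))) {x : Fin m → ℂ}
    (hx : ∀ μ, x μ ∈ poleFree q (ext2 ζ' w v₀)) {D : ℂ}
    (hD : Function.Injective x → DeltaPol q (Fin.snoc x (w ^ 2 * q⁻¹) : Fin (m + 1) → ℂ)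
      (fun j : Fin (n + 1) => ζ' (headIdx j) ^ 2)
      (fun i : Fin (l + 1 + 1) => ext2 ζ' w v₀ (Fin.natAdd (n + 1) i) ^ 2) =
        (∏ μ, (x μ - w ^ 2 * q⁻¹)) * D) :
    integrand q ϑ (ext2 ζ' w v₀) (Fin.snoc x (w ^ 2 * q⁻¹)) *
        ∏ μ, psiProd q (ext2 ζ' w v₀) (x μ) =
      kernelConst p q r ε σ m ζ' w * (-(q * w ^ 2)) ^ m * ((∏ j : Fin (n + 1), ζ' (headIdx j)) /
        extDen q ζ' w v₀) * (Psi q ϑ' x ζ' * D) := by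
  have hx0 : NonZero x := fun μ => (hx μ).1
  have hvw : v₀ ^ 2 = w ^ 2 * q⁻¹ ^ 2 := by
    rw [hv₀]; linear_combination w ^ 2 * q⁻¹ ^ 2 * sgn_sq σ
  have hv0 : v₀ ≠ 0 := by
    rw [hv₀]
    exact neg_ne_zero.mpr (mul_ne_zero (mul_ne_zero (sgn_ne_zero σ) hw) (inv_ne_zero hq0))
  have hnz : NonZero (ext2 ζ' w v₀) := forall_bigIdx.mpr
    ⟨fun i => by rw [ext2_smallIdx]; exact hζ' i, by rwa [ext2_wIdx], by rwa [ext2_vIdx]⟩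
  have hker := kernel_snoc_eq hq0 hϑ hrec hζ' hw hreg' (hv₀ ▸ hreg₁) hreg₂ hr hx0
  rw [← hv₀] at hker
  rw [integrand, hker, Psi_eq]
  by_cases hinj : Function.Injective x
  · rw [bracketExt_ext2, hD hinj]
    simp only [psiProd_ext2]
    have key : (∏ μ, (-(w ^ 2 * q) / x μ * thetaFn (q * x μ / w ^ 2) (q ^ 2))) *
        (∏ μ, (psi q (x μ / w ^ 2) * psi q (x μ / v₀ ^ 2))) * ∏ μ, (x μ - w ^ 2 * q⁻¹) =
          (-(q * w ^ 2)) ^ m := by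
      rw [← Finset.prod_mul_distrib, ← Finset.prod_mul_distrib,
        Finset.prod_congr rfl fun μ _ => by
          rw [psi_mul_psi_mul_theta_of_mem hq0 hq1 hnz hw hvw (hx μ),
            div_mul_cancel₀ _ (sub_ne_zero.mpr (ne_of_mem_poleFree_ext2 (hx μ)))]]
      simp
    have hsplit : ∏ μ, psi q (x μ / w ^ 2) * psi q (x μ / v₀ ^ 2) * psiProd q ζ' (x μ) =
        (∏ μ, (psi q (x μ / w ^ 2) * psi q (x μ / v₀ ^ 2))) * ∏ μ, psiProd q ζ' (x μ) :=
      Finset.prod_mul_distrib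
    rw [hsplit, ← key]
    ring
  · obtain ⟨i, j, he, hij⟩ : ∃ i j, x i = x j ∧ i ≠ j := by
      simpa [Function.Injective] using hinj
    rw [hϑ'.eq_zero_of_eq hζ' hreg' hx0 hij he]
    ring

end

end QKZ

namespace QKZ
open Set Filter Metric

/-! ### The residue as an integral over the contour -/

lemma differentiable_sumDelta (q z : ℂ) {m n l : ℕ} (a : Fin (n + 1) → ℂ) (b : Fin l → ℂ) :
    Differentiable ℂ fun x : Fin m → ℂ => sumDelta q z a b x := by
  unfold sumDelta
  have h : ∀ i : Fin (n + 1), Differentiable ℂ fun x : Fin m → ℂ =>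
      DeltaPol q x (a ∘ i.succAbove) (Fin.cons (a i) b : Fin (l + 1) → ℂ) := fun i =>
    differentiable_DeltaPol q (x := fun x : Fin m → ℂ => x) (a ∘ i.succAbove)
      (b := fun _ => (Fin.cons (a i) b : Fin (l + 1) → ℂ)) differentiable_id (differentiable_const _)
  fun_prop

/-- The factor that relates the two polynomials. -/
def deltaConst (q w : ℂ) {n l : ℕ} (ζ' : Fin (n + (l + 1)) → ℂ) : ℂ :=
  (q⁻¹ ^ 2 - 1) * q⁻¹ ^ (n + 1) * (∏ j : Fin (n + 1), (ζ' (headIdx j) ^ 2 - w ^ 2)) ^ 2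

/-- For the parameters `ζ'` alone the pinch point is not a pole, so the cycle has the winding
numbers of an admissible contour at all remaining poles. The exact terms integrate to zero. -/
theorem cycMulti_integrand_snoc {ι : Type*} [Fintype ι] {p q : ℂ} {r : ℂ → ℂ} {ε σ ε' : ℤˣ}
    {m n l : ℕ} (hm : (n < l + 1 ∧ m = n) ∨ (n = l + 1 ∧ m + 1 = n))
    {ϑ : (Fin (m + 1) → ℂ) → (Fin (n + 1 + (l + 1 + 1)) → ℂ) → ℂ}
    {ϑ' : (Fin m → ℂ) → (Fin (n + (l + 1)) → ℂ) → ℂ} (hq0 : q ≠ 0) (hq1 : ‖q‖ < 1)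
    (hϑ : IsKernel p q r ε ϑ) (hϑ' : IsKernel p q r ε' ϑ') (hrec : Recurrence q σ ϑ ϑ')
    {ζ' : Fin (n + (l + 1)) → ℂ} {w v₀ : ℂ} (hv₀ : v₀ = -(sgn σ * w * q⁻¹)) (hζ' : Generic q ζ')
    (hw : w ≠ 0) (hgenw : ∀ i (k : ℤ), ζ' i ^ 2 ≠ w ^ 2 * q ^ (2 * k))
    (hreg' : RegularAt ϑ' ζ') (hreg₁ : RegularAt ϑ (ext2 ζ' w v₀))
    (hreg₂ : RegularAt ϑ (ext2 ζ' w (-(sgn σ * w * q))))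
    (hr : AnalyticAt ℂ r (-(sgn σ * w * q))) {γ : ℝ → ℂ} (hγ : IsContour q ζ' γ) {Γ : ι → Loop}
    (h0 : cycWind Γ 1 0 = 1) (hsupp : ∀ i, (Γ i).supp ⊆ poleFree q (ext2 ζ' w v₀))
    (hin : ∀ j k, cycWind Γ 1 (innerPt q (ext2 ζ' w v₀) j k) = 1)
    (hout : ∀ j k, (j, k) ≠ (wIdx n (l + 1), 0) →
      cycWind Γ 1 (outerPt q (ext2 ζ' w v₀) j k) = 0)
    (h3 : ∀ i, ∀ x ∈ (Γ i).supp, ∀ j, x ≠ ζ' j ^ 2 * q⁻¹ ^ 3) :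
    cycMulti Γ (fun _ => 1) (fun x : Fin m → ℂ =>
        integrand q ϑ (ext2 ζ' w v₀) (Fin.snoc x (w ^ 2 * q⁻¹)) *
          ∏ μ, psiProd q (ext2 ζ' w v₀) (x μ)) =
      kernelConst p q r ε σ m ζ' w * (-(q * w ^ 2)) ^ m * ((∏ j : Fin (n + 1), ζ' (headIdx j)) /
        extDen q ζ' w v₀) * (deltaConst q w ζ' * multiContour γ fun x => Psi q ϑ' x ζ' *
          sumDelta q (w ^ 2) (fun j => ζ' (headIdx j) ^ 2) (fun t => ζ' (tailIdx t) ^ 2) x) := by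
  have hvw : v₀ ^ 2 = w ^ 2 * q⁻¹ ^ 2 := by
    rw [hv₀]; linear_combination w ^ 2 * q⁻¹ ^ 2 * sgn_sq σ
  set a : Fin (n + 1) → ℂ := fun j => ζ' (headIdx j) ^ 2 with ha
  set b : Fin l → ℂ := fun t => ζ' (tailIdx t) ^ 2 with hb
  have hi : ∀ j t, (headIdx j : Fin (n + (l + 1))) ≠ tailIdx t := fun j t h => by
    have := congrArg Fin.val h
    simp only [headIdx, tailIdx] at this
    omega
  obtain ⟨Rem, hRi, hRc, hRem⟩ := DeltaPol_snoc_eq hq0 hm a b (z := w ^ 2)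
    (fun j => pow_ne_zero 2 (hζ'.1 _)) (fun i j h => by
      by_contra hij
      exact hζ'.2 _ _ (fun e => hij (headIdx_injective e)) 0 (by simpa using h))
    (pow_ne_zero 2 hw) (fun j h => hgenw (headIdx j) 0 (by simpa using h))
    (fun j h => hgenw (headIdx j) 1 (by rw [← h]; norm_cast; field_simp; rfl))
    (fun j h => hgenw (headIdx j) (-1) (by
      rw [show (2 * (-1) : ℤ) = -2 by norm_num, zpow_neg, ← inv_zpow]; exact_mod_cast h))
    (fun j => Finset.prod_ne_zero_iff.mpr fun t _ h => hζ'.2 _ _ (hi j t) 1 (by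
      have h' : a j * q⁻¹ ^ 3 = b t * q⁻¹ := sub_eq_zero.mp h
      norm_num
      field_simp at h'
      exact h'.trans (mul_comm _ _)))
    (fun i => ext2 ζ' w v₀ (Fin.natAdd (n + 1) i) ^ 2)
    fun f => by rw [prod_natAdd_ext2, hvw]
  have hcube : cube Γ m ⊆ {x | ∀ μ, x μ ∈ poleFree q (ext2 ζ' w v₀)} := cube_subset_of_supp hsupp
  have hgood : cube Γ m ⊆ {x | ∀ μ, x μ ∈ goodPts q a (w ^ 2)} :=
    cube_subset_of_supp fun i x hx => mem_goodPts (hsupp i hx) (h3 i x hx)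
  have hsupp' : ∀ i, (Γ i).supp ⊆ poleFree q ζ' := fun i =>
    (hsupp i).trans (poleFree_ext2_subset _ _)
  have hin' : ∀ j k, cycWind Γ 1 (innerPt q ζ' j k) = 1 := fun j k => by
    have := hin (smallIdx j) k
    rwa [innerPt, ext2_smallIdx] at this
  have hout' : ∀ j k, cycWind Γ 1 (outerPt q ζ' j k) = 0 := fun j k => by
    have := hout (smallIdx j) k fun h => smallIdx_ne_wIdx j (Prod.ext_iff.mp h).1
    rwa [outerPt, ext2_smallIdx] at this
  have hcube' : cube Γ m ⊆ {x | ∀ μ, x μ ∈ poleFree q ζ'} := cube_subset_of_supp hsupp'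
  have hPsi : ContinuousOn (fun x => Psi q ϑ' x ζ') (cube Γ m) :=
    (continuousOn_Psi hq0 hq1 hζ'.1 hreg').mono hcube'
  have hS := differentiable_sumDelta (m := m) q (w ^ 2) a b
  have hE : ∀ c : Fin m, ContinuousOn (fun x : Fin m → ℂ => Psi q ϑ' x ζ' *
      (exactFn q a b (x c) * Rem c x)) (cube Γ m) := fun c =>
    hPsi.mul (((continuousOn_exactFn q a b).comp (continuous_apply c).continuousOn
      fun x hx => (hcube hx c).1).mul ((hRc c).mono hgood))
  rw [cycMulti_congr fun x hx => integrand_snoc_eq hq0 hq1 hϑ hϑ' hrec hv₀ hζ'.1 hw hreg' hreg₁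
    hreg₂ hr (hcube hx) (hRem x (hgood hx)), cycMulti_const_mul]
  congr 1
  rw [cycMulti_congr (G := fun x => deltaConst q w ζ' * (Psi q ϑ' x ζ' * sumDelta q (w ^ 2) a b x) +
      ∑ c, Psi q ϑ' x ζ' * (exactFn q a b (x c) * Rem c x)) fun x hx => by
    rw [← Finset.mul_sum, deltaConst, sumDelta]; ring]
  rw [cycMulti_add (F := fun x => deltaConst q w ζ' * (Psi q ϑ' x ζ' * sumDelta q (w ^ 2) a b x))
    (G := fun x => ∑ c, Psi q ϑ' x ζ' * (exactFn q a b (x c) * Rem c x))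
    (continuousOn_const.mul (hPsi.mul hS.continuous.continuousOn))
    (continuousOn_finsetSum _ fun c _ => hE c),
    cycMulti_sum (F := fun c x => Psi q ϑ' x ζ' * (exactFn q a b (x c) * Rem c x)) Finset.univ
      fun c _ => hE c, cycMulti_const_mul, Finset.sum_eq_zero fun c _ =>
      cycMulti_exact_eq_zero hq0 hq1 hζ' hsupp' hin' hout' hϑ' hreg' c (exactFn_eq q ζ') (hRi c)
        ((hRc c).mono hgood), add_zero]
  congr 1
  have e : (fun x => Psi q ϑ' x ζ' * sumDelta q (w ^ 2) a b x) =
      fun x => ϑ' x ζ' * sumDelta q (w ^ 2) a b x * ∏ μ, psiProd q ζ' (x μ) := by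
    funext x; rw [Psi_eq]; ring
  rw [e, multiContour_eq_cycMulti (A := fun x => ϑ' x ζ' * sumDelta q (w ^ 2) a b x) hq0 hq1 hζ' hγ
    (headIdx 0) hsupp' h0 hin' hout' fun x hx =>
    DifferentiableAt.mul ((hreg'.differentiableAt hx).comp (f := fun x => (x, ζ')) x
      (differentiableAt_id.prodMk (differentiableAt_const _))) (hS x)]

end QKZ

namespace QKZ
open Set Filter Metric

/-! ### Regularity of the integrand and the constants -/

lemma extDen_ne_zero {q : ℂ} (hq0 : q ≠ 0) {n l : ℕ} {ζ' : Fin (n + (l + 1)) → ℂ} {w v : ℂ}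
    (hζ' : Generic q ζ') (hgenw : ∀ i (k : ℤ), ζ' i ^ 2 ≠ w ^ 2 * q ^ (2 * k))
    (hvw : v ^ 2 = w ^ 2 * q⁻¹ ^ 2) : extDen q ζ' w v ≠ 0 := by
  have hi : ∀ j t, (headIdx j : Fin (n + (l + 1))) ≠ tailIdx t := fun j t h => by
    have := congrArg Fin.val h
    simp only [headIdx, tailIdx] at this
    omega
  refine Finset.prod_ne_zero_iff.mpr fun j _ => mul_ne_zero
    (Finset.prod_ne_zero_iff.mpr fun t _ h => ?_) (mul_ne_zero (fun h => ?_) fun h => ?_)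
  · refine hζ'.2 _ _ (hi j t) 1 ?_
    rw [sub_eq_zero.mp h]; norm_cast; field_simp
  · refine hgenw (headIdx j) 1 ?_
    rw [sub_eq_zero.mp h]; norm_cast; field_simp
  · refine hgenw (headIdx j) 0 ?_
    rw [hvw] at h
    have := mul_right_cancel₀ (pow_ne_zero 2 (inv_ne_zero hq0)) (sub_eq_zero.mp h)
    rw [this]; simp

/-- At `v² = w² τ²` the two factors of the denominator with `w` and `v` are, up to `q^(-4)`, the
factors that occur in `chainConst`. -/
lemma extDen_eq {q : ℂ} (hq0 : q ≠ 0) {n l : ℕ} (ζ' : Fin (n + (l + 1)) → ℂ) {w v : ℂ}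
    (hvw : v ^ 2 = w ^ 2 * q⁻¹ ^ 2) : extDen q ζ' w v * q ^ (4 * (n + 1)) =
      (∏ j : Fin (n + 1), ∏ t : Fin l, (ζ' (tailIdx t) ^ 2 - ζ' (headIdx j) ^ 2 * q⁻¹ ^ 2)) *
        ((∏ j : Fin (n + 1), (ζ' (headIdx j) ^ 2 - w ^ 2 * q ^ 2)) *
          ∏ j : Fin (n + 1), (ζ' (headIdx j) ^ 2 - w ^ 2)) := by
  have e : q ^ (4 * (n + 1)) = ∏ _j : Fin (n + 1), q ^ 4 := by
    rw [Finset.prod_const, Finset.card_univ, Fintype.card_fin, pow_mul]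
  rw [e, extDen, ← Finset.prod_mul_distrib, ← Finset.prod_mul_distrib, ← Finset.prod_mul_distrib]
  refine Finset.prod_congr rfl fun j _ => ?_
  rw [mul_assoc]
  congr 1
  rw [hvw]
  field_simp
  ring

lemma differentiable_extDen (q : ℂ) {n l : ℕ} (ζ' : Fin (n + (l + 1)) → ℂ) (w : ℂ) :
    Differentiable ℂ fun v => extDen q ζ' w v := by
  unfold extDen
  fun_prop

lemma eventually_differentiableAt_integrand {q : ℂ} {m n l : ℕ}
    {ϑ : (Fin m → ℂ) → (Fin (n + 1 + (l + 1 + 1)) → ℂ) → ℂ} {ζ' : Fin (n + (l + 1)) → ℂ} {w v₀ : ℂ}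
    (hreg : RegularAt ϑ (ext2 ζ' w v₀)) (hden : extDen q ζ' w v₀ ≠ 0) :
    ∀ᶠ v in 𝓝 v₀, ∀ x, NonZero x → DifferentiableAt ℂ
      (fun e : ℂ × (Fin m → ℂ) => integrand q ϑ (ext2 ζ' w e.1) e.2) (v, x) := by
  have hd := differentiable_ext2 (n := n) (l := l + 1) ζ' w
  have hE := differentiable_extDen q ζ' w
  filter_upwards [(hd.continuous.tendsto v₀).eventually hreg.eventually,
    hE.continuous.continuousAt.eventually_ne hden] with v h1 h2 x hx
  unfold integrand
  simp only [bracketExt_ext2, div_eq_mul_inv]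
  have hϑd : DifferentiableAt ℂ (fun e : ℂ × (Fin m → ℂ) => ϑ e.2 (ext2 ζ' w e.1)) (v, x) :=
    (h1.differentiableAt hx).comp (f := fun e : ℂ × (Fin m → ℂ) => (e.2, ext2 ζ' w e.1)) (v, x)
      (differentiableAt_snd.prodMk (DifferentiableAt.comp (g := fun v => ext2 ζ' w v)
        (f := Prod.fst) (v, x) (hd v) differentiableAt_fst))
  have hdi := differentiable_pi.mp hd
  have hΔ := differentiable_DeltaPol (E := ℂ × (Fin m → ℂ)) q (x := fun e => e.2)
    (fun j : Fin (n + 1) => ζ' (headIdx j) ^ 2)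
    (b := fun e (i : Fin (l + 1 + 1)) => ext2 ζ' w e.1 (Fin.natAdd (n + 1) i) ^ 2)
    differentiable_snd (differentiable_pi.mpr fun i =>
      ((hdi _).comp differentiable_fst).pow 2)
  have hE' : DifferentiableAt ℂ (fun e : ℂ × (Fin m → ℂ) => extDen q ζ' w e.1) (v, x) :=
    DifferentiableAt.comp (g := fun v => extDen q ζ' w v) (f := Prod.fst) (v, x) (hE v)
      differentiableAt_fst
  refine hϑd.fun_mul (DifferentiableAt.mul_const ?_ _)
  exact (hΔ (v, x)).fun_mul (hE'.fun_inv h2)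

/-- The half-integral powers combine to an integral one (`e1`), the sign `s` drops out because its
exponents add up to an even number (`e2`), and the dependence on `m` cancels between the constant of
the recurrence and the factor `(-(q w²))^m` (`e3` to `e5`). -/
lemma prefactor_eq {p q w s : ℂ} (hp : p ^ 2 = q) (hq0 : q ≠ 0) (hw : w ≠ 0) (hs : s ^ 2 = 1)
    (m n l : ℕ) :
    s ^ (n + 1 + (l + 1 + 1) + 1) * p⁻¹ ^ ((n : ℤ) - ((l + 1 : ℕ) : ℤ)) * (w ^ 2 * q⁻¹) *
      (p⁻¹ ^ (n + 1 + (l + 1 + 1)) * (s * q) * ((-(s * w * q)) ^ (n + (l + 1)))⁻¹ *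
        ((-q⁻¹) ^ (((m + 1 : ℕ) : ℤ) - ((n + 1 : ℕ) : ℤ) - 2 * ((l + 1 + 1 : ℕ) : ℤ) + 3) *
          (w ^ 2) ^ (((n + 1 + (l + 1 + 1) : ℕ) : ℤ) - ((m + 1 : ℕ) : ℤ) - 1)) *
        (-(q * w ^ 2)) ^ m) * q ^ (3 * (n + 1)) =
      q ^ 2 * w ^ 2 * w ^ (n + (l + 1)) * (q ^ (2 * n) * (-q) ^ l) := by
  have hp0 : p ≠ 0 := fun h => hq0 (by rw [← hp, h]; simp)
  have hs0 : s ≠ 0 := fun h => by rw [h] at hs; norm_num at hs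
  have hw2 : w ^ 2 ≠ 0 := pow_ne_zero 2 hw
  have e1 : p⁻¹ ^ ((n : ℤ) - ((l + 1 : ℕ) : ℤ)) * p⁻¹ ^ (n + 1 + (l + 1 + 1)) = q⁻¹ ^ (n + 1) := by
    rw [← hp, ← inv_pow, ← pow_mul, ← zpow_natCast, ← zpow_natCast, ← zpow_add₀ (inv_ne_zero hp0)]
    congr 1; push_cast; ring
  have e2 : s ^ (n + 1 + (l + 1 + 1) + 1) * (s * q) * ((-(s * w * q)) ^ (n + (l + 1)))⁻¹ =
      q * ((-1) ^ (n + l + 1) * (w * q) ^ (n + (l + 1)))⁻¹ := by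
    rw [show -(s * w * q) = s * (-1 * (w * q)) by ring, mul_pow s, mul_pow (-1),
      show n + 1 + (l + 1 + 1) + 1 = n + (l + 1) + 3 by ring, pow_add s _ 3,
      mul_inv (s ^ _), ← add_assoc n l 1]
    have : s ^ 3 * s = 1 := by linear_combination (s ^ 2 + 1) * hs
    have h2 : s ^ (n + l + 1) * (s ^ (n + l + 1))⁻¹ = 1 := mul_inv_cancel₀ (pow_ne_zero _ hs0)
    linear_combination (q * (s ^ (n + l + 1) * (s ^ (n + l + 1))⁻¹) *
      ((-1) ^ (n + l + 1) * (w * q) ^ (n + l + 1))⁻¹) * this +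
      q * ((-1) ^ (n + l + 1) * (w * q) ^ (n + l + 1))⁻¹ * h2
  have e3 : (-q⁻¹) ^ (((m + 1 : ℕ) : ℤ) - ((n + 1 : ℕ) : ℤ) - 2 * ((l + 1 + 1 : ℕ) : ℤ) + 3) =
      (-q⁻¹) ^ m * (-q) ^ (n + 2 * l + 1) := by
    have hi : -q = (-q⁻¹)⁻¹ := by rw [inv_neg, inv_inv]
    rw [hi, inv_pow, ← zpow_natCast, ← zpow_natCast, ← zpow_neg,
      ← zpow_add₀ (neg_ne_zero.mpr (inv_ne_zero hq0))]
    congr 1; push_cast; ring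
  have e4 : (w ^ 2) ^ (((n + 1 + (l + 1 + 1) : ℕ) : ℤ) - ((m + 1 : ℕ) : ℤ) - 1) * (w ^ 2) ^ m =
      (w ^ 2) ^ (n + l + 1) := by
    generalize w ^ 2 = z at hw2 ⊢
    rw [← zpow_natCast, ← zpow_natCast, ← zpow_add₀ hw2]
    congr 1; push_cast; ring
  have e5 : (-q⁻¹) ^ m * (-(q * w ^ 2)) ^ m = (w ^ 2) ^ m := by
    rw [← mul_pow]; congr 1; field_simp
  have e6 : ((-1 : ℂ) ^ (n + l + 1) * (w * q) ^ (n + (l + 1)))⁻¹ =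
      (-1) ^ (n + l + 1) * ((w * q) ^ (n + (l + 1)))⁻¹ := by
    rw [mul_inv, ← inv_pow]; norm_num
  calc _ = (p⁻¹ ^ ((n : ℤ) - ((l + 1 : ℕ) : ℤ)) * p⁻¹ ^ (n + 1 + (l + 1 + 1))) *
        (s ^ (n + 1 + (l + 1 + 1) + 1) * (s * q) * ((-(s * w * q)) ^ (n + (l + 1)))⁻¹) *
        (w ^ 2 * q⁻¹) * ((-q⁻¹) ^ (((m + 1 : ℕ) : ℤ) - ((n + 1 : ℕ) : ℤ) -
          2 * ((l + 1 + 1 : ℕ) : ℤ) + 3) * (-(q * w ^ 2)) ^ m *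
        (w ^ 2) ^ (((n + 1 + (l + 1 + 1) : ℕ) : ℤ) - ((m + 1 : ℕ) : ℤ) - 1)) *
        q ^ (3 * (n + 1)) := by ring
    _ = q⁻¹ ^ (n + 1) * (q * ((-1) ^ (n + l + 1) * ((w * q) ^ (n + (l + 1)))⁻¹)) *
        (w ^ 2 * q⁻¹) * ((-q) ^ (n + 2 * l + 1) * (w ^ 2) ^ (n + l + 1)) * q ^ (3 * (n + 1)) := by
      rw [e1, e2, e3, e6, ← e4, ← e5]; ring
    _ = _ := by
      have hm1 : ((-1 : ℂ)) ^ (n + l + 1) * (-1) ^ (n + 2 * l + 1) = (-1) ^ l := by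
        rw [← pow_add, show n + l + 1 + (n + 2 * l + 1) = 2 * (n + l + 1) + l by ring, pow_add,
          pow_mul]
        norm_num
      rw [neg_pow q (n + 2 * l + 1), neg_pow q l, ← hm1, inv_pow, mul_pow w q]
      field_simp
      ring

end QKZ

namespace QKZ
open Set Filter Metric

/-! ### The recurrence -/

lemma poch_four_mul_poch_two {q : ℂ} (hq1 : ‖q‖ < 1) :
    poch (q ^ 4) (q ^ 4) * poch (q ^ 2) (q ^ 4) = poch (q ^ 2) (q ^ 2) := by
  rw [← poch_mul_poch_sq (q ^ 2) hq1, mul_comm, ← pow_add]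

/-- The infinite products, `r`, the sign `ε` and the products of the `ζ'_j` and of the `ψ` occur
twice and cancel; `-2` meets the factor `-1/2` of the residue. -/
lemma const_cancel {u t Q Ψ S e r₀ w c₉ : ℂ} (hu : u ≠ 0) (ht : t ≠ 0) (hQ : Q ≠ 0) (hΨ : Ψ ≠ 0)
    (hS : S ≠ 0) (he : e ≠ 0) (hr₀ : r₀ ≠ 0) (c₁ c₂ c₃ c₄ c₅ c₆ c₇ c₈ F G H K I : ℂ) :
    -2 * (u ^ 2 / t ^ 2) * (c₅ * c₃ * (-(1 / 2) * c₆ * (Q⁻¹ ^ 2 * Ψ) * (F * (c₄ * (e * r₀) * c₇ *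
      (S / c₈) * (c₁ * Q ^ 2 * (t ^ 2 / u ^ 2) * c₂) * G * H * (K * I)))) /
        (e * r₀ * w * (S * c₉ * Ψ))) =
      c₅ * c₃ * c₆ * (c₄ * c₇ * c₈⁻¹ * (c₁ * c₂) * G) * (H * K) * (F * I) / (w * c₉) := by
  have h1 : u ^ 2 / t ^ 2 * (t ^ 2 / u ^ 2) = 1 := by field_simp
  have h2 : Q⁻¹ ^ 2 * Q ^ 2 = 1 := by field_simp
  have h3 : e * r₀ * S * Ψ ≠ 0 := by simp [*]
  generalize u ^ 2 / t ^ 2 = a at *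
  generalize t ^ 2 / u ^ 2 = b at *
  generalize Q⁻¹ ^ 2 = a' at *
  generalize Q ^ 2 = b' at *
  rw [div_eq_mul_inv S, show e * r₀ * w * (S * c₉ * Ψ) = w * c₉ * (e * r₀ * S * Ψ) by ring,
    ← mul_div_mul_right _ (w * c₉) h3, ← mul_div_assoc]
  congr 1
  linear_combination (c₅ * c₃ * c₆ * (c₄ * c₇ * c₈⁻¹ * (c₁ * c₂) * G) * (H * K) * (F * I) *
    (e * r₀ * S * Ψ)) * (a' * b' * h1 + h2)

lemma ratio_eq {q D E X₀ X₂ : ℂ} (hq0 : q ≠ 0) (hD : D ≠ 0) (hX₀ : X₀ ≠ 0)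
    (hX₂ : X₂ ≠ 0) {n : ℕ} (hE : E * q ^ (4 * (n + 1)) = D * (X₂ * X₀)) (Z : ℂ) :
    Z / E * ((q⁻¹ ^ 2 - 1) * q⁻¹ ^ (n + 1) * X₀ ^ 2) =
      q ^ (3 * (n + 1)) * ((q⁻¹ ^ 2 - 1) * (Z * X₀ / (D * X₂))) := by
  have h1 : q ^ (4 * (n + 1)) * q⁻¹ ^ (n + 1) = q ^ (3 * (n + 1)) := by
    rw [show 4 * (n + 1) = 3 * (n + 1) + (n + 1) by ring, pow_add, mul_assoc, ← mul_pow,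
      mul_inv_cancel₀ hq0, one_pow, mul_one]
  have h2 : Z / E = Z * q ^ (4 * (n + 1)) / (D * (X₂ * X₀)) := by
    rw [← hE, mul_div_mul_right _ _ (pow_ne_zero _ hq0)]
  rw [h2, ← h1]
  generalize q⁻¹ ^ 2 - 1 = c
  generalize q⁻¹ ^ (n + 1) = d
  field_simp

lemma prefactor_ratio {q w D X₀ X₂ c₉ : ℂ} (hq0 : q ≠ 0) (hw : w ≠ 0) (h₉ : c₉ ≠ 0)
    (Z Y c J : ℂ) :
    q ^ 2 * w ^ 2 * c₉ * (Y * c) * ((q⁻¹ ^ 2 - 1) * (Z * X₀ / (D * X₂))) * J / (w * c₉) =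
      (1 - q ^ 2) * w * Z * Y * c * X₀ / X₂ / D * J := by
  have e : q ^ 2 * (q⁻¹ ^ 2 - 1) = 1 - q ^ 2 := by field_simp
  rw [← e, show w ^ 2 = w * w by ring, div_div, mul_comm X₂ D]
  rw [div_eq_iff (mul_ne_zero hw h₉)]
  ring

lemma recurrence_const {p q w : ℂ} (hp : p ^ 2 = q) (hq0 : q ≠ 0) (hq1 : ‖q‖ < 1) (hw : w ≠ 0)
    {r : ℂ → ℂ} {ε σ : ℤˣ} (m : ℕ) {n l : ℕ} {ζ' : Fin (n + (l + 1)) → ℂ} {v₀ : ℂ}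
    (hζ' : Generic q ζ') (hgenw : ∀ i (k : ℤ), ζ' i ^ 2 ≠ w ^ 2 * q ^ (2 * k))
    (hvw : v₀ ^ 2 = w ^ 2 * q⁻¹ ^ 2) (hr0 : r (-(sgn σ * w * q)) ≠ 0) (I : ℂ) :
    -2 * (poch2 (q ^ 2) (q ^ 4) (q ^ 4) ^ 2 / poch2 (q ^ 4) (q ^ 4) (q ^ 4) ^ 2) *
        (sgn σ ^ (n + 1 + (l + 1 + 1) + 1) * p⁻¹ ^ ((n : ℤ) - ((l + 1 : ℕ) : ℤ)) *
          (-(1 / 2) * (w ^ 2 * q⁻¹) * (((poch (q ^ 4) (q ^ 4) * poch (q ^ 2) (q ^ 4))⁻¹) ^ 2 *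
            ∏ i, psi q (w ^ 2 * q⁻¹ / ζ' i ^ 2)) * ((m.factorial : ℂ)⁻¹ *
              (kernelConst p q r ε σ m ζ' w * (-(q * w ^ 2)) ^ m *
                ((∏ j : Fin (n + 1), ζ' (headIdx j)) / extDen q ζ' w v₀) *
                (deltaConst q w ζ' * I)))) /
          (sgn ε * r (-(sgn σ * w * q)) * w *
            ∏ j, (ζ' j * w * psi q (q⁻¹ * w ^ 2 / ζ' j ^ 2)))) =
      chainConst q w ζ' * ((m.factorial : ℂ)⁻¹ * I) := by
  have hp0 : w ^ 2 * q⁻¹ ≠ 0 := mul_ne_zero (pow_ne_zero 2 hw) (inv_ne_zero hq0)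
  -- Genericity of `w` keeps this point off the poles, so the product of the `ψ` by which one
  -- divides is nonzero.
  have hz : w ^ 2 * q⁻¹ ∈ poleFree q ζ' := by
    refine ⟨hp0, fun j k h => hgenw j (-(1 + 2 * k)) ?_, fun j k h => hgenw j (2 * k) ?_⟩
    · rw [innerPt_eq_zpow hq0] at h
      have h' : w ^ 2 = ζ' j ^ 2 * q ^ (1 + 4 * (k : ℤ)) * q := by rw [← h]; field_simp
      rw [h', mul_assoc (ζ' j ^ 2), ← zpow_add_one₀ hq0, mul_assoc, ← zpow_add₀ hq0]
      ring_nf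
      simp
    · rw [outerPt_eq_zpow hq0] at h
      have h' : w ^ 2 = ζ' j ^ 2 * q ^ (-(1 + 4 * (k : ℤ))) * q := by rw [← h]; field_simp
      rw [h', mul_assoc (ζ' j ^ 2), ← zpow_add_one₀ hq0, mul_assoc, ← zpow_add₀ hq0]
      ring_nf
      simp
  have hΨ : ∏ i, psi q (w ^ 2 * q⁻¹ / ζ' i ^ 2) ≠ 0 := Finset.prod_ne_zero_iff.mpr fun j _ => by
    rw [psi_div_eq]
    exact one_div_ne_zero (psi_denominator_ne_zero hq0 hq1 hζ'.1 hz j)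
  have hX0 : ∏ j : Fin (n + 1), (ζ' (headIdx j) ^ 2 - w ^ 2) ≠ 0 :=
    Finset.prod_ne_zero_iff.mpr fun j _ h => hgenw (headIdx j) 0 (by simpa [sub_eq_zero] using h)
  have hE0 := extDen_ne_zero hq0 hζ' hgenw hvw
  have hE := extDen_eq hq0 ζ' hvw
  have hS : ∏ i, ζ' i ≠ 0 := Finset.prod_ne_zero_iff.mpr fun j _ => hζ'.1 j
  have hQ : poch (q ^ 2) (q ^ 2) ≠ 0 := by
    rw [← poch_four_mul_poch_two hq1]
    exact mul_ne_zero (poch_pow_ne_zero hq1 (by norm_num) (by norm_num))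
      (poch_pow_ne_zero hq1 (by norm_num) (by norm_num))
  have hu := poch2_pow_ne_zero hq1 two_ne_zero
  have ht := poch2_pow_ne_zero hq1 four_ne_zero
  have hpre := prefactor_eq hp hq0 hw (sgn_sq σ) m n l
  have hprod : ∏ j, (ζ' j * w * psi q (q⁻¹ * w ^ 2 / ζ' j ^ 2)) =
      (∏ i, ζ' i) * w ^ (n + (l + 1)) * ∏ i, psi q (w ^ 2 * q⁻¹ / ζ' i ^ 2) := by
    simp only [mul_comm q⁻¹, Finset.prod_mul_distrib, Finset.prod_const, Finset.card_univ,
      Fintype.card_fin]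
  have hε := sgn_ne_zero ε
  rw [hprod, poch_four_mul_poch_two hq1, kernelConst, cConst, deltaConst, chainConst]
  have hED : (∏ j : Fin (n + 1), (ζ' (headIdx j) ^ 2 - w ^ 2 * q ^ 2)) ≠ 0 ∧
      (∏ j : Fin (n + 1), ∏ t : Fin l, (ζ' (tailIdx t) ^ 2 - ζ' (headIdx j) ^ 2 * q⁻¹ ^ 2)) ≠ 0 := by
    have := mul_ne_zero hE0 (pow_ne_zero (4 * (n + 1)) hq0)
    rw [hE] at this
    exact ⟨left_ne_zero_of_mul (right_ne_zero_of_mul this), left_ne_zero_of_mul this⟩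
  obtain ⟨hX2, hD⟩ := hED
  have hwn := pow_ne_zero (n + (l + 1)) hw
  rw [const_cancel hu ht hQ hΨ hS hε hr0, ratio_eq hq0 hD hX0 hX2 hE, ← mul_assoc _ (q ^ _), hpre]
  exact prefactor_ratio hq0 hw hwn _ _ _ _

end QKZ

end

/-- Here `m`, `n`, `l` belong to the smaller function and `m + 1`, `n + 1`, `l + 1` to the larger
one. In the second case of `hm` one has `n = l ≥ 1`, which rules out `(1, 1)` for the larger
indices. The family `C` chooses a contour for each set of parameters, without any continuity in
them; this suffices because the integrals depend on winding numbers only. -/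
theorem mainTheorem2
    (q p : ℂ) (hq0 : 0 < ‖q‖) (hq1 : ‖q‖ < 1) (hp : p ^ 2 = q)
    (m n l : ℕ) (hm : (n < l ∧ m = n) ∨ (n = l ∧ m + 1 = n))
    (ε σ : ℤˣ) (r : ℂ → ℂ)
    (ϑ : (Fin (m + 1) → ℂ) → (Fin (n + 1 + (l + 1)) → ℂ) → ℂ)
    (ϑ' : (Fin m → ℂ) → (Fin (n + l) → ℂ) → ℂ)
    (hϑ : QKZ.IsKernel p q r ε ϑ)
    (hϑ' : QKZ.IsKernel p q r (σ * ε) ϑ')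
    (hrec : QKZ.Recurrence q σ ϑ ϑ')
    (C : (N : ℕ) → (Fin N → ℂ) → ℝ → ℂ)
    (hC : ∀ (N : ℕ) (ζ : Fin N → ℂ), QKZ.NonZero ζ → QKZ.NoPinch q ζ →
      QKZ.IsContour q ζ (C N ζ))
    (ζ' : Fin (n + l) → ℂ) (w : ℂ) (hζ' : QKZ.NonZero ζ') (hw : w ≠ 0)
    (hgen : ∀ i j : Fin (n + l), i ≠ j → ∀ k : ℤ, ζ' i ^ 2 ≠ ζ' j ^ 2 * q ^ (2 * k))
    (hgenw : ∀ (i : Fin (n + l)) (k : ℤ), ζ' i ^ 2 ≠ w ^ 2 * q ^ (2 * k))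
    (hreg' : QKZ.RegularAt ϑ' ζ')
    (hreg₁ : QKZ.RegularAt ϑ (QKZ.ext2 ζ' w (-(QKZ.sgn σ * w * q⁻¹))))
    (hreg₂ : QKZ.RegularAt ϑ (QKZ.ext2 ζ' w (-(QKZ.sgn σ * w * q))))
    (hr : AnalyticAt ℂ r (-(QKZ.sgn σ * w * q)))
    (hr0 : r (-(QKZ.sgn σ * w * q)) ≠ 0) :
    ∃ ρ : ℂ,
      QKZ.HasRes
        (fun v => QKZ.Gbar q ϑ (C _ (QKZ.ext2 ζ' w v)) (QKZ.ext2 ζ' w v)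
          (QKZ.extreme (n + 1 + (l + 1)) (n + 1)))
        (-(QKZ.sgn σ * w * q⁻¹)) ρ ∧
      -2 * (QKZ.poch2 (q ^ 2) (q ^ 4) (q ^ 4) ^ 2 / QKZ.poch2 (q ^ 4) (q ^ 4) (q ^ 4) ^ 2) *
        (QKZ.sgn σ ^ (n + 1 + (l + 1) + 1) * p⁻¹ ^ ((n : ℤ) - (l : ℤ)) * ρ /
          (QKZ.sgn ε * r (-(QKZ.sgn σ * w * q)) * w *
            ∏ j, (ζ' j * w * QKZ.psi q (q⁻¹ * w ^ 2 / ζ' j ^ 2)))) =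
      QKZ.Rchain q w ζ'
        (QKZ.tensorU σ (QKZ.Gbar q ϑ' (C _ ζ') ζ'))
        (QKZ.extreme (n + l + 2) (n + 1)) := by
  -- Both alternatives in `hm` force `l ≥ 1`, so the smaller index always contains a sign `+`.
  obtain ⟨l, rfl⟩ : ∃ l', l = l' + 1 := ⟨l - 1, by omega⟩
  have hq : q ≠ 0 := norm_pos_iff.mp hq0
  have hG : QKZ.Generic q ζ' := ⟨hζ', hgen⟩
  have hv0 : -(QKZ.sgn σ * w * q⁻¹) ≠ 0 :=
    neg_ne_zero.mpr (mul_ne_zero (mul_ne_zero (QKZ.sgn_ne_zero σ) hw) (inv_ne_zero hq))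
  have hvw : (-(QKZ.sgn σ * w * q⁻¹)) ^ 2 = w ^ 2 * q⁻¹ ^ 2 := by
    linear_combination w ^ 2 * q⁻¹ ^ 2 * QKZ.sgn_sq σ
  obtain ⟨v₀, hv₀⟩ : ∃ v, v = -(QKZ.sgn σ * w * q⁻¹) := ⟨_, rfl⟩
  rw [← hv₀] at hv0 hvw hreg₁ ⊢
  obtain ⟨κ, _, Γ, h0, hP, hsupp, hin, hout, h3⟩ := QKZ.exists_cycle hq hq1 hG hw hv0 hgenw hvw
  have hgenE := QKZ.eventually_generic_ext2 hq hq1 hG hw hv0 hgenw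
  have hregE : ∀ᶠ v in nhds v₀, QKZ.RegularAt ϑ (QKZ.ext2 ζ' w v) :=
    ((QKZ.differentiable_ext2 ζ' w).continuous.tendsto v₀).eventually hreg₁.eventually
  have hnzE : ∀ᶠ v in nhds v₀, QKZ.NonZero (QKZ.ext2 ζ' w v) := by
    filter_upwards [eventually_ne_nhds hv0] with v hv
    exact QKZ.forall_bigIdx.mpr ⟨fun i => by rw [QKZ.ext2_smallIdx]; exact hζ' i,
      by rwa [QKZ.ext2_wIdx], by rwa [QKZ.ext2_vIdx]⟩
  have hres := QKZ.hasRes_multiContour (γ := fun v => C _ (QKZ.ext2 ζ' w v))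
    (A := fun v => QKZ.integrand q ϑ (QKZ.ext2 ζ' w v)) hq hq1 hζ' hw hv0 hvw hgenE
    (hgenE.mono fun v hv => hC _ _ hv.1 (hv.noPinch hq hq1)) hsupp h0 hin hout hP
    (QKZ.eventually_differentiableAt_integrand hreg₁ (QKZ.extDen_ne_zero hq hG hgenw hvw))
    (by filter_upwards [hregE, hnzE] with v h1 h2 k y x hy hx using
      QKZ.integrand_insertNth hϑ h2 h1 k hy hx)
    (by filter_upwards [hregE, hnzE] with v h1 h2 x k hx using
      QKZ.integrand_snoc_eq_zero hϑ h2 h1 hx k)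
  have hCζ := hC _ ζ' hζ' (hG.noPinch hq hq1)
  simp only [QKZ.Gbar_extreme]
  refine ⟨_, hres, ?_⟩
  rw [QKZ.cycMulti_integrand_snoc hm hq hq1 hϑ hϑ' hrec hv₀ hG hw hgenw hreg' hreg₁ hreg₂ hr hCζ h0
    hsupp.self_of_nhds hin.self_of_nhds hout.self_of_nhds h3,
    QKZ.Rchain_Gbar_extreme hq hq1 σ hG hgenw hreg' hCζ]
  exact QKZ.recurrence_const hp hq hq1 hw m hG hgenw hvw hr0 _
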